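/- Conventions. Let $A$ be a unital $C^*$-algebra. $U(A)$ is its unitary group, $U_0(A)$ the path component of $1$ in $U(A)$, and $\mathrm{T}(A)$ the set of tracial states. $A$ is simple if $A\neq 0$ and its only closed two-sided ideals are $0$ and $A$. Write $TR(A)\le 1$ if for every $\varepsilon>0$, every nonzero positive $a\in A$ and every finite $\mathcal F\subset A$ there are a nonzero projection $p\in A$ and a $C^*$-subalgebra $B\subset A$ with $1_B=p$, where $B$ is $*$-isomorphic to $P M_m(C(X))P$ for some finite CW complex $X$ of dimension at most $1$, some $m$ and some projection $P\in M_m(C(X))$, such that (1) $\|xp-px\|<\varepsilon$ for all $x\in\mathcal F$; (2) for each $x\in\mathcal F$ there is $b\in B$ with $\|pxp-b\|<\varepsilon$; (3) $1-p$ is Murray–von Neumann equivalent to a projection in $\overline{aAa}$. For $z\in U(A)$ and $\tau\in \mathrm{T}(A)$ let $\imath:C(\mathbb T)\to A$, $\imath(g)=g(z)$ (continuous functional calculus), and let $\mu_{\tau\circ\imath}$ be the Borel probability measure on $\mathbb T$ with $\int g\,d\mu_{\tau\circ\imath}=\tau(g(z))$ for all $g\in C(\mathbb T)$. Define $\Delta_{00}:(0,\infty)\to(0,1)$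 by $$\Delta_{00}(r)=\frac{1}{2(n+1)^2}\quad\text{if}\quad \frac{8\pi}{n+1}+\frac{4\pi}{2^{n+2}(n+1)}<r\le \frac{8\pi}{n}+\frac{4\pi}{2^{n+1}n},\qquad n\ge 64,$$ and $\Delta_{00}(r)=\frac{1}{2(65)^2}$ if $r\ge \frac{8\pi}{64}+\frac{4\pi}{2^{65}\cdot 64}$. Statement. Let $A$ be an infinite-dimensional unital separable simple $C^*$-algebra with $TR(A)\le 1$, let $\mathcal F\subset A$ be a finite subset and let $u\in U(A)$. For any $\varepsilon>0$ and any $\eta>0$ there exist a unitary $v\in U_0(A)$ and a continuous path of unitaries $\{w(t):t\in[0,1]\}\subset U_0(A)$ such that $$w(0)=1,\qquad w(1)=v,\qquad \|f\,w(t)-w(t)f\|<\varepsilon\quad\text{for all } f\in\mathcal F,\ t\in[0,1],$$ and $$\mu_{\tau\circ\imath}(I_a)\ge \Delta_{00}(a)\quad\text{for all }\tau\in \mathrm{T}(A)$$ and for every open arc $I_a\subset\mathbb T$ of length $a$ with $\eta\le a\le 2\pi$, where $\imath(g)=g(vu)$ for $g\in C(\mathbb T)$. -/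

import Mathlib

open scoped ComplexOrder

noncomputable section

/-! ### Simple C*-algebras and tracial rank -/

/-- A C*-algebra is simple if it is nonzero and its only closed two-sided ideals are the two
trivial ones. (In a unital algebra every two-sided ring ideal is closed under scalars.) -/
def IsSimpleCStarAlgebra (A : Type*) [CStarAlgebra A] : Prop :=
  Nontrivial A ∧ ∀ I : TwoSidedIdeal A, IsClosed (I : Set A) → I = ⊥ ∨ I = ⊤

/-- The corner `P M P = {x | P x = x and x P = x}` of a star algebra `M` at a projection `P`. -/
def projCorner {M : Type*} [Ring M] [StarRing M] [Algebra ℂ M] [StarModule ℂ M]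
    (P : M) (hP : IsStarProjection P) : NonUnitalStarSubalgebra ℂ M where
  carrier := {x | P * x = x ∧ x * P = x}
  add_mem' := by
    rintro a b ⟨ha, ha'⟩ ⟨hb, hb'⟩
    exact ⟨by rw [mul_add, ha, hb], by rw [add_mul, ha', hb']⟩
  zero_mem' := by simp
  mul_mem' := by
    rintro a b ⟨ha, _⟩ ⟨_, hb'⟩
    exact ⟨by rw [← mul_assoc, ha], by rw [mul_assoc, hb']⟩
  smul_mem' := by
    rintro c x ⟨hx, hx'⟩
    exact ⟨by rw [mul_smul_comm, hx], by rw [smul_mul_assoc, hx']⟩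
  star_mem' := by
    rintro a ⟨ha, ha'⟩
    have hs : star P = P := hP.isSelfAdjoint
    refine ⟨?_, ?_⟩
    · rw [← hs, ← star_mul, ha']
    · rw [← hs, ← star_mul, ha]

/-- `X` is a finite CW complex (in particular a compact Hausdorff space) of dimension at most
`k`: it carries a CW structure with finitely many cells, all of dimension at most `k`. -/
def IsFiniteCWComplexDimLE (k : ℕ) (X : Type) [TopologicalSpace X] : Prop :=
  T2Space X ∧ ∃ _ : Topology.CWComplex (Set.univ : Set X),
    Topology.RelCWComplex.Finite (Set.univ : Set X) ∧
      ∀ n, k < n → IsEmpty (Topology.RelCWComplex.cell (Set.univ : Set X) n)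

/-- The class `I_k`: the C*-algebras `*`-isomorphic to `P M_m(C(X)) P`, where `X` is a finite CW
complex of dimension at most `k` and `P` is a projection in `M_m(C(X))`. -/
def InClassI (k : ℕ) (B : Type*) [NonUnitalRing B] [StarRing B] [Module ℂ B] : Prop :=
  ∃ (X : Type) (_ : TopologicalSpace X) (_ : IsFiniteCWComplexDimLE k X) (m : ℕ)
    (P : Matrix (Fin m) (Fin m) C(X, ℂ)) (hP : IsStarProjection P),
    Nonempty (B ≃⋆ₐ[ℂ] projCorner P hP)

/-- `TR(A) ≤ k`, for a unital (simple) C*-algebra `A`. -/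
def TracialRankLE (k : ℕ) (A : Type*) [CStarAlgebra A] [PartialOrder A] [StarOrderedRing A] :
    Prop :=
  ∀ (ε : ℝ), 0 < ε → ∀ a : A, 0 ≤ a → a ≠ 0 → ∀ F : Finset A,
    ∃ (p : A) (B : NonUnitalStarSubalgebra ℂ A),
      IsStarProjection p ∧ p ≠ 0 ∧
      -- `B` is a C*-subalgebra in the class `I_k` with unit `p`
      IsClosed (B : Set A) ∧ InClassI k B ∧ p ∈ B ∧ (∀ b ∈ B, p * b = b ∧ b * p = b) ∧
      (∀ x ∈ F, ‖x * p - p * x‖ < ε) ∧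
      (∀ x ∈ F, ∃ b ∈ B, ‖p * x * p - b‖ < ε) ∧
      -- `1 - p` is Murray-von Neumann equivalent to a projection in the closure of `a A a`
      ∃ q : A, IsStarProjection q ∧ q ∈ closure (Set.range fun x : A => a * x * a) ∧
        ∃ s : A, star s * s = 1 - p ∧ s * star s = q

/-! ### Tracial states and induced measures -/

/-- The tracial state space `T(A)`. -/
def tracialStateSpace (A : Type*) [CStarAlgebra A] [PartialOrder A] [StarOrderedRing A] :
    Set (A →ₚ[ℂ] ℂ) :=
  {τ | τ 1 = 1 ∧ ∀ a b : A, τ (a * b) = τ (b * a)}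

/-- The real positive functional on `C_c(X, ℝ)` given by restricting a positive functional on
`C(X)`. -/
def realRestrict {X : Type*} [TopologicalSpace X] [CompactSpace X] (φ : C(X, ℂ) →ₚ[ℂ] ℂ) :
    CompactlySupportedContinuousMap X ℝ →ₚ[ℝ] ℝ :=
  PositiveLinearMap.mk₀
    { toFun := fun f => (φ ⟨fun x => (f x : ℂ), by fun_prop⟩).re
      map_add' := by
        intro f g
        rw [← Complex.add_re, ← map_add]
        congr 2
        ext x
        simp
      map_smul' := by
        intro c f
        have h : (⟨fun x => ((c • f) x : ℂ), by fun_prop⟩ : C(X, ℂ))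
            = (c : ℂ) • ⟨fun x => (f x : ℂ), by fun_prop⟩ := by
          ext x
          simp
        rw [h, map_smul]
        simp }
    (by
      intro f hf
      have h : (0 : C(X, ℂ)) ≤ ⟨fun x => (f x : ℂ), by fun_prop⟩ := by
        intro x
        have := hf x
        simpa using this
      have h2 : 0 ≤ φ ⟨fun x => (f x : ℂ), by fun_prop⟩ := by
        have := OrderHomClass.mono φ h
        simpa using this
      exact (Complex.le_def.mp h2).1)

/-- The Borel measure on a compact Hausdorff space `X` induced by a positive functional `φ` on
`C(X)`, through the Riesz representation theorem: it is the regular Borel measure `μ` with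
`φ g = ∫ g dμ` for all `g` in `C(X)`. -/
def inducedMeasure {X : Type*} [TopologicalSpace X] [CompactSpace X] [T2Space X]
    [MeasurableSpace X] [BorelSpace X] (φ : C(X, ℂ) →ₚ[ℂ] ℂ) : MeasureTheory.Measure X :=
  RealRMK.rieszMeasure (realRestrict φ)

/-- The induced measure represents the functional. -/
theorem integral_inducedMeasure {X : Type*} [TopologicalSpace X] [CompactSpace X] [T2Space X]
    [MeasurableSpace X] [BorelSpace X] (φ : C(X, ℂ) →ₚ[ℂ] ℂ) (g : C(X, ℂ)) :
    ∫ x, g x ∂(inducedMeasure φ) = φ g := by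
  have hreal : ∀ f : C(X, ℝ), ((∫ x, f x ∂(inducedMeasure φ) : ℝ) : ℂ)
      = φ ⟨fun x => (f x : ℂ), by fun_prop⟩ := by
    intro f
    have h1 := RealRMK.integral_rieszMeasure (realRestrict φ)
      (CompactlySupportedContinuousMap.continuousMapEquiv f)
    have h2 : (φ ⟨fun x => (f x : ℂ), by fun_prop⟩).im = 0 := by
      have hpos : ∀ k : C(X, ℂ), 0 ≤ k → (φ k).im = 0 := by
        intro k hk
        have : 0 ≤ φ k := by simpa using OrderHomClass.mono φ hk
        exact (Complex.le_def.mp this).2.symm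
      have hdec : (⟨fun x => (f x : ℂ), by fun_prop⟩ : C(X, ℂ))
          = ⟨fun x => ((f x + ‖f‖ : ℝ) : ℂ), by fun_prop⟩
            - ⟨fun _ => ((‖f‖ : ℝ) : ℂ), by fun_prop⟩ := by
        ext x
        simp
      rw [hdec, map_sub, Complex.sub_im, hpos, hpos, sub_zero]
      · intro x
        simp
      · intro x
        have := (abs_le.mp (f.norm_coe_le_norm x)).1
        exact Complex.zero_le_real.mpr (by linarith : 0 ≤ f x + ‖f‖)
    apply Complex.ext
    · rw [Complex.ofReal_re]
      exact h1
    · rw [Complex.ofReal_im, h2]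
  have hfin : MeasureTheory.IsFiniteMeasureOnCompacts (inducedMeasure φ) := by
    unfold inducedMeasure
    infer_instance
  have hint : MeasureTheory.Integrable (fun x => g x) (inducedMeasure φ) :=
    g.continuous.integrable_of_hasCompactSupport (HasCompactSupport.of_compactSpace _)
  have h1 := hreal ⟨fun x => (g x).re, by fun_prop⟩
  have h2 := hreal ⟨fun x => (g x).im, by fun_prop⟩
  simp only [ContinuousMap.coe_mk] at h1 h2
  refine ((integral_re_add_im hint).symm.trans
    (congrArg₂ (fun p q => p + q * Complex.I) h1 h2)).trans ?_
  rw [mul_comm, ← smul_eq_mul, ← map_smul, ← map_add]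
  congr 1
  ext x
  simp [mul_comm Complex.I]

/-- The inclusion of the spectrum of a unitary into the circle. -/
def spectrumToCircle {A : Type*} [CStarAlgebra A] (u : unitary A) :
    C(spectrum ℂ (u : A), Circle) where
  toFun z := ⟨z, mem_sphere_zero_iff_norm.mp (Unitary.spectrum_subset_circle u z.2) |> fun h => by
    simpa [Submonoid.unitSphere] using h⟩
  continuous_toFun := by fun_prop

/-- The homomorphism `C(𝕋) → A`, `g ↦ g(u)`, for a unitary `u` (continuous functional
calculus). -/
def unitaryCalculus {A : Type*} [CStarAlgebra A] (u : unitary A) : C(Circle, ℂ) →⋆ₐ[ℂ] A :=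
  (cfcHom (R := ℂ) (a := (u : A)) (p := IsStarNormal) inferInstance).comp
    (ContinuousMap.compStarAlgHom' ℂ ℂ (spectrumToCircle u))

/-- The circle carries its Borel σ-algebra. -/
instance circleMeasurableSpace : MeasurableSpace Circle := borel Circle

instance circleBorelSpace : BorelSpace Circle := ⟨rfl⟩

/-- The measure `μ_{τ ∘ ι}` on the circle, where `ι(g) = g(u)` for `g` in `C(𝕋)`. -/
def traceSpectralMeasure {A : Type*} [CStarAlgebra A] [PartialOrder A] [StarOrderedRing A]
    (τ : A →ₚ[ℂ] ℂ) (u : unitary A) : MeasureTheory.Measure Circle :=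
  inducedMeasure (τ.comp (PositiveLinearMap.ofClass (unitaryCalculus u)))

/-- The open arc of length `a` (for `0 < a ≤ 2π`) on the circle which starts, counterclockwise,
at `exp (i s)`. -/
def openArc (s a : ℝ) : Set Circle := Circle.exp '' Set.Ioo s (s + a)

/-! ### The function `Δ₀₀` -/

/-- The breakpoints `8π/n + 4π/(2^(n+1) n)`. -/
def arcBreak (n : ℕ) : ℝ := 8 * Real.pi / n + 4 * Real.pi / (2 ^ (n + 1) * n)

open Classical in
/-- The function `Δ₀₀ : (0, ∞) → (0, 1)`: its value is `1/(2(n+1)²)` at `r` in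
`(arcBreak (n+1), arcBreak n]` for `n ≥ 64`, and `1/(2·65²)` at `r ≥ arcBreak 64`. -/
def Delta00 (r : ℝ) : ℝ :=
  if arcBreak 64 ≤ r then 1 / (2 * 65 ^ 2)
  else if h : ∃ n : ℕ, 64 ≤ n ∧ arcBreak (n + 1) < r ∧ r ≤ arcBreak n then
    1 / (2 * ((h.choose : ℝ) + 1) ^ 2)
  else 0

theorem arcBreak_lt {m n : ℕ} (hm : 0 < m) (h : m < n) : arcBreak n < arcBreak m := by
  have hm' : (0 : ℝ) < m := by exact_mod_cast hm
  have h' : (m : ℝ) < n := by exact_mod_cast h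
  have hp : (2 : ℝ) ^ (m + 1) ≤ 2 ^ (n + 1) := pow_le_pow_right₀ (by norm_num) (by omega)
  have hpi := Real.pi_pos
  unfold arcBreak
  gcongr
  norm_num

theorem Delta00_eq {n : ℕ} (hn : 64 ≤ n) {r : ℝ} (h1 : arcBreak (n + 1) < r)
    (h2 : r ≤ arcBreak n) : Delta00 r = 1 / (2 * ((n : ℝ) + 1) ^ 2) := by
  unfold Delta00
  split_ifs with h64 h
  · have : n = 64 := by
      by_contra hne
      exact absurd (arcBreak_lt (by norm_num) (by omega : 64 < n)) (by linarith)
    subst this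
    norm_num
  · obtain ⟨hk, hk1, hk2⟩ := h.choose_spec
    have key : ∀ a b : ℕ, 64 ≤ a → arcBreak (a + 1) < r → r ≤ arcBreak b → b ≤ a := by
      intro a b ha h3 h4
      by_contra hlt
      rcases Nat.lt_or_ge (a + 1) b with h5 | h5
      · have := arcBreak_lt (by omega) h5
        linarith
      · have : b = a + 1 := by omega
        subst this
        linarith
    have : h.choose = n := le_antisymm (key _ _ hn h1 hk2) (key _ _ hk hk1 h2)
    rw [this]
  · exact absurd ⟨n, hn, h1, h2⟩ h

end

/-!
The unitary `v` rotates large pieces of the unit of `A` by the angles `2πk / (N + 1)`. More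
precisely, there are positive elements `z i k`, for two colours `i` and `0 ≤ k ≤ N`, which almost
commute with `F` and `u` and on which `v` is almost the scalar `exp (2πik / (N + 1))`; for fixed `i`
the traces do not distinguish the `z i k`, even in products with functions of `u`, and all of them
together have trace at least `1/130`. If `T` is a function on the circle whose `N + 1` rotations
have sum at least `m`, then `T (vu) z i k` is almost `z i k T (exp (2πik / (N + 1)) u)`. Summing over
`k`, and exchanging `z i k` for `z i 0` under the trace, gives `τ (T (vu)) ≥ m τ (z i 0)` up to a
small error. When `T` is supported in an arc of length `a`, then `m` can be close to
`a (N + 1) / 2π`, so that the arc has measure at least `a/2000`; and `Δ₀₀ a` is at most that. This is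
the content of `trace_ge_of_intertwine`, `exists_arcFunction` and `Delta00_le`.

To find the `z i k`, use the corners `P M_m(C(X)) P` provided by the tracial rank. A finite CW
complex of dimension at most one is a graph (`IsFiniteCWComplexDimLE.exists_graphModel`), so that
`X` has fine partitions of unity in two colours, where the supports of one colour are disjoint
(`GraphModel.exists_two_coloured_partition`). As `A` is simple and infinite-dimensional, the fibres
of `P` can be assumed to have large rank wherever they do not vanish (`exists_finset_rank_ge`), and
`1 - P` to have small trace (`exists_cornerModel_trace_le`). On the support of a member of the
partition, `P` and the functions which approximate `F` are almost constant up to conjugation, so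
there are matrix units there, up to cut-offs. If `x` lives under a minimal one of these, its
copies `∑ s x s*` along the matrix units almost commute with `F`, and the traces of their products
with elements of `F` depend only on the trace of `x`. Such data form a `LocalSystem`; they exist
with complement of small trace (`exists_localSystem_trace_le`). The copies of the elements of one
colour are orthogonal, but there is no control between the two colours.

It remains to divide a positive contraction `a` under a minimal projection into `N + 1` almost
orthogonal pieces which commute with `a` up to a small error, and on which the traces are equal.
This is done in another corner `P M_m(C(X)) P`, now of large rank: over a graph, selfadjoint
matrix-valued functions are approximately diagonal in a continuous basis, with ordered eigenvalues
(`GraphModel.exists_diagFun_approx`), and distributing the eigenvalues cyclically over the `N + 1`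
classes, the sums over the classes differ by the largest eigenvalue at most, whereas the trace of
one of many eigenvalues is small (`CornerModel.exists_divide`, `exists_isDivision`).

Let `φ j` be the cut-offs of a local system, one for each patch and living under the minimal
projections, whose squares have copies with sum the unit of the corner. To separate the two colours,
choose positive contractions `d₀` and `d₁` with `d₀ d₁ = 0` which almost commute with everything so
far, and whose products have traces bounded below (`exists_orthogonal_pair`): functions of an
element that consists of an eighth of the unit in each patch. For each patch `j` of the colour `i`
divide the unit, with respect to `φ j dᵢ φ j`, into pieces `e j k`. Under cut-offs by functions of
`φ j dᵢ φ j`, the copies of `∑ (k / (N + 1)) e j k` have sum `Hᵢ`, and those of `e j k` have sum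
`z i k`; each `Hᵢ` is almost `k / (N + 1)` on `z i k`, and almost vanishes on the pieces of the other
colour (`exists_spread`). Then `v = exp (2πi H₀) exp (2πi H₁)`, joined to `1` by
`t ↦ exp (2πi t H₀) exp (2πi t H₁)` (`exists_spread_path`).
-/

open scoped Matrix.Norms.L2Operator

/-! ### Approximate intertwining and functional calculus -/

section FunctionalCalculus

variable {A : Type*} [CStarAlgebra A]

theorem exists_norm_aeval_intertwine_le (q : Polynomial ℝ) (R : ℝ) :
    ∃ C : ℝ, 0 ≤ C ∧ ∀ x y z : A, ‖x‖ ≤ R → ‖y‖ ≤ R →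
      ‖Polynomial.aeval x q * z - z * Polynomial.aeval y q‖ ≤ C * ‖x * z - z * y‖ := by
  induction q using Polynomial.induction_on' with
  | add p q hp hq =>
    obtain ⟨C, hC, h⟩ := hp
    obtain ⟨D, hD, h'⟩ := hq
    refine ⟨C + D, by positivity, fun x y z hx hy => ?_⟩
    have e : Polynomial.aeval x (p + q) * z - z * Polynomial.aeval y (p + q)
        = (Polynomial.aeval x p * z - z * Polynomial.aeval y p)
          + (Polynomial.aeval x q * z - z * Polynomial.aeval y q) := by
      simp only [map_add]; noncomm_ring
    rw [e, add_mul]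
    exact (norm_add_le _ _).trans (add_le_add (h x y z hx hy) (h' x y z hx hy))
  | monomial n a =>
    have key : ∃ C : ℝ, 0 ≤ C ∧ ∀ x y z : A, ‖x‖ ≤ R → ‖y‖ ≤ R →
        ‖x ^ n * z - z * y ^ n‖ ≤ C * ‖x * z - z * y‖ := by
      induction n with
      | zero => exact ⟨0, le_rfl, fun x y z _ _ => by simp⟩
      | succ n ih =>
        obtain ⟨C, hC, h⟩ := ih
        refine ⟨|R| * C + max 1 |R| ^ n, by positivity, fun x y z hx hy => ?_⟩
        have e : x ^ (n + 1) * z - z * y ^ (n + 1)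
            = x * (x ^ n * z - z * y ^ n) + (x * z - z * y) * y ^ n := by
          rw [pow_succ' x, pow_succ' y]; noncomm_ring
        have hR : 0 ≤ R := (norm_nonneg x).trans hx
        have hyn : ‖y ^ n‖ ≤ max 1 |R| ^ n := by
          rcases Nat.eq_zero_or_pos n with h0 | h0
          · subst h0
            simp only [pow_zero]
            rcases subsingleton_or_nontrivial A with hs | hs
            · rw [Subsingleton.elim (1 : A) 0, norm_zero]; norm_num
            · rw [norm_one]
          · refine (norm_pow_le' y h0).trans ?_
            gcongr
            exact (hy.trans (le_abs_self R)).trans (le_max_right _ _)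
        rw [e, add_mul]
        refine (norm_add_le _ _).trans (add_le_add ?_ ?_)
        · refine (norm_mul_le _ _).trans ?_
          rw [mul_assoc]
          exact mul_le_mul (hx.trans (le_abs_self R)) (h x y z hx hy) (norm_nonneg _)
            (abs_nonneg _)
        · refine (norm_mul_le _ _).trans ?_
          rw [mul_comm]
          gcongr
    obtain ⟨C, hC, h⟩ := key
    refine ⟨|a| * C, by positivity, fun x y z hx hy => ?_⟩
    have e : Polynomial.aeval x (Polynomial.monomial n a) * z
        - z * Polynomial.aeval y (Polynomial.monomial n a) = a • (x ^ n * z - z * y ^ n) := by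
      simp only [Polynomial.aeval_monomial, ← Algebra.smul_def, smul_mul_assoc, mul_smul_comm,
        smul_sub]
    rw [e, norm_smul, Real.norm_eq_abs, mul_assoc]
    gcongr
    exact h x y z hx hy

theorem exists_polynomial_norm_cfc_sub_le {g : ℝ → ℝ} (hg : Continuous g) (R : ℝ) {ε : ℝ}
    (hε : 0 < ε) : ∃ q : Polynomial ℝ, (∀ t, |t| ≤ R → |q.eval t - g t| ≤ ε) ∧
      ∀ x : A, IsSelfAdjoint x → ‖x‖ ≤ R → ‖Polynomial.aeval x q - cfc g x‖ ≤ ε := by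
  obtain ⟨q, hq⟩ := exists_polynomial_near_of_continuousOn (-R) R g hg.continuousOn ε hε
  have hq' : ∀ t, |t| ≤ R → |q.eval t - g t| ≤ ε := fun t ht => (hq t (abs_le.mp ht)).le
  refine ⟨q, hq', fun x hx hxR => ?_⟩
  rw [← cfc_polynomial q x hx, ← cfc_sub q.eval g x (by fun_prop) (by fun_prop)]
  refine norm_cfc_le hε.le fun t ht => hq' t ?_
  have := spectrum.norm_le_norm_mul_of_mem ht
  rcases subsingleton_or_nontrivial A with hs | hs
  · simp [spectrum.of_subsingleton] at ht
  · rw [norm_one, mul_one] at this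
    exact this.trans hxR

/-- Functional calculus preserves approximate intertwining, uniformly on bounded sets. The cases
`x = y`, `y` scalar and `z = 1` are used for approximate commutants, for approximate
eigenvectors and for uniform continuity of the calculus. -/
theorem exists_cfc_intertwine_le {g : ℝ → ℝ} (hg : Continuous g) (R : ℝ) {ε : ℝ} (hε : 0 < ε) :
    ∃ δ > 0, ∀ x y z : A, IsSelfAdjoint x → IsSelfAdjoint y → ‖x‖ ≤ R → ‖y‖ ≤ R → ‖z‖ ≤ 1 →
      ‖x * z - z * y‖ ≤ δ → ‖cfc g x * z - z * cfc g y‖ ≤ ε := by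
  obtain ⟨q, -, hq⟩ := exists_polynomial_norm_cfc_sub_le (A := A) hg R (ε := ε / 4) (by positivity)
  obtain ⟨C, hC, h⟩ := exists_norm_aeval_intertwine_le (A := A) q R
  refine ⟨ε / (2 * (C + 1)), by positivity, fun x y z hx hy hxR hyR hz hd => ?_⟩
  have e : cfc g x * z - z * cfc g y
      = (Polynomial.aeval x q * z - z * Polynomial.aeval y q)
        - (Polynomial.aeval x q - cfc g x) * z + z * (Polynomial.aeval y q - cfc g y) := by
    noncomm_ring
  have h1 : ‖(Polynomial.aeval x q - cfc g x) * z‖ ≤ ε / 4 := by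
    refine (norm_mul_le _ _).trans ?_
    nlinarith [hq x hx hxR, norm_nonneg z, norm_nonneg (Polynomial.aeval x q - cfc g x)]
  have h2 : ‖z * (Polynomial.aeval y q - cfc g y)‖ ≤ ε / 4 := by
    refine (norm_mul_le _ _).trans ?_
    nlinarith [hq y hy hyR, norm_nonneg z, norm_nonneg (Polynomial.aeval y q - cfc g y)]
  have h3 : ‖Polynomial.aeval x q * z - z * Polynomial.aeval y q‖ ≤ ε / 2 := by
    refine (h x y z hxR hyR).trans ?_
    calc C * ‖x * z - z * y‖ ≤ (C + 1) * (ε / (2 * (C + 1))) := by gcongr; linarith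
      _ = ε / 2 := by field_simp
  rw [e]
  refine (norm_add_le _ _).trans ?_
  linarith [norm_sub_le (Polynomial.aeval x q * z - z * Polynomial.aeval y q)
    ((Polynomial.aeval x q - cfc g x) * z)]

theorem exists_cfc_sub_le {g : ℝ → ℝ} (hg : Continuous g) (R : ℝ) {ε : ℝ} (hε : 0 < ε) :
    ∃ δ > 0, ∀ x y : A, IsSelfAdjoint x → IsSelfAdjoint y → ‖x‖ ≤ R → ‖y‖ ≤ R →
      ‖x - y‖ ≤ δ → ‖cfc g x - cfc g y‖ ≤ ε := by
  rcases subsingleton_or_nontrivial A with hs | hs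
  · refine ⟨1, one_pos, fun x y _ _ _ _ _ => ?_⟩
    rw [Subsingleton.elim (cfc g x - cfc g y) 0, norm_zero]
    exact hε.le
  obtain ⟨δ, hδ, h⟩ := exists_cfc_intertwine_le (A := A) hg R hε
  exact ⟨δ, hδ, fun x y hx hy hxR hyR hd => by
    simpa using h x y 1 hx hy hxR hyR (by simp) (by simpa using hd)⟩

theorem norm_pow_intertwine_le (x y z : A) (R : ℝ) (hx : ‖x‖ ≤ R) (hy : ‖y‖ ≤ R) (n : ℕ) :
    ‖x ^ (n + 1) * z - z * y ^ (n + 1)‖ ≤ (n + 1) * R ^ n * ‖x * z - z * y‖ := by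
  have hR : 0 ≤ R := (norm_nonneg x).trans hx
  induction n with
  | zero => simp
  | succ n ih =>
    have e : x ^ (n + 1 + 1) * z - z * y ^ (n + 1 + 1)
        = x * (x ^ (n + 1) * z - z * y ^ (n + 1)) + (x * z - z * y) * y ^ (n + 1) := by
      rw [pow_succ' x (n + 1), pow_succ' y (n + 1)]; noncomm_ring
    have hyn : ‖y ^ (n + 1)‖ ≤ R ^ (n + 1) :=
      (norm_pow_le' y (Nat.succ_pos n)).trans (by gcongr)
    rw [e]
    have h1 := (norm_mul_le x (x ^ (n + 1) * z - z * y ^ (n + 1))).trans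
      (mul_le_mul hx ih (norm_nonneg _) hR)
    have h2 := (norm_mul_le (x * z - z * y) (y ^ (n + 1))).trans
      (mul_le_mul_of_nonneg_left hyn (norm_nonneg _))
    refine ((norm_add_le _ _).trans (add_le_add h1 h2)).trans (le_of_eq ?_)
    push_cast
    ring

theorem norm_exp_intertwine_le (x y z : A) (R : ℝ) (hx : ‖x‖ ≤ R) (hy : ‖y‖ ≤ R) :
    ‖NormedSpace.exp x * z - z * NormedSpace.exp y‖ ≤ Real.exp R * ‖x * z - z * y‖ := by
  have hxs := (NormedSpace.exp_series_hasSum_exp' (𝕂 := ℂ) x).mul_right z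
  have hys := (NormedSpace.exp_series_hasSum_exp' (𝕂 := ℂ) y).mul_left z
  have hs := hxs.sub hys
  have hs' : HasSum (fun n : ℕ => ((n + 1).factorial⁻¹ : ℂ) • (x ^ (n + 1) * z - z * y ^ (n + 1)))
      (NormedSpace.exp x * z - z * NormedSpace.exp y) := by
    have := (hasSum_nat_add_iff' 1).mpr hs
    simpa [smul_mul_assoc, mul_smul_comm, smul_sub] using this
  have hb : HasSum (fun n : ℕ => R ^ n / n.factorial * ‖x * z - z * y‖)
      (Real.exp R * ‖x * z - z * y‖) := by
    have := NormedSpace.expSeries_div_hasSum_exp (𝔸 := ℝ) R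
    rw [← Real.exp_eq_exp_ℝ] at this
    exact this.mul_right _
  rw [← hs'.tsum_eq]
  refine tsum_of_norm_bounded hb fun n => ?_
  rw [norm_smul]
  have h1 := norm_pow_intertwine_le x y z R hx hy n
  have h2 : ‖((n + 1).factorial⁻¹ : ℂ)‖ = ((n + 1).factorial : ℝ)⁻¹ := by
    rw [norm_inv]; simp
  rw [h2]
  calc ((n + 1).factorial : ℝ)⁻¹ * ‖x ^ (n + 1) * z - z * y ^ (n + 1)‖
      ≤ ((n + 1).factorial : ℝ)⁻¹ * ((n + 1) * R ^ n * ‖x * z - z * y‖) := by gcongr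
    _ = R ^ n / n.factorial * ‖x * z - z * y‖ := by
      rw [Nat.factorial_succ]
      push_cast
      have : ((n : ℝ) + 1) ≠ 0 := by positivity
      have : (n.factorial : ℝ) ≠ 0 := by positivity
      field_simp

end FunctionalCalculus

/-! ### Tracial states -/

section Traces

variable {A : Type*} [CStarAlgebra A] [PartialOrder A] [StarOrderedRing A] {τ : A →ₚ[ℂ] ℂ}

theorem trace_mono (τ : A →ₚ[ℂ] ℂ) {a b : A} (h : a ≤ b) : (τ a).re ≤ (τ b).re :=
  (Complex.le_def.mp (OrderHomClass.mono τ h)).1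

theorem trace_re_nonneg (τ : A →ₚ[ℂ] ℂ) {a : A} (h : 0 ≤ a) : 0 ≤ (τ a).re := by
  simpa using trace_mono τ h

theorem trace_mul_comm (hτ : τ ∈ tracialStateSpace A) (a b : A) : τ (a * b) = τ (b * a) := hτ.2 a b

theorem norm_trace_le (hτ : τ ∈ tracialStateSpace A) (x : A) : ‖τ x‖ ≤ ‖x‖ := by
  have hsa : ∀ y : A, IsSelfAdjoint y → (τ y).re ≤ ‖y‖ := by
    intro y hy
    have := trace_mono τ (IsSelfAdjoint.le_algebraMap_norm_self hy)
    have h2 : τ (algebraMap ℝ A ‖y‖) = (‖y‖ : ℂ) := by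
      rw [Algebra.algebraMap_eq_smul_one, ← Complex.coe_smul, map_smul, hτ.1]; simp
    rw [h2] at this
    simpa using this
  obtain ⟨c, hc, hcx⟩ : ∃ c : ℂ, ‖c‖ = 1 ∧ c * τ x = ‖τ x‖ := by
    rcases eq_or_ne (τ x) 0 with h | h
    · exact ⟨1, by simp, by simp [h]⟩
    · refine ⟨(‖τ x‖ : ℂ) / τ x, ?_, ?_⟩
      · rw [norm_div]; simp [h]
      · field_simp
  have h1 : (τ ((1 / 2 : ℂ) • (c • x + star (c • x)))).re = ‖τ x‖ := by
    have hst : τ (star (c • x)) = star (τ (c • x)) := map_star τ _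
    rw [map_smul, map_add, hst, map_smul, smul_eq_mul, smul_eq_mul, hcx]
    simp
    ring
  have h2 : IsSelfAdjoint ((1 / 2 : ℂ) • (c • x + star (c • x))) := by
    refine IsSelfAdjoint.smul ?_ ?_
    · rw [isSelfAdjoint_iff]; simp
    · exact IsSelfAdjoint.add_star_self _
  have h3 := hsa _ h2
  rw [h1] at h3
  refine h3.trans ?_
  rw [norm_smul]
  have h4 : ‖c • x‖ = ‖x‖ := by rw [norm_smul, hc, one_mul]
  have h5 := norm_add_le (c • x) (star (c • x))
  rw [norm_star, h4] at h5
  have h6 : ‖(1 / 2 : ℂ)‖ = 1 / 2 := by norm_num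
  rw [h6]
  linarith

theorem norm_trace_sub_le (hτ : τ ∈ tracialStateSpace A) (x y : A) : ‖τ x - τ y‖ ≤ ‖x - y‖ := by
  rw [← map_sub]; exact norm_trace_le hτ _

theorem abs_re_trace_sub_le (hτ : τ ∈ tracialStateSpace A) (x y : A) :
    |(τ x).re - (τ y).re| ≤ ‖x - y‖ := by
  rw [← Complex.sub_re]
  exact (Complex.abs_re_le_norm _).trans (norm_trace_sub_le hτ x y)

theorem trace_mul_nonneg (hτ : τ ∈ tracialStateSpace A) {a b : A} (ha : 0 ≤ a) (hb : 0 ≤ b) :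
    0 ≤ (τ (a * b)).re := by
  have h : τ (a * b) = τ (star (CFC.sqrt b) * a * CFC.sqrt b) := by
    have hs : star (CFC.sqrt b) = CFC.sqrt b := (IsSelfAdjoint.of_nonneg (CFC.sqrt_nonneg b))
    rw [hs, mul_assoc, trace_mul_comm hτ (CFC.sqrt b), mul_assoc, CFC.sqrt_mul_sqrt_self b hb]
  rw [h]
  exact trace_re_nonneg τ (star_left_conjugate_nonneg ha _)

theorem trace_mul_mono (hτ : τ ∈ tracialStateSpace A) {f a b : A} (hf : 0 ≤ f) (hab : a ≤ b) :
    (τ (f * a)).re ≤ (τ (f * b)).re := by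
  have := trace_mul_nonneg hτ hf (sub_nonneg.mpr hab)
  rw [mul_sub, map_sub, Complex.sub_re] at this
  linarith

theorem trace_re_le_one (hτ : τ ∈ tracialStateSpace A) {a : A} (h : a ≤ 1) : (τ a).re ≤ 1 := by
  have := trace_mono τ h
  rwa [hτ.1, Complex.one_re] at this

/-- The trace of a product with a positive element is controlled by the trace of the latter. -/
theorem trace_mul_le_norm_mul (hτ : τ ∈ tracialStateSpace A) {a b : A} (ha : IsSelfAdjoint a)
    (hb : 0 ≤ b) : (τ (a * b)).re ≤ ‖a‖ * (τ b).re := by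
  have h := trace_mul_mono hτ hb (IsSelfAdjoint.le_algebraMap_norm_self ha)
  rw [trace_mul_comm hτ a b]
  refine h.trans (le_of_eq ?_)
  rw [Algebra.algebraMap_eq_smul_one, mul_smul_comm, mul_one, ← Complex.coe_smul, map_smul]
  simp

end Traces

/-! ### Graphs: finite CW complexes of dimension at most one -/

/-- A presentation of a space as a finite graph: finitely many vertices `V` and edges
`Φ e : [0,1] → X`, whose interiors are embedded, disjoint from each other and from `V`. -/
structure GraphModel (X : Type) [TopologicalSpace X] where
  E : Type
  finiteE : Finite E
  V : Set X
  finiteV : V.Finite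
  Φ : E → C(unitInterval, X)
  cover : ∀ x, x ∈ V ∨ ∃ e t, Φ e t = x
  zero_mem : ∀ e, Φ e 0 ∈ V
  one_mem : ∀ e, Φ e 1 ∈ V
  inj : ∀ e e' t t', t ≠ 0 → t ≠ 1 → Φ e t = Φ e' t' → e = e' ∧ t = t'
  notMem : ∀ e t, t ≠ 0 → t ≠ 1 → Φ e t ∉ V

/-- The vertices are the 0-cells, and the edges are the 1-cells with their characteristic maps,
reparametrised from `[-1, 1]` to `[0, 1]`; the frontier of a 1-cell lies in the 0-skeleton. -/
theorem IsFiniteCWComplexDimLE.exists_graphModel {X : Type} [TopologicalSpace X]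
    (h : IsFiniteCWComplexDimLE 1 X) : Nonempty (GraphModel X) := by
  obtain ⟨hT2, hCW, hfin, hdim⟩ := h
  have hf0 : Finite (Topology.RelCWComplex.cell (Set.univ : Set X) 0) := hfin.finite_cell 0
  have hf1 : Finite (Topology.RelCWComplex.cell (Set.univ : Set X) 1) := hfin.finite_cell 1
  let μ (i : Topology.RelCWComplex.cell (Set.univ : Set X) 1) : unitInterval → X :=
    fun t => Topology.RelCWComplex.map (C := (Set.univ : Set X)) 1 i (fun _ => 2 * (t : ℝ) - 1)
  have hball : ∀ t : unitInterval, t ≠ 0 → t ≠ 1 →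
      (fun _ : Fin 1 => 2 * (t : ℝ) - 1) ∈ Metric.ball (0 : Fin 1 → ℝ) 1 := by
    intro t h0 h1
    have h0' : 0 < (t : ℝ) := unitInterval.pos_iff_ne_zero.mpr h0
    have h1' : (t : ℝ) < 1 := unitInterval.lt_one_iff_ne_one.mpr h1
    rw [mem_ball_zero_iff, pi_norm_lt_iff one_pos]
    intro _
    rw [Real.norm_eq_abs, abs_lt]
    constructor <;> linarith
  have hcball : ∀ t : unitInterval,
      (fun _ : Fin 1 => 2 * (t : ℝ) - 1) ∈ Metric.closedBall (0 : Fin 1 → ℝ) 1 := by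
    intro t
    rw [mem_closedBall_zero_iff, pi_norm_le_iff_of_nonneg zero_le_one]
    intro _
    rw [Real.norm_eq_abs, abs_le]
    constructor <;> linarith [t.2.1, t.2.2]
  have hμ : ∀ i, Continuous (μ i) := by
    intro i
    have := Topology.RelCWComplex.continuousOn (C := (Set.univ : Set X)) 1 i
    exact this.comp_continuous (by fun_prop) hcball
  let V : Set X := Set.range fun i : Topology.RelCWComplex.cell (Set.univ : Set X) 0 =>
    Topology.RelCWComplex.map (C := (Set.univ : Set X)) 0 i 0
  have hcell0 : ∀ i, Topology.RelCWComplex.closedCell (C := (Set.univ : Set X)) 0 i ⊆ V := by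
    rintro i _ ⟨y, -, rfl⟩
    exact ⟨i, by rw [Subsingleton.elim y 0]⟩
  have hend : ∀ i (y : Fin 1 → ℝ), y ∈ Metric.sphere (0 : Fin 1 → ℝ) 1 →
      Topology.RelCWComplex.map (C := (Set.univ : Set X)) 1 i y ∈ V := by
    intro i y hy
    obtain ⟨I, hI⟩ := Topology.CWComplex.cellFrontier_subset_finite_closedCell
      (C := (Set.univ : Set X)) 1 i
    have := hI ⟨y, hy, rfl⟩
    simp only [Set.mem_iUnion] at this
    obtain ⟨m, hm, j, -, hj⟩ := this
    obtain rfl : m = 0 := by omega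
    exact hcell0 j hj
  refine ⟨⟨Topology.RelCWComplex.cell (Set.univ : Set X) 1, hf1, V, Set.finite_range _,
    fun i => ⟨μ i, hμ i⟩, ?_, ?_, ?_, ?_, ?_⟩⟩
  · intro x
    have hx : x ∈ ⋃ (n : ℕ) (j : Topology.RelCWComplex.cell (Set.univ : Set X) n),
        Topology.RelCWComplex.closedCell n j := by
      rw [Topology.CWComplex.union]; trivial
    simp only [Set.mem_iUnion] at hx
    obtain ⟨n, j, hj⟩ := hx
    have hn : n ≤ 1 := by
      by_contra hn
      exact (hdim n (by omega)).elim j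
    rcases Nat.le_one_iff_eq_zero_or_eq_one.mp hn with rfl | rfl
    · exact Or.inl (hcell0 j hj)
    · right
      obtain ⟨y, hy, rfl⟩ := hj
      rw [mem_closedBall_zero_iff, pi_norm_le_iff_of_nonneg zero_le_one] at hy
      have h0 := hy 0
      rw [Real.norm_eq_abs, abs_le] at h0
      refine ⟨j, ⟨(y 0 + 1) / 2, by constructor <;> linarith⟩, ?_⟩
      change Topology.RelCWComplex.map (C := (Set.univ : Set X)) 1 j _ = _
      congr 1
      ext k
      rw [Subsingleton.elim k 0]
      ring
  · intro e
    refine hend e _ ?_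
    rw [mem_sphere_zero_iff_norm]
    simp [Pi.norm_def]
  · intro e
    refine hend e _ ?_
    rw [mem_sphere_zero_iff_norm]
    simp [Pi.norm_def]; norm_num
  · intro e e' t t' h0 h1 hee
    have hmem : Topology.RelCWComplex.map (C := (Set.univ : Set X)) 1 e
        (fun _ => 2 * (t : ℝ) - 1) ∈ Topology.RelCWComplex.openCell (C := (Set.univ : Set X)) 1 e :=
      ⟨_, hball t h0 h1, rfl⟩
    have hV : ∀ i : Topology.RelCWComplex.cell (Set.univ : Set X) 0,
        Topology.RelCWComplex.map (C := (Set.univ : Set X)) 1 e (fun _ => 2 * (t : ℝ) - 1)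
          ≠ Topology.RelCWComplex.map (C := (Set.univ : Set X)) 0 i 0 := by
      intro i hi
      refine Set.disjoint_left.mp (Topology.RelCWComplex.disjoint_openCell_of_ne
        (C := (Set.univ : Set X)) (i := e) (j := i) (by simp)) hmem ?_
      rw [hi]
      exact Topology.RelCWComplex.map_zero_mem_openCell 0 i
    have hee' : μ e t = μ e' t' := hee
    have ht' : t' ≠ 0 ∧ t' ≠ 1 := by
      constructor
      · rintro rfl
        obtain ⟨i, hi⟩ : μ e' 0 ∈ V := by
          refine hend e' _ ?_
          rw [mem_sphere_zero_iff_norm]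
          simp [Pi.norm_def]
        exact hV i (hee'.trans hi.symm)
      · rintro rfl
        obtain ⟨i, hi⟩ : μ e' 1 ∈ V := by
          refine hend e' _ ?_
          rw [mem_sphere_zero_iff_norm]
          simp [Pi.norm_def]; norm_num
        exact hV i (hee'.trans hi.symm)
    have he : e = e' := by
      by_contra hne
      refine Set.disjoint_left.mp (Topology.RelCWComplex.disjoint_openCell_of_ne
        (C := (Set.univ : Set X)) (i := e) (j := e') (by simpa using hne)) hmem ?_
      refine ⟨_, hball t' ht'.1 ht'.2, hee'.symm⟩
    subst he
    refine ⟨rfl, ?_⟩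
    have hinj := (Topology.RelCWComplex.map (C := (Set.univ : Set X)) 1 e).injOn
    rw [Topology.RelCWComplex.source_eq] at hinj
    have := congrFun (hinj (hball t h0 h1) (hball t' ht'.1 ht'.2) hee') 0
    ext
    linarith
  · rintro e t h0 h1 ⟨i, hi⟩
    refine Set.disjoint_left.mp (Topology.RelCWComplex.disjoint_openCell_of_ne
        (C := (Set.univ : Set X)) (i := e) (j := i) (by simp)) ⟨_, hball t h0 h1, rfl⟩ ?_
    have : Topology.RelCWComplex.map (C := (Set.univ : Set X)) 1 e (fun _ => 2 * (t : ℝ) - 1)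
        = Topology.RelCWComplex.map (C := (Set.univ : Set X)) 0 i 0 := hi.symm
    rw [this]
    exact Topology.RelCWComplex.map_zero_mem_openCell 0 i

namespace GraphModel

variable {X : Type} [TopologicalSpace X]

theorem compactSpace (Γ : GraphModel X) : CompactSpace X := by
  have := Γ.finiteE
  have h : (Set.univ : Set X) = Γ.V ∪ ⋃ e, Set.range (Γ.Φ e) := by
    ext x
    simpa using Γ.cover x
  refine ⟨?_⟩
  rw [h]
  exact Γ.finiteV.isCompact.union (isCompact_iUnion fun e => isCompact_range (Γ.Φ e).continuous)

/-- Compatible continuous data on the vertices and the edges of a graph glue to a continuous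
function. -/
theorem exists_glue [T2Space X] (Γ : GraphModel X) {T : Type*} [TopologicalSpace T] (c : X → T)
    (g : Γ.E → unitInterval → T) (hg : ∀ e, Continuous (g e)) (h0 : ∀ e, g e 0 = c (Γ.Φ e 0))
    (h1 : ∀ e, g e 1 = c (Γ.Φ e 1)) :
    ∃ G : C(X, T), (∀ v ∈ Γ.V, G v = c v) ∧ ∀ e t, G (Γ.Φ e t) = g e t := by
  classical
  have := Γ.finiteE
  let G : X → T := fun x => if hx : x ∈ Γ.V then c x else
    g ((Γ.cover x).resolve_left hx).choose ((Γ.cover x).resolve_left hx).choose_spec.choose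
  have hGV : ∀ v ∈ Γ.V, G v = c v := fun v hv => dif_pos hv
  have hGE : ∀ e t, G (Γ.Φ e t) = g e t := by
    intro e t
    by_cases h0' : t = 0
    · subst h0'; rw [hGV _ (Γ.zero_mem e), h0]
    by_cases h1' : t = 1
    · subst h1'; rw [hGV _ (Γ.one_mem e), h1]
    have hnot := Γ.notMem e t h0' h1'
    change dite _ _ _ = _
    rw [dif_neg hnot]
    have hspec := ((Γ.cover (Γ.Φ e t)).resolve_left hnot).choose_spec.choose_spec
    obtain ⟨h2, h3⟩ := Γ.inj _ _ _ _ h0' h1' hspec.symm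
    rw [← h3]
    congr 1
    exact h2.symm
  have hcont : Continuous G := by
    have hVf : Finite Γ.V := Γ.finiteV
    let f : Γ.V ⊕ Γ.E → Set X := Sum.elim (fun v => {v.1}) (fun e => Set.range (Γ.Φ e))
    refine (locallyFinite_of_finite f).continuous ?_ ?_ ?_
    · ext x
      simp only [Set.mem_iUnion, Set.mem_univ, iff_true]
      rcases Γ.cover x with hx | ⟨e, t, rfl⟩
      · exact ⟨Sum.inl ⟨x, hx⟩, rfl⟩
      · exact ⟨Sum.inr e, t, rfl⟩
    · rintro (v | e)
      · exact isClosed_singleton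
      · exact (isCompact_range (Γ.Φ e).continuous).isClosed
    · rintro (v | e)
      · exact continuousOn_singleton _ _
      · change ContinuousOn G (Set.range (Γ.Φ e))
        rw [continuousOn_iff_continuous_domRestrict]
        have hq : Topology.IsQuotientMap (Set.rangeFactorization (Γ.Φ e)) :=
          ((Γ.Φ e).continuous.rangeFactorization.isClosedMap).isQuotientMap
            ((Γ.Φ e).continuous.rangeFactorization) Set.rangeFactorization_surjective
        rw [hq.continuous_iff]
        have : (Set.range (Γ.Φ e)).domRestrict G ∘ Set.rangeFactorization (Γ.Φ e) = g e := by
          ext t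
          exact hGE e t
        rw [this]
        exact hg e
  exact ⟨⟨G, hcont⟩, hGV, hGE⟩

end GraphModel

/-! ### Two-coloured partitions of unity on graphs -/

/-- The piecewise linear hat function centred at `k` with support of radius one. -/
def hat (k s : ℝ) : ℝ := max 0 (1 - |s - k|)

theorem hat_nonneg (k s : ℝ) : 0 ≤ hat k s := le_max_left _ _

theorem continuous_hat (k : ℝ) : Continuous (hat k) := by unfold hat; fun_prop

theorem hat_eq_zero {k s : ℝ} (h : 1 ≤ |s - k|) : hat k s = 0 :=
  max_eq_left (by linarith)

theorem abs_sub_lt_one_of_hat_ne_zero {k s : ℝ} (h : hat k s ≠ 0) : |s - k| < 1 := by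
  by_contra h'
  exact h (hat_eq_zero (not_lt.mp h'))

theorem hat_mul_hat {k l s : ℝ} (h : 2 ≤ |k - l|) : hat k s * hat l s = 0 := by
  by_contra h'
  have h1 := abs_sub_lt_one_of_hat_ne_zero (left_ne_zero_of_mul h')
  have h2 := abs_sub_lt_one_of_hat_ne_zero (right_ne_zero_of_mul h')
  have := abs_sub_le k s l
  rw [abs_sub_comm k s] at this
  linarith

theorem sum_hat_eq (N : ℕ) {s : ℝ} (hs : 0 ≤ s) :
    ∑ k ∈ Finset.range (N + 1), hat k s = min 1 (max 0 (N + 1 - s)) := by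
  induction N with
  | zero =>
    simp only [zero_add, Finset.range_one, Finset.sum_singleton, hat, Nat.cast_zero, sub_zero,
      abs_of_nonneg hs]
    rw [min_eq_right]
    exact max_le zero_le_one (by linarith)
  | succ N ih =>
    rw [Finset.sum_range_succ, ih]
    unfold hat
    push_cast
    rcases le_total s N with h1 | h1
    · rw [max_eq_right (by linarith), min_eq_left (by linarith),
        max_eq_left (a := (0 : ℝ)) (b := 1 - |s - (N + 1)|), max_eq_right (by linarith),
        min_eq_left (by linarith), add_zero]
      rw [abs_of_nonpos (by linarith)]; linarith
    · rcases le_total s (N + 1) with h2 | h2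
      · rw [abs_of_nonpos (by linarith), max_eq_right (by linarith), min_eq_right (by linarith),
          max_eq_right (by linarith), max_eq_right (by linarith), min_eq_left (by linarith)]
        ring
      · rw [abs_of_nonneg (by linarith), max_eq_left (a := (0 : ℝ)) (b := (N : ℝ) + 1 - s)
          (by linarith), min_eq_right (by norm_num), zero_add, min_eq_right]
        · congr 1; ring
        · exact max_le zero_le_one (by linarith)

namespace GraphModel

variable {X : Type} [TopologicalSpace X]

/-- A graph has arbitrarily fine partitions of unity in two colours, the members of each colour
having disjoint supports: barycentric subdivision, with hat functions at the nodes. This is the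
only use of the dimension of the graph. -/
theorem exists_two_coloured_partition [T2Space X] (Γ : GraphModel X) {M : Type*}
    [PseudoMetricSpace M] {q : X → M} (hq : Continuous q) {δ : ℝ} (hδ : 0 < δ) :
    ∃ (J : Type) (_ : Fintype J) (c : J → Bool) (r : J → C(X, ℝ)) (b : J → X),
      (∀ j x, 0 ≤ r j x) ∧ (∀ x, ∑ j, r j x = 1) ∧
      (∀ j j' x, j ≠ j' → c j = c j' → r j x * r j' x = 0) ∧
      (∀ j x, r j x ≠ 0 → dist (q x) (q (b j)) < δ) := by
  classical
  have := Γ.finiteE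
  have hVf : Finite Γ.V := Γ.finiteV
  have := Fintype.ofFinite Γ.E
  have := Fintype.ofFinite Γ.V
  -- a common mesh on which `q` oscillates by less than `δ` along every edge
  obtain ⟨n, hn0, hn⟩ : ∃ n : ℕ, 0 < n ∧ ∀ e (t t' : unitInterval), |(t : ℝ) - t'| < 1 / n →
      dist (q (Γ.Φ e t)) (q (Γ.Φ e t')) < δ := by
    have h1 : ∀ e, ∃ κ > 0, ∀ t t' : unitInterval, dist t t' < κ →
        dist (q (Γ.Φ e t)) (q (Γ.Φ e t')) < δ := by
      intro e
      have huc : UniformContinuous fun t => q (Γ.Φ e t) :=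
        CompactSpace.uniformContinuous_of_continuous (by fun_prop)
      obtain ⟨κ, hκ, h⟩ := Metric.uniformContinuous_iff.mp huc δ hδ
      exact ⟨κ, hκ, fun t t' ht => h ht⟩
    choose κ hκ h1 using h1
    obtain ⟨κ0, hκ0, hle⟩ : ∃ κ0 > 0, ∀ e, κ0 ≤ κ e := by
      rcases isEmpty_or_nonempty Γ.E with he | he
      · exact ⟨1, one_pos, fun e => he.elim e⟩
      · obtain ⟨e0, he0⟩ := Finite.exists_min κ
        exact ⟨κ e0, hκ e0, he0⟩
    obtain ⟨n, hn⟩ := exists_nat_one_div_lt hκ0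
    refine ⟨n + 1, Nat.succ_pos n, fun e t t' ht => h1 e t t' ?_⟩
    push_cast at ht
    rw [Subtype.dist_eq, Real.dist_eq]
    linarith [hle e]
  -- With an even number of steps, the nodes of an edge can be coloured alternately so that both
  -- ends have the colour of the vertices.
  let N : ℕ := 2 * n
  have hN : (2 : ℝ) ≤ N := by
    have : 2 ≤ N := by omega
    exact_mod_cast this
  have hnear : ∀ e (t t' : unitInterval) (k : ℝ), N * (t' : ℝ) = k → hat k (N * t) ≠ 0 →
      dist (q (Γ.Φ e t)) (q (Γ.Φ e t')) < δ := by
    intro e t t' k hk h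
    have h1 := abs_sub_lt_one_of_hat_ne_zero h
    refine hn e t t' ?_
    rw [← hk, ← mul_sub, abs_mul, abs_of_nonneg (by linarith : (0 : ℝ) ≤ N)] at h1
    have hN' : (N : ℝ) = 2 * n := by push_cast [N]; ring
    have hn0' : (0 : ℝ) < n := by exact_mod_cast hn0
    rw [lt_div_iff₀ hn0']
    nlinarith [abs_nonneg ((t : ℝ) - t')]
  -- The hat function at a vertex, on all edges which end there; a loop contributes two terms.
  have hvert : ∀ v : Γ.V, ∃ r : C(X, ℝ), (∀ w ∈ Γ.V, r w = if w = v then 1 else 0) ∧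
      ∀ e t, r (Γ.Φ e t) = (if Γ.Φ e 0 = v then hat 0 (N * (t : ℝ)) else 0)
        + (if Γ.Φ e 1 = v then hat N (N * (t : ℝ)) else 0) := by
    intro v
    refine Γ.exists_glue (fun w => if w = v then 1 else 0) _ ?_ ?_ ?_
    · intro e
      have h0 : Continuous fun t : unitInterval => hat 0 (N * (t : ℝ)) :=
        (continuous_hat 0).comp (by fun_prop)
      have h1 : Continuous fun t : unitInterval => hat N (N * (t : ℝ)) :=
        (continuous_hat N).comp (by fun_prop)
      split_ifs <;> fun_prop
    · intro e
      have h1 : hat 0 (N * ((0 : unitInterval) : ℝ)) = 1 := by simp [hat]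
      have h2 : hat N (N * ((0 : unitInterval) : ℝ)) = 0 := hat_eq_zero (by
        rw [Set.Icc.coe_zero, mul_zero, zero_sub, abs_neg]
        exact le_trans (by linarith) (le_abs_self _))
      rw [h1, h2]; simp
    · intro e
      have h1 : hat 0 (N * ((1 : unitInterval) : ℝ)) = 0 := hat_eq_zero (by
        rw [Set.Icc.coe_one, mul_one, sub_zero]
        exact le_trans (by linarith) (le_abs_self _))
      have h2 : hat N (N * ((1 : unitInterval) : ℝ)) = 1 := by simp [hat]
      rw [h1, h2]; simp
  -- The hat functions at the interior nodes of the edges.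
  have hedge : ∀ p : Γ.E × Fin (N - 1), ∃ r : C(X, ℝ), (∀ w ∈ Γ.V, r w = 0) ∧
      ∀ e t, r (Γ.Φ e t) = if e = p.1 then hat ((p.2 : ℕ) + 1 : ℕ) (N * (t : ℝ)) else 0 := by
    rintro ⟨e0, k⟩
    have hk : ((k : ℕ) + 1 : ℝ) + 1 ≤ N := by
      have := k.2
      have : (k : ℕ) + 1 + 1 ≤ N := by omega
      exact_mod_cast this
    refine Γ.exists_glue (fun _ => 0) _ ?_ ?_ ?_
    · intro e
      have h0 : Continuous fun t : unitInterval => hat ((k : ℕ) + 1 : ℕ) (N * (t : ℝ)) :=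
        (continuous_hat _).comp (by fun_prop)
      split_ifs <;> fun_prop
    · intro e
      have : hat ((k : ℕ) + 1 : ℕ) (N * ((0 : unitInterval) : ℝ)) = 0 := by
        refine hat_eq_zero ?_
        rw [Set.Icc.coe_zero, mul_zero, zero_sub, abs_neg, abs_of_nonneg (by positivity)]
        push_cast; linarith [(Nat.cast_nonneg (k : ℕ) : (0 : ℝ) ≤ (k : ℕ))]
      simp only [this, ite_self]
    · intro e
      have : hat ((k : ℕ) + 1 : ℕ) (N * ((1 : unitInterval) : ℝ)) = 0 := by
        refine hat_eq_zero ?_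
        rw [Set.Icc.coe_one, mul_one]
        push_cast
        exact le_trans (by linarith) (le_abs_self _)
      simp only [this, ite_self]
  choose rv hrv hrv' using hvert
  choose re hre hre' using hedge
  have hparity : ∀ a b : ℕ, a ≠ b → decide (a % 2 = 1) = decide (b % 2 = 1) →
      ∀ s, hat (a : ℝ) s * hat (b : ℝ) s = 0 := by
    intro a b hab hpar s
    refine hat_mul_hat ?_
    have h2 : a % 2 = 1 ↔ b % 2 = 1 := by simpa using hpar
    rcases lt_or_gt_of_ne hab with h | h
    · have : a + 2 ≤ b := by omega
      have : (a : ℝ) + 2 ≤ b := by exact_mod_cast this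
      rw [abs_sub_comm]
      exact le_trans (by linarith) (le_abs_self _)
    · have : b + 2 ≤ a := by omega
      have : (b : ℝ) + 2 ≤ a := by exact_mod_cast this
      exact le_trans (by linarith) (le_abs_self _)
  have hve : ∀ (v : Γ.V) (p : Γ.E × Fin (N - 1)) x,
      false = decide (((p.2 : ℕ) + 1) % 2 = 1) → rv v x * re p x = 0 := by
    intro v p x hc
    rcases Γ.cover x with hx | ⟨e, t, rfl⟩
    · rw [hre p x hx, mul_zero]
    · rw [hrv', hre']
      have hp := p.2.2
      have h0 := hparity 0 ((p.2 : ℕ) + 1) (by omega) (by simpa using hc) (N * (t : ℝ))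
      have h1 := hparity N ((p.2 : ℕ) + 1) (by omega) (by
        rw [← hc]; simp [N]) (N * (t : ℝ))
      rw [Nat.cast_zero] at h0
      rw [add_mul]
      split_ifs <;> simp only [h0, h1, mul_zero, zero_mul, add_zero]
  refine ⟨Γ.V ⊕ (Γ.E × Fin (N - 1)), inferInstance,
    Sum.elim (fun _ => false) (fun p => decide (((p.2 : ℕ) + 1) % 2 = 1)),
    Sum.elim rv re,
    Sum.elim (fun v => v.1) (fun p => Γ.Φ p.1 ⟨(((p.2 : ℕ) + 1 : ℕ) : ℝ) / N, by
      have := p.2.2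
      have h1 : (((p.2 : ℕ) + 1 : ℕ) : ℝ) ≤ N := by
        have : (p.2 : ℕ) + 1 ≤ N := by omega
        exact_mod_cast this
      exact ⟨by positivity, div_le_one_of_le₀ h1 (by linarith)⟩⟩), ?_, ?_, ?_, ?_⟩
  · rintro (v | p) x
    · rcases Γ.cover x with hx | ⟨e, t, rfl⟩
      · simp only [Sum.elim_inl, hrv v x hx]; split_ifs <;> norm_num
      · simp only [Sum.elim_inl, hrv']
        have := hat_nonneg 0 (N * (t : ℝ))
        have := hat_nonneg N (N * (t : ℝ))
        split_ifs <;> positivity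
    · rcases Γ.cover x with hx | ⟨e, t, rfl⟩
      · simp only [Sum.elim_inr, hre p x hx, le_refl]
      · simp only [Sum.elim_inr, hre']
        split_ifs
        · exact hat_nonneg _ _
        · exact le_rfl
  · intro x
    simp only [Fintype.sum_sum_type, Sum.elim_inl, Sum.elim_inr]
    rcases Γ.cover x with hx | ⟨e, t, rfl⟩
    · have h1 : ∑ v : Γ.V, rv v x = 1 := by
        rw [Finset.sum_eq_single (⟨x, hx⟩ : Γ.V)]
        · rw [hrv _ x hx]; simp
        · intro v _ hv
          rw [hrv _ x hx, if_neg]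
          rintro rfl
          exact hv rfl
        · simp
      have h2 : ∑ p, re p x = 0 := Finset.sum_eq_zero fun p _ => hre p x hx
      rw [h1, h2, add_zero]
    · have h1 : ∑ v : Γ.V, rv v (Γ.Φ e t) = hat 0 (N * (t : ℝ)) + hat N (N * (t : ℝ)) := by
        simp only [hrv']
        rw [Finset.sum_add_distrib]
        congr 1
        · rw [Finset.sum_eq_single (⟨_, Γ.zero_mem e⟩ : Γ.V)]
          · simp
          · intro v _ hv
            rw [if_neg]
            intro h
            exact hv (Subtype.ext h.symm)
          · simp
        · rw [Finset.sum_eq_single (⟨_, Γ.one_mem e⟩ : Γ.V)]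
          · simp
          · intro v _ hv
            rw [if_neg]
            intro h
            exact hv (Subtype.ext h.symm)
          · simp
      have h2 : ∑ p, re p (Γ.Φ e t)
          = ∑ k : Fin (N - 1), hat ((k : ℕ) + 1 : ℕ) (N * (t : ℝ)) := by
        rw [Fintype.sum_prod_type]
        simp only [hre']
        rw [Finset.sum_eq_single e]
        · simp
        · intro e' _ he'
          simp [Ne.symm he']
        · simp
      have hs : (0 : ℝ) ≤ N * (t : ℝ) := by have := t.2.1; positivity
      have hs' : N * (t : ℝ) ≤ N := by nlinarith [t.2.2]
      have h3 := sum_hat_eq N hs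
      rw [max_eq_right (by linarith), min_eq_left (by linarith)] at h3
      rw [h1, h2, ← h3, Finset.sum_range_succ, Fin.sum_univ_eq_sum_range
        (fun k => hat ((k + 1 : ℕ) : ℝ) (N * (t : ℝ))) (N - 1)]
      have hN1 : N = N - 1 + 1 := by omega
      have h4 : ∑ k ∈ Finset.range N, hat (k : ℝ) (N * (t : ℝ))
          = ∑ k ∈ Finset.range (N - 1), hat ((k + 1 : ℕ) : ℝ) (N * (t : ℝ))
            + hat 0 (N * (t : ℝ)) := by
        have := Finset.sum_range_succ' (fun k : ℕ => hat (k : ℝ) (N * (t : ℝ))) (N - 1)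
        rw [← hN1] at this
        simpa using this
      rw [h4]
      ring
  · rintro (v | p) (w | p') x hne hc
    · simp only [Sum.elim_inl]
      have hvw : v.1 ≠ w.1 := fun h => hne (congrArg Sum.inl (Subtype.ext h))
      rcases Γ.cover x with hx | ⟨e, t, rfl⟩
      · rw [hrv _ x hx, hrv _ x hx]
        by_cases h1 : x = v.1
        · rw [if_neg (fun h2 => hvw (h1.symm.trans h2)), mul_zero]
        · rw [if_neg h1, zero_mul]
      · rw [hrv', hrv']
        have h0 := hat_mul_hat (k := 0) (l := N) (s := N * (t : ℝ)) (by
          rw [zero_sub, abs_neg]; exact hN.trans (le_abs_self _))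
        have h1 : hat N (N * (t : ℝ)) * hat 0 (N * (t : ℝ)) = 0 := by rw [mul_comm]; exact h0
        have hA : ∀ (y : X) (a b : ℝ),
            (if y = v.1 then a else 0) * (if y = w.1 then b else 0) = 0 := by
          intro y a b
          by_cases h2 : y = v.1
          · rw [if_neg (fun h3 => hvw (h2.symm.trans h3)), mul_zero]
          · rw [if_neg h2, zero_mul]
        have hB : ∀ (y z : X) (a b : ℝ), a * b = 0 →
            (if y = v.1 then a else 0) * (if z = w.1 then b else 0) = 0 := by
          intro y z a b h2
          rw [ite_mul, mul_ite, h2, mul_zero, zero_mul, ite_self, ite_self]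
        rw [add_mul, mul_add, mul_add, hA, hA, hB _ _ _ _ h0, hB _ _ _ _ h1]
        norm_num
    · exact hve v p' x hc
    · rw [mul_comm]; exact hve w p x hc.symm
    · simp only [Sum.elim_inr]
      rcases Γ.cover x with hx | ⟨e, t, rfl⟩
      · rw [hre p x hx, zero_mul]
      · rw [hre', hre']
        by_cases h1 : e = p.1
        · by_cases h2 : e = p'.1
          · rw [if_pos h1, if_pos h2]
            refine hparity _ _ ?_ hc _
            intro h
            refine hne (congrArg Sum.inr (Prod.ext (h1.symm.trans h2) (Fin.ext ?_)))
            omega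
          · rw [if_neg h2, mul_zero]
        · rw [if_neg h1, zero_mul]
  · rintro (v | p) x hx
    · simp only [Sum.elim_inl] at hx ⊢
      rcases Γ.cover x with hxV | ⟨e, t, rfl⟩
      · rw [hrv _ x hxV] at hx
        have : x = v := by
          by_contra h
          exact hx (if_neg h)
        rw [this, dist_self]; exact hδ
      · rw [hrv'] at hx
        by_cases h0 : Γ.Φ e 0 = v ∧ hat 0 (N * (t : ℝ)) ≠ 0
        · rw [← h0.1]
          exact hnear e t 0 0 (by simp) h0.2
        · by_cases h1 : Γ.Φ e 1 = v ∧ hat N (N * (t : ℝ)) ≠ 0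
          · rw [← h1.1]
            exact hnear e t 1 N (by simp) h1.2
          · exfalso
            apply hx
            have e0 : (if Γ.Φ e 0 = v then hat 0 (N * (t : ℝ)) else 0) = 0 := by
              split_ifs with h
              · by_contra h'; exact h0 ⟨h, h'⟩
              · rfl
            have e1 : (if Γ.Φ e 1 = v then hat N (N * (t : ℝ)) else 0) = 0 := by
              split_ifs with h
              · by_contra h'; exact h1 ⟨h, h'⟩
              · rfl
            rw [e0, e1, add_zero]
    · simp only [Sum.elim_inr] at hx ⊢
      rcases Γ.cover x with hxV | ⟨e, t, rfl⟩
      · exact absurd (hre p x hxV) hx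
      · rw [hre'] at hx
        have he : e = p.1 := by
          by_contra h
          exact hx (if_neg h)
        rw [if_pos he] at hx
        rw [← he]
        refine hnear e t _ _ ?_ hx
        have : (N : ℝ) ≠ 0 := by linarith
        field_simp

end GraphModel

/-! ### Models of corners -/


/-- Continuous functions on `X` with values in the `m × m` matrices. -/
abbrev MatFun (X : Type) [TopologicalSpace X] (m : ℕ) : Type := C(X, Matrix (Fin m) (Fin m) ℂ)

/-- Matrices of continuous functions are the same as continuous matrix-valued functions. -/
noncomputable def matrixMatFun (X : Type) [TopologicalSpace X] (m : ℕ) :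
    Matrix (Fin m) (Fin m) C(X, ℂ) ≃⋆ₐ[ℂ] MatFun X m where
  toFun M := ⟨fun x => M.map fun f => f x, by
    refine continuous_matrix fun i j => ?_
    exact (M i j).continuous⟩
  invFun N := Matrix.of fun i j => ⟨fun x => N x i j, (N.continuous).matrix_elem i j⟩
  left_inv M := by ext; rfl
  right_inv N := by ext; rfl
  map_mul' M N := by
    ext x i j
    simp [Matrix.mul_apply]
  map_add' M N := by ext; rfl
  map_smul' c M := by ext; rfl
  map_star' M := by ext; rfl

/-- A description of a subalgebra of `A` as a corner `P M_m(C(X)) P`. The isomorphism from the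
corner is recorded as the linear map `ι` on all of `M_m(C(X))` which first compresses to the
corner; the unit of the subalgebra is `ι P`. -/
structure CornerModel (A : Type*) [CStarAlgebra A] (X : Type)
    [TopologicalSpace X] [CompactSpace X] (m : ℕ) where
  /-- The projection defining the corner. -/
  P : MatFun X m
  isStarProjection : IsStarProjection P
  /-- The isomorphism from the corner, preceded by compression to the corner. -/
  ι : MatFun X m →ₗ[ℂ] A
  map_star : ∀ M, ι (star M) = star (ι M)
  map_mul : ∀ M N, ι M * ι N = ι (M * P * N)
  map_corner : ∀ M, ι (P * M * P) = ι M
  norm_map : ∀ M, ‖ι M‖ = ‖P * M * P‖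

/-- Star isomorphisms of closed subalgebras are isometric, also when the target is given as a
corner of a star algebra that is only isomorphic to a C*-algebra. -/
theorem norm_symm_projCorner {A : Type*} [CStarAlgebra A] {B : NonUnitalStarSubalgebra ℂ A}
    (hcl : IsClosed (B : Set A)) {M : Type*} [Ring M] [StarRing M] [Algebra ℂ M] [StarModule ℂ M]
    {P : M} (hP : IsStarProjection P) (e : B ≃⋆ₐ[ℂ] projCorner P hP) {E : Type*} [CStarAlgebra E]
    (θ : M ≃⋆ₐ[ℂ] E) (y : projCorner P hP) : ‖((e.symm y : B) : A)‖ = ‖θ (y : M)‖ := by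
  have : IsClosed (B : Set A) := hcl
  let ψ : B →⋆ₙₐ[ℂ] E :=
    { toFun := fun b => θ ((e b : projCorner P hP) : M)
      map_smul' := fun c b => by simp
      map_zero' := by simp
      map_add' := fun a b => by simp
      map_mul' := fun a b => by simp
      map_star' := fun a => by simp [StarHomClass.map_star] }
  have hψ : Function.Injective ψ := fun a b h => e.injective (Subtype.ext (θ.injective h))
  have h1 := NonUnitalStarAlgHom.norm_map ψ hψ (e.symm y)
  have h2 : ψ (e.symm y) = θ (y : M) :=
    congrArg (fun z : projCorner P hP => θ (z : M)) (e.apply_symm_apply y)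
  rw [← h2, h1]
  rfl

/-- A corner model of a subalgebra isomorphic to a corner of an algebra `R` which is isomorphic to
the matrix-valued functions. -/
theorem exists_cornerModel_of_starAlgEquiv {A : Type*} [CStarAlgebra A] {p : A}
    {B : NonUnitalStarSubalgebra ℂ A} (hcl : IsClosed (B : Set A)) (hpB : p ∈ B)
    (hp : ∀ b ∈ B, p * b = b ∧ b * p = b) {R : Type*} [Ring R] [StarRing R] [Algebra ℂ R]
    [StarModule ℂ R] {P₀ : R} (hP₀ : IsStarProjection P₀) (e : B ≃⋆ₐ[ℂ] projCorner P₀ hP₀)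
    {X : Type} [TopologicalSpace X] [CompactSpace X] {m : ℕ} (θ : R ≃⋆ₐ[ℂ] MatFun X m) :
    ∃ Q : CornerModel A X m, Q.ι Q.P = p ∧ ∀ b ∈ B, ∃ M, Q.P * M * Q.P = M ∧ Q.ι M = b := by
  have hPP : P₀ * P₀ = P₀ := hP₀.isIdempotentElem
  have hPs : star P₀ = P₀ := hP₀.isSelfAdjoint
  have hmem : ∀ N, P₀ * N * P₀ ∈ projCorner P₀ hP₀ := fun N =>
    ⟨by rw [← mul_assoc, ← mul_assoc, hPP], by rw [mul_assoc, hPP]⟩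
  let κ : MatFun X m →ₗ[ℂ] A :=
    { toFun := fun M => (e.symm ⟨P₀ * θ.symm M * P₀, hmem _⟩ : B)
      map_add' := fun M N => by
        rw [← AddMemClass.coe_add, ← map_add]
        congr 2
        ext1
        simp [mul_add, add_mul]
      map_smul' := fun c M => by
        rw [RingHom.id_apply, ← SetLike.val_smul, ← map_smul]
        congr 2
        ext1
        simp }
  have hκ : ∀ M, κ M = (e.symm ⟨P₀ * θ.symm M * P₀, hmem _⟩ : B) := fun M => rfl
  have hκeq : ∀ M (y : projCorner P₀ hP₀), P₀ * θ.symm M * P₀ = y → κ M = (e.symm y : B) := by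
    intro M y h
    rw [hκ]
    congr 2
    exact Subtype.ext h
  have hone : ((e.symm ⟨P₀, hPP, hPP⟩ : B) : A) = p := by
    have h1 : e.symm ⟨P₀, hPP, hPP⟩ * e.symm (e ⟨p, hpB⟩) = e.symm (e ⟨p, hpB⟩) := by
      rw [← _root_.map_mul]
      congr 1
      exact Subtype.ext (e ⟨p, hpB⟩).2.1
    rw [StarAlgEquiv.symm_apply_apply] at h1
    exact ((hp _ (e.symm ⟨P₀, hPP, hPP⟩).2).2).symm.trans (congrArg Subtype.val h1)
  refine ⟨
    { P := θ P₀
      isStarProjection := ?_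
      ι := κ
      map_star := ?_
      map_mul := ?_
      map_corner := ?_
      norm_map := ?_ }, ?_, ?_⟩
  · exact ⟨by rw [IsIdempotentElem, ← _root_.map_mul, hPP], by
      rw [IsSelfAdjoint, ← StarHomClass.map_star, hPs]⟩
  · intro M
    rw [hκ M, ← StarMemClass.coe_star, ← StarHomClass.map_star]
    refine hκeq _ _ ?_
    simp [hPs, mul_assoc, StarHomClass.map_star]
  · intro M N
    rw [hκ M, hκ N, ← MulMemClass.coe_mul, ← _root_.map_mul]
    refine (hκeq _ _ ?_).symm
    simp only [_root_.map_mul, StarAlgEquiv.symm_apply_apply, MulMemClass.coe_mul]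
    calc _ = P₀ * θ.symm M * (P₀ * P₀) * θ.symm N * P₀ := by rw [hPP]; noncomm_ring
      _ = _ := by noncomm_ring
  · intro M
    rw [hκ M]
    refine hκeq _ _ ?_
    simp only [_root_.map_mul, StarAlgEquiv.symm_apply_apply]
    calc _ = (P₀ * P₀) * θ.symm M * (P₀ * P₀) := by noncomm_ring
      _ = _ := by rw [hPP]
  · intro M
    have h := norm_symm_projCorner (E := MatFun X m) hcl hP₀ e θ
    refine (h ⟨P₀ * θ.symm M * P₀, hmem _⟩).trans ?_
    simp only [_root_.map_mul, StarAlgEquiv.apply_symm_apply]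
  · rw [← hone]
    refine hκeq _ _ ?_
    simp [hPP]
  · intro b hb
    have h1 := (e ⟨b, hb⟩).2
    have h2 : P₀ * ((e ⟨b, hb⟩ : projCorner P₀ hP₀) : R) * P₀
        = (e ⟨b, hb⟩ : projCorner P₀ hP₀) := by rw [h1.1, h1.2]
    refine ⟨θ (e ⟨b, hb⟩ : projCorner P₀ hP₀), ?_, ?_⟩
    · rw [← _root_.map_mul, ← _root_.map_mul, h2]
    · rw [hκeq _ (e ⟨b, hb⟩) (by rw [StarAlgEquiv.symm_apply_apply, h2]),
        StarAlgEquiv.symm_apply_apply]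

/-- The members of the class `I_1` inside a C*-algebra have a corner model. -/
theorem InClassI.exists_cornerModel {A : Type*} [CStarAlgebra A] {p : A}
    {B : NonUnitalStarSubalgebra ℂ A} (hcl : IsClosed (B : Set A)) (hB : InClassI 1 B)
    (hpB : p ∈ B) (hp : ∀ b ∈ B, p * b = b ∧ b * p = b) :
    ∃ (X : Type) (_ : TopologicalSpace X) (_ : CompactSpace X) (m : ℕ),
      T2Space X ∧ Nonempty (GraphModel X) ∧ ∃ Q : CornerModel A X m, Q.ι Q.P = p ∧
        ∀ b ∈ B, ∃ M, Q.P * M * Q.P = M ∧ Q.ι M = b := by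
  obtain ⟨X, _, hX, m, P₀, hP₀, ⟨e⟩⟩ := hB
  obtain ⟨Γ⟩ := hX.exists_graphModel
  have := Γ.compactSpace
  exact ⟨X, inferInstance, inferInstance, m, hX.1, ⟨Γ⟩,
    exists_cornerModel_of_starAlgEquiv hcl hpB hp hP₀ e (matrixMatFun X m)⟩

/-- A positive element of the form `star c * c` is the square of a selfadjoint `s`; if `c` is in
the right ideal of a projection, `s` is in its corner. -/
theorem exists_selfAdjoint_sq_eq {E : Type*} [CStarAlgebra E] (c : E) {P : E}
    (hP : IsStarProjection P) (hc : c * P = c) :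
    ∃ s : E, IsSelfAdjoint s ∧ s * s = star c * c ∧ P * s = s ∧ s * P = s := by
  have hsa : IsSelfAdjoint (star c * c) := IsSelfAdjoint.star_mul_self c
  set s := cfc Real.sqrt (star c * c) with hs
  have hssa : IsSelfAdjoint s := cfc_predicate _ _
  have hss : s * s = star c * c := by
    rw [hs, ← cfc_mul Real.sqrt Real.sqrt _ (by fun_prop) (by fun_prop)]
    conv_rhs => rw [← cfc_id' ℝ (star c * c) hsa]
    refine cfc_congr fun x hx => ?_
    exact Real.mul_self_sqrt (spectrum_star_mul_self_nonneg x hx)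
  have hsP : s * P = s := by
    have h1 : star (s - s * P) * (s - s * P) = 0 := by
      have hPs : star P = P := hP.isSelfAdjoint
      have h2 : star (s - s * P) = s - P * s := by
        rw [star_sub, star_mul, hPs, hssa.star_eq]
      rw [h2]
      calc (s - P * s) * (s - s * P) = s * s - (s * s) * P - (P * (s * s)) + P * (s * s) * P := by
            noncomm_ring
        _ = 0 := by
          have h3 : star c * c * P = star c * c := by rw [mul_assoc, hc]
          rw [hss, mul_assoc P, h3]; abel
    have := CStarRing.star_mul_self_eq_zero_iff _ |>.mp h1
    exact (sub_eq_zero.mp this).symm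
  refine ⟨s, hssa, hss, ?_, hsP⟩
  have := congrArg star hsP
  rwa [star_mul, hssa.star_eq, hP.isSelfAdjoint.star_eq] at this

namespace CornerModel

variable {A : Type*} [CStarAlgebra A] {X : Type}
  [TopologicalSpace X] [CompactSpace X] {m : ℕ} (Q : CornerModel A X m)

theorem P_mul_P : Q.P * Q.P = Q.P := Q.isStarProjection.isIdempotentElem

theorem star_P : star Q.P = Q.P := Q.isStarProjection.isSelfAdjoint

theorem isStarProjection_apply (x : X) : IsStarProjection (Q.P x) :=
  ⟨congrArg (fun M : MatFun X m => M x) Q.P_mul_P, congrArg (fun M : MatFun X m => M x) Q.star_P⟩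

theorem norm_P_le : ‖Q.P‖ ≤ 1 := Q.isStarProjection.norm_le

theorem norm_map_le (M : MatFun X m) : ‖Q.ι M‖ ≤ ‖M‖ := by
  rw [Q.norm_map]
  calc ‖Q.P * M * Q.P‖ ≤ ‖Q.P‖ * ‖M‖ * ‖Q.P‖ := norm_mul₃_le
    _ ≤ 1 * ‖M‖ * 1 := by gcongr <;> exact Q.norm_P_le
    _ = ‖M‖ := by ring

theorem map_mul_of_left {M : MatFun X m} (N : MatFun X m) (h : M * Q.P = M) :
    Q.ι M * Q.ι N = Q.ι (M * N) := by rw [Q.map_mul, h]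

theorem map_mul_of_right (M : MatFun X m) {N : MatFun X m} (h : Q.P * N = N) :
    Q.ι M * Q.ι N = Q.ι (M * N) := by rw [Q.map_mul, mul_assoc, h]

theorem map_isSelfAdjoint {M : MatFun X m} (h : IsSelfAdjoint M) : IsSelfAdjoint (Q.ι M) := by
  rw [IsSelfAdjoint, ← Q.map_star, h.star_eq]

theorem map_mul_P (M : MatFun X m) : Q.ι (M * Q.P) = Q.ι M := by
  rw [← Q.map_corner (M * Q.P), ← Q.map_corner M]
  congr 1
  simp only [mul_assoc, Q.P_mul_P]

theorem map_P_mul (M : MatFun X m) : Q.ι (Q.P * M) = Q.ι M := by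
  rw [← Q.map_corner (Q.P * M), ← Q.map_corner M]
  congr 1
  simp only [← mul_assoc, Q.P_mul_P]

theorem map_star_mul_self_nonneg [PartialOrder A] [StarOrderedRing A] (M : MatFun X m) :
    0 ≤ Q.ι (star M * M) := by
  obtain ⟨s, hs, hss, hPs, hsP⟩ := exists_selfAdjoint_sq_eq (M * Q.P) Q.isStarProjection
    (by rw [mul_assoc, Q.P_mul_P])
  have h1 : Q.ι (star M * M) = star (Q.ι s) * Q.ι s := by
    rw [← Q.map_star, hs.star_eq, Q.map_mul_of_left _ hsP, hss, star_mul, Q.star_P,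
      ← Q.map_corner (star M * M)]
    congr 1
    noncomm_ring
  rw [h1]
  exact star_mul_self_nonneg _

theorem map_nonneg_of_sq [PartialOrder A] [StarOrderedRing A] {M : MatFun X m} {N : MatFun X m}
    (hN : IsSelfAdjoint N) (h : M = N * N) : 0 ≤ Q.ι M := by
  have := Q.map_star_mul_self_nonneg N
  rwa [hN.star_eq, ← h] at this

theorem mul_map (M : MatFun X m) : Q.ι Q.P * Q.ι M = Q.ι M := by
  rw [Q.map_mul, Q.P_mul_P, Q.map_P_mul]

theorem map_mul_unit (M : MatFun X m) : Q.ι M * Q.ι Q.P = Q.ι M := by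
  rw [Q.map_mul, mul_assoc, Q.P_mul_P, Q.map_mul_P]

end CornerModel

/-! ### Approximate diagonalisation over graphs -/

/-- A unitary with finite spectrum is an exponential, within its bicommutant. -/
theorem exists_expUnitary_eq_of_finite_spectrum {M : Type*} [CStarAlgebra M] (w : unitary M)
    (hw : (spectrum ℂ (w : M)).Finite) :
    ∃ k : selfAdjoint M, selfAdjoint.expUnitary k = w ∧
      ∀ d : M, Commute (w : M) d → Commute (star (w : M)) d → Commute (k : M) d := by
  refine ⟨Unitary.argSelfAdjoint w, ?_, fun d h1 h2 => ?_⟩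
  · ext
    have : ContinuousOn Complex.arg (spectrum ℂ (w : M)) := hw.continuousOn _
    rw [selfAdjoint.expUnitary_coe, Unitary.argSelfAdjoint_coe,
      ← CFC.exp_eq_normedSpace_exp (𝕜 := ℂ), ← cfc_comp_smul .., ← cfc_comp' ..]
    conv_rhs => rw [← cfc_id' ℂ (w : M)]
    refine cfc_congr fun y hy => ?_
    have hy₁ : ‖y‖ = 1 := spectrum.norm_eq_one_of_unitary w.2 hy
    have : Complex.I * y.arg = Complex.log y :=
      Complex.ext (by simp [Complex.log_re, hy₁]) (by simp [Complex.log_im])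
    have hy0 : y ≠ 0 := by rintro rfl; simp at hy₁
    simpa [← Complex.exp_eq_exp_ℂ, this] using Complex.exp_log hy0
  · rw [Unitary.argSelfAdjoint_coe]
    exact h1.cfc h2 _

/-- Pairs of a unitary matrix and a list of real numbers, to be thought of as a basis and
eigenvalues. -/
abbrev DiagData (m : ℕ) : Type := unitary (Matrix (Fin m) (Fin m) ℂ) × (Fin m → ℝ)

namespace DiagData

variable {m : ℕ}

/-- The selfadjoint matrix which has the given eigenvalues in the given basis. -/
noncomputable def toMatrix (k : DiagData m) : Matrix (Fin m) (Fin m) ℂ :=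
  k.1 * Matrix.diagonal (fun i => (k.2 i : ℂ)) * star (k.1 : Matrix (Fin m) (Fin m) ℂ)

theorem continuous_toMatrix : Continuous (toMatrix (m := m)) := by
  unfold toMatrix
  have h1 : Continuous fun k : DiagData m => (k.1 : Matrix (Fin m) (Fin m) ℂ) := by fun_prop
  have h2 : Continuous fun k : DiagData m => Matrix.diagonal (fun i => (k.2 i : ℂ)) :=
    Continuous.matrix_diagonal (by fun_prop)
  exact (h1.mul h2).mul h1.star

theorem exists_monotone_of_isHermitian {g : Matrix (Fin m) (Fin m) ℂ} (hg : g.IsHermitian) :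
    ∃ k : DiagData m, Monotone k.2 ∧ k.toMatrix = g := by
  let σ := Tuple.sort hg.eigenvalues
  let S : Matrix (Fin m) (Fin m) ℂ := fun i j => if i = σ j then 1 else 0
  have hSs : ∀ i j, star S i j = if j = σ i then 1 else 0 := by
    intro i j
    rw [Matrix.star_apply]
    simp only [S]
    split_ifs <;> simp
  have hS : S ∈ unitary (Matrix (Fin m) (Fin m) ℂ) := by
    rw [Unitary.mem_iff]
    constructor
    · ext i j
      rw [Matrix.mul_apply]
      simp only [hSs, S, Matrix.one_apply, ite_mul, one_mul, zero_mul, Finset.sum_ite_eq',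
        Finset.mem_univ, if_true, EmbeddingLike.apply_eq_iff_eq]
    · ext i j
      rw [Matrix.mul_apply]
      simp only [hSs, S, Matrix.one_apply, ite_mul, one_mul, zero_mul]
      rw [Finset.sum_eq_single (σ.symm i)]
      · simp [eq_comm]
      · intro b _ hb
        rw [if_neg]
        rintro rfl
        simp at hb
      · simp
  refine ⟨(hg.eigenvectorUnitary * ⟨S, hS⟩, hg.eigenvalues ∘ σ),
    Tuple.monotone_sort hg.eigenvalues, ?_⟩
  have h1 : S * Matrix.diagonal (fun i => ((hg.eigenvalues ∘ σ) i : ℂ)) * star S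
      = Matrix.diagonal (fun i => (hg.eigenvalues i : ℂ)) := by
    have h2 : S * Matrix.diagonal (fun i => ((hg.eigenvalues ∘ σ) i : ℂ))
        = Matrix.diagonal (fun i => (hg.eigenvalues i : ℂ)) * S := by
      ext i j
      rw [Matrix.mul_diagonal, Matrix.diagonal_mul]
      simp only [S, Function.comp]
      split_ifs with h
      · rw [h]; ring
      · ring
    rw [h2, mul_assoc, (Unitary.mem_iff.mp hS).2, mul_one]
  conv_rhs => rw [hg.spectral_theorem]
  rw [Unitary.conjStarAlgAut_apply]
  unfold toMatrix
  have h3 : ((hg.eigenvectorUnitary * ⟨S, hS⟩ : unitary (Matrix (Fin m) (Fin m) ℂ)) :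
      Matrix (Fin m) (Fin m) ℂ) = hg.eigenvectorUnitary * S := rfl
  simp only [h3, star_mul]
  have h4 : (Matrix.diagonal (RCLike.ofReal ∘ hg.eigenvalues) : Matrix (Fin m) (Fin m) ℂ)
    = Matrix.diagonal (fun i => (hg.eigenvalues i : ℂ)) := rfl
  rw [h4, ← h1]
  simp only [mul_assoc]

theorem isHermitian_toMatrix (k : DiagData m) : k.toMatrix.IsHermitian := by
  change star k.toMatrix = k.toMatrix
  have hd : star (Matrix.diagonal (fun i => (k.2 i : ℂ)))
      = (Matrix.diagonal (fun i => (k.2 i : ℂ)) : Matrix (Fin m) (Fin m) ℂ) := by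
    rw [Matrix.star_eq_conjTranspose, Matrix.diagonal_conjTranspose]
    congr 1
    ext i
    simp
  unfold toMatrix
  rw [star_mul, star_mul, star_star, hd, mul_assoc]

theorem norm_toMatrix (k : DiagData m) : ‖k.toMatrix‖ = ‖k.2‖ := by
  unfold toMatrix
  rw [← Unitary.coe_star, CStarRing.norm_mul_coe_unitary, CStarRing.norm_coe_unitary_mul,
    Matrix.l2_opNorm_diagonal]
  simp [Pi.norm_def]

theorem charpoly_toMatrix (k : DiagData m) :
    k.toMatrix.charpoly = ∏ i, (Polynomial.X - Polynomial.C (k.2 i : ℂ)) := by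
  unfold toMatrix
  rw [Matrix.charpoly_mul_comm, ← mul_assoc, Unitary.coe_star_mul_self, one_mul,
    Matrix.charpoly_diagonal]

theorem eq_of_toMatrix_eq {k k' : DiagData m} (hk : Monotone k.2) (hk' : Monotone k'.2)
    (h : k.toMatrix = k'.toMatrix) : k.2 = k'.2 := by
  have h1 := congrArg (fun M => M.charpoly.roots) h
  simp only [charpoly_toMatrix] at h1
  rw [Polynomial.roots_prod _ _
      (Finset.prod_ne_zero_iff.mpr fun i _ => Polynomial.X_sub_C_ne_zero _),
    Polynomial.roots_prod _ _ (Finset.prod_ne_zero_iff.mpr fun i _ => Polynomial.X_sub_C_ne_zero _)]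
    at h1
  simp only [Polynomial.roots_X_sub_C, Multiset.bind_singleton] at h1
  have h2 := congrArg (Multiset.map Complex.re) h1
  simp only [Multiset.map_map, Function.comp_def, Complex.ofReal_re] at h2
  have h3 : ∀ l : Fin m → ℝ,
      Multiset.map (fun i => l i) Finset.univ.val = (List.ofFn l : Multiset ℝ) := by
    intro l
    rw [List.ofFn_eq_map]
    rfl
  rw [h3, h3, Multiset.coe_eq_coe] at h2
  refine List.ofFn_injective (h2.eq_of_pairwise' (r := (· ≤ ·)) ?_ ?_)
  · exact List.pairwise_ofFn.mpr fun i j hij => hk hij.le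
  · exact List.pairwise_ofFn.mpr fun i j hij => hk' hij.le

/-- The sorted data whose matrix is within `ε` of `g`. -/
def near (g : Matrix (Fin m) (Fin m) ℂ) (ε : ℝ) : Set (DiagData m) :=
  {k | Monotone k.2 ∧ ‖k.toMatrix - g‖ < ε}

/-- Any two sorted diagonalisations of a matrix are connected: the change of basis commutes with
the matrix, and so do its logarithms. -/
theorem joinedIn_near_of_eq {k k' : DiagData m} (hk : Monotone k.2) (hk' : Monotone k'.2)
    (h : k.toMatrix = k'.toMatrix) {ε : ℝ} (hε : 0 < ε) : JoinedIn (near k.toMatrix ε) k k' := by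
  have hl := eq_of_toMatrix_eq hk hk' h
  obtain ⟨H, hH, hHc⟩ := exists_expUnitary_eq_of_finite_spectrum (star k.1 * k'.1)
    (Matrix.finite_spectrum _)
  set d : Matrix (Fin m) (Fin m) ℂ := Matrix.diagonal (fun i => (k.2 i : ℂ)) with hd
  have hkm : k.toMatrix = k.1 * d * star (k.1 : Matrix (Fin m) (Fin m) ℂ) := rfl
  have hkm' : k'.toMatrix = k'.1 * d * star (k'.1 : Matrix (Fin m) (Fin m) ℂ) := by
    rw [hd, hl]; rfl
  have u1 : star (k.1 : Matrix (Fin m) (Fin m) ℂ) * k.1 = 1 := Unitary.coe_star_mul_self _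
  have u2 : star (k'.1 : Matrix (Fin m) (Fin m) ℂ) * k'.1 = 1 := Unitary.coe_star_mul_self _
  have hcomm : Commute ((star k.1 * k'.1 : unitary (Matrix (Fin m) (Fin m) ℂ)) :
      Matrix (Fin m) (Fin m) ℂ) d := by
    change star (k.1 : Matrix (Fin m) (Fin m) ℂ) * k'.1 * d
      = d * (star (k.1 : Matrix (Fin m) (Fin m) ℂ) * k'.1)
    calc _ = star (k.1 : Matrix (Fin m) (Fin m) ℂ)
          * (k'.1 * d * star (k'.1 : Matrix (Fin m) (Fin m) ℂ)) * k'.1 := by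
          simp only [mul_assoc, u2, mul_one]
      _ = star (k.1 : Matrix (Fin m) (Fin m) ℂ)
          * (k.1 * d * star (k.1 : Matrix (Fin m) (Fin m) ℂ)) * k'.1 := by
          rw [← hkm', ← h, hkm]
      _ = (star (k.1 : Matrix (Fin m) (Fin m) ℂ) * k.1) * d
          * (star (k.1 : Matrix (Fin m) (Fin m) ℂ) * k'.1) := by simp only [mul_assoc]
      _ = _ := by rw [u1, one_mul]
  have hds : star d = d := by
    rw [hd, Matrix.star_eq_conjTranspose, Matrix.diagonal_conjTranspose]
    congr 1
    ext i
    simp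
  have hcomm' : Commute (star ((star k.1 * k'.1 : unitary (Matrix (Fin m) (Fin m) ℂ)) :
      Matrix (Fin m) (Fin m) ℂ)) d := by
    have := hcomm.star_star
    rwa [hds] at this
  have hHd := hHc d hcomm hcomm'
  let γ : Path k k' :=
    { toFun := fun t => (k.1 * selfAdjoint.expUnitary ((t : ℝ) • H), k.2)
      continuous_toFun := by fun_prop
      source' := by simp
      target' := by
        simp only [Set.Icc.coe_one, one_smul, hH]
        refine Prod.ext ?_ hl
        simp only [← mul_assoc, Unitary.mul_star_self, one_mul] }
  refine ⟨γ, fun t => ⟨hk, ?_⟩⟩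
  have h1 : (γ t).toMatrix = k.toMatrix := by
    set W := selfAdjoint.expUnitary ((t : ℝ) • H) with hW
    have hWd : Commute (W : Matrix (Fin m) (Fin m) ℂ) d := by
      rw [hW, selfAdjoint.expUnitary_coe]
      refine Commute.exp_left ?_
      exact ((hHd.smul_left (t : ℝ)).smul_left Complex.I)
    have : (γ t).toMatrix = k.1 * W * d * star (k.1 * W : Matrix (Fin m) (Fin m) ℂ) := rfl
    rw [this, hkm, star_mul, mul_assoc (k.1 : Matrix (Fin m) (Fin m) ℂ), hWd.eq]
    calc _ = k.1 * d * (W * star (W : Matrix (Fin m) (Fin m) ℂ))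
          * star (k.1 : Matrix (Fin m) (Fin m) ℂ) := by simp only [mul_assoc]
      _ = _ := by rw [Unitary.mul_star_self_of_mem W.2, mul_one]
  rw [h1, sub_self, norm_zero]
  exact hε

theorem exists_forall_joinedIn_near {k₀ : DiagData m} (hk₀ : Monotone k₀.2) {ε : ℝ} (hε : 0 < ε) :
    ∃ r > 0, ∀ k : DiagData m, Monotone k.2 → dist k k₀ < r →
      ‖k.toMatrix - k₀.toMatrix‖ < ε ∧ JoinedIn (near k₀.toMatrix ε) k k₀ := by
  obtain ⟨r, hr, h⟩ := Metric.continuous_iff.mp (continuous_toMatrix (m := m)) k₀ ε hε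
  have hr1 : 0 < min r 1 := lt_min hr one_pos
  refine ⟨min r 1, hr1, fun k hk hd => ?_⟩
  rw [Prod.dist_eq, max_lt_iff] at hd
  have hU : JoinedIn (Metric.ball k₀.1 (min r 1)) k.1 k₀.1 :=
    (Unitary.isPathConnected_ball k₀.1 _ hr1 (by have := min_le_right r 1; linarith)).joinedIn
      _ hd.1 _ (Metric.mem_ball_self hr1)
  obtain ⟨γ, hγ⟩ := hU
  let s : Path k.2 k₀.2 :=
    { toFun := fun t => (1 - (t : ℝ)) • k.2 + (t : ℝ) • k₀.2
      continuous_toFun := by fun_prop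
      source' := by simp
      target' := by simp }
  have hdist : ∀ k' : DiagData m, dist k' k₀ < r → ‖k'.toMatrix - k₀.toMatrix‖ < ε := by
    intro k' hk'
    rw [← dist_eq_norm]
    exact h k' hk'
  refine ⟨hdist k ?_, γ.prod s, fun t => ⟨?_, hdist _ ?_⟩⟩
  · rw [Prod.dist_eq, max_lt_iff]
    exact ⟨hd.1.trans_le (min_le_left _ _), hd.2.trans_le (min_le_left _ _)⟩
  · intro i j hij
    change (1 - (t : ℝ)) * k.2 i + (t : ℝ) * k₀.2 i ≤ (1 - (t : ℝ)) * k.2 j + (t : ℝ) * k₀.2 j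
    have h1 := mul_le_mul_of_nonneg_left (hk hij) (by linarith [t.2.2] : (0 : ℝ) ≤ 1 - t)
    have h2 := mul_le_mul_of_nonneg_left (hk₀ hij) t.2.1
    linarith
  · rw [Prod.dist_eq, max_lt_iff]
    refine ⟨lt_of_lt_of_le (Metric.mem_ball.mp (hγ t)) (min_le_left _ _), ?_⟩
    have h3 : s t - k₀.2 = (1 - (t : ℝ)) • (k.2 - k₀.2) := by
      change (1 - (t : ℝ)) • k.2 + (t : ℝ) • k₀.2 - k₀.2 = _
      module
    change dist (s t) k₀.2 < r
    rw [dist_eq_norm, h3, norm_smul, Real.norm_of_nonneg (by linarith [t.2.2]), ← dist_eq_norm]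
    calc _ ≤ 1 * dist k.2 k₀.2 := by
          gcongr
          linarith [t.2.1]
      _ < r := by rw [one_mul]; exact hd.2.trans_le (min_le_left _ _)

theorem isCompact_setOf_monotone_norm_le (m : ℕ) (R : ℝ) :
    IsCompact {k : DiagData m | Monotone k.2 ∧ ‖k.2‖ ≤ R} := by
  have h1 : IsCompact (Set.univ : Set (unitary (Matrix (Fin m) (Fin m) ℂ))) := by
    have := FiniteDimensional.proper ℂ (Matrix (Fin m) (Fin m) ℂ)
    rw [isCompact_iff_isCompact_univ.symm]
    refine Metric.isCompact_of_isClosed_isBounded isClosed_unitary ?_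
    refine Metric.isBounded_closedBall (x := 0) (r := 1) |>.subset fun u hu => ?_
    rw [mem_closedBall_zero_iff]
    rcases subsingleton_or_nontrivial (Matrix (Fin m) (Fin m) ℂ) with h | h
    · rw [Subsingleton.elim u 0, norm_zero]; exact zero_le_one
    · exact (CStarRing.norm_of_mem_unitary hu).le
  have h2 : IsCompact {l : Fin m → ℝ | Monotone l ∧ ‖l‖ ≤ R} := by
    have : {l : Fin m → ℝ | Monotone l ∧ ‖l‖ ≤ R} = {l | Monotone l} ∩ Metric.closedBall 0 R := by
      ext l; simp
    rw [this]
    exact (isCompact_closedBall _ _).inter_left isClosed_monotone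
  have := h1.prod h2
  convert this using 1
  ext k
  simp

/-- Diagonalisations of nearby matrices are connected through approximate diagonalisations. -/
theorem exists_forall_dist_lt_joinedIn_near (m : ℕ) (R : ℝ) {ε : ℝ} (hε : 0 < ε) :
    ∃ δ > 0, ∀ k k' : DiagData m, Monotone k.2 → Monotone k'.2 → ‖k.2‖ ≤ R → ‖k'.2‖ ≤ R →
      ‖k.toMatrix - k'.toMatrix‖ < δ → JoinedIn (near k.toMatrix ε) k k' := by
  set K := {k : DiagData m | Monotone k.2 ∧ ‖k.2‖ ≤ R} with hK
  have hKc : IsCompact (K ×ˢ K) :=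
    (isCompact_setOf_monotone_norm_le m R).prod (isCompact_setOf_monotone_norm_le m R)
  let G : Set (DiagData m × DiagData m) :=
    {q | Monotone q.1.2 → Monotone q.2.2 → JoinedIn (near q.1.toMatrix ε) q.1 q.2}
  have hbad : IsCompact ((K ×ˢ K) \ interior G) := hKc.diff isOpen_interior
  have hD : Continuous fun q : DiagData m × DiagData m => ‖q.1.toMatrix - q.2.toMatrix‖ :=
    ((continuous_toMatrix.comp continuous_fst).sub (continuous_toMatrix.comp continuous_snd)).norm
  have hint : ∀ q ∈ K ×ˢ K, q.1.toMatrix = q.2.toMatrix → q ∈ interior G := by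
    rintro ⟨k, k'⟩ ⟨hk, hk'⟩ h
    simp only at h
    obtain ⟨r, hr, h1⟩ := exists_forall_joinedIn_near hk.1 (half_pos hε)
    obtain ⟨r', hr', h1'⟩ := exists_forall_joinedIn_near hk'.1 (half_pos hε)
    rw [mem_interior_iff_mem_nhds, mem_nhds_prod_iff]
    refine ⟨_, Metric.ball_mem_nhds k hr, _, Metric.ball_mem_nhds k' hr', ?_⟩
    rintro ⟨l, l'⟩ ⟨hl, hl'⟩ hlm hlm'
    obtain ⟨h2, h3⟩ := h1 l hlm hl
    obtain ⟨h2', h3'⟩ := h1' l' hlm' hl'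
    have hsub : near k.toMatrix (ε / 2) ⊆ near l.toMatrix ε := by
      intro q hq
      refine ⟨hq.1, ?_⟩
      have h4 := norm_sub_le_norm_sub_add_norm_sub q.toMatrix k.toMatrix l.toMatrix
      rw [norm_sub_rev k.toMatrix] at h4
      linarith [hq.2]
    rw [← h] at h3'
    exact (h3.mono hsub).trans (((joinedIn_near_of_eq hk.1 hk'.1 h (half_pos hε)).mono hsub).trans
      (h3'.symm.mono hsub))
  have hpos : ∀ q ∈ (K ×ˢ K) \ interior G, 0 < ‖q.1.toMatrix - q.2.toMatrix‖ := by
    intro q hq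
    rw [norm_pos_iff, sub_ne_zero]
    exact fun h => hq.2 (hint q hq.1 h)
  obtain ⟨δ, hδ, h⟩ : ∃ δ > 0, ∀ q ∈ (K ×ˢ K) \ interior G,
      δ ≤ ‖q.1.toMatrix - q.2.toMatrix‖ := by
    rcases ((K ×ˢ K) \ interior G).eq_empty_or_nonempty with he | hne
    · exact ⟨1, one_pos, fun q hq => by rw [he] at hq; exact hq.elim⟩
    · obtain ⟨q₀, hq₀, hmin⟩ := hbad.exists_isMinOn hne hD.continuousOn
      exact ⟨_, hpos q₀ hq₀, fun q hq => hmin hq⟩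
  refine ⟨δ, hδ, fun k k' hk hk' hR hR' hlt => ?_⟩
  by_contra hcon
  have hmem : (k, k') ∈ (K ×ˢ K) \ interior G :=
    ⟨⟨⟨hk, hR⟩, ⟨hk', hR'⟩⟩, fun hG => hcon (interior_subset hG hk hk')⟩
  exact absurd (h _ hmem) (not_le.mpr hlt)

/-- A path of selfadjoint matrices has an approximate diagonalisation with given ends. -/
theorem exists_path_near {h : unitInterval → Matrix (Fin m) (Fin m) ℂ} (hc : Continuous h)
    (hh : ∀ t, (h t).IsHermitian) {k₀ k₁ : DiagData m} (hk₀ : Monotone k₀.2) (hk₁ : Monotone k₁.2)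
    (h₀ : k₀.toMatrix = h 0) (h₁ : k₁.toMatrix = h 1) {ε : ℝ} (hε : 0 < ε) :
    ∃ γ : unitInterval → DiagData m, Continuous γ ∧ γ 0 = k₀ ∧ γ 1 = k₁ ∧
      ∀ t, γ t ∈ near (h t) ε := by
  obtain ⟨R, hR⟩ : ∃ R, ∀ t, ‖h t‖ ≤ R := by
    obtain ⟨R, hR⟩ := (isCompact_range hc).isBounded.exists_norm_le
    exact ⟨R, fun t => hR _ ⟨t, rfl⟩⟩
  obtain ⟨δ, hδ, hjoin⟩ := exists_forall_dist_lt_joinedIn_near m R (half_pos hε)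
  have huc : UniformContinuous h := CompactSpace.uniformContinuous_of_continuous hc
  obtain ⟨κ, hκ, hκ'⟩ := Metric.uniformContinuous_iff.mp huc (min δ (ε / 2))
    (lt_min hδ (half_pos hε))
  obtain ⟨N, hN⟩ := exists_nat_one_div_lt hκ
  set n : ℝ := N + 1 with hn
  have hn0 : 0 < n := by positivity
  let H : ℝ → Matrix (Fin m) (Fin m) ℂ := Set.IccExtend zero_le_one h
  have hHκ : ∀ s t : ℝ, |s - t| ≤ 1 / n → ‖H s - H t‖ < min δ (ε / 2) := by
    intro s t hst
    rw [← dist_eq_norm]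
    refine hκ' (lt_of_le_of_lt ?_ hN)
    refine le_trans ?_ hst
    rw [Subtype.dist_eq, Real.dist_eq]
    exact Set.abs_projIcc_sub_projIcc zero_le_one
  -- exact diagonalisations at the nodes of a fine mesh, not yet depending continuously on the node
  have hnode : ∀ j : ℕ, ∃ k : DiagData m, Monotone k.2 ∧ k.toMatrix = H (j / n) ∧
      (j = 0 → k = k₀) ∧ (j = N + 1 → k = k₁) := by
    intro j
    by_cases hj0 : j = 0
    · refine ⟨k₀, hk₀, ?_, fun _ => rfl, fun h => by omega⟩
      rw [h₀, hj0, Nat.cast_zero, zero_div]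
      exact (Set.IccExtend_left zero_le_one h).symm
    · by_cases hj1 : j = N + 1
      · refine ⟨k₁, hk₁, ?_, fun h => by omega, fun _ => rfl⟩
        have : ((j : ℕ) : ℝ) / n = 1 := by
          rw [hj1, hn]; push_cast; exact div_self (by positivity)
        rw [h₁, this]
        exact (Set.IccExtend_right zero_le_one h).symm
      · obtain ⟨k, hk, hk'⟩ :=
          exists_monotone_of_isHermitian (hh (Set.projIcc 0 1 zero_le_one (j / n)))
        exact ⟨k, hk, hk', fun h => absurd h hj0, fun h => absurd h hj1⟩
  choose k hkm hkH hk0 hk1 using hnode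
  have hkR : ∀ j, ‖(k j).2‖ ≤ R := by
    intro j
    rw [← norm_toMatrix, hkH]
    exact hR _
  -- They are joined one step of the mesh at a time.
  have hind : ∀ j : ℕ, ∃ γ : ℝ → DiagData m, Continuous γ ∧ γ 0 = k₀ ∧ γ (j / n) = k j ∧
      ∀ t, 0 ≤ t → t ≤ j / n → γ t ∈ near (H t) ε := by
    intro j
    induction j with
    | zero =>
      refine ⟨fun _ => k₀, continuous_const, rfl, (hk0 0 rfl).symm, fun t ht ht' => ?_⟩
      have ht0 : t = 0 := le_antisymm (by simpa using ht') ht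
      refine ⟨hk₀, ?_⟩
      have h3 := hkH 0
      rw [hk0 0 rfl, Nat.cast_zero, zero_div] at h3
      rw [ht0, ← h3, sub_self, norm_zero]
      exact hε
    | succ j ih =>
      obtain ⟨γ, hγ, hγ0, hγj, hγn⟩ := ih
      have hstep : ‖(k j).toMatrix - (k (j + 1)).toMatrix‖ < δ := by
        rw [hkH, hkH]
        refine lt_of_lt_of_le (hHκ _ _ ?_) (min_le_left _ _)
        push_cast
        rw [← sub_div, abs_div, abs_of_pos hn0]
        gcongr
        rw [abs_le]; constructor <;> linarith
      obtain ⟨p, hp⟩ := hjoin _ _ (hkm j) (hkm (j + 1)) (hkR _) (hkR _) hstep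
      refine ⟨fun t => if t ≤ j / n then γ t else p.extend (n * t - j), ?_, ?_, ?_, ?_⟩
      · refine Continuous.if_le hγ (p.continuous_extend.comp (by fun_prop)) continuous_id
          continuous_const ?_
        intro t ht
        rw [ht, hγj, mul_div_cancel₀ _ hn0.ne', sub_self, Path.extend_zero]
      · have h4 : (0 : ℝ) ≤ j / n := by positivity
        simp only [if_pos h4, hγ0]
      · have h4 : ¬ (((j + 1 : ℕ) : ℝ) / n ≤ j / n) := by
          rw [not_le]
          gcongr
          omega
        simp only [if_neg h4, mul_div_cancel₀ _ hn0.ne']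
        push_cast
        rw [add_sub_cancel_left, Path.extend_one]
      · intro t ht ht'
        by_cases h5 : t ≤ j / n
        · simp only [if_pos h5]
          exact hγn t ht h5
        · simp only [if_neg h5]
          have h6 := hp (Set.projIcc 0 1 zero_le_one (n * t - j))
          refine ⟨h6.1, ?_⟩
          have h7 : ‖H (j / n) - H t‖ < ε / 2 := by
            refine lt_of_lt_of_le (hHκ _ _ ?_) (min_le_right _ _)
            push_cast at ht'
            rw [add_div] at ht'
            rw [abs_le]
            constructor <;> linarith [not_le.mp h5, (by positivity : 0 ≤ 1 / n)]
          have h8 := norm_sub_le_norm_sub_add_norm_sub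
            (p (Set.projIcc 0 1 zero_le_one (n * t - j))).toMatrix (k j).toMatrix (H t)
          have h9 := h6.2
          rw [hkH j] at h8 h9
          calc _ ≤ _ := h8
            _ < ε := by linarith
  obtain ⟨γ, hγ, hγ0, hγ1, hγn⟩ := hind (N + 1)
  have h1n : ((N + 1 : ℕ) : ℝ) / n = 1 := by
    rw [hn]; push_cast; exact div_self (by positivity)
  rw [h1n, hk1 _ rfl] at hγ1
  refine ⟨fun t => γ t, by fun_prop, hγ0, hγ1, fun t => ?_⟩
  have := hγn t t.2.1 (by rw [h1n]; exact t.2.2)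
  rwa [show H t = h t from Set.IccExtend_val zero_le_one h t] at this

end DiagData

/-- Selfadjoint matrices over a graph are approximately diagonalisable, with sorted eigenvalues:
diagonalise at the vertices, and connect the results along the edges. -/
theorem GraphModel.exists_approx_diagonalisation {X : Type} [TopologicalSpace X] [T2Space X]
    (Γ : GraphModel X) {m : ℕ} (g : MatFun X m) (hg : ∀ x, (g x).IsHermitian) {ε : ℝ}
    (hε : 0 < ε) :
    ∃ k : C(X, DiagData m), ∀ x, Monotone (k x).2 ∧ ‖(k x).toMatrix - g x‖ < ε := by
  choose c hc hc' using fun x => DiagData.exists_monotone_of_isHermitian (hg x)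
  have hedge : ∀ e, ∃ γ : unitInterval → DiagData m, Continuous γ ∧ γ 0 = c (Γ.Φ e 0) ∧
      γ 1 = c (Γ.Φ e 1) ∧ ∀ t, γ t ∈ DiagData.near (g (Γ.Φ e t)) ε := fun e =>
    DiagData.exists_path_near (h := fun t => g (Γ.Φ e t)) (by fun_prop) (fun t => hg _) (hc _)
      (hc _) (hc' _) (hc' _) hε
  choose γ hγ hγ0 hγ1 hγn using hedge
  obtain ⟨k, hk, hk'⟩ := Γ.exists_glue c γ hγ hγ0 hγ1
  refine ⟨k, fun x => ?_⟩
  rcases Γ.cover x with hx | ⟨e, t, rfl⟩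
  · rw [hk x hx, hc', sub_self, norm_zero]
    exact ⟨hc x, hε⟩
  · rw [hk']
    exact hγn e t

/-! ### Ranks of the approximating corners -/

theorem norm_mul_mul_sub_le {A : Type*} [NormedRing A] (x y z x' y' z' : A) :
    ‖x * y * z - x' * y' * z'‖
      ≤ ‖x - x'‖ * ‖y‖ * ‖z‖ + ‖x'‖ * ‖y - y'‖ * ‖z‖ + ‖x'‖ * ‖y'‖ * ‖z - z'‖ := by
  have : x * y * z - x' * y' * z'
      = (x - x') * y * z + x' * (y - y') * z + x' * y' * (z - z') := by noncomm_ring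
  rw [this]
  exact (norm_add₃_le).trans (add_le_add_three norm_mul₃_le norm_mul₃_le norm_mul₃_le)

/-- In a simple algebra, every nonzero element generates the unit, approximately. -/
theorem IsSimpleCStarAlgebra.exists_list_sum_near_one {A : Type*} [CStarAlgebra A]
    (hA : IsSimpleCStarAlgebra A) {y : A} (hy : y ≠ 0) {ε : ℝ} (hε : 0 < ε) :
    ∃ l : List (A × A), ‖(l.map fun q => q.1 * y * q.2).sum - 1‖ < ε := by
  let S : Set A := {z | ∃ l : List (A × A), z = (l.map fun q => q.1 * y * q.2).sum}
  have hadd : ∀ z ∈ S, ∀ w ∈ S, z + w ∈ S := by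
    rintro _ ⟨l, rfl⟩ _ ⟨l', rfl⟩
    exact ⟨l ++ l', by simp⟩
  have hleft : ∀ c, ∀ z ∈ S, c * z ∈ S := by
    rintro c _ ⟨l, rfl⟩
    refine ⟨l.map fun q => (c * q.1, q.2), ?_⟩
    rw [← List.sum_map_mul_left, List.map_map]
    simp [Function.comp_def, mul_assoc]
  have hright : ∀ c, ∀ z ∈ S, z * c ∈ S := by
    rintro c _ ⟨l, rfl⟩
    refine ⟨l.map fun q => (q.1, q.2 * c), ?_⟩
    rw [← List.sum_map_mul_right, List.map_map]
    simp [Function.comp_def, mul_assoc]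
  let I : TwoSidedIdeal A := TwoSidedIdeal.mk' (closure S)
    (subset_closure ⟨[], by simp⟩)
    (fun hx hy => map_mem_closure₂ continuous_add hx hy hadd)
    (fun {x} hx => by
      have := map_mem_closure (continuous_const.mul continuous_id : Continuous fun z : A => -1 * z)
        hx (fun z hz => hleft (-1) z hz)
      simpa using this)
    (fun {x y} hy => map_mem_closure (f := fun z => x * z) (by fun_prop) hy
      (fun z hz => hleft x z hz))
    (fun {x y} hx => map_mem_closure (f := fun z => z * y) (by fun_prop) hx
      (fun z hz => hright y z hz))
  have hI : (I : Set A) = closure S := by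
    ext z
    exact TwoSidedIdeal.mem_mk' _ _ _ _ _ _ _
  have hyI : y ∈ I := by
    have : y ∈ (I : Set A) := by
      rw [hI]
      exact subset_closure ⟨[(1, 1)], by simp⟩
    exact this
  rcases hA.2 I (by rw [hI]; exact isClosed_closure) with h | h
  · rw [h] at hyI
    exact absurd ((TwoSidedIdeal.mem_bot A).mp hyI) hy
  · have h1 : (1 : A) ∈ closure S := by
      rw [← hI, h]
      exact TwoSidedIdeal.mem_top A
    obtain ⟨z, ⟨l, rfl⟩, hz⟩ := Metric.mem_closure_iff.mp h1 ε hε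
    refine ⟨l, ?_⟩
    rwa [dist_comm, dist_eq_norm] at hz

theorem IsStarProjection.eq_zero_of_norm_lt_one {M : Type*} [NonUnitalNormedRing M] [StarRing M]
    [CStarRing M] {p : M} (hp : IsStarProjection p) (h : ‖p‖ < 1) : p = 0 := by
  have h1 : ‖p‖ * ‖p‖ = ‖p‖ := by
    rw [← CStarRing.norm_star_mul_self, hp.isSelfAdjoint.star_eq, hp.isIdempotentElem.eq]
  rw [← norm_eq_zero]
  nlinarith [norm_nonneg p]

/-- A projection matrix is diagonal, with entries zero and one, in some orthonormal basis. -/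
theorem IsStarProjection.exists_eq_conj_diagonal {m : ℕ} {P : Matrix (Fin m) (Fin m) ℂ}
    (hP : IsStarProjection P) :
    ∃ (W : unitary (Matrix (Fin m) (Fin m) ℂ)) (I : Finset (Fin m)),
      P = (W : Matrix (Fin m) (Fin m) ℂ) * Matrix.diagonal (fun i => if i ∈ I then 1 else 0)
        * star (W : Matrix (Fin m) (Fin m) ℂ) := by
  obtain ⟨⟨W, l⟩, -, hk⟩ := DiagData.exists_monotone_of_isHermitian (g := P) hP.isSelfAdjoint
  classical
  set d : Matrix (Fin m) (Fin m) ℂ := Matrix.diagonal fun i => (l i : ℂ) with hd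
  have hP' : P = W * d * star (W : Matrix (Fin m) (Fin m) ℂ) := hk.symm
  have hW : star (W : Matrix (Fin m) (Fin m) ℂ) * W = 1 := Unitary.coe_star_mul_self _
  have hdP : d = star (W : Matrix (Fin m) (Fin m) ℂ) * P * W := by
    rw [hP']
    calc d = (star (W : Matrix (Fin m) (Fin m) ℂ) * W) * d
          * (star (W : Matrix (Fin m) (Fin m) ℂ) * W) := by
          rw [hW, one_mul, mul_one]
      _ = _ := by simp only [mul_assoc]
  have hdd : d * d = d := by
    have hW' : (W : Matrix (Fin m) (Fin m) ℂ) * star (W : Matrix (Fin m) (Fin m) ℂ) = 1 :=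
      Unitary.mul_star_self_of_mem W.2
    calc d * d = star (W : Matrix (Fin m) (Fin m) ℂ) * P
          * (W * star (W : Matrix (Fin m) (Fin m) ℂ)) * P * W := by
          rw [hdP]; simp only [mul_assoc]
      _ = star (W : Matrix (Fin m) (Fin m) ℂ) * (P * P) * W := by
          rw [hW', mul_one]; simp only [mul_assoc]
      _ = d := by rw [hP.isIdempotentElem.eq, ← hdP]
  refine ⟨W, Finset.univ.filter fun i => l i ≠ 0, ?_⟩
  rw [hP']
  congr 2
  rw [hd]
  congr 1
  ext i
  have h1 := congrFun (congrFun hdd i) i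
  rw [hd, Matrix.diagonal_mul_diagonal, Matrix.diagonal_apply_eq, Matrix.diagonal_apply_eq] at h1
  by_cases h0 : l i = 0
  · simp [h0]
  · have h2 : (l i : ℂ) ≠ 0 := by exact_mod_cast h0
    simp only [Finset.mem_filter, Finset.mem_univ, true_and, ne_eq, h0, not_false_iff, if_true]
    exact mul_right_cancel₀ h2 (by rw [h1, one_mul])

/-- An element of the corner at a diagonalised projection vanishes if its relevant matrix entries
vanish. -/
theorem corner_eq_zero_of_entries {m : ℕ} (W : unitary (Matrix (Fin m) (Fin m) ℂ))
    (I : Finset (Fin m)) {P g : Matrix (Fin m) (Fin m) ℂ}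
    (hP : P = (W : Matrix (Fin m) (Fin m) ℂ) * Matrix.diagonal (fun i => if i ∈ I then 1 else 0)
      * star (W : Matrix (Fin m) (Fin m) ℂ))
    (hg : ∀ i ∈ I, ∀ j ∈ I, (star (W : Matrix (Fin m) (Fin m) ℂ) * g
      * (W : Matrix (Fin m) (Fin m) ℂ)) i j = 0) : P * g * P = 0 := by
  have h1 : Matrix.diagonal (fun i => if i ∈ I then (1 : ℂ) else 0)
      * (star (W : Matrix (Fin m) (Fin m) ℂ) * g * (W : Matrix (Fin m) (Fin m) ℂ))
      * Matrix.diagonal (fun i => if i ∈ I then (1 : ℂ) else 0)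
      = 0 := by
    ext i j
    rw [Matrix.mul_diagonal, Matrix.diagonal_mul]
    by_cases hi : i ∈ I
    · by_cases hj : j ∈ I
      · rw [hg i hi j hj]; simp
      · simp [hj]
    · simp [hi]
  calc P * g * P = W * (Matrix.diagonal (fun i => if i ∈ I then (1 : ℂ) else 0)
      * (star (W : Matrix (Fin m) (Fin m) ℂ) * g * (W : Matrix (Fin m) (Fin m) ℂ))
      * Matrix.diagonal (fun i => if i ∈ I then (1 : ℂ) else 0))
      * star (W : Matrix (Fin m) (Fin m) ℂ) := by rw [hP]; simp only [mul_assoc]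
    _ = 0 := by rw [h1]; simp

theorem trace_conj_diagonal {m : ℕ} (W : unitary (Matrix (Fin m) (Fin m) ℂ)) (d : Fin m → ℂ) :
    ((W : Matrix (Fin m) (Fin m) ℂ) * Matrix.diagonal d
      * star (W : Matrix (Fin m) (Fin m) ℂ)).trace = ∑ i, d i := by
  rw [Matrix.trace_mul_comm, ← mul_assoc, Unitary.coe_star_mul_self, one_mul,
    Matrix.trace_diagonal]

/-- The corner model `Q` approximates compressions of the elements of `G` to within `δ`. -/
structure CornerModel.Approximates {A : Type*} [CStarAlgebra A] {X : Type} [TopologicalSpace X]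
    [CompactSpace X] {m : ℕ} (Q : CornerModel A X m) (G : Set A) (δ : ℝ) : Prop where
  norm_commutator_lt : ∀ x ∈ G, ‖x * Q.ι Q.P - Q.ι Q.P * x‖ < δ
  exists_near : ∀ x ∈ G, ∃ M, Q.P * M * Q.P = M ∧ ‖Q.ι Q.P * x * Q.ι Q.P - Q.ι M‖ < δ

namespace CornerModel

variable {A : Type*} [CStarAlgebra A] {X : Type} [TopologicalSpace X]
    [CompactSpace X] {m : ℕ} (Q : CornerModel A X m)

theorem isStarProjection_unit : IsStarProjection (Q.ι Q.P) :=
  ⟨by rw [IsIdempotentElem, Q.map_mul, Q.P_mul_P, Q.P_mul_P], Q.map_isSelfAdjoint Q.star_P⟩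

theorem norm_unit_le : ‖Q.ι Q.P‖ ≤ 1 := Q.isStarProjection_unit.norm_le

variable {Q} in
theorem Approximates.mono {G G' : Set A} {δ δ' : ℝ} (h : Q.Approximates G δ) (hG : G' ⊆ G)
    (hδ : δ ≤ δ') : Q.Approximates G' δ' :=
  ⟨fun x hx => (h.1 x (hG hx)).trans_le hδ, fun x hx => by
    obtain ⟨M, hM, hM'⟩ := h.2 x (hG hx)
    exact ⟨M, hM, hM'.trans_le hδ⟩⟩

/-- Compression to a corner is multiplicative on triples, up to the approximation errors. -/
theorem norm_compress_mul_sub_le {a y b : A} {g h k : MatFun X m} {δ B C : ℝ} (hδ0 : 0 ≤ δ)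
    (hδ : δ ≤ 1) (hB : 1 ≤ B) (hC : 1 ≤ C) (ha : ‖a‖ ≤ B) (hb : ‖b‖ ≤ B) (hy : ‖y‖ ≤ C)
    (hap : ‖a * Q.ι Q.P - Q.ι Q.P * a‖ ≤ δ) (hbp : ‖b * Q.ι Q.P - Q.ι Q.P * b‖ ≤ δ)
    (hg : ‖Q.ι Q.P * a * Q.ι Q.P - Q.ι g‖ ≤ δ) (hh : ‖Q.ι Q.P * y * Q.ι Q.P - Q.ι h‖ ≤ C * δ)
    (hk : ‖Q.ι Q.P * b * Q.ι Q.P - Q.ι k‖ ≤ δ) :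
    ‖Q.ι Q.P * (a * y * b) * Q.ι Q.P - Q.ι (g * Q.P * h * Q.P * k)‖ ≤ 11 * B ^ 2 * C * δ := by
  set p := Q.ι Q.P with hp
  have hpn : ‖p‖ ≤ 1 := Q.norm_unit_le
  have hpp : p * p = p := Q.isStarProjection_unit.isIdempotentElem.eq
  have hnc : ∀ z : A, ‖p * z * p‖ ≤ ‖z‖ := fun z => by
    calc _ ≤ ‖p‖ * ‖z‖ * ‖p‖ := norm_mul₃_le
      _ ≤ 1 * ‖z‖ * 1 := by gcongr
      _ = ‖z‖ := by ring
  have h1 : ‖p * a - p * a * p‖ ≤ δ := by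
    have : p * a - p * a * p = p * (p * a - a * p) := by
      rw [mul_sub, ← mul_assoc, hpp, mul_assoc]
    rw [this]
    calc _ ≤ ‖p‖ * ‖p * a - a * p‖ := norm_mul_le _ _
      _ ≤ 1 * δ := by gcongr; rwa [norm_sub_rev]
      _ = δ := one_mul _
  have h2 : ‖b * p - p * b * p‖ ≤ δ := by
    have : b * p - p * b * p = (b * p - p * b) * p := by
      rw [sub_mul, mul_assoc b, hpp]
    rw [this]
    calc _ ≤ ‖b * p - p * b‖ * ‖p‖ := norm_mul_le _ _
      _ ≤ δ * 1 := by gcongr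
      _ = δ := mul_one _
  have hpa : ‖p * a * p‖ ≤ B := (hnc a).trans ha
  have hpb : ‖p * b * p‖ ≤ B := (hnc b).trans hb
  have hpy : ‖p * y * p‖ ≤ C := (hnc y).trans hy
  have hbp' : ‖b * p‖ ≤ B := by
    calc _ ≤ ‖b‖ * ‖p‖ := norm_mul_le _ _
      _ ≤ B * 1 := by gcongr
      _ = B := mul_one _
  have h3 : ‖p * (a * y * b) * p - (p * a * p) * (p * y * p) * (p * b * p)‖ ≤ 2 * B * C * δ := by
    have e1 : p * (a * y * b) * p = (p * a) * y * (b * p) := by simp only [mul_assoc]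
    have e2 : (p * a * p) * (p * y * p) * (p * b * p) = (p * a * p) * y * (p * b * p) := by
      calc _ = p * a * (p * p) * y * (p * p) * b * p := by simp only [mul_assoc]
        _ = _ := by rw [hpp]; simp only [mul_assoc]
    rw [e1, e2]
    refine (norm_mul_mul_sub_le _ _ _ _ _ _).trans ?_
    rw [sub_self, norm_zero, mul_zero, zero_mul, add_zero]
    calc _ ≤ δ * C * B + B * C * δ := by gcongr
      _ = 2 * B * C * δ := by ring
  have hg' : ‖Q.ι g‖ ≤ B + δ := by
    have := norm_sub_norm_le (Q.ι g) (p * a * p)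
    rw [norm_sub_rev] at this
    linarith
  have hh' : ‖Q.ι h‖ ≤ C + C * δ := by
    have := norm_sub_norm_le (Q.ι h) (p * y * p)
    rw [norm_sub_rev] at this
    linarith
  have h4 : ‖(p * a * p) * (p * y * p) * (p * b * p) - Q.ι (g * Q.P * h * Q.P * k)‖
      ≤ δ * C * B + (B + δ) * (C * δ) * B + (B + δ) * (C + C * δ) * δ := by
    have e1 : Q.ι (g * Q.P * h * Q.P * k) = Q.ι g * Q.ι h * Q.ι k := by
      rw [Q.map_mul, Q.map_mul]
    rw [e1]
    refine (norm_mul_mul_sub_le _ _ _ _ _ _).trans ?_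
    gcongr
  have h5 := norm_sub_le_norm_sub_add_norm_sub (p * (a * y * b) * p)
    ((p * a * p) * (p * y * p) * (p * b * p)) (Q.ι (g * Q.P * h * Q.P * k))
  have h6 : δ * C * B + (B + δ) * (C * δ) * B + (B + δ) * (C + C * δ) * δ ≤
      δ * C * B + (B + B) * (C * δ) * B + (B + B) * (C + C * 1) * δ := by
    gcongr <;> linarith
  have h7 : B * (C * δ) ≤ B ^ 2 * (C * δ) := by
    have : B ≤ B ^ 2 := by nlinarith
    gcongr
  have h8 : 0 ≤ B ^ 2 * (C * δ) := by positivity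
  linarith

end CornerModel

/-- In an infinite-dimensional simple algebra, the corners that approximate a suitable finite set
have everywhere either vanishing or large rank: few dimensions would force a linear relation at
some point of `X` among the images of linearly independent elements, although any combination of
these generates the unit. -/
theorem exists_finset_rank_ge {A : Type*} [CStarAlgebra A] (hA : IsSimpleCStarAlgebra A)
    (hinf : ¬ FiniteDimensional ℂ A) (K : ℕ) :
    ∃ (G : Finset A) (δ : ℝ), 0 < δ ∧ ∀ (X : Type) [TopologicalSpace X] [CompactSpace X] (m : ℕ)
      (Q : CornerModel A X m), Q.Approximates G δ →
        ∀ x, Q.P x = 0 ∨ (K : ℝ) ≤ (Q.P x).trace.re := by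
  classical
  -- linearly independent elements
  obtain ⟨e, he⟩ : ∃ e : Fin (K ^ 2) → A, LinearIndependent ℂ e := by
    let b := Module.Basis.ofVectorSpace ℂ A
    have : Infinite (Module.Basis.ofVectorSpaceIndex ℂ A) := by
      by_contra h
      rw [not_infinite_iff_finite] at h
      exact hinf (Module.Finite.of_basis b)
    let f := Infinite.natEmbedding (Module.Basis.ofVectorSpaceIndex ℂ A)
    exact ⟨fun i => b (f i), b.linearIndependent.comp _ (f.injective.comp Fin.val_injective)⟩
  let y : (Fin (K ^ 2) → ℂ) → A := fun α => ∑ i, α i • e i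
  have hy : Continuous y := by fun_prop
  have hy0 : ∀ α ∈ Metric.sphere (0 : Fin (K ^ 2) → ℂ) 1, y α ≠ 0 := by
    intro α hα h
    have h1 := Fintype.linearIndependent_iff.mp he α h
    have : α = 0 := funext h1
    rw [this] at hα
    simp at hα
  have hl := fun α : Metric.sphere (0 : Fin (K ^ 2) → ℂ) 1 =>
    hA.exists_list_sum_near_one (hy0 α α.2) (by norm_num : (0 : ℝ) < 1 / 4)
  choose l hl using hl
  -- finitely many of these relations serve the whole sphere
  obtain ⟨t, ht⟩ :=
    (isCompact_univ (X := Metric.sphere (0 : Fin (K ^ 2) → ℂ) 1)).elim_finite_subcover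
    (fun α => {β | ‖((l α).map fun q => q.1 * y β * q.2).sum - 1‖ < 1 / 4})
    (fun α => by
      refine isOpen_lt (Continuous.norm (Continuous.sub ?_ continuous_const)) continuous_const
      generalize l α = l'
      induction l' with
      | nil => simpa using continuous_const
      | cons q l' ih =>
        simp only [List.map_cons, List.sum_cons]
        have h2 : Continuous fun β : Metric.sphere (0 : Fin (K ^ 2) → ℂ) 1 => y β :=
          hy.comp continuous_subtype_val
        exact ((continuous_const.mul h2).mul continuous_const).add ih)
    (fun α _ => Set.mem_iUnion.mpr ⟨α, hl α⟩)
  let G : Finset A := Finset.univ.image e ∪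
    t.biUnion fun α => ((l α).map Prod.fst).toFinset ∪ ((l α).map Prod.snd).toFinset
  obtain ⟨B, hB1, hB⟩ : ∃ B : ℝ, 1 ≤ B ∧ ∀ z ∈ G, ‖z‖ ≤ B := by
    refine ⟨1 + ∑ z ∈ G, ‖z‖, by linarith [Finset.sum_nonneg fun z (_ : z ∈ G) => norm_nonneg z],
      fun z hz => ?_⟩
    linarith [Finset.single_le_sum (fun z _ => norm_nonneg z) hz]
  let n : ℕ := ∑ α ∈ t, (l α).length
  have hn : ∀ α ∈ t, (l α).length ≤ n := fun α hα =>
    Finset.single_le_sum (f := fun α => (l α).length) (fun _ _ => Nat.zero_le _) hα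
  let C : ℝ := 1 + K ^ 2 * B
  have hC : 1 ≤ C := by have : (0 : ℝ) ≤ K ^ 2 * B := by positivity
                        linarith
  have hKC : (K : ℝ) ^ 2 ≤ C := by
    have : (K : ℝ) ^ 2 * 1 ≤ K ^ 2 * B := by gcongr
    linarith
  let δ : ℝ := 1 / (44 * B ^ 2 * C * (n + 1))
  have hδ : 0 < δ := by positivity
  have hδn : n * (11 * B ^ 2 * C * δ) ≤ 1 / 4 := by
    have : n * (11 * B ^ 2 * C * δ) = n / (n + 1) * (1 / 4) := by
      simp only [δ]; field_simp; ring
    rw [this]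
    have : (n : ℝ) / (n + 1) ≤ 1 := div_le_one_of_le₀ (by linarith) (by positivity)
    linarith
  have hδ1 : δ ≤ 1 := by
    refine div_le_one_of_le₀ ?_ (by positivity)
    have h1 : 1 ≤ B ^ 2 * C := one_le_mul_of_one_le_of_one_le (one_le_pow₀ hB1) hC
    have h2 : 1 ≤ B ^ 2 * C * (n + 1) :=
      one_le_mul_of_one_le_of_one_le h1 (by linarith [(Nat.cast_nonneg n : (0 : ℝ) ≤ n)])
    nlinarith
  refine ⟨G, δ, hδ, ?_⟩
  intro X _ _ m Q hQ x
  by_contra hcon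
  rw [not_or, not_le] at hcon
  obtain ⟨hPx, hK⟩ := hcon
  obtain ⟨W, I, hWI⟩ := (Q.isStarProjection_apply x).exists_eq_conj_diagonal
  have hcard : I.card < K := by
    rw [hWI, trace_conj_diagonal] at hK
    have : (∑ i, if i ∈ I then (1 : ℂ) else 0) = (I.card : ℂ) := by simp
    rw [this, Complex.natCast_re] at hK
    exact_mod_cast hK
  have hne := hQ.2
  choose! g hgP hg using hne
  have heG : ∀ i, e i ∈ G := fun i =>
    Finset.mem_union_left _ (Finset.mem_image_of_mem e (Finset.mem_univ i))
  -- a linear relation at the point `x`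
  obtain ⟨α, hα0, hα⟩ : ∃ α : Fin (K ^ 2) → ℂ, α ≠ 0 ∧
      Q.P x * (∑ i, α i • g (e i) x) * Q.P x = 0 := by
    let f : (Fin (K ^ 2) → ℂ) →ₗ[ℂ] (I × I → ℂ) :=
      { toFun := fun α ij =>
          ∑ i, α i • (star (W : Matrix (Fin m) (Fin m) ℂ) * g (e i) x * W) ij.1 ij.2
        map_add' := fun α β => by ext; simp [add_mul, Finset.sum_add_distrib]
        map_smul' := fun c α => by ext; simp [Finset.mul_sum, mul_assoc] }
    have hker : LinearMap.ker f ≠ ⊥ := by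
      refine f.ker_ne_bot_of_finrank_lt ?_
      simp only [Module.finrank_fintype_fun_eq_card, Fintype.card_prod, Fintype.card_coe,
        Fintype.card_fin]
      rw [sq]
      exact Nat.mul_lt_mul'' hcard hcard
    obtain ⟨α, hα, hα0⟩ := Submodule.exists_mem_ne_zero_of_ne_bot hker
    refine ⟨α, hα0, corner_eq_zero_of_entries W I hWI fun i hi j hj => ?_⟩
    have h1 := congrFun (LinearMap.mem_ker.mp hα) (⟨i, hi⟩, ⟨j, hj⟩)
    rw [Finset.mul_sum, Finset.sum_mul, Matrix.sum_apply]
    simp only [mul_smul_comm, smul_mul_assoc, Matrix.smul_apply]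
    exact h1
  obtain ⟨β, hβ1, hβ⟩ : ∃ β : Fin (K ^ 2) → ℂ, ‖β‖ = 1 ∧
      Q.P x * (∑ i, β i • g (e i) x) * Q.P x = 0 := by
    refine ⟨((‖α‖⁻¹ : ℝ) : ℂ) • α, ?_, ?_⟩
    · rw [norm_smul, Complex.norm_real, norm_inv, norm_norm,
        inv_mul_cancel₀ (norm_ne_zero_iff.mpr hα0)]
    · have : ∑ i, (((‖α‖⁻¹ : ℝ) : ℂ) • α) i • g (e i) x
          = ((‖α‖⁻¹ : ℝ) : ℂ) • ∑ i, α i • g (e i) x := by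
        rw [Finset.smul_sum]
        refine Finset.sum_congr rfl fun i _ => ?_
        rw [Pi.smul_apply, smul_eq_mul, mul_smul]
      rw [this, mul_smul_comm, smul_mul_assoc, hα, smul_zero]
  have hβs : β ∈ Metric.sphere (0 : Fin (K ^ 2) → ℂ) 1 := by simpa using hβ1
  obtain ⟨γ, hγt, hγ⟩ : ∃ γ ∈ t, ‖((l γ).map fun q => q.1 * y β * q.2).sum - 1‖ < 1 / 4 := by
    have := ht (Set.mem_univ ⟨β, hβs⟩)
    simpa using this
  set p := Q.ι Q.P with hp
  set h : MatFun X m := ∑ i, β i • g (e i) with hh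
  have hβi : ∀ i, ‖β i‖ ≤ 1 := fun i => (norm_le_pi_norm β i).trans hβ1.le
  have hyβ : ‖y β‖ ≤ C := by
    calc ‖y β‖ ≤ ∑ i, ‖β i • e i‖ := norm_sum_le _ _
      _ ≤ ∑ i : Fin (K ^ 2), B := Finset.sum_le_sum fun i _ => by
          rw [norm_smul]
          calc _ ≤ 1 * B := by gcongr; exacts [hβi i, hB _ (heG i)]
            _ = B := one_mul B
      _ = K ^ 2 * B := by simp
      _ ≤ C := by simp [C]
  have hyh : ‖p * y β * p - Q.ι h‖ ≤ C * δ := by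
    have : p * y β * p - Q.ι h = ∑ i, β i • (p * e i * p - Q.ι (g (e i))) := by
      simp only [y, hh, map_sum, map_smul, smul_sub, Finset.sum_sub_distrib, Finset.mul_sum,
        Finset.sum_mul, mul_smul_comm, smul_mul_assoc]
    rw [this]
    calc _ ≤ ∑ i, ‖β i • (p * e i * p - Q.ι (g (e i)))‖ := norm_sum_le _ _
      _ ≤ ∑ i : Fin (K ^ 2), δ := Finset.sum_le_sum fun i _ => by
          rw [norm_smul]
          calc _ ≤ 1 * δ := by gcongr; exacts [hβi i, (hg _ (heG i)).le]
            _ = δ := one_mul δ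
      _ = K ^ 2 * δ := by simp
      _ ≤ C * δ := by gcongr
  -- The relation `∑ a * y β * b ≈ 1` passes to the corner, with `h` in place of `y β`; at the point
  -- where `P * h * P` vanishes, its left-hand side vanishes.
  have hlist : ∀ l' : List (A × A), (∀ q ∈ l', q.1 ∈ G ∧ q.2 ∈ G) →
      ‖p * (l'.map fun q => q.1 * y β * q.2).sum * p
        - Q.ι (l'.map fun q => g q.1 * Q.P * h * Q.P * g q.2).sum‖
        ≤ l'.length * (11 * B ^ 2 * C * δ) := by
    intro l' hl'
    induction l' with
    | nil => simp
    | cons q l' ih =>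
      obtain ⟨h1, h2⟩ := hl' q List.mem_cons_self
      have h3 := Q.norm_compress_mul_sub_le hδ.le hδ1 hB1 hC (hB _ h1) (hB _ h2) hyβ
        (hQ.1 _ h1).le (hQ.1 _ h2).le (hg _ h1).le hyh (hg _ h2).le
      have h4 := ih fun q hq => hl' q (List.mem_cons_of_mem _ hq)
      simp only [List.map_cons, List.sum_cons, List.length_cons, map_add]
      have e1 : p * (q.1 * y β * q.2 + (l'.map fun q => q.1 * y β * q.2).sum) * p
          - (Q.ι (g q.1 * Q.P * h * Q.P * g q.2)
            + Q.ι (l'.map fun q => g q.1 * Q.P * h * Q.P * g q.2).sum)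
          = (p * (q.1 * y β * q.2) * p - Q.ι (g q.1 * Q.P * h * Q.P * g q.2))
            + (p * (l'.map fun q => q.1 * y β * q.2).sum * p
            - Q.ι (l'.map fun q => g q.1 * Q.P * h * Q.P * g q.2).sum) := by noncomm_ring
      rw [e1]
      refine (norm_add_le _ _).trans ?_
      push_cast
      linarith
  have hlG : ∀ q ∈ l γ, q.1 ∈ G ∧ q.2 ∈ G := by
    intro q hq
    constructor
    · refine Finset.mem_union_right _ (Finset.mem_biUnion.mpr ⟨γ, hγt, Finset.mem_union_left _ ?_⟩)
      exact List.mem_toFinset.mpr (List.mem_map_of_mem hq)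
    · refine Finset.mem_union_right _ (Finset.mem_biUnion.mpr ⟨γ, hγt, Finset.mem_union_right _ ?_⟩)
      exact List.mem_toFinset.mpr (List.mem_map_of_mem hq)
  have h1 := hlist (l γ) hlG
  set N : MatFun X m := ((l γ).map fun q => g q.1 * Q.P * h * Q.P * g q.2).sum with hN
  have hpp : p * p = p := Q.isStarProjection_unit.isIdempotentElem.eq
  have h2 : ‖Q.ι (N - Q.P)‖ ≤ 1 / 2 := by
    have e1 : Q.ι (N - Q.P) = p * (((l γ).map fun q => q.1 * y β * q.2).sum - 1) * p
        - (p * ((l γ).map fun q => q.1 * y β * q.2).sum * p - Q.ι N) := by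
      rw [map_sub, ← hp, mul_sub, sub_mul, mul_one, hpp]
      abel
    rw [e1]
    have h3 : ‖p * (((l γ).map fun q => q.1 * y β * q.2).sum - 1) * p‖ ≤ 1 / 4 := by
      calc _ ≤ ‖p‖ * ‖((l γ).map fun q => q.1 * y β * q.2).sum - 1‖ * ‖p‖ := norm_mul₃_le
        _ ≤ 1 * (1 / 4) * 1 := by gcongr <;> exact Q.norm_unit_le
        _ = 1 / 4 := by ring
    have h4 : ((l γ).length : ℝ) * (11 * B ^ 2 * C * δ) ≤ n * (11 * B ^ 2 * C * δ) := by
      gcongr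
      exact hn γ hγt
    have := norm_sub_le (p * (((l γ).map fun q => q.1 * y β * q.2).sum - 1) * p)
      (p * ((l γ).map fun q => q.1 * y β * q.2).sum * p - Q.ι N)
    linarith
  rw [Q.norm_map] at h2
  have h3 := ((Q.P * (N - Q.P) * Q.P).norm_coe_le_norm x).trans h2
  have hNx : N x = 0 := by
    have hev : ∀ l' : List (A × A),
        ((l'.map fun q => g q.1 * Q.P * h * Q.P * g q.2).sum : MatFun X m) x = 0 := by
      intro l'
      induction l' with
      | nil => simp
      | cons q l' ih =>
        simp only [List.map_cons, List.sum_cons, ContinuousMap.add_apply, ih, add_zero,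
          ContinuousMap.mul_apply]
        have : h x = ∑ i, β i • g (e i) x := by
          rw [hh, ContinuousMap.sum_apply]
          rfl
        rw [mul_assoc (g q.1 x), mul_assoc (g q.1 x), this, hβ]
        simp
    exact hev _
  have h4 : (Q.P * (N - Q.P) * Q.P) x = -Q.P x := by
    simp only [ContinuousMap.mul_apply, ContinuousMap.sub_apply, hNx, zero_sub]
    rw [mul_neg, neg_mul, (Q.isStarProjection_apply x).isIdempotentElem.eq,
      (Q.isStarProjection_apply x).isIdempotentElem.eq]
  rw [h4, norm_neg] at h3
  exact hPx ((Q.isStarProjection_apply x).eq_zero_of_norm_lt_one (by linarith))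

/-! ### Local trivialisation of projections -/

section LocalUnitary

variable {M : Type*} [CStarAlgebra M]

/-- The canonical element intertwining two projections. -/
def projIntertwiner (p q : M) : M := p * q + (1 - p) * (1 - q)

/-- The function `1 / √t`, cut off near zero. -/
noncomputable def invSqrtCutoff (t : ℝ) : ℝ := 1 / Real.sqrt (max t (1 / 2))

theorem continuous_invSqrtCutoff : Continuous invSqrtCutoff := by
  unfold invSqrtCutoff
  refine continuous_const.div (by fun_prop) fun t => ?_
  exact (Real.sqrt_pos.mpr (lt_of_lt_of_le (by norm_num) (le_max_right _ _))).ne'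

/-- The polar part of the canonical element intertwining two projections that are close; in
general only a cut-off of it. -/
noncomputable def projUnitary (p q : M) : M :=
  projIntertwiner p q * cfc invSqrtCutoff (star (projIntertwiner p q) * projIntertwiner p q)

variable {p q : M}

theorem projIntertwiner_sub_one (p q : M) (hq : q * q = q) :
    projIntertwiner p q - 1 = (p - q) * (2 * q - 1) := by
  have : (p - q) * (2 * q - 1) = 2 * (p * q) - p - 2 * (q * q) + q := by noncomm_ring
  rw [this, hq, projIntertwiner]
  noncomm_ring

theorem star_projIntertwiner_mul_self (hp : IsStarProjection p) (hq : IsStarProjection q) :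
    star (projIntertwiner p q) * projIntertwiner p q = 1 - (p - q) * (p - q) := by
  have hpp : p * p = p := hp.isIdempotentElem
  have hqq : q * q = q := hq.isIdempotentElem
  have hps : star p = p := hp.isSelfAdjoint
  have hqs : star q = q := hq.isSelfAdjoint
  have h1 : star (projIntertwiner p q) = q * p + (1 - q) * (1 - p) := by
    simp [projIntertwiner, hps, hqs]
  rw [h1, projIntertwiner]
  simp only [mul_add, add_mul, mul_sub, sub_mul, mul_one, one_mul, hpp, hqq, ← mul_assoc]
  rw [mul_assoc q p p, hpp]
  abel

theorem projIntertwiner_mul (hp : p * p = p) (hq : q * q = q) :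
    projIntertwiner p q * q = p * projIntertwiner p q := by
  simp only [projIntertwiner, mul_add, add_mul, mul_sub, sub_mul, mul_one, one_mul, hp, ← mul_assoc,
    mul_assoc p q q, hq]
  abel

theorem projUnitary_mul (hp : IsStarProjection p) (hq : IsStarProjection q) :
    projUnitary p q * q = p * projUnitary p q := by
  have hpp : p * p = p := hp.isIdempotentElem
  have hqq : q * q = q := hq.isIdempotentElem
  have hc : Commute (star (projIntertwiner p q) * projIntertwiner p q) q := by
    rw [star_projIntertwiner_mul_self hp hq]
    change (1 - (p - q) * (p - q)) * q = q * (1 - (p - q) * (p - q))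
    simp only [mul_sub, sub_mul, mul_one, one_mul, hpp, hqq, ← mul_assoc]
    rw [mul_assoc p q q, hqq]
    abel
  rw [projUnitary, mul_assoc, (hc.cfc_real invSqrtCutoff).eq, ← mul_assoc,
    projIntertwiner_mul hpp hqq, mul_assoc]

theorem star_projUnitary_mul_self (hp : IsStarProjection p) (hq : IsStarProjection q)
    (h : ‖p - q‖ ≤ 1 / 2) : star (projUnitary p q) * projUnitary p q = 1 := by
  set w := projIntertwiner p q with hw
  have hsa : IsSelfAdjoint (star w * w) := IsSelfAdjoint.star_mul_self w
  have hspec : ∀ t ∈ spectrum ℝ (star w * w), 1 / 2 ≤ t := by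
    intro t ht
    have h1 := norm_apply_le_norm_cfc (fun t : ℝ => t - 1) (star w * w) ht
    rw [cfc_sub (fun t : ℝ => t) (fun _ => 1) (star w * w), cfc_id' ℝ (star w * w),
      cfc_const_one ℝ (star w * w),
      star_projIntertwiner_mul_self hp hq] at h1
    have h2 : ‖1 - (p - q) * (p - q) - 1‖ ≤ 1 / 4 := by
      rw [sub_sub_cancel_left, norm_neg]
      calc _ ≤ ‖p - q‖ * ‖p - q‖ := norm_mul_le _ _
        _ ≤ 1 / 2 * (1 / 2) := by gcongr
        _ = 1 / 4 := by norm_num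
    have h3 := abs_le.mp (h1.trans h2)
    linarith [h3.1]
  have hG : ContinuousOn invSqrtCutoff (spectrum ℝ (star w * w)) :=
    continuous_invSqrtCutoff.continuousOn
  have hg : IsSelfAdjoint (cfc invSqrtCutoff (star w * w)) := cfc_predicate _ _
  rw [projUnitary, star_mul, hg.star_eq, mul_assoc, ← mul_assoc (star w)]
  have h1 : cfc (fun t : ℝ => t) (star w * w) = star w * w := cfc_id' ℝ (star w * w) hsa
  have h2 : cfc invSqrtCutoff (star w * w) * (star w * w * cfc invSqrtCutoff (star w * w))
      = cfc (fun t => invSqrtCutoff t * (t * invSqrtCutoff t)) (star w * w) := by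
    rw [cfc_mul invSqrtCutoff (fun t => t * invSqrtCutoff t) _ hG (continuousOn_id.mul hG),
      cfc_mul (fun t => t) invSqrtCutoff _ continuousOn_id hG, h1]
  rw [h2]
  have h3 : cfc (fun t => invSqrtCutoff t * (t * invSqrtCutoff t)) (star w * w)
      = cfc (fun _ : ℝ => (1 : ℝ)) (star w * w) := by
    refine cfc_congr fun t ht => ?_
    have ht' := hspec t ht
    have ht0 : 0 < Real.sqrt t := Real.sqrt_pos.mpr (by linarith)
    simp only [invSqrtCutoff, max_eq_left ht']
    field_simp
    exact (Real.sq_sqrt (by linarith)).symm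
  rw [h3, cfc_const_one ℝ (star w * w)]

variable (M) in
theorem exists_norm_projUnitary_sub_one_le {ε : ℝ} (hε : 0 < ε) :
    ∃ δ > 0, ∀ p q : M, IsStarProjection p → IsStarProjection q → ‖p - q‖ ≤ δ →
      ‖projUnitary p q - 1‖ ≤ ε := by
  obtain ⟨δ, hδ, h⟩ := exists_cfc_sub_le (A := M) continuous_invSqrtCutoff 2
    (by positivity : 0 < ε / 8)
  refine ⟨min (min 1 δ) (ε / 12), by positivity, fun p q hp hq hpq => ?_⟩
  have h1 : ‖p - q‖ ≤ 1 := hpq.trans ((min_le_left _ _).trans (min_le_left _ _))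
  have h2 : ‖p - q‖ ≤ δ := hpq.trans ((min_le_left _ _).trans (min_le_right _ _))
  have h3 : ‖p - q‖ ≤ ε / 12 := hpq.trans (min_le_right _ _)
  have hone : ‖(1 : M)‖ ≤ 1 := (IsStarProjection.one (R := M)).norm_le
  set w := projIntertwiner p q with hw
  set G := cfc invSqrtCutoff (star w * w) with hG
  have hww : ‖star w * w - 1‖ ≤ ‖p - q‖ := by
    rw [star_projIntertwiner_mul_self hp hq, sub_sub_cancel_left, norm_neg]
    calc _ ≤ ‖p - q‖ * ‖p - q‖ := norm_mul_le _ _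
      _ ≤ 1 * ‖p - q‖ := by gcongr
      _ = ‖p - q‖ := one_mul _
  have hR : ‖star w * w‖ ≤ 2 := by
    have := norm_add_le (star w * w - 1) 1
    rw [sub_add_cancel] at this
    linarith
  have hg1 : cfc invSqrtCutoff (1 : M) = 1 := by
    have := cfc_algebraMap (R := ℝ) (A := M) (1 : ℝ) invSqrtCutoff
    rw [map_one] at this
    rw [this, invSqrtCutoff, max_eq_left (by norm_num : (1 / 2 : ℝ) ≤ 1), Real.sqrt_one, div_one,
      map_one]
  have hGn : ‖G - 1‖ ≤ ε / 8 := by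
    have := h (star w * w) 1 (IsSelfAdjoint.star_mul_self w) (IsSelfAdjoint.one M) hR
      (by linarith) (hww.trans h2)
    rwa [hg1] at this
  have hwn : ‖w - 1‖ ≤ 3 * ‖p - q‖ := by
    rw [hw, projIntertwiner_sub_one p q hq.isIdempotentElem]
    have : ‖2 * q - 1‖ ≤ 3 := by
      have e : 2 * q - 1 = q + q - 1 := by rw [two_mul]
      rw [e]
      have h4 := norm_sub_le (q + q) 1
      have h5 := norm_add_le q q
      have h6 := hq.norm_le
      linarith
    calc _ ≤ ‖p - q‖ * ‖2 * q - 1‖ := norm_mul_le _ _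
      _ ≤ ‖p - q‖ * 3 := by gcongr
      _ = _ := by ring
  have e : projUnitary p q - 1 = (w - 1) * (G - 1) + (w - 1) + (G - 1) := by
    rw [projUnitary]; noncomm_ring
  rw [e]
  have h7 : ‖(w - 1) * (G - 1)‖ ≤ 3 * (ε / 8) := by
    calc _ ≤ ‖w - 1‖ * ‖G - 1‖ := norm_mul_le _ _
      _ ≤ 3 * (ε / 8) := by gcongr; linarith
  have := norm_add₃_le (a := (w - 1) * (G - 1)) (b := w - 1) (c := G - 1)
  linarith

end LocalUnitary

/-! ### Patches -/

section Patch

variable {X : Type} [TopologicalSpace X] {m : ℕ}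

/-- The constant matrix `c`, moved by `U` and cut off by `y`. -/
noncomputable def patch (U : MatFun X m) (y : C(X, ℝ)) (c : Matrix (Fin m) (Fin m) ℂ) :
    MatFun X m :=
  ⟨fun x => (y x : ℂ) • (U x * c * star (U x)), by
    have h1 : Continuous fun x => U x * c * star (U x) :=
      (U.continuous.mul continuous_const).mul U.continuous.star
    have h2 : Continuous fun x => (y x : ℂ) := by fun_prop
    exact h2.smul h1⟩

theorem patch_apply (U : MatFun X m) (y : C(X, ℝ)) (c : Matrix (Fin m) (Fin m) ℂ) (x : X) :
    patch U y c x = (y x : ℂ) • (U x * c * star (U x)) := rfl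

theorem patch_mul_patch {U : MatFun X m} {y : C(X, ℝ)} (y' : C(X, ℝ))
    (c c' : Matrix (Fin m) (Fin m) ℂ) (hU : ∀ x, y x ≠ 0 → star (U x) * U x = 1) :
    patch U y c * patch U y' c' = patch U (y * y') (c * c') := by
  ext1 x
  rw [ContinuousMap.mul_apply, patch_apply, patch_apply, patch_apply, smul_mul_smul_comm,
    ContinuousMap.mul_apply, Complex.ofReal_mul]
  by_cases h : y x = 0
  · simp [h]
  · congr 1
    calc _ = U x * c * (star (U x) * U x) * c' * star (U x) := by simp only [mul_assoc]
      _ = _ := by rw [hU x h, mul_one]; simp only [mul_assoc]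

theorem patch_mul_patch_of_disjoint (U U' : MatFun X m) {y y' : C(X, ℝ)} (h : y * y' = 0)
    (c c' : Matrix (Fin m) (Fin m) ℂ) : patch U y c * patch U' y' c' = 0 := by
  ext1 x
  have h1 : (y x : ℂ) * y' x = 0 := by
    have := congrArg (fun z : C(X, ℝ) => z x) h
    exact_mod_cast this
  rw [ContinuousMap.mul_apply, patch_apply, patch_apply, smul_mul_smul_comm, h1, zero_smul]
  rfl

theorem star_patch (U : MatFun X m) (y : C(X, ℝ)) (c : Matrix (Fin m) (Fin m) ℂ) :
    star (patch U y c) = patch U y (star c) := by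
  ext1 x
  rw [ContinuousMap.star_apply, patch_apply, patch_apply, star_smul, star_mul, star_mul, star_star]
  congr 1
  · simp
  · rw [mul_assoc]

theorem mul_patch {P U : MatFun X m} {y : C(X, ℝ)} {p c : Matrix (Fin m) (Fin m) ℂ}
    (h : ∀ x, y x ≠ 0 → P x * U x = U x * p) : P * patch U y c = patch U y (p * c) := by
  ext1 x
  rw [ContinuousMap.mul_apply, patch_apply, patch_apply, mul_smul_comm]
  by_cases hy : y x = 0
  · simp [hy]
  · congr 1
    rw [← mul_assoc, ← mul_assoc, h x hy, ← mul_assoc]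

theorem patch_smul (U : MatFun X m) (y : C(X, ℝ)) (z : ℂ) (c : Matrix (Fin m) (Fin m) ℂ) :
    patch U y (z • c) = z • patch U y c := by
  ext1 x
  rw [ContinuousMap.smul_apply, patch_apply, patch_apply, mul_smul_comm, smul_mul_assoc,
    smul_comm]

theorem patch_sum {ι : Type*} (s : Finset ι) (U : MatFun X m) (y : C(X, ℝ))
    (c : ι → Matrix (Fin m) (Fin m) ℂ) :
    patch U y (∑ i ∈ s, c i) = ∑ i ∈ s, patch U y (c i) := by
  ext1 x
  rw [ContinuousMap.sum_apply]
  simp only [patch_apply, Finset.mul_sum, Finset.sum_mul, Finset.smul_sum]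

end Patch

/-- A two-coloured family of patches over which the projection `P` and the functions `g` are
conjugate to constants, together with a partition of unity (the fourth powers of `root`)
subordinate to it, as far as `P` does not vanish. -/
structure PatchSystem {X : Type} [TopologicalSpace X] {m : ℕ} (P : MatFun X m) {F : Type*}
    (g : F → MatFun X m) (κ : ℝ) where
  /-- The patches. -/
  J : Type
  fintype : Fintype J
  /-- The colour of a patch. -/
  color : J → Bool
  /-- A function equal to one on the support of `root`. -/
  cutoff : J → C(X, ℝ)
  /-- The fourth root of the member of the partition of unity. -/
  root : J → C(X, ℝ)
  /-- The conjugating functions, unitary on the patch. -/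
  U : J → MatFun X m
  /-- The base point of a patch. -/
  base : J → X
  cutoff_nonneg : ∀ j x, 0 ≤ cutoff j x
  cutoff_le_one : ∀ j x, cutoff j x ≤ 1
  root_nonneg : ∀ j x, 0 ≤ root j x
  root_le_one : ∀ j x, root j x ≤ 1
  cutoff_mul_root : ∀ j, cutoff j * root j = root j
  disjoint : ∀ j j', j ≠ j' → color j = color j' → cutoff j * cutoff j' = 0
  sum_root : ∀ x, (∑ j, (((root j x) ^ 4 : ℝ) : ℂ)) • P x = P x
  star_mul : ∀ j x, cutoff j x ≠ 0 → star (U j x) * U j x = 1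
  mul_star : ∀ j x, cutoff j x ≠ 0 → U j x * star (U j x) = 1
  intertwine : ∀ j x, cutoff j x ≠ 0 → P x * U j x = U j x * P (base j)
  near : ∀ j x, cutoff j x ≠ 0 → ∀ f, ‖g f x - U j x * g f (base j) * star (U j x)‖ ≤ κ
  base_ne_zero : ∀ j, P (base j) ≠ 0

attribute [instance] PatchSystem.fintype

theorem sum_filter_apply_eq {J : Type*} [Fintype J] (s : Finset J) (r : J → ℝ) {ξ : ℝ → ℝ}
    (hξ : ξ 0 = 0) (h : ∀ j ∈ s, ∀ j' ∈ s, j ≠ j' → r j * r j' = 0) :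
    ∑ j ∈ s, ξ (r j) = ξ (∑ j ∈ s, r j) := by
  by_cases h0 : ∃ j ∈ s, r j ≠ 0
  · obtain ⟨j, hj, hr⟩ := h0
    have h1 : ∀ j' ∈ s, j' ≠ j → r j' = 0 := fun j' hj' hne =>
      (mul_eq_zero.mp (h j' hj' j hj hne)).resolve_right hr
    rw [Finset.sum_eq_single_of_mem j hj fun j' hj' hne => by rw [h1 j' hj' hne, hξ],
      Finset.sum_eq_single_of_mem j hj h1]
  · push Not at h0
    rw [Finset.sum_eq_zero h0, hξ]
    exact Finset.sum_eq_zero fun j hj => by rw [h0 j hj, hξ]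

/-- The piecewise linear function with value zero up to `a` and one from `b` on. -/
noncomputable def ramp (a b t : ℝ) : ℝ := max 0 (min 1 ((t - a) / (b - a)))

theorem continuous_ramp (a b : ℝ) : Continuous (ramp a b) := by unfold ramp; fun_prop

theorem ramp_nonneg (a b t : ℝ) : 0 ≤ ramp a b t := le_max_left _ _

theorem ramp_le_one (a b t : ℝ) : ramp a b t ≤ 1 := max_le zero_le_one (min_le_left _ _)

theorem ramp_of_le {a b t : ℝ} (hab : a < b) (h : t ≤ a) : ramp a b t = 0 :=
  max_eq_left ((min_le_right _ _).trans
    (div_nonpos_of_nonpos_of_nonneg (by linarith) (by linarith)))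

theorem ramp_of_ge {a b t : ℝ} (hab : a < b) (h : b ≤ t) : ramp a b t = 1 := by
  have : 1 ≤ (t - a) / (b - a) := by rw [le_div_iff₀ (by linarith)]; linarith
  rw [ramp, min_eq_left this, max_eq_right zero_le_one]

theorem ramp_mono {a b : ℝ} (hab : a < b) : Monotone (ramp a b) := by
  intro s t hst
  unfold ramp
  have : 0 < b - a := by linarith
  gcongr

theorem ramp_add_ramp {s t : ℝ} (h : s + t = 1) :
    ramp (1 / 3) (2 / 3) s + ramp (1 / 3) (2 / 3) t = 1 := by
  have ht : t = 1 - s := by linarith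
  subst ht
  unfold ramp
  rcases le_total s (1 / 3) with h1 | h1
  · rw [max_eq_left, min_eq_left, max_eq_right zero_le_one, zero_add]
    · rw [le_div_iff₀ (by norm_num)]; linarith
    · refine (min_le_right _ _).trans ?_
      rw [div_le_iff₀ (by norm_num)]; linarith
  · rcases le_total s (2 / 3) with h2 | h2
    · rw [min_eq_right, min_eq_right, max_eq_right, max_eq_right]
      · field_simp; ring
      all_goals first | (rw [div_le_iff₀ (by norm_num)]; linarith) |
        exact div_nonneg (by linarith) (by norm_num)
    · rw [min_eq_left, max_eq_right zero_le_one, max_eq_left, add_zero]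
      · refine (min_le_right _ _).trans ?_
        rw [div_le_iff₀ (by norm_num)]; linarith
      · rw [le_div_iff₀ (by norm_num)]; linarith

open scoped CStarAlgebra in
theorem map_projUnitary {M N : Type*} [CStarAlgebra M] [CStarAlgebra N] (φ : M →⋆ₐ[ℂ] N)
    (p q : M) : φ (projUnitary p q) = projUnitary (φ p) (φ q) := by
  have hφ : Continuous φ := map_continuous φ
  have h1 : φ (projIntertwiner p q) = projIntertwiner (φ p) (φ q) := by simp [projIntertwiner]
  have h2 : φ (star (projIntertwiner p q) * projIntertwiner p q)
      = star (projIntertwiner (φ p) (φ q)) * projIntertwiner (φ p) (φ q) := by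
    rw [map_mul, map_star, h1]
  rw [projUnitary, projUnitary, map_mul, h1, ← h2]
  congr 1
  exact StarAlgHomClass.map_cfc (S := ℂ) φ invSqrtCutoff _
    continuous_invSqrtCutoff.continuousOn hφ (IsSelfAdjoint.star_mul_self _)
    (by rw [h2]; exact IsSelfAdjoint.star_mul_self _)

theorem projUnitary_apply {X : Type} [TopologicalSpace X] [CompactSpace X] {m : ℕ}
    (P R : MatFun X m) (x : X) : projUnitary P R x = projUnitary (P x) (R x) :=
  map_projUnitary (M := MatFun X m)
    { toFun := fun M => M x
      map_one' := rfl
      map_mul' := fun _ _ => rfl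
      map_zero' := rfl
      map_add' := fun _ _ => rfl
      commutes' := fun _ => rfl
      map_star' := fun _ => rfl } P R

/-- Over a graph, there are patch systems. -/
theorem GraphModel.exists_patchSystem {X : Type} [TopologicalSpace X] [T2Space X] [CompactSpace X]
    (Γ : GraphModel X) {m : ℕ} {P : MatFun X m} (hP : IsStarProjection P) {F : Type*} [Fintype F]
    (g : F → MatFun X m) {κ : ℝ} (hκ : 0 < κ) : Nonempty (PatchSystem P g κ) := by
  classical
  have hPx : ∀ x, IsStarProjection (P x) := fun x =>
    ⟨congrArg (fun M : MatFun X m => M x) hP.isIdempotentElem,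
      congrArg (fun M : MatFun X m => M x) hP.isSelfAdjoint⟩
  let B : ℝ := 1 + ∑ f, ‖g f‖
  have hB : 0 < B := by positivity
  have hgB : ∀ f x, ‖g f x‖ ≤ B := fun f x => by
    have h1 := (g f).norm_coe_le_norm x
    have h2 := Finset.single_le_sum (f := fun f => ‖g f‖) (fun f _ => norm_nonneg _)
      (Finset.mem_univ f)
    simp only [B]
    linarith
  obtain ⟨δ, hδ, hU⟩ := exists_norm_projUnitary_sub_one_le (Matrix (Fin m) (Fin m) ℂ)
    (by positivity : 0 < κ / (4 * B))
  let q : X → Matrix (Fin m) (Fin m) ℂ × (F → Matrix (Fin m) (Fin m) ℂ) :=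
    fun x => (P x, fun f => g f x)
  have hq : Continuous q := by fun_prop
  obtain ⟨J, _, c, r, b, hr0, hr1, hrd, hrq⟩ := Γ.exists_two_coloured_partition hq
    (by positivity : 0 < min (min δ (1 / 2)) (κ / 2))
  have hdP : ∀ j x, r j x ≠ 0 → ‖P x - P (b j)‖ ≤ min δ (1 / 2) := by
    intro j x h
    rw [← dist_eq_norm]
    exact (le_max_left _ _).trans ((hrq j x h).le.trans (min_le_left _ _))
  have hdg : ∀ j x, r j x ≠ 0 → ∀ f, ‖g f x - g f (b j)‖ ≤ κ / 2 := by
    intro j x h f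
    rw [← dist_eq_norm]
    exact (dist_le_pi_dist (fun f => g f x) (fun f => g f (b j)) f).trans
      ((le_max_right _ _).trans ((hrq j x h).le.trans (min_le_right _ _)))
  -- The cut-off functions are `1` where the roots do not vanish. The fourth powers of the roots
  -- still have sum `1`: at each point at most one member of each colour does not vanish, and the
  -- ramp from `1/3` to `2/3` takes `t` and `1 - t` to two numbers with sum `1`.
  let cut : J → C(X, ℝ) := fun j => ⟨fun x => ramp (1 / 6) (1 / 3) (r j x),
    (continuous_ramp _ _).comp (r j).continuous⟩
  let root : J → C(X, ℝ) := fun j =>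
    ⟨fun x => Real.sqrt (Real.sqrt (ramp (1 / 3) (2 / 3) (r j x))),
      ((continuous_ramp _ _).comp (r j).continuous).sqrt.sqrt⟩
  have hcut : ∀ j x, cut j x ≠ 0 → r j x ≠ 0 := by
    intro j x h h0
    refine h ?_
    change ramp _ _ (r j x) = 0
    rw [h0, ramp_of_le (by norm_num) (by norm_num)]
  have hroot4 : ∀ j x, (root j x) ^ 4 = ramp (1 / 3) (2 / 3) (r j x) := by
    intro j x
    change (Real.sqrt (Real.sqrt (ramp (1 / 3) (2 / 3) (r j x)))) ^ 4 = _
    rw [show (4 : ℕ) = 2 * 2 from rfl, pow_mul, Real.sq_sqrt (Real.sqrt_nonneg _),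
      Real.sq_sqrt (ramp_nonneg _ _ _)]
  let U : J → MatFun X m := fun j => projUnitary P (ContinuousMap.const X (P (b j)))
  have hUx : ∀ j x, U j x = projUnitary (P x) (P (b j)) := fun j x => projUnitary_apply _ _ x
  have hUs : ∀ j x, cut j x ≠ 0 → star (U j x) * U j x = 1 := by
    intro j x h
    rw [hUx]
    exact star_projUnitary_mul_self (hPx _) (hPx _)
      ((hdP j x (hcut j x h)).trans (min_le_right _ _))
  have hUs' : ∀ j x, cut j x ≠ 0 → U j x * star (U j x) = 1 := fun j x h =>
    mul_eq_one_comm.mp (hUs j x h)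
  refine ⟨{
    J := {j // P (b j) ≠ 0}
    fintype := inferInstance
    color := fun j => c j
    cutoff := fun j => cut j
    root := fun j => root j
    U := fun j => U j
    base := fun j => b j
    cutoff_nonneg := fun j x => ramp_nonneg _ _ _
    cutoff_le_one := fun j x => ramp_le_one _ _ _
    root_nonneg := fun j x => Real.sqrt_nonneg _
    root_le_one := fun j x => Real.sqrt_le_one.mpr (Real.sqrt_le_one.mpr (ramp_le_one _ _ _))
    cutoff_mul_root := ?_
    disjoint := ?_
    sum_root := ?_
    star_mul := fun j x h => hUs j x h
    mul_star := fun j x h => hUs' j x h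
    intertwine := ?_
    near := ?_
    base_ne_zero := fun j => j.2 }⟩
  · intro j
    ext x
    change ramp (1 / 6) (1 / 3) (r j x) * Real.sqrt (Real.sqrt (ramp (1 / 3) (2 / 3) (r j x)))
      = Real.sqrt (Real.sqrt (ramp (1 / 3) (2 / 3) (r j x)))
    rcases le_total (1 / 3) (r j x) with h | h
    · rw [ramp_of_ge (by norm_num) h, one_mul]
    · rw [ramp_of_le (a := 1 / 3) (by norm_num) h]; simp
  · intro j j' hne hcol
    ext x
    change cut j x * cut j' x = 0
    by_contra h
    refine mul_ne_zero (hcut _ _ (left_ne_zero_of_mul h)) (hcut _ _ (right_ne_zero_of_mul h)) ?_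
    exact hrd _ _ x (fun h => hne (Subtype.ext h)) hcol
  · intro x
    by_cases hx : P x = 0
    · rw [hx, smul_zero]
    · have h1 : ∑ j : {j // P (b j) ≠ 0}, (root j x) ^ 4 = ∑ j, (root j x) ^ 4 := by
        rw [← Finset.sum_subtype (Finset.univ.filter fun j => P (b j) ≠ 0) (by simp)
          fun j => (root j x) ^ 4]
        refine Finset.sum_filter_of_ne fun j _ hj hPb => hx ?_
        -- a base point where `P` vanishes has a patch where it vanishes
        have hrx : r j x ≠ 0 := by
          intro h0
          refine hj ?_
          rw [hroot4, h0, ramp_of_le (by norm_num) (by norm_num)]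
        have h2 := (hdP j x hrx).trans (min_le_right _ _)
        rw [hPb, sub_zero] at h2
        exact (hPx x).eq_zero_of_norm_lt_one (by linarith)
      have h2 : ∀ i, ∑ j ∈ Finset.univ.filter (fun j => c j = i), ramp (1 / 3) (2 / 3) (r j x)
          = ramp (1 / 3) (2 / 3) (∑ j ∈ Finset.univ.filter (fun j => c j = i), r j x) := by
        intro i
        refine sum_filter_apply_eq _ _ (ramp_of_le (by norm_num) (by norm_num)) ?_
        intro j hj j' hj' hne
        exact hrd j j' x hne ((Finset.mem_filter.mp hj).2.trans (Finset.mem_filter.mp hj').2.symm)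
      have hsplit : ∀ f : J → ℝ, ∑ j, f j = ∑ j ∈ Finset.univ.filter (fun j => c j = true), f j
          + ∑ j ∈ Finset.univ.filter (fun j => c j = false), f j := by
        intro f
        rw [← Finset.sum_filter_add_sum_filter_not Finset.univ (fun j => c j = true)]
        simp
      have h3 : ∑ j : {j // P (b j) ≠ 0}, (root j x) ^ 4 = 1 := by
        rw [h1]
        simp only [hroot4]
        rw [hsplit, h2, h2]
        refine ramp_add_ramp ?_
        rw [← hsplit, hr1]
      have h4 : ∑ j : {j // P (b j) ≠ 0}, (((root j x) ^ 4 : ℝ) : ℂ) = 1 := by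
        rw [← Complex.ofReal_sum, h3, Complex.ofReal_one]
      rw [h4, one_smul]
  · intro j x h
    rw [hUx, projUnitary_mul (hPx _) (hPx _)]
  · intro j x h f
    have hrx := hcut j x h
    have hη : ‖U j x - 1‖ ≤ κ / (4 * B) := by
      rw [hUx]
      exact hU _ _ (hPx _) (hPx _) ((hdP j x hrx).trans (min_le_left _ _))
    have hUn : ‖U j x‖ ≤ 1 := by
      have h1 : ‖U j x‖ * ‖U j x‖ ≤ 1 := by
        rw [← CStarRing.norm_star_mul_self, hUs j x h]
        exact (IsStarProjection.one (R := Matrix (Fin m) (Fin m) ℂ)).norm_le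
      nlinarith [norm_nonneg (U j x)]
    have e : g f x - U j x * g f (b j) * star (U j x) = (g f x - g f (b j))
        - (U j x - 1) * g f (b j) - U j x * g f (b j) * star (U j x - 1) := by
      rw [star_sub, star_one]; noncomm_ring
    rw [e]
    have h1 : ‖(U j x - 1) * g f (b j)‖ ≤ κ / 4 := by
      calc _ ≤ ‖U j x - 1‖ * ‖g f (b j)‖ := norm_mul_le _ _
        _ ≤ κ / (4 * B) * B := by gcongr; exact hgB _ _
        _ = κ / 4 := by field_simp
    have h2 : ‖U j x * g f (b j) * star (U j x - 1)‖ ≤ κ / 4 := by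
      calc _ ≤ ‖U j x‖ * ‖g f (b j)‖ * ‖star (U j x - 1)‖ := norm_mul₃_le
        _ ≤ 1 * B * (κ / (4 * B)) := by
          rw [norm_star]
          gcongr
          exact hgB _ _
        _ = κ / 4 := by field_simp
    have h3 := hdg j x hrx f
    have h4 := norm_sub_le (g f x - g f (b j) - (U j x - 1) * g f (b j))
      (U j x * g f (b j) * star (U j x - 1))
    have h5 := norm_sub_le (g f x - g f (b j)) ((U j x - 1) * g f (b j))
    linarith

/-! ### Local systems of matrix units -/

section MatrixUnits

variable {m : ℕ} (W : unitary (Matrix (Fin m) (Fin m) ℂ))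

/-- The matrix units of the basis given by a unitary. -/
noncomputable def matUnit (i k : Fin m) : Matrix (Fin m) (Fin m) ℂ :=
  (W : Matrix (Fin m) (Fin m) ℂ) * Matrix.single i k 1 * star (W : Matrix (Fin m) (Fin m) ℂ)

theorem conj_mul_conj (c d : Matrix (Fin m) (Fin m) ℂ) :
    ((W : Matrix (Fin m) (Fin m) ℂ) * c * star (W : Matrix (Fin m) (Fin m) ℂ))
      * ((W : Matrix (Fin m) (Fin m) ℂ) * d * star (W : Matrix (Fin m) (Fin m) ℂ))
      = (W : Matrix (Fin m) (Fin m) ℂ) * (c * d) * star (W : Matrix (Fin m) (Fin m) ℂ) := by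
  have hW : star (W : Matrix (Fin m) (Fin m) ℂ) * W = 1 := Unitary.coe_star_mul_self _
  calc _ = (W : Matrix (Fin m) (Fin m) ℂ) * c * (star (W : Matrix (Fin m) (Fin m) ℂ) * W) * d
        * star (W : Matrix (Fin m) (Fin m) ℂ) := by simp only [mul_assoc]
    _ = _ := by rw [hW, mul_one]; simp only [mul_assoc]

theorem matUnit_mul (i k l : Fin m) : matUnit W i k * matUnit W k l = matUnit W i l := by
  rw [matUnit, matUnit, conj_mul_conj, Matrix.single_mul_single_same, mul_one, matUnit]

theorem matUnit_mul_of_ne (i l : Fin m) {k k' : Fin m} (h : k ≠ k') :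
    matUnit W i k * matUnit W k' l = 0 := by
  rw [matUnit, matUnit, conj_mul_conj, Matrix.single_mul_single_of_ne _ _ _ _ h]
  simp

theorem star_matUnit (i k : Fin m) : star (matUnit W i k) = matUnit W k i := by
  rw [matUnit, star_mul, star_mul, star_star, Matrix.star_eq_conjTranspose (Matrix.single i k 1),
    Matrix.conjTranspose_single, star_one, ← mul_assoc, matUnit]

variable {W} {I : Finset (Fin m)} {P : Matrix (Fin m) (Fin m) ℂ}

theorem mul_matUnit
    (hP : P = (W : Matrix (Fin m) (Fin m) ℂ) * Matrix.diagonal (fun i => if i ∈ I then 1 else 0)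
    * star (W : Matrix (Fin m) (Fin m) ℂ))
    {i : Fin m} (hi : i ∈ I) (k : Fin m) : P * matUnit W i k = matUnit W i k := by
  rw [hP, matUnit, conj_mul_conj]
  congr 2
  ext a b
  rw [Matrix.diagonal_mul, Matrix.single_apply]
  split_ifs <;> simp_all

theorem sum_matUnit
    (hP : P = (W : Matrix (Fin m) (Fin m) ℂ) * Matrix.diagonal (fun i => if i ∈ I then 1 else 0)
    * star (W : Matrix (Fin m) (Fin m) ℂ)) : ∑ i ∈ I, matUnit W i i = P := by
  have h1 : (∑ i ∈ I, Matrix.single i i (1 : ℂ))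
      = Matrix.diagonal (fun i => if i ∈ I then 1 else 0) := by
    ext a b
    rw [Matrix.sum_apply, Matrix.diagonal_apply]
    simp only [Matrix.single_apply]
    by_cases hab : a = b
    · subst hab
      simp
    · rw [if_neg hab]
      refine Finset.sum_eq_zero fun i _ => if_neg ?_
      rintro ⟨rfl, rfl⟩
      exact hab rfl
  rw [hP, ← h1, Finset.mul_sum, Finset.sum_mul]
  rfl

theorem matUnit_expand
    (hP : P = (W : Matrix (Fin m) (Fin m) ℂ) * Matrix.diagonal (fun i => if i ∈ I then 1 else 0)
    * star (W : Matrix (Fin m) (Fin m) ℂ))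
    {c : Matrix (Fin m) (Fin m) ℂ} (hc : P * c = c) (k l : Fin m) :
    c * matUnit W k l
      = ∑ i ∈ I, (star (W : Matrix (Fin m) (Fin m) ℂ) * c * (W : Matrix (Fin m) (Fin m) ℂ)) i k
        • matUnit W i l := by
  have hW : star (W : Matrix (Fin m) (Fin m) ℂ) * W = 1 := Unitary.coe_star_mul_self _
  have hW' : (W : Matrix (Fin m) (Fin m) ℂ) * star (W : Matrix (Fin m) (Fin m) ℂ) = 1 :=
    Unitary.mul_star_self_of_mem W.2
  set d := star (W : Matrix (Fin m) (Fin m) ℂ) * c * (W : Matrix (Fin m) (Fin m) ℂ) with hd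
  have hcd : c = (W : Matrix (Fin m) (Fin m) ℂ) * d * star (W : Matrix (Fin m) (Fin m) ℂ) := by
    calc c = ((W : Matrix (Fin m) (Fin m) ℂ) * star (W : Matrix (Fin m) (Fin m) ℂ)) * c
          * ((W : Matrix (Fin m) (Fin m) ℂ) * star (W : Matrix (Fin m) (Fin m) ℂ)) := by
          rw [hW', one_mul, mul_one]
      _ = _ := by rw [hd]; simp only [mul_assoc]
  have hPd : Matrix.diagonal (fun i => if i ∈ I then 1 else 0) * d = d := by
    calc _ = star (W : Matrix (Fin m) (Fin m) ℂ) * (P * c) * (W : Matrix (Fin m) (Fin m) ℂ) := by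
          rw [hP, hd]
          simp only [← mul_assoc]
          rw [hW, one_mul]
      _ = d := by rw [hc]
  have hentry : d * Matrix.single k l 1 = ∑ i ∈ I, d i k • Matrix.single i l 1 := by
    ext a b
    rw [Matrix.sum_apply]
    simp only [Matrix.smul_apply, Matrix.single_apply, smul_eq_mul]
    have ha : a ∉ I → d a k = 0 := by
      intro ha
      have := congrFun (congrFun hPd a) k
      rw [Matrix.diagonal_mul, if_neg ha, zero_mul] at this
      exact this.symm
    rw [Matrix.mul_apply, Finset.sum_eq_single k]
    · by_cases hab : a ∈ I
      · rw [Finset.sum_eq_single_of_mem a hab]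
        · simp [Matrix.single_apply]
        · intro i _ hi
          simp [hi]
      · rw [ha hab, zero_mul, Finset.sum_eq_zero]
        intro i hi
        have : i ≠ a := fun h => hab (h ▸ hi)
        simp [this]
    · intro j _ hj
      simp [hj.symm]
    · simp
  conv_lhs => rw [hcd]
  rw [matUnit, conj_mul_conj, hentry, Finset.mul_sum, Finset.sum_mul]
  refine Finset.sum_congr rfl fun i _ => ?_
  rw [mul_smul_comm, smul_mul_assoc, matUnit]

end MatrixUnits

/-- Finitely many systems of partial isometries up to cut-offs, in two colours: the `s j b`, for
fixed `j`, move copies of the element `e j` to orthogonal places, and different `j` of one colour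
are orthogonal. The elements of `F` almost commute with sums `∑ s x s*` of positive contractions
`x` living under the `e j`, as long as the `j` have one colour, and traces of products factor. -/
structure LocalSystem {A : Type*} [CStarAlgebra A] [PartialOrder A] [StarOrderedRing A]
    (F : Set A) (ε : ℝ) (p : A) where
  J : Type
  fintypeJ : Fintype J
  color : J → Bool
  β : J → Type
  fintypeβ : ∀ j, Fintype (β j)
  φ : J → A
  e : J → A
  s : ∀ j, β j → A
  φ_nonneg : ∀ j, 0 ≤ φ j
  φ_le_one : ∀ j, φ j ≤ 1
  e_mul_φ : ∀ j, e j * φ j = φ j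
  star_mul_self : ∀ j b, star (s j b) * s j b = e j * e j
  star_mul_of_ne : ∀ j b b', b ≠ b' → star (s j b) * s j b' = 0
  star_mul_of_color : ∀ j j', j ≠ j' → color j = color j' → ∀ b b', star (s j b) * s j' b' = 0
  sum_le_one : ∀ i, ∑ j with color j = i, ∑ b, s j b * star (s j b) ≤ 1
  sum_eq : ∑ j, ∑ b, s j b * (φ j * φ j) * star (s j b) = p
  weight : A → J → ℂ
  norm_commutator_le : ∀ f ∈ F, ∀ i (x : J → A), (∀ j, e j * x j = x j) →
    (∀ j, 0 ≤ x j) → (∀ j, x j ≤ 1) →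
    ‖f * ∑ j with color j = i, ∑ b, s j b * x j * star (s j b)
      - (∑ j with color j = i, ∑ b, s j b * x j * star (s j b)) * f‖ ≤ ε
  norm_trace_sub_le : ∀ f ∈ F, ∀ τ ∈ tracialStateSpace A, ∀ i (x : J → A),
    (∀ j, e j * x j = x j) → (∀ j, 0 ≤ x j) → (∀ j, x j ≤ 1) →
    ‖τ (f * ∑ j with color j = i, ∑ b, s j b * x j * star (s j b))
      - ∑ j with color j = i, weight f j * τ (x j)‖ ≤ ε

attribute [instance] LocalSystem.fintypeJ LocalSystem.fintypeβ

section Construction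

variable {X : Type} [TopologicalSpace X] {m : ℕ} {ι : Type*} {g : ι → MatFun X m} {κ : ℝ}

theorem PatchSystem.mul_patch' {P : MatFun X m} (S : PatchSystem P g κ) {j : S.J} {y : C(X, ℝ)}
    (hy : ∀ x, y x ≠ 0 → S.cutoff j x ≠ 0) {c : Matrix (Fin m) (Fin m) ℂ}
    (hc : P (S.base j) * c = c) : P * patch (S.U j) y c = patch (S.U j) y c := by
  rw [mul_patch (p := P (S.base j)) fun x hx => S.intertwine j x (hy x hx), hc]

/-- The elements of one colour, each conjugated to be constant on its patch. -/
noncomputable def PatchSystem.localConst {P : MatFun X m} (S : PatchSystem P g κ) (i : Bool)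
    (c : S.J → Matrix (Fin m) (Fin m) ℂ) : MatFun X m :=
  ∑ j with S.color j = i, patch (S.U j) (S.cutoff j) (c j)

theorem PatchSystem.cutoff_eq_zero_of_ne {P : MatFun X m} (S : PatchSystem P g κ) {j j' : S.J}
    (h : j ≠ j') (hcol : S.color j = S.color j') {x : X} (hx : S.cutoff j x ≠ 0) :
    S.cutoff j' x = 0 := by
  have := congrArg (fun y : C(X, ℝ) => y x) (S.disjoint j j' h hcol)
  exact (mul_eq_zero.mp this).resolve_left hx

/-- The sum of the cut-off functions of one colour. -/
noncomputable def PatchSystem.cutoffSum {P : MatFun X m} (S : PatchSystem P g κ) (i : Bool) :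
    C(X, ℝ) :=
  ∑ j with S.color j = i, S.cutoff j

theorem PatchSystem.cutoffSum_apply_of_ne_zero {P : MatFun X m} (S : PatchSystem P g κ)
    {j : S.J} {x : X} (hx : S.cutoff j x ≠ 0) : S.cutoffSum (S.color j) x = S.cutoff j x := by
  rw [cutoffSum, ContinuousMap.sum_apply]
  refine Finset.sum_eq_single_of_mem j (by simp) fun j' hj' hne => ?_
  exact S.cutoff_eq_zero_of_ne hne.symm (Finset.mem_filter.mp hj').2.symm hx

theorem PatchSystem.localConst_apply_of_ne_zero {P : MatFun X m} (S : PatchSystem P g κ)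
    (c : S.J → Matrix (Fin m) (Fin m) ℂ) {j : S.J} {x : X} (hx : S.cutoff j x ≠ 0) :
    S.localConst (S.color j) c x = patch (S.U j) (S.cutoff j) (c j) x := by
  rw [localConst, ContinuousMap.sum_apply]
  refine Finset.sum_eq_single_of_mem j (by simp) fun j' hj' hne => ?_
  rw [patch_apply, S.cutoff_eq_zero_of_ne hne.symm (Finset.mem_filter.mp hj').2.symm hx]
  simp

/-- Multiplication of matrix-valued functions by scalar functions. -/
noncomputable def scaleFun (y : C(X, ℝ)) (M : MatFun X m) : MatFun X m :=
  ⟨fun x => (y x : ℂ) • M x, by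
    have h2 : Continuous fun x => (y x : ℂ) := by fun_prop
    exact h2.smul M.continuous⟩

theorem scaleFun_apply (y : C(X, ℝ)) (M : MatFun X m) (x : X) :
    scaleFun y M x = (y x : ℂ) • M x := rfl

theorem PatchSystem.norm_scaleFun_sub_localConst_le [CompactSpace X] {P : MatFun X m}
    (S : PatchSystem P g κ)
    (hκ : 0 ≤ κ) (i : Bool) {h : MatFun X m} {c : S.J → Matrix (Fin m) (Fin m) ℂ}
    (hh : ∀ j x, S.cutoff j x ≠ 0 → ‖h x - S.U j x * c j * star (S.U j x)‖ ≤ κ) :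
    ‖scaleFun (S.cutoffSum i) h - S.localConst i c‖ ≤ κ := by
  rw [ContinuousMap.norm_le _ hκ]
  intro x
  rw [ContinuousMap.sub_apply, scaleFun_apply]
  by_cases h0 : ∃ j, S.color j = i ∧ S.cutoff j x ≠ 0
  · obtain ⟨j, rfl, hj⟩ := h0
    rw [S.cutoffSum_apply_of_ne_zero hj, S.localConst_apply_of_ne_zero c hj, patch_apply,
      ← smul_sub, norm_smul, Complex.norm_real, Real.norm_of_nonneg (S.cutoff_nonneg j x)]
    calc _ ≤ 1 * κ := by
          gcongr
          exacts [S.cutoff_le_one j x, hh j x hj]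
      _ = κ := one_mul κ
  · push Not at h0
    have h1 : S.cutoffSum i x = 0 := by
      rw [cutoffSum, ContinuousMap.sum_apply]
      exact Finset.sum_eq_zero fun j hj => h0 j (Finset.mem_filter.mp hj).2
    have h2 : S.localConst i c x = 0 := by
      rw [localConst, ContinuousMap.sum_apply]
      refine Finset.sum_eq_zero fun j hj => ?_
      rw [patch_apply, h0 j (Finset.mem_filter.mp hj).2]
      simp
    rw [h1, h2]
    simpa using hκ

theorem PatchSystem.scaleFun_mul_patch {P : MatFun X m} (S : PatchSystem P g κ) (h : MatFun X m)
    (j : S.J) (c : Matrix (Fin m) (Fin m) ℂ) :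
    scaleFun (S.cutoffSum (S.color j)) h * patch (S.U j) (S.cutoff j) c
      = h * patch (S.U j) (S.cutoff j * S.cutoff j) c := by
  ext1 x
  rw [ContinuousMap.mul_apply, ContinuousMap.mul_apply, scaleFun_apply, patch_apply, patch_apply,
    smul_mul_smul_comm, mul_smul_comm, ContinuousMap.mul_apply, Complex.ofReal_mul]
  by_cases hx : S.cutoff j x = 0
  · simp [hx]
  · rw [S.cutoffSum_apply_of_ne_zero hx]

theorem PatchSystem.patch_base {P : MatFun X m} (S : PatchSystem P g κ) (j : S.J) {y : C(X, ℝ)}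
    (hy : ∀ x, y x ≠ 0 → S.cutoff j x ≠ 0) : patch (S.U j) y (P (S.base j)) = scaleFun y P := by
  ext1 x
  rw [patch_apply, scaleFun_apply]
  by_cases hx : y x = 0
  · simp [hx]
  · rw [← S.intertwine j x (hy x hx), mul_assoc, S.mul_star j x (hy x hx), mul_one]

variable [CompactSpace X] {A : Type*} [CStarAlgebra A] (Q : CornerModel A X m)
  (S : PatchSystem Q.P g κ)

theorem CornerModel.map_patch_mul {j : S.J} {y y' : C(X, ℝ)}
    (hy : ∀ x, y x ≠ 0 → S.cutoff j x ≠ 0) (hy' : ∀ x, y' x ≠ 0 → S.cutoff j x ≠ 0)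
    (c : Matrix (Fin m) (Fin m) ℂ) {c' : Matrix (Fin m) (Fin m) ℂ}
    (hc' : Q.P (S.base j) * c' = c') :
    Q.ι (patch (S.U j) y c) * Q.ι (patch (S.U j) y' c')
      = Q.ι (patch (S.U j) (y * y') (c * c')) := by
  rw [Q.map_mul_of_right _ (S.mul_patch' hy' hc'),
    patch_mul_patch _ _ _ fun x hx => S.star_mul j x (hy x hx)]

theorem CornerModel.map_patch_mul_of_color {j j' : S.J} (hj : j ≠ j')
    (hcol : S.color j = S.color j') (c : Matrix (Fin m) (Fin m) ℂ)
    {c' : Matrix (Fin m) (Fin m) ℂ} (hc' : Q.P (S.base j') * c' = c') :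
    Q.ι (patch (S.U j) (S.cutoff j) c) * Q.ι (patch (S.U j') (S.cutoff j') c') = 0 := by
  rw [Q.map_mul_of_right _ (S.mul_patch' (fun x hx => hx) hc'),
    patch_mul_patch_of_disjoint _ _ (S.disjoint j j' hj hcol), map_zero]


end Construction

section Construction

variable {X : Type} [TopologicalSpace X] [CompactSpace X] {m : ℕ} {ι : Type*} {g : ι → MatFun X m}
  {κ : ℝ} {A : Type*} [CStarAlgebra A] (Q : CornerModel A X m) (S : PatchSystem Q.P g κ)
  (W : S.J → unitary (Matrix (Fin m) (Fin m) ℂ)) (o : S.J → Fin m)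

/-- The partial isometries, up to cut-offs, that move the matrix unit at `o` to others. -/
noncomputable def CornerModel.isom (j : S.J) (b : Fin m) : A :=
  Q.ι (patch (S.U j) (S.cutoff j) (matUnit (W j) b (o j)))

variable {I : S.J → Finset (Fin m)}
  (hI : ∀ j, Q.P (S.base j) = (W j : Matrix (Fin m) (Fin m) ℂ)
    * Matrix.diagonal (fun i => if i ∈ I j then 1 else 0) * star (W j : Matrix (Fin m) (Fin m) ℂ))
  (ho : ∀ j, o j ∈ I j)

theorem CornerModel.star_isom (j : S.J) (b : Fin m) :
    star (Q.isom S W o j b) = Q.ι (patch (S.U j) (S.cutoff j) (matUnit (W j) (o j) b)) := by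
  rw [isom, ← Q.map_star, star_patch, star_matUnit]

include hI in
theorem CornerModel.star_isom_mul_isom (j : S.J) {b b' : Fin m} (hb' : b' ∈ I j) :
    star (Q.isom S W o j b) * Q.isom S W o j b' = if b = b' then
      Q.ι (patch (S.U j) (S.cutoff j * S.cutoff j) (matUnit (W j) (o j) (o j))) else 0 := by
  rw [star_isom, isom, Q.map_patch_mul S (fun x hx => hx) (fun x hx => hx) _
    (mul_matUnit (hI j) hb' _)]
  split_ifs with h
  · rw [h, matUnit_mul]
  · rw [matUnit_mul_of_ne _ _ _ h]
    have : patch (S.U j) (S.cutoff j * S.cutoff j) (0 : Matrix (Fin m) (Fin m) ℂ) = 0 := by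
      ext1 x; rw [patch_apply]; simp
    rw [this, map_zero]

include hI ho in
theorem CornerModel.isom_mul_isom (j : S.J) (b : Fin m) :
    Q.isom S W o j b * Q.isom S W o j (o j)
      = Q.ι (patch (S.U j) (S.cutoff j * S.cutoff j) (matUnit (W j) b (o j))) := by
  rw [isom, isom, Q.map_patch_mul S (fun x hx => hx) (fun x hx => hx) _
    (mul_matUnit (hI j) (ho j) _), matUnit_mul]

include hI in
theorem CornerModel.star_isom_mul_isom_of_color {j j' : S.J} (h : j ≠ j')
    (hcol : S.color j = S.color j') (b : Fin m) {b' : Fin m} (hb' : b' ∈ I j') :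
    star (Q.isom S W o j b) * Q.isom S W o j' b' = 0 := by
  rw [star_isom, isom, Q.map_patch_mul_of_color S h hcol _ (mul_matUnit (hI j') hb' _)]

include hI ho in
/-- A locally constant function acts on the partial isometries by a scalar matrix. -/
theorem CornerModel.localConst_mul_isom (c : S.J → Matrix (Fin m) (Fin m) ℂ)
    (hc : ∀ j, Q.P (S.base j) * c j = c j) (j : S.J) {b : Fin m} (hb : b ∈ I j) :
    Q.ι (S.localConst (S.color j) c) * Q.isom S W o j b
      = ∑ i ∈ I j, (star (W j : Matrix (Fin m) (Fin m) ℂ) * c j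
        * (W j : Matrix (Fin m) (Fin m) ℂ)) i b • (Q.isom S W o j i * Q.isom S W o j (o j)) := by
  have h1 : Q.ι (S.localConst (S.color j) c) * Q.isom S W o j b
      = Q.ι (patch (S.U j) (S.cutoff j) (c j)) * Q.isom S W o j b := by
    rw [PatchSystem.localConst, map_sum, Finset.sum_mul]
    refine Finset.sum_eq_single_of_mem j (by simp) fun j' hj' hne => ?_
    exact Q.map_patch_mul_of_color S hne (Finset.mem_filter.mp hj').2 _
      (mul_matUnit (hI j) hb _)
  rw [h1, isom, Q.map_patch_mul S (fun x hx => hx) (fun x hx => hx) _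
    (mul_matUnit (hI j) hb _), matUnit_expand (hI j) (hc j), patch_sum, map_sum]
  refine Finset.sum_congr rfl fun i _ => ?_
  rw [patch_smul, map_smul, Q.isom_mul_isom S W o hI ho]

end Construction

section Construction

variable {X : Type} [TopologicalSpace X] [CompactSpace X] {m : ℕ} {ι : Type*} {g : ι → MatFun X m}
  {κ : ℝ} {A : Type*} [CStarAlgebra A] (Q : CornerModel A X m) (S : PatchSystem Q.P g κ)
  (W : S.J → unitary (Matrix (Fin m) (Fin m) ℂ)) (o : S.J → Fin m) (I : S.J → Finset (Fin m))

/-- Copies of the elements `x j`, for `j` of one colour, along the partial isometries. -/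
noncomputable def CornerModel.copies (i : Bool) (x : S.J → A) : A :=
  ∑ j with S.color j = i, ∑ b : I j, Q.isom S W o j b * x j * star (Q.isom S W o j b)

variable (hI : ∀ j, Q.P (S.base j) = (W j : Matrix (Fin m) (Fin m) ℂ)
    * Matrix.diagonal (fun i => if i ∈ I j then 1 else 0) * star (W j : Matrix (Fin m) (Fin m) ℂ))
  (ho : ∀ j, o j ∈ I j) {x : S.J → A} (hx : ∀ j, Q.isom S W o j (o j) * x j = x j)

theorem CornerModel.unit_mul_copies (i : Bool) :
    Q.ι Q.P * Q.copies S W o I i x = Q.copies S W o I i x := by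
  rw [copies, Finset.mul_sum]
  refine Finset.sum_congr rfl fun j _ => ?_
  rw [Finset.mul_sum]
  refine Finset.sum_congr rfl fun b _ => ?_
  rw [← mul_assoc, ← mul_assoc, isom, Q.mul_map]

include hI ho hx in
theorem CornerModel.scaleFun_mul_copies (i : Bool) (h : MatFun X m) :
    Q.ι (scaleFun (S.cutoffSum i) h) * Q.copies S W o I i x = Q.ι h * Q.copies S W o I i x := by
  rw [copies, Finset.mul_sum, Finset.mul_sum]
  refine Finset.sum_congr rfl fun j hj => ?_
  obtain rfl := (Finset.mem_filter.mp hj).2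
  rw [Finset.mul_sum, Finset.mul_sum]
  refine Finset.sum_congr rfl fun b _ => ?_
  have hP : ∀ y : C(X, ℝ), (∀ x, y x ≠ 0 → S.cutoff j x ≠ 0) →
      Q.P * patch (S.U j) y (matUnit (W j) b (o j)) = patch (S.U j) y (matUnit (W j) b (o j)) :=
    fun y hy => S.mul_patch' hy (mul_matUnit (hI j) b.2 _)
  have h1 : Q.ι (scaleFun (S.cutoffSum (S.color j)) h) * Q.isom S W o j b
      = Q.ι h * (Q.isom S W o j b * Q.isom S W o j (o j)) := by
    rw [Q.isom_mul_isom S W o hI ho, isom, Q.map_mul_of_right _ (hP _ fun x hx => hx),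
      S.scaleFun_mul_patch, Q.map_mul_of_right _ (hP _ fun x hx => left_ne_zero_of_mul hx)]
  rw [← mul_assoc, ← mul_assoc, h1, mul_assoc (Q.ι h), mul_assoc (Q.isom S W o j b), hx j,
    mul_assoc (Q.ι h)]

include hI ho hx in
theorem CornerModel.norm_mul_copies_sub_le {f : A} {h : MatFun X m} {δ : ℝ}
    (hf : ‖f * Q.ι Q.P - Q.ι h‖ ≤ δ) (hκ : 0 ≤ κ) {c : S.J → Matrix (Fin m) (Fin m) ℂ}
    (hh : ∀ j x, S.cutoff j x ≠ 0 → ‖h x - S.U j x * c j * star (S.U j x)‖ ≤ κ) (i : Bool)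
    (hX : ‖Q.copies S W o I i x‖ ≤ 1) :
    ‖f * Q.copies S W o I i x - Q.ι (S.localConst i c) * Q.copies S W o I i x‖ ≤ δ + κ := by
  have e : f * Q.copies S W o I i x - Q.ι (S.localConst i c) * Q.copies S W o I i x
      = (f * Q.ι Q.P - Q.ι h) * Q.copies S W o I i x
        + Q.ι (scaleFun (S.cutoffSum i) h - S.localConst i c) * Q.copies S W o I i x := by
    rw [map_sub, sub_mul, sub_mul, mul_assoc, Q.unit_mul_copies S W o I,
      Q.scaleFun_mul_copies S W o I hI ho hx]
    abel
  rw [e]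
  have h1 := (Q.norm_map_le _).trans (S.norm_scaleFun_sub_localConst_le hκ i hh)
  have hδ : 0 ≤ δ := (norm_nonneg _).trans hf
  refine (norm_add_le _ _).trans (add_le_add ?_ ?_)
  · calc _ ≤ ‖f * Q.ι Q.P - Q.ι h‖ * ‖Q.copies S W o I i x‖ := norm_mul_le _ _
      _ ≤ δ * 1 := by gcongr
      _ = δ := mul_one _
  · calc _ ≤ ‖Q.ι (scaleFun (S.cutoffSum i) h - S.localConst i c)‖ * ‖Q.copies S W o I i x‖ :=
          norm_mul_le _ _
      _ ≤ κ * 1 := by gcongr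
      _ = κ := mul_one _

include hI ho hx in
theorem CornerModel.localConst_mul_copies (i : Bool) (c : S.J → Matrix (Fin m) (Fin m) ℂ)
    (hc : ∀ j, Q.P (S.base j) * c j = c j) :
    Q.ι (S.localConst i c) * Q.copies S W o I i x = ∑ j with S.color j = i, ∑ b : I j, ∑ k : I j,
      (star (W j : Matrix (Fin m) (Fin m) ℂ) * c j * (W j : Matrix (Fin m) (Fin m) ℂ)) k b
        • (Q.isom S W o j k * x j * star (Q.isom S W o j b)) := by
  rw [copies, Finset.mul_sum]
  refine Finset.sum_congr rfl fun j hj => ?_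
  obtain rfl := (Finset.mem_filter.mp hj).2
  rw [Finset.mul_sum]
  refine Finset.sum_congr rfl fun b _ => ?_
  rw [← mul_assoc, ← mul_assoc, Q.localConst_mul_isom S W o hI ho c hc j b.2, Finset.sum_mul,
    Finset.sum_mul, ← Finset.sum_coe_sort]
  refine Finset.sum_congr rfl fun k _ => ?_
  rw [smul_mul_assoc, smul_mul_assoc, mul_assoc (Q.isom S W o j k), hx j]

include hI ho hx in
theorem CornerModel.copies_mul_localConst (hxs : ∀ j, IsSelfAdjoint (x j)) (i : Bool)
    (c : S.J → Matrix (Fin m) (Fin m) ℂ)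
    (hc : ∀ j, c j * Q.P (S.base j) = c j) :
    Q.copies S W o I i x * Q.ι (S.localConst i c) = ∑ j with S.color j = i, ∑ b : I j, ∑ k : I j,
      (star (W j : Matrix (Fin m) (Fin m) ℂ) * c j * (W j : Matrix (Fin m) (Fin m) ℂ)) b k
        • (Q.isom S W o j b * x j * star (Q.isom S W o j k)) := by
  have hPs : ∀ x, star (Q.P x) = Q.P x := fun x => (Q.isStarProjection_apply x).isSelfAdjoint
  have h1 := congrArg star (Q.localConst_mul_copies S W o I hI ho hx i (fun j => star (c j))
    (fun j => by rw [← hPs, ← star_mul, hc]))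
  have hX : star (Q.copies S W o I i x) = Q.copies S W o I i x := by
    rw [copies, star_sum]
    refine Finset.sum_congr rfl fun j _ => ?_
    rw [star_sum]
    refine Finset.sum_congr rfl fun b _ => ?_
    rw [star_mul, star_mul, star_star, (hxs j).star_eq, mul_assoc]
  have hL : star (Q.ι (S.localConst i fun j => star (c j))) = Q.ι (S.localConst i c) := by
    rw [← Q.map_star, PatchSystem.localConst, star_sum, PatchSystem.localConst]
    congr 1
    refine Finset.sum_congr rfl fun j _ => ?_
    rw [star_patch, star_star]
  rw [star_mul, hX, hL] at h1
  rw [h1, star_sum]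
  refine Finset.sum_congr rfl fun j _ => ?_
  rw [star_sum]
  refine Finset.sum_congr rfl fun b _ => ?_
  rw [star_sum]
  refine Finset.sum_congr rfl fun k _ => ?_
  have h2 : star (W j : Matrix (Fin m) (Fin m) ℂ) * c j * (W j : Matrix (Fin m) (Fin m) ℂ)
      = star (star (W j : Matrix (Fin m) (Fin m) ℂ) * star (c j)
        * (W j : Matrix (Fin m) (Fin m) ℂ)) := by
    rw [star_mul, star_mul, star_star, star_star, mul_assoc]
  rw [star_smul, star_mul, star_mul, star_star, (hxs j).star_eq, h2, Matrix.star_apply,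
    mul_assoc (Q.isom S W o j b)]

include hI ho hx in
theorem CornerModel.commute_localConst_copies (hxs : ∀ j, IsSelfAdjoint (x j)) (i : Bool)
    (c : S.J → Matrix (Fin m) (Fin m) ℂ) (hc : ∀ j, Q.P (S.base j) * c j = c j)
    (hc' : ∀ j, c j * Q.P (S.base j) = c j) :
    Q.ι (S.localConst i c) * Q.copies S W o I i x
      = Q.copies S W o I i x * Q.ι (S.localConst i c) := by
  rw [Q.localConst_mul_copies S W o I hI ho hx i c hc,
    Q.copies_mul_localConst S W o I hI ho hx hxs i c hc']
  refine Finset.sum_congr rfl fun j _ => ?_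
  rw [Finset.sum_comm]

include hI ho hx in
theorem CornerModel.trace_localConst_mul_copies [PartialOrder A] [StarOrderedRing A]
    {τ : A →ₚ[ℂ] ℂ} (hτ : τ ∈ tracialStateSpace A) (i : Bool)
    (c : S.J → Matrix (Fin m) (Fin m) ℂ) (hc : ∀ j, Q.P (S.base j) * c j = c j) :
    τ (Q.ι (S.localConst i c) * Q.copies S W o I i x) = ∑ j with S.color j = i,
      (∑ b : I j, (star (W j : Matrix (Fin m) (Fin m) ℂ) * c j
        * (W j : Matrix (Fin m) (Fin m) ℂ)) b b) * τ (x j) := by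
  rw [Q.localConst_mul_copies S W o I hI ho hx i c hc, map_sum]
  refine Finset.sum_congr rfl fun j _ => ?_
  rw [map_sum, Finset.sum_mul]
  refine Finset.sum_congr rfl fun b _ => ?_
  rw [map_sum]
  have hee : Q.isom S W o j (o j) * Q.isom S W o j (o j) * x j = x j := by
    rw [mul_assoc, hx, hx]
  rw [Finset.sum_eq_single b]
  · rw [map_smul, smul_eq_mul, trace_mul_comm hτ, ← mul_assoc,
      Q.star_isom_mul_isom S W o hI j b.2, if_pos rfl, ← Q.isom_mul_isom S W o hI ho, hee]
  · intro k _ hk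
    rw [map_smul, trace_mul_comm hτ, ← mul_assoc, Q.star_isom_mul_isom S W o hI j k.2, if_neg,
      zero_mul, map_zero, smul_zero]
    exact fun h => hk (Subtype.ext h.symm)
  · simp

include hI in
theorem CornerModel.sum_isom_mul_star (j : S.J) {y : C(X, ℝ)}
    (hy : ∀ x, y x ≠ 0 → S.cutoff j x ≠ 0) :
    ∑ b : I j, Q.ι (patch (S.U j) y (matUnit (W j) b b)) = Q.ι (scaleFun y Q.P) := by
  rw [← map_sum, ← patch_sum, Finset.sum_coe_sort (I j) fun b => matUnit (W j) b b,
    sum_matUnit (hI j), S.patch_base j hy]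

end Construction

theorem IsSelfAdjoint.le_one_of_norm_le_one {A : Type*} [CStarAlgebra A] [PartialOrder A]
    [StarOrderedRing A] {a : A} (ha : IsSelfAdjoint a) (h : ‖a‖ ≤ 1) : a ≤ 1 := by
  refine ha.le_algebraMap_norm_self.trans ?_
  have h1 : algebraMap ℝ A ‖a‖ ≤ algebraMap ℝ A 1 := algebraMap_mono A h
  rwa [map_one] at h1

section Construction

variable {X : Type} [TopologicalSpace X] [CompactSpace X] {m : ℕ} {ι : Type*} {g : ι → MatFun X m}
  {κ : ℝ} {A : Type*} [CStarAlgebra A] (Q : CornerModel A X m) (S : PatchSystem Q.P g κ)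
  (W : S.J → unitary (Matrix (Fin m) (Fin m) ℂ)) (o : S.J → Fin m) {I : S.J → Finset (Fin m)}
  (hI : ∀ j, Q.P (S.base j) = (W j : Matrix (Fin m) (Fin m) ℂ)
    * Matrix.diagonal (fun i => if i ∈ I j then 1 else 0) * star (W j : Matrix (Fin m) (Fin m) ℂ))
  (ho : ∀ j, o j ∈ I j)

omit [CompactSpace X] in
theorem PatchSystem.cutoff_ne_zero_of_root {P : MatFun X m} (S : PatchSystem P g κ) {j : S.J}
    {x : X} (hx : S.root j x ≠ 0) : S.cutoff j x ≠ 0 := by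
  intro h
  have := congrArg (fun y : C(X, ℝ) => y x) (S.cutoff_mul_root j)
  exact hx (by simpa [h] using this.symm)

theorem PatchSystem.norm_patch_le {P : MatFun X m} (S : PatchSystem P g κ) {j : S.J}
    {y : C(X, ℝ)} (hy : ∀ x, y x ≠ 0 → S.cutoff j x ≠ 0) (hy1 : ∀ x, |y x| ≤ 1)
    {c : Matrix (Fin m) (Fin m) ℂ} (hc : ‖c‖ ≤ 1) : ‖patch (S.U j) y c‖ ≤ 1 := by
  rw [ContinuousMap.norm_le _ zero_le_one]
  intro x
  rw [patch_apply]
  by_cases hx : y x = 0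
  · simp [hx]
  have hU : S.U j x ∈ unitary (Matrix (Fin m) (Fin m) ℂ) :=
    ⟨S.star_mul j x (hy x hx), S.mul_star j x (hy x hx)⟩
  rw [norm_smul, CStarRing.norm_mul_mem_unitary _ (Unitary.star_mem hU),
    CStarRing.norm_mem_unitary_mul _ hU, Complex.norm_real, Real.norm_eq_abs]
  exact mul_le_one₀ (hy1 x) (norm_nonneg _) hc

theorem norm_matUnit_self_le (W : unitary (Matrix (Fin m) (Fin m) ℂ)) (i : Fin m) :
    ‖matUnit W i i‖ ≤ 1 :=
  (show IsStarProjection (matUnit W i i) from ⟨matUnit_mul W i i i, star_matUnit W i i⟩).norm_le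

/-- The element carrying the fraction of the unit which is attached to a patch. -/
noncomputable def CornerModel.bump (j : S.J) : A :=
  Q.ι (patch (S.U j) (S.root j * S.root j) (matUnit (W j) (o j) (o j)))

theorem CornerModel.bump_nonneg [PartialOrder A] [StarOrderedRing A] (j : S.J) :
    0 ≤ Q.bump S W o j := by
  refine Q.map_nonneg_of_sq (N := patch (S.U j) (S.root j) (matUnit (W j) (o j) (o j))) ?_ ?_
  · rw [IsSelfAdjoint, star_patch, star_matUnit]
  · rw [patch_mul_patch _ _ _ fun x hx => S.star_mul j x (S.cutoff_ne_zero_of_root hx),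
      matUnit_mul]

theorem CornerModel.bump_le_one [PartialOrder A] [StarOrderedRing A] (j : S.J) :
    Q.bump S W o j ≤ 1 := by
  refine IsSelfAdjoint.le_one_of_norm_le_one (IsSelfAdjoint.of_nonneg (Q.bump_nonneg S W o j))
    ((Q.norm_map_le _).trans (S.norm_patch_le ?_ ?_ (norm_matUnit_self_le _ _)))
  · exact fun x hx => S.cutoff_ne_zero_of_root (left_ne_zero_of_mul hx)
  · intro x
    rw [ContinuousMap.mul_apply, abs_mul, abs_of_nonneg (S.root_nonneg j x)]
    exact mul_le_one₀ (S.root_le_one j x) (S.root_nonneg j x) (S.root_le_one j x)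

include hI ho in
theorem CornerModel.isom_mul_bump (j : S.J) (b : Fin m) :
    Q.isom S W o j b * Q.bump S W o j
      = Q.ι (patch (S.U j) (S.root j * S.root j) (matUnit (W j) b (o j))) := by
  rw [isom, bump, Q.map_patch_mul S (fun x hx => hx)
    (fun x hx => S.cutoff_ne_zero_of_root (left_ne_zero_of_mul hx)) _
    (mul_matUnit (hI j) (ho j) _), matUnit_mul, ← mul_assoc, S.cutoff_mul_root]

include hI ho in
theorem CornerModel.sum_isom_bump (j : S.J) :
    ∑ b : I j, Q.isom S W o j b * (Q.bump S W o j * Q.bump S W o j) * star (Q.isom S W o j b)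
      = Q.ι (scaleFun (S.root j ^ 4) Q.P) := by
  have hroot : ∀ x, (S.root j * S.root j) x ≠ 0 → S.cutoff j x ≠ 0 :=
    fun x hx => S.cutoff_ne_zero_of_root (left_ne_zero_of_mul hx)
  have hsb : star (Q.bump S W o j) = Q.bump S W o j := by
    rw [bump, ← Q.map_star, star_patch, star_matUnit]
  rw [← Q.sum_isom_mul_star S W I hI]
  · refine Finset.sum_congr rfl fun b _ => ?_
    calc _ = Q.isom S W o j b * Q.bump S W o j * star (Q.isom S W o j b * Q.bump S W o j) := by
          rw [star_mul, hsb]; simp only [mul_assoc]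
      _ = _ := by
          rw [Q.isom_mul_bump S W o hI ho, ← Q.map_star, star_patch, star_matUnit,
            Q.map_patch_mul S hroot hroot _ (mul_matUnit (hI j) (ho j) _), matUnit_mul]
          congr 2
          ring
  · intro x hx
    exact S.cutoff_ne_zero_of_root fun h => hx (by simp [h])

include hI in
theorem CornerModel.sum_isom_star_le_one [PartialOrder A] [StarOrderedRing A]
    (ho : ∀ j, o j ∈ I j) (i : Bool) :
    ∑ j with S.color j = i, ∑ b : I j, Q.isom S W o j b * star (Q.isom S W o j b) ≤ 1 := by
  set y : C(X, ℝ) := ∑ j with S.color j = i, S.cutoff j * S.cutoff j with hy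
  have e : ∑ j with S.color j = i, ∑ b : I j, Q.isom S W o j b * star (Q.isom S W o j b)
      = Q.ι (scaleFun y Q.P) := by
    have h1 : scaleFun y Q.P
        = ∑ j with S.color j = i, scaleFun (S.cutoff j * S.cutoff j) Q.P := by
      ext1 x
      rw [ContinuousMap.sum_apply, scaleFun_apply, hy, ContinuousMap.sum_apply]
      push_cast
      rw [Finset.sum_smul]
      rfl
    rw [h1, map_sum]
    refine Finset.sum_congr rfl fun j _ => ?_
    rw [← Q.sum_isom_mul_star S W I hI j fun x hx => left_ne_zero_of_mul hx]
    refine Finset.sum_congr rfl fun b _ => ?_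
    rw [Q.star_isom, isom, Q.map_patch_mul S (fun x hx => hx) (fun x hx => hx) _
      (mul_matUnit (hI j) (ho j) _), matUnit_mul]
  have hy01 : ∀ x, |y x| ≤ 1 := by
    intro x
    rw [hy, ContinuousMap.sum_apply]
    by_cases h0 : ∃ j, S.color j = i ∧ S.cutoff j x ≠ 0
    · obtain ⟨j, rfl, hj⟩ := h0
      rw [Finset.sum_eq_single_of_mem j (by simp), ContinuousMap.mul_apply, abs_mul,
        abs_of_nonneg (S.cutoff_nonneg j x)]
      · exact mul_le_one₀ (S.cutoff_le_one j x) (S.cutoff_nonneg j x) (S.cutoff_le_one j x)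
      · intro j' hj' hne
        rw [ContinuousMap.mul_apply,
          S.cutoff_eq_zero_of_ne hne.symm (Finset.mem_filter.mp hj').2.symm hj, mul_zero]
    · push Not at h0
      rw [Finset.sum_eq_zero]
      · simp
      · intro j hj
        rw [ContinuousMap.mul_apply, h0 j (Finset.mem_filter.mp hj).2, mul_zero]
  rw [e]
  refine IsSelfAdjoint.le_one_of_norm_le_one (Q.map_isSelfAdjoint ?_)
    ((Q.norm_map_le _).trans ?_)
  · rw [IsSelfAdjoint]
    ext1 x
    rw [ContinuousMap.star_apply, scaleFun_apply, star_smul,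
      (Q.isStarProjection_apply x).isSelfAdjoint.star_eq]
    simp
  · rw [ContinuousMap.norm_le _ zero_le_one]
    intro x
    rw [scaleFun_apply, norm_smul, Complex.norm_real, Real.norm_eq_abs]
    exact mul_le_one₀ (hy01 x) (norm_nonneg _) (Q.isStarProjection_apply x).norm_le

end Construction

section Construction

variable {X : Type} [TopologicalSpace X] [CompactSpace X] {m : ℕ}
  {κ : ℝ} {A : Type*} [CStarAlgebra A] [PartialOrder A] [StarOrderedRing A]

theorem CornerModel.norm_copies_le {ι : Type*} {g : ι → MatFun X m} (Q : CornerModel A X m)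
    (S : PatchSystem Q.P g κ) (W : S.J → unitary (Matrix (Fin m) (Fin m) ℂ)) (o : S.J → Fin m)
    {I : S.J → Finset (Fin m)}
    (hI : ∀ j, Q.P (S.base j) = (W j : Matrix (Fin m) (Fin m) ℂ)
      * Matrix.diagonal (fun i => if i ∈ I j then 1 else 0)
      * star (W j : Matrix (Fin m) (Fin m) ℂ)) (ho : ∀ j, o j ∈ I j) (i : Bool) {x : S.J → A}
    (hx0 : ∀ j, 0 ≤ x j) (hx1 : ∀ j, x j ≤ 1) : ‖Q.copies S W o I i x‖ ≤ 1 := by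
  have h0 : 0 ≤ Q.copies S W o I i x :=
    Finset.sum_nonneg fun j _ => Finset.sum_nonneg fun b _ =>
      star_right_conjugate_nonneg (hx0 j) _
  rw [CStarAlgebra.norm_le_one_iff_of_nonneg _ h0]
  refine le_trans ?_ (Q.sum_isom_star_le_one S W o hI ho i)
  refine Finset.sum_le_sum fun j _ => Finset.sum_le_sum fun b _ => ?_
  have := star_right_conjugate_le_conjugate (hx1 j) (Q.isom S W o j b)
  rwa [mul_one] at this

/-- A corner model in which the elements of `F` are approximated by functions, together with
patches on which these functions are almost constant up to conjugation, gives a local system. -/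
theorem CornerModel.exists_localSystem (Q : CornerModel A X m) (F : Finset A) (G : A → MatFun X m)
    (hG : ∀ f ∈ F, Q.P * G f = G f ∧ G f * Q.P = G f) {δ ε : ℝ}
    (hδ : ∀ f ∈ F, ‖f * Q.ι Q.P - Q.ι (G f)‖ ≤ δ ∧ ‖Q.ι Q.P * f - Q.ι (G f)‖ ≤ δ)
    (hδ0 : 0 ≤ δ) (hκ : 0 ≤ κ)
    (S : PatchSystem Q.P (fun f : F => G f) κ) (hε : 2 * (δ + κ) ≤ ε) :
    ∃ L : LocalSystem (F : Set A) ε (Q.ι Q.P), ∀ j : L.J, ∃ x, Q.P x ≠ 0 ∧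
      (Fintype.card (L.β j) : ℝ) = (Q.P x).trace.re := by
  classical
  -- At each base point diagonalise `P`; its range is spanned by the vectors of the basis in `I j`.
  have hW : ∀ j, ∃ (W : unitary (Matrix (Fin m) (Fin m) ℂ)) (I : Finset (Fin m)),
      Q.P (S.base j) = (W : Matrix (Fin m) (Fin m) ℂ)
        * Matrix.diagonal (fun i => if i ∈ I then 1 else 0)
        * star (W : Matrix (Fin m) (Fin m) ℂ) :=
    fun j => (Q.isStarProjection_apply (S.base j)).exists_eq_conj_diagonal
  choose W I hI using hW
  have hne : ∀ j, (I j).Nonempty := by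
    intro j
    by_contra h
    rw [Finset.not_nonempty_iff_eq_empty] at h
    refine S.base_ne_zero j ?_
    rw [hI, h]
    simp
  -- The copies are taken of elements living under the rank one projection of a vector `o j`.
  choose o ho using hne
  have := S.fintype
  have hPs : ∀ x, star (Q.P x) = Q.P x := fun x => (Q.isStarProjection_apply x).isSelfAdjoint
  let c : A → S.J → Matrix (Fin m) (Fin m) ℂ := fun f j => G f (S.base j)
  have hc : ∀ f ∈ F, ∀ j, Q.P (S.base j) * c f j = c f j := fun f hf j =>
    congrArg (fun M : MatFun X m => M (S.base j)) (hG f hf).1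
  have hc' : ∀ f ∈ F, ∀ j, c f j * Q.P (S.base j) = c f j := fun f hf j =>
    congrArg (fun M : MatFun X m => M (S.base j)) (hG f hf).2
  have hnear : ∀ f ∈ F, ∀ j x, S.cutoff j x ≠ 0 →
      ‖G f x - S.U j x * c f j * star (S.U j x)‖ ≤ κ := fun f hf j x hx => S.near j x hx ⟨f, hf⟩
  have hleft : ∀ f ∈ F, ∀ i (x : S.J → A), (∀ j, Q.isom S W o j (o j) * x j = x j) →
      (∀ j, 0 ≤ x j) → (∀ j, x j ≤ 1) → ‖f * Q.copies S W o I i x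
        - Q.ι (S.localConst i (c f)) * Q.copies S W o I i x‖ ≤ δ + κ :=
    fun f hf i x hx hx0 hx1 => Q.norm_mul_copies_sub_le S W o I hI ho hx (hδ f hf).1 hκ
      (hnear f hf) i (Q.norm_copies_le S W o hI ho i hx0 hx1)
  -- Multiplication from the right is multiplication of the adjoints from the left.
  have hright : ∀ f ∈ F, ∀ i (x : S.J → A), (∀ j, Q.isom S W o j (o j) * x j = x j) →
      (∀ j, 0 ≤ x j) → (∀ j, x j ≤ 1) → ‖Q.copies S W o I i x * f
        - Q.copies S W o I i x * Q.ι (S.localConst i (c f))‖ ≤ δ + κ := by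
    intro f hf i x hx hx0 hx1
    have h1 := Q.norm_mul_copies_sub_le S W o I hI ho hx (f := star f) (h := star (G f)) (δ := δ)
      (c := fun j => star (c f j)) (by
        rw [← norm_star, star_sub, star_mul, star_star, ← Q.map_star, ← Q.map_star, star_star,
          Q.star_P]
        exact (hδ f hf).2) hκ (fun j x hx => by
        rw [← norm_star, star_sub, star_mul, star_mul, star_star, star_star,
          ContinuousMap.star_apply,
          star_star, ← mul_assoc]
        exact hnear f hf j x hx) i (Q.norm_copies_le S W o hI ho i hx0 hx1)
    have hX : star (Q.copies S W o I i x) = Q.copies S W o I i x :=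
      IsSelfAdjoint.of_nonneg (Finset.sum_nonneg fun j _ => Finset.sum_nonneg fun b _ =>
        star_right_conjugate_nonneg (hx0 j) _)
    have hL : star (Q.ι (S.localConst i fun j => star (c f j))) = Q.ι (S.localConst i (c f)) := by
      rw [← Q.map_star, PatchSystem.localConst, star_sum, PatchSystem.localConst]
      congr 1
      refine Finset.sum_congr rfl fun j _ => ?_
      rw [star_patch, star_star]
    rw [← norm_star, star_sub, star_mul, star_mul, star_star, hX, hL] at h1
    exact h1
  refine ⟨
    { J := S.J
      fintypeJ := S.fintype
      color := S.color
      β := fun j => I j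
      fintypeβ := fun j => inferInstance
      φ := Q.bump S W o
      e := fun j => Q.isom S W o j (o j)
      s := fun j b => Q.isom S W o j b
      φ_nonneg := Q.bump_nonneg S W o
      φ_le_one := Q.bump_le_one S W o
      e_mul_φ := fun j => Q.isom_mul_bump S W o hI ho j (o j)
      star_mul_self := fun j b => by
        rw [Q.star_isom_mul_isom S W o hI j b.2, if_pos rfl, Q.isom_mul_isom S W o hI ho]
      star_mul_of_ne := fun j b b' h => by
        rw [Q.star_isom_mul_isom S W o hI j b'.2, if_neg fun h' => h (Subtype.ext h')]
      star_mul_of_color := fun j j' h hcol b b' =>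
        Q.star_isom_mul_isom_of_color S W o hI h hcol _ b'.2
      sum_le_one := Q.sum_isom_star_le_one S W o hI ho
      sum_eq := ?_
      weight := fun f j => ∑ b : I j, (star (W j : Matrix (Fin m) (Fin m) ℂ) * c f j
        * (W j : Matrix (Fin m) (Fin m) ℂ)) b b
      norm_commutator_le := ?_
      norm_trace_sub_le := ?_ }, ?_⟩
  · simp only [Q.sum_isom_bump S W o hI ho]
    rw [← map_sum]
    congr 1
    ext1 x
    rw [ContinuousMap.sum_apply]
    simp only [scaleFun_apply]
    rw [← Finset.sum_smul]
    exact S.sum_root x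
  · intro f hf i x hx hx0 hx1
    have h1 := hleft f hf i x hx hx0 hx1
    have h2 := hright f hf i x hx hx0 hx1
    rw [← Q.commute_localConst_copies S W o I hI ho hx (fun j => IsSelfAdjoint.of_nonneg (hx0 j)) i
      _ (hc f hf) (hc' f hf), norm_sub_rev] at h2
    have := (norm_sub_le_norm_sub_add_norm_sub (f * Q.copies S W o I i x)
      (Q.ι (S.localConst i (c f)) * Q.copies S W o I i x) (Q.copies S W o I i x * f))
    exact (this.trans (add_le_add h1 h2)).trans (by linarith)
  · intro f hf τ hτ i x hx hx0 hx1
    have h1 := hleft f hf i x hx hx0 hx1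
    rw [← Q.trace_localConst_mul_copies S W o I hI ho hx hτ i _ (hc f hf)]
    refine ((norm_trace_sub_le hτ _ _).trans h1).trans ?_
    linarith
  · intro j
    refine ⟨S.base j, S.base_ne_zero j, ?_⟩
    rw [hI, trace_conj_diagonal]
    simp

end Construction

/-! ### Corners with small complement -/

/-- The projection `p` is equivalent to a projection in the hereditary subalgebra generated
by `a`. -/
def IsSubequivalent {A : Type*} [CStarAlgebra A] (p a : A) : Prop :=
  ∃ q : A, IsStarProjection q ∧ q ∈ closure (Set.range fun x : A => a * x * a) ∧
    ∃ s : A, star s * s = p ∧ s * star s = q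

section

variable {A : Type*} [CStarAlgebra A] [PartialOrder A] [StarOrderedRing A]

theorem TracialRankLE.exists_cornerModel (hTR : TracialRankLE 1 A) (G : Finset A) {δ : ℝ}
    (hδ : 0 < δ) {a : A} (ha : 0 ≤ a) (ha0 : a ≠ 0) :
    ∃ (X : Type) (_ : TopologicalSpace X) (_ : CompactSpace X) (m : ℕ),
      T2Space X ∧ Nonempty (GraphModel X) ∧ ∃ Q : CornerModel A X m, Q.Approximates G δ ∧
        Q.ι Q.P ≠ 0 ∧ IsSubequivalent (1 - Q.ι Q.P) a := by
  obtain ⟨p, B, hp, hp0, hcl, hB, hpB, hpb, hcomm, hnear, hq⟩ := hTR δ hδ a ha ha0 G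
  obtain ⟨X, hX1, hX2, m, hT2, hΓ, Q, hQp, hQB⟩ := hB.exists_cornerModel hcl hpB hpb
  refine ⟨X, hX1, hX2, m, hT2, hΓ, Q, ⟨fun x hx => by rw [hQp]; exact hcomm x hx, ?_⟩, ?_, ?_⟩
  · intro x hx
    obtain ⟨b, hb, hbx⟩ := hnear x hx
    obtain ⟨M, hM, rfl⟩ := hQB b hb
    exact ⟨M, hM, by rwa [hQp]⟩
  · rwa [hQp]
  · rwa [hQp]

theorem CornerModel.Approximates.exists_localSystem {X : Type} [TopologicalSpace X]
    [CompactSpace X] [T2Space X] (Γ : GraphModel X) {m : ℕ} {Q : CornerModel A X m} {F : Finset A}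
    {ε : ℝ} (hε : 0 < ε) (h : Q.Approximates (F : Set A) (ε / 8)) :
    ∃ L : LocalSystem (F : Set A) ε (Q.ι Q.P), ∀ j : L.J, ∃ x, Q.P x ≠ 0 ∧
      (Fintype.card (L.β j) : ℝ) = (Q.P x).trace.re := by
  classical
  have hex : ∀ f, ∃ M, f ∈ F → Q.P * M * Q.P = M ∧ ‖Q.ι Q.P * f * Q.ι Q.P - Q.ι M‖ < ε / 8 := by
    intro f
    by_cases hf : f ∈ F
    · obtain ⟨M, hM⟩ := h.exists_near f hf
      exact ⟨M, fun _ => hM⟩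
    · exact ⟨0, fun h => absurd h hf⟩
  choose G hG using hex
  obtain ⟨S⟩ := Γ.exists_patchSystem Q.isStarProjection (fun f : F => G f) (κ := ε / 4)
    (by positivity)
  have hpp := Q.isStarProjection_unit.isIdempotentElem.eq
  have hn : ∀ y : A, ‖y * Q.ι Q.P‖ ≤ ‖y‖ := fun y => (norm_mul_le _ _).trans
    (mul_le_of_le_one_right (norm_nonneg _) Q.norm_unit_le)
  have hn' : ∀ y : A, ‖Q.ι Q.P * y‖ ≤ ‖y‖ := fun y => (norm_mul_le _ _).trans
    (mul_le_of_le_one_left (norm_nonneg _) Q.norm_unit_le)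
  refine Q.exists_localSystem F G (fun f hf => ⟨?_, ?_⟩) (δ := ε / 4) (fun f hf => ⟨?_, ?_⟩)
    (by positivity) (by positivity) S (by linarith)
  · rw [← (hG f hf).1, ← mul_assoc, ← mul_assoc, Q.P_mul_P]
  · rw [← (hG f hf).1, mul_assoc, Q.P_mul_P]
  · have e : f * Q.ι Q.P - Q.ι (G f) = (f * Q.ι Q.P - Q.ι Q.P * f) * Q.ι Q.P
        + (Q.ι Q.P * f * Q.ι Q.P - Q.ι (G f)) := by
      rw [sub_mul, mul_assoc f, hpp]; abel
    rw [e]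
    have h1 := (hn _).trans (h.norm_commutator_lt f hf).le
    have h2 := (hG f hf).2
    exact (norm_add_le _ _).trans (by linarith)
  · have e : Q.ι Q.P * f - Q.ι (G f) = -(Q.ι Q.P * (f * Q.ι Q.P - Q.ι Q.P * f))
        + (Q.ι Q.P * f * Q.ι Q.P - Q.ι (G f)) := by
      rw [mul_sub, ← mul_assoc _ _ f, hpp, ← mul_assoc]; abel
    rw [e]
    have h1 := (hn' _).trans (h.norm_commutator_lt f hf).le
    have h2 := (hG f hf).2
    refine (norm_add_le _ _).trans ?_
    rw [norm_neg]
    linarith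

variable (hA : IsSimpleCStarAlgebra A) (hinf : ¬ FiniteDimensional ℂ A)
  (hTR : TracialRankLE 1 A)

include hA hinf hTR

/-- There are arbitrarily small hereditary subalgebras, as measured by the traces: many orthogonal
copies of the element carried by a patch fit into the unit. -/
theorem exists_forall_isSubequivalent_trace_le {ε : ℝ} (hε : 0 < ε) :
    ∃ a : A, 0 ≤ a ∧ a ≠ 0 ∧ ∀ p, IsSubequivalent p a → ∀ τ ∈ tracialStateSpace A,
      (τ p).re ≤ ε := by
  classical
  obtain ⟨K, hK⟩ := exists_nat_gt (1 / ε)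
  obtain ⟨G, δ, hδ, hG⟩ := exists_finset_rank_ge hA hinf K
  have := hA.1
  obtain ⟨X, _, _, m, hT2, ⟨Γ⟩, Q, hQ, hQ0, -⟩ :=
    hTR.exists_cornerModel G hδ (a := 1) zero_le_one one_ne_zero
  obtain ⟨L, hL⟩ := CornerModel.Approximates.exists_localSystem (F := ∅) Γ zero_lt_one
    (Q := Q) ⟨by simp, by simp⟩
  have hj : ∃ j, L.φ j ≠ 0 := by
    by_contra! h
    exact hQ0 (by rw [← L.sum_eq]; simp [h])
  obtain ⟨j, hj⟩ := hj
  refine ⟨L.φ j, L.φ_nonneg j, hj, ?_⟩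
  rintro p ⟨q, hq, hqcl, s, rfl, hs⟩ τ hτ
  rw [trace_mul_comm hτ, hs]
  have heq : L.e j * q = q := by
    have hc : IsClosed {q : A | L.e j * q = q} :=
      isClosed_eq (continuous_const.mul continuous_id) continuous_id
    refine hc.closure_subset_iff.mpr ?_ hqcl
    rintro _ ⟨x, rfl⟩
    change L.e j * (L.φ j * x * L.φ j) = _
    rw [← mul_assoc, ← mul_assoc, L.e_mul_φ]
  have hq1 : q ≤ 1 := hq.le_one
  have hle : ∑ b, L.s j b * q * star (L.s j b) ≤ 1 := by
    refine le_trans (Finset.sum_le_sum (g := fun b => L.s j b * star (L.s j b)) fun b _ => ?_)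
      (le_trans ?_ (L.sum_le_one (L.color j)))
    · have := star_right_conjugate_le_conjugate hq1 (L.s j b)
      rwa [mul_one] at this
    · exact Finset.single_le_sum (f := fun j' => ∑ b, L.s j' b * star (L.s j' b))
        (fun j' _ => Finset.sum_nonneg fun b _ => mul_star_self_nonneg _)
        (Finset.mem_filter.mpr ⟨Finset.mem_univ j, rfl⟩)
  have h1 := trace_re_le_one hτ hle
  have h2 : ∀ b, τ (L.s j b * q * star (L.s j b)) = τ q := fun b => by
    rw [trace_mul_comm hτ, ← mul_assoc, L.star_mul_self, mul_assoc, heq, heq]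
  rw [map_sum] at h1
  simp only [h2] at h1
  have h2' : ∀ (n : ℕ) (z : ℂ), ((n : ℂ) * z).re = n * z.re := fun n z => by simp
  rw [Finset.sum_const, Finset.card_univ, nsmul_eq_mul, h2'] at h1
  obtain ⟨x, hx, hcard⟩ := hL j
  have h3 := (hG X m Q hQ x).resolve_left hx
  rw [hcard] at h1
  have h4 : (K : ℝ) * (τ q).re ≤ 1 :=
    (mul_le_mul_of_nonneg_right h3 (trace_re_nonneg τ hq.nonneg)).trans h1
  have h5 : 0 < (K : ℝ) := lt_trans (by positivity) hK
  have h6 : 1 < K * ε := by rwa [div_lt_iff₀ hε] at hK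
  by_contra! h7
  have := mul_lt_mul_of_pos_left h7 h5
  linarith

/-- Corners of large rank that approximate a finite set, with complement of small trace. -/
theorem exists_cornerModel_trace_le (G : Finset A) {δ : ℝ} (hδ : 0 < δ) (K : ℕ) :
    ∃ (X : Type) (_ : TopologicalSpace X) (_ : CompactSpace X) (m : ℕ),
      T2Space X ∧ Nonempty (GraphModel X) ∧ ∃ Q : CornerModel A X m, Q.Approximates G δ ∧
        (∀ x, Q.P x = 0 ∨ (K : ℝ) ≤ (Q.P x).trace.re) ∧
        ∀ τ ∈ tracialStateSpace A, (τ (1 - Q.ι Q.P)).re ≤ δ := by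
  classical
  obtain ⟨a, ha, ha0, hsmall⟩ := exists_forall_isSubequivalent_trace_le hA hinf hTR hδ
  obtain ⟨G', δ', hδ', hG'⟩ := exists_finset_rank_ge hA hinf K
  obtain ⟨X, _, _, m, hT2, hΓ, Q, hQ, hQ0, hsub⟩ :=
    hTR.exists_cornerModel (G ∪ G') (lt_min hδ hδ') ha ha0
  exact ⟨X, _, _, m, hT2, hΓ, Q, hQ.mono (by simp) (min_le_left _ _),
    hG' X m Q (hQ.mono (by simp) (min_le_right _ _)), hsmall _ hsub⟩

theorem exists_localSystem_trace_le (F : Finset A) {ε : ℝ} (hε : 0 < ε) :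
    ∃ p : A, IsStarProjection p ∧ (∀ τ ∈ tracialStateSpace A, (τ (1 - p)).re ≤ ε) ∧
      Nonempty (LocalSystem (F : Set A) ε p) := by
  obtain ⟨X, _, _, m, hT2, ⟨Γ⟩, Q, hQ, -, htr⟩ :=
    exists_cornerModel_trace_le hA hinf hTR F (δ := ε / 8) (by positivity) 0
  obtain ⟨L, -⟩ := hQ.exists_localSystem Γ hε
  exact ⟨Q.ι Q.P, Q.isStarProjection_unit, fun τ hτ => (htr τ hτ).trans (by linarith), ⟨L⟩⟩

end

/-! ### Diagonal functions -/

/-- The continuous functional calculus for selfadjoint elements. This copy of `cfc` takes all its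
structure from the C*-algebra, and can thus be applied to algebras whose ring structure and
topology are declared separately. -/
noncomputable def saCalculus {M : Type*} [CStarAlgebra M] (f : C(ℝ, ℝ)) (a : M) : M := cfc f a

open scoped CStarAlgebra in
theorem map_saCalculus {M N : Type*} [CStarAlgebra M] [CStarAlgebra N] (φ : M →⋆ₐ[ℂ] N)
    (f : C(ℝ, ℝ)) {a : M} (ha : IsSelfAdjoint a) :
    φ (saCalculus f a) = saCalculus f (φ a) :=
  StarAlgHomClass.map_cfc (S := ℂ) φ f a f.continuous.continuousOn (map_continuous φ) ha
    (ha.map φ)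

theorem saCalculus_algebraMap {M : Type*} [CStarAlgebra M] (f : C(ℝ, ℝ)) (r : ℝ) :
    saCalculus f (algebraMap ℝ M r) = algebraMap ℝ M (f r) :=
  cfc_algebraMap r f

/-- The diagonal matrices in the basis given by a unitary. -/
noncomputable def conjDiagonal {m : ℕ} (W : unitary (Matrix (Fin m) (Fin m) ℂ)) :
    (Fin m → ℂ) →⋆ₐ[ℂ] Matrix (Fin m) (Fin m) ℂ where
  toFun d := W * Matrix.diagonal d * star (W : Matrix (Fin m) (Fin m) ℂ)
  map_one' := by
    rw [show (1 : Fin m → ℂ) = fun _ => 1 from rfl, Matrix.diagonal_one, mul_one]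
    exact Unitary.mul_star_self_of_mem W.2
  map_mul' d d' := by
    rw [conj_mul_conj, Matrix.diagonal_mul_diagonal]
    rfl
  map_zero' := by simp
  map_add' d d' := by
    rw [← add_mul, ← mul_add, Matrix.diagonal_add]
    rfl
  commutes' c := by
    rw [Algebra.algebraMap_eq_smul_one, Algebra.algebraMap_eq_smul_one,
      show c • (1 : Fin m → ℂ) = fun _ => c from by ext; simp, ← Matrix.smul_one_eq_diagonal,
      mul_smul_comm, smul_mul_assoc, mul_one, Unitary.mul_star_self_of_mem W.2]
  map_star' d := by
    rw [star_mul, star_mul, star_star, Matrix.star_eq_conjTranspose (Matrix.diagonal d),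
      Matrix.diagonal_conjTranspose, mul_assoc]

theorem DiagData.toMatrix_eq {m : ℕ} (k : DiagData m) :
    k.toMatrix = conjDiagonal k.1 (fun i => (k.2 i : ℂ)) := rfl

theorem DiagData.saCalculus_toMatrix {m : ℕ} (k : DiagData m) (f : C(ℝ, ℝ)) :
    saCalculus f k.toMatrix = toMatrix (k.1, fun i => f (k.2 i)) := by
  have h1 : IsSelfAdjoint (fun i => (k.2 i : ℂ)) := by
    ext i
    simp
  rw [toMatrix_eq, toMatrix_eq, ← map_saCalculus (conjDiagonal k.1) f h1]
  congr 1
  ext i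
  exact (map_saCalculus (Pi.evalStarAlgHom ℂ (fun _ : Fin m => ℂ) i) f h1).trans
    (saCalculus_algebraMap (M := ℂ) f (k.2 i))

section

variable {X : Type} [TopologicalSpace X] {m : ℕ}
  (V : C(X, unitary (Matrix (Fin m) (Fin m) ℂ)))

/-- The function which is diagonal, with real entries `d`, in a moving basis. -/
noncomputable def diagFun (d : Fin m → C(X, ℝ)) : MatFun X m :=
  ⟨fun x => DiagData.toMatrix (V x, fun i => d i x),
    DiagData.continuous_toMatrix.comp (by fun_prop)⟩

theorem diagFun_apply (d : Fin m → C(X, ℝ)) (x : X) :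
    diagFun V d x = DiagData.toMatrix (V x, fun i => d i x) := rfl

theorem diagFun_mul (d d' : Fin m → C(X, ℝ)) :
    diagFun V d * diagFun V d' = diagFun V (d * d') := by
  ext1 x
  rw [ContinuousMap.mul_apply, diagFun_apply, diagFun_apply, diagFun_apply, DiagData.toMatrix_eq,
    DiagData.toMatrix_eq, DiagData.toMatrix_eq, ← map_mul]
  congr 1
  ext i
  simp

theorem diagFun_add (d d' : Fin m → C(X, ℝ)) :
    diagFun V (d + d') = diagFun V d + diagFun V d' := by
  ext1 x
  rw [ContinuousMap.add_apply, diagFun_apply, diagFun_apply, diagFun_apply, DiagData.toMatrix_eq,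
    DiagData.toMatrix_eq, DiagData.toMatrix_eq, ← map_add]
  congr 1
  ext i
  simp

theorem diagFun_zero : diagFun V (0 : Fin m → C(X, ℝ)) = 0 := by
  have := diagFun_add V (0 : Fin m → C(X, ℝ)) 0
  rwa [add_zero, left_eq_add] at this

theorem diagFun_sum {ι : Type*} (s : Finset ι) (d : ι → Fin m → C(X, ℝ)) :
    diagFun V (∑ k ∈ s, d k) = ∑ k ∈ s, diagFun V (d k) := by
  classical
  induction s using Finset.induction_on with
  | empty => simp [diagFun_zero]
  | insert a s ha ih => rw [Finset.sum_insert ha, Finset.sum_insert ha, diagFun_add, ih]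

theorem isSelfAdjoint_diagFun (d : Fin m → C(X, ℝ)) : IsSelfAdjoint (diagFun V d) := by
  ext1 x
  exact DiagData.isHermitian_toMatrix _

theorem norm_diagFun_le [CompactSpace X] {d : Fin m → C(X, ℝ)} {c : ℝ} (hc : 0 ≤ c)
    (hd : ∀ i x, |d i x| ≤ c) : ‖diagFun V d‖ ≤ c := by
  rw [ContinuousMap.norm_le _ hc]
  intro x
  rw [diagFun_apply, DiagData.norm_toMatrix]
  exact (pi_norm_le_iff_of_nonneg hc).mpr fun i => hd i x

theorem saCalculus_diagFun [CompactSpace X] (d : Fin m → C(X, ℝ)) (f : C(ℝ, ℝ)) :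
    saCalculus f (diagFun V d) = diagFun V (fun i => f.comp (d i)) := by
  ext1 x
  let ev : MatFun X m →⋆ₐ[ℂ] Matrix (Fin m) (Fin m) ℂ :=
    { toFun := fun M => M x
      map_one' := rfl
      map_mul' := fun _ _ => rfl
      map_zero' := rfl
      map_add' := fun _ _ => rfl
      commutes' := fun _ => rfl
      map_star' := fun _ => rfl }
  exact (map_saCalculus ev f (isSelfAdjoint_diagFun V d)).trans (DiagData.saCalculus_toMatrix _ f)

theorem trace_diagFun (d : Fin m → C(X, ℝ)) (x : X) :
    (diagFun V d x).trace = ((∑ i, d i x : ℝ) : ℂ) := by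
  rw [diagFun_apply, DiagData.toMatrix, trace_conj_diagonal]
  simp

/-- The moving basis as a matrix-valued function. -/
noncomputable def basisFun : MatFun X m :=
  ⟨fun x => (V x : Matrix (Fin m) (Fin m) ℂ), by fun_prop⟩

theorem star_basisFun_mul_self (x : X) : star (basisFun V x) * basisFun V x = 1 :=
  Unitary.coe_star_mul_self (V x)

/-- The multiples of the matrix units of a moving basis. -/
noncomputable def unitFun (a b : Fin m) (c : C(X, ℝ)) : MatFun X m :=
  patch (basisFun V) c (Matrix.single a b 1)

theorem unitFun_mul (a b e : Fin m) (c c' : C(X, ℝ)) :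
    unitFun V a b c * unitFun V b e c' = unitFun V a e (c * c') := by
  rw [unitFun, unitFun, patch_mul_patch _ _ _ fun x _ => star_basisFun_mul_self V x,
    Matrix.single_mul_single_same, mul_one, unitFun]

theorem star_unitFun (a b : Fin m) (c : C(X, ℝ)) :
    star (unitFun V a b c) = unitFun V b a c := by
  rw [unitFun, star_patch, Matrix.star_eq_conjTranspose, Matrix.conjTranspose_single, star_one,
    unitFun]

theorem diagFun_eq_sum (d : Fin m → C(X, ℝ)) :
    diagFun V d = ∑ i, unitFun V i i (d i) := by
  ext1 x
  rw [ContinuousMap.sum_apply, diagFun_apply, DiagData.toMatrix]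
  have h1 : Matrix.diagonal (fun i => (d i x : ℂ)) = ∑ i, Matrix.single i i (d i x : ℂ) := by
    rw [← Matrix.sum_single_eq_diagonal]
  rw [h1, Finset.mul_sum, Finset.sum_mul]
  refine Finset.sum_congr rfl fun i _ => ?_
  rw [unitFun, patch_apply, ← smul_mul_assoc, ← mul_smul_comm, Matrix.smul_single, smul_eq_mul,
    mul_one]
  rfl

theorem unitFun_eq_diagFun (i : Fin m) (c : C(X, ℝ)) :
    unitFun V i i c = diagFun V (Pi.single i c) := by
  classical
  rw [diagFun_eq_sum, Finset.sum_eq_single i]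
  · simp
  · intro j _ hj
    rw [Pi.single_eq_of_ne hj, unitFun]
    ext1 x
    rw [patch_apply]
    simp
  · simp

theorem unitFun_mul_diagFun (a b : Fin m) (c : C(X, ℝ)) (d : Fin m → C(X, ℝ)) :
    unitFun V a b c * diagFun V d = unitFun V a b (c * d b) := by
  classical
  have h1 : (Pi.single b c * d : Fin m → C(X, ℝ)) = Pi.single b (c * d b) := by
    funext i
    by_cases hi : i = b
    · subst hi
      simp
    · simp [hi]
  rw [← one_mul c, ← unitFun_mul V a b b, mul_assoc, unitFun_eq_diagFun V b, diagFun_mul, one_mul,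
    h1, ← unitFun_eq_diagFun, unitFun_mul, one_mul]

end

section

variable {M : Type*} [CStarAlgebra M]

theorem isSelfAdjoint_saCalculus (f : C(ℝ, ℝ)) (a : M) : IsSelfAdjoint (saCalculus f a) :=
  cfc_predicate f a

theorem exists_saCalculus_sub_le (f : C(ℝ, ℝ)) (R : ℝ) {ε : ℝ} (hε : 0 < ε) :
    ∃ δ > 0, ∀ x y : M, IsSelfAdjoint x → IsSelfAdjoint y → ‖x‖ ≤ R → ‖y‖ ≤ R →
      ‖x - y‖ ≤ δ → ‖saCalculus f x - saCalculus f y‖ ≤ ε :=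
  exists_cfc_sub_le f.continuous R hε

theorem saCalculus_intertwine (f : C(ℝ, ℝ)) {x y z : M} (hx : IsSelfAdjoint x)
    (hy : IsSelfAdjoint y) (h : x * z = z * y) : saCalculus f x * z = z * saCalculus f y := by
  set r : ℝ := (‖z‖ + 1)⁻¹ with hr
  have hr0 : 0 < r := by positivity
  have key : ‖saCalculus f x * (r • z) - (r • z) * saCalculus f y‖ = 0 := by
    refine le_antisymm (le_of_forall_pos_le_add fun ε hε => ?_) (norm_nonneg _)
    rw [zero_add]
    obtain ⟨δ, hδ, H⟩ := exists_cfc_intertwine_le (A := M) f.continuous (max ‖x‖ ‖y‖) hε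
    refine H x y (r • z) hx hy (le_max_left _ _) (le_max_right _ _) ?_ ?_
    · rw [norm_smul, Real.norm_of_nonneg hr0.le, hr, inv_mul_le_iff₀ (by positivity)]
      linarith
    · rw [mul_smul_comm, smul_mul_assoc, h, sub_self, norm_zero]
      exact hδ.le
  rw [norm_eq_zero, mul_smul_comm, smul_mul_assoc, ← smul_sub, smul_eq_zero] at key
  exact sub_eq_zero.mp (key.resolve_left hr0.ne')

theorem saCalculus_add_const (f g : C(ℝ, ℝ)) {N : M} (hN : IsSelfAdjoint N) {R c : ℝ}
    (hNR : ‖N‖ ≤ R) (hfg : ∀ t, |t| ≤ R → f (t + c) = g t) :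
    saCalculus f (N + algebraMap ℝ M c) = saCalculus g N := by
  have h1 : cfc (fun t : ℝ => t + c) N = N + algebraMap ℝ M c := by
    rw [cfc_add_const c (fun t => t) N (by fun_prop) hN, cfc_id' ℝ N hN]
  rw [saCalculus, saCalculus, ← h1,
    ← cfc_comp f (fun t => t + c) N hN f.continuous.continuousOn (by fun_prop)]
  refine cfc_congr fun t ht => hfg t ?_
  have := spectrum.norm_le_norm_mul_of_mem ht
  rcases subsingleton_or_nontrivial M with hs | hs
  · simp [spectrum.of_subsingleton] at ht
  · rw [norm_one, mul_one] at this
    exact this.trans hNR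

/-- Adding a large multiple of a projection `P` to a selfadjoint element `N` of its corner separates
the spectrum in the corner from zero, so that the functional calculus of `N` inside the corner is
a functional calculus of `N + 5 P`. -/
theorem saCalculus_add_smul_projection {P N : M} (hP : IsStarProjection P) (hN : IsSelfAdjoint N)
    (hPN : P * N = N) (hn : ‖N‖ ≤ 2) {f g : C(ℝ, ℝ)} (hf : f 0 = 0)
    (hfg : ∀ t, |t| ≤ 2 → f (t + 5) = g t) :
    saCalculus f (N + (5 : ℝ) • P) = P * saCalculus g N := by
  have hPP : P * P = P := hP.isIdempotentElem
  have hNP : N * P = N := by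
    have := congrArg star hPN
    rwa [star_mul, hN.star_eq, hP.isSelfAdjoint.star_eq] at this
  have hG : IsSelfAdjoint (N + (5 : ℝ) • P) :=
    hN.add ((IsSelfAdjoint.all (5 : ℝ)).smul hP.isSelfAdjoint)
  have h1 : saCalculus f (N + (5 : ℝ) • P) * P = P * saCalculus g N := by
    rw [← saCalculus_add_const f g hN hn hfg]
    refine saCalculus_intertwine f hG
      (hN.add (IsSelfAdjoint.algebraMap _ (by simp [IsSelfAdjoint]))) ?_
    rw [add_mul, mul_add, hNP, hPN, smul_mul_assoc, hPP, Algebra.algebraMap_eq_smul_one,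
      mul_smul_comm, mul_one]
  have h2 : saCalculus f (N + (5 : ℝ) • P) * (1 - P) = 0 := by
    rw [saCalculus_intertwine f (y := algebraMap ℝ M 0) hG (by simp), saCalculus_algebraMap, hf]
    · simp
    · rw [mul_sub, mul_one, add_mul, hNP, smul_mul_assoc, hPP, sub_self]
      simp
  rw [← h1, ← sub_eq_zero, ← h2]
  noncomm_ring

end

/-- Over a graph, a selfadjoint function `N` with values in the corner of a projection `P` is almost
diagonal in a moving basis, with eigenvalues in increasing order. To keep track of `P`, the
eigenvalues `l` used here are those of `N + 5 P`. -/
theorem GraphModel.exists_diagFun_approx {X : Type} [TopologicalSpace X] [T2Space X]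
    [CompactSpace X] (Γ : GraphModel X) {m : ℕ} {P N : MatFun X m} (hP : IsStarProjection P)
    (hN : IsSelfAdjoint N) (hPN : P * N = N) (hn : ‖N‖ ≤ 2) {ι : Type*} [Finite ι]
    (f g : ι → C(ℝ, ℝ)) (hf : ∀ j, f j 0 = 0) (hfg : ∀ j t, |t| ≤ 2 → f j (t + 5) = g j t) {κ : ℝ}
    (hκ : 0 < κ) :
    ∃ (V : C(X, unitary (Matrix (Fin m) (Fin m) ℂ))) (l : Fin m → C(X, ℝ)),
      (∀ x, Monotone fun i => l i x) ∧
      ∀ j, ‖diagFun V (fun i => (f j).comp (l i)) - P * saCalculus (g j) N‖ ≤ κ := by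
  have h := fun j => exists_saCalculus_sub_le (M := MatFun X m) (f j) 8 hκ
  choose δ hδ H using h
  obtain ⟨δ₀, hδ₀, hle⟩ : ∃ δ₀ > 0, ∀ j, δ₀ ≤ δ j := by
    rcases isEmpty_or_nonempty ι with hι | hι
    · exact ⟨1, one_pos, fun j => isEmptyElim j⟩
    · obtain ⟨j, hj⟩ := Finite.exists_min δ
      exact ⟨δ j, hδ j, hj⟩
  have hG : IsSelfAdjoint (N + (5 : ℝ) • P) :=
    hN.add ((IsSelfAdjoint.all (5 : ℝ)).smul hP.isSelfAdjoint)
  obtain ⟨k, hk⟩ := Γ.exists_approx_diagonalisation (N + (5 : ℝ) • P)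
    (fun x => congrArg (fun M : MatFun X m => M x) hG) (ε := min δ₀ 1) (lt_min hδ₀ one_pos)
  let V : C(X, unitary (Matrix (Fin m) (Fin m) ℂ)) := ⟨fun x => (k x).1, by fun_prop⟩
  let l : Fin m → C(X, ℝ) := fun i => ⟨fun x => (k x).2 i, by fun_prop⟩
  have hd : ‖diagFun V l - (N + (5 : ℝ) • P)‖ ≤ min δ₀ 1 := by
    rw [ContinuousMap.norm_le _ (le_min hδ₀.le zero_le_one)]
    exact fun x => (hk x).2.le
  have hG8 : ‖N + (5 : ℝ) • P‖ ≤ 7 := by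
    refine (norm_add_le _ _).trans ?_
    rw [norm_smul]
    have := hP.norm_le
    norm_num
    linarith
  refine ⟨V, l, fun x => (hk x).1, fun j => ?_⟩
  rw [← saCalculus_diagFun, ← saCalculus_add_smul_projection hP hN hPN hn (hf j) (hfg j)]
  refine H j _ _ (isSelfAdjoint_diagFun V l) hG ?_ (hG8.trans (by norm_num))
    (hd.trans ((min_le_left _ _).trans (hle j)))
  have := norm_le_norm_add_norm_sub' (diagFun V l) (N + (5 : ℝ) • P)
  have h1 := hd.trans (min_le_right _ _)
  linarith

/-! ### Division of the unit -/

theorem Nat.succ_mod_eq_zero_iff_mod_eq {n L : ℕ} : (n + 1) % (L + 1) = 0 ↔ n % (L + 1) = L := by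
  have h : n % (L + 1) < L + 1 := Nat.mod_lt n (Nat.succ_pos L)
  have e := Nat.div_add_mod n (L + 1)
  constructor
  · intro h0
    rw [← e, add_assoc, Nat.mul_add_mod] at h0
    by_contra hne
    rw [Nat.mod_eq_of_lt (by omega)] at h0
    omega
  · intro h1
    rw [← e, h1, add_assoc, Nat.mul_add_mod, Nat.mod_self]

theorem Nat.succ_mod_eq_succ_iff_mod_eq {n L k : ℕ} (hk : k < L) :
    (n + 1) % (L + 1) = k + 1 ↔ n % (L + 1) = k := by
  have h : n % (L + 1) < L + 1 := Nat.mod_lt n (Nat.succ_pos L)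
  have e := Nat.div_add_mod n (L + 1)
  constructor
  · intro h0
    rw [← e, add_assoc, Nat.mul_add_mod] at h0
    by_cases hne : n % (L + 1) = L
    · rw [hne, Nat.mod_self] at h0
      omega
    · rw [Nat.mod_eq_of_lt (by omega)] at h0
      omega
  · intro h1
    rw [← e, h1, add_assoc, Nat.mul_add_mod, Nat.mod_eq_of_lt (by omega)]

/-- Distributing the terms of a decreasing sequence cyclically over `L + 1` classes, the sums of
two classes differ by the first term at most. -/
theorem sum_mod_interlace (L : ℕ) : ∀ (n : ℕ) (a : ℕ → ℝ), Antitone a → (∀ i, 0 ≤ a i) →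
    ∀ k l, k ≤ l → l < L + 1 →
      (∑ i ∈ Finset.range n, if i % (L + 1) = l then a i else 0)
          ≤ (∑ i ∈ Finset.range n, if i % (L + 1) = k then a i else 0) ∧
        (∑ i ∈ Finset.range n, if i % (L + 1) = k then a i else 0)
          ≤ (∑ i ∈ Finset.range n, if i % (L + 1) = l then a i else 0) + a 0 := by
  intro n
  induction n with
  | zero => intro a ha h0 k l _ _; simp [h0 0]
  | succ n ih =>
    intro a ha h0 k l hkl hl
    have hsh : Antitone fun i => a (i + 1) := fun i j h => ha (by omega)
    have h01 : a 1 ≤ a 0 := ha zero_le_one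
    rw [Finset.sum_range_succ', Finset.sum_range_succ']
    rcases Nat.eq_zero_or_pos l with rfl | hl0
    · obtain rfl : k = 0 := by omega
      simp [h0 0]
    obtain ⟨l, rfl⟩ : ∃ l', l = l' + 1 := ⟨l - 1, by omega⟩
    have e1 : ∀ i, ((i + 1) % (L + 1) = l + 1) = (i % (L + 1) = l) := fun i =>
      propext (Nat.succ_mod_eq_succ_iff_mod_eq (by omega))
    have e0 : ∀ i, ((i + 1) % (L + 1) = 0) = (i % (L + 1) = L) := fun i =>
      propext Nat.succ_mod_eq_zero_iff_mod_eq
    have hl1 : (if 0 % (L + 1) = l + 1 then a 0 else 0) = 0 := by simp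
    rw [hl1, add_zero]
    simp only [e1]
    rcases Nat.eq_zero_or_pos k with rfl | hk0
    · have := ih (fun i => a (i + 1)) hsh (fun i => h0 _) l L (by omega) (by omega)
      have hk1 : (if 0 % (L + 1) = 0 then a 0 else 0) = a 0 := by simp
      rw [hk1]
      simp only [e0]
      simp only [zero_add] at this
      constructor <;> linarith [this.1, this.2]
    · obtain ⟨k, rfl⟩ : ∃ k', k = k' + 1 := ⟨k - 1, by omega⟩
      have e2 : ∀ i, ((i + 1) % (L + 1) = k + 1) = (i % (L + 1) = k) := fun i =>
        propext (Nat.succ_mod_eq_succ_iff_mod_eq (by omega))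
      have := ih (fun i => a (i + 1)) hsh (fun i => h0 _) k l (by omega) (by omega)
      have hk1 : (if 0 % (L + 1) = k + 1 then a 0 else 0) = 0 := by simp
      rw [hk1, add_zero]
      simp only [e2]
      simp only [zero_add] at this
      constructor <;> linarith [this.1, this.2]

theorem abs_sum_rev_mod_sub_le {n L : ℕ} {c : Fin (n + 1) → ℝ} (hc : Monotone c)
    (h0 : ∀ i, 0 ≤ c i) (k l : Fin (L + 1)) :
    |(∑ i, if (Fin.rev i : ℕ) % (L + 1) = k then c i else 0)
      - ∑ i, if (Fin.rev i : ℕ) % (L + 1) = l then c i else 0| ≤ c (Fin.last n) := by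
  let a : ℕ → ℝ := fun i => c (Fin.rev ⟨min i n, by omega⟩)
  have ha : Antitone a := fun i j h => hc (by
    rw [Fin.rev_le_rev, Fin.mk_le_mk]
    exact min_le_min_right n h)
  have e : ∀ k : Fin (L + 1), (∑ i, if (Fin.rev i : ℕ) % (L + 1) = k then c i else 0)
      = ∑ i ∈ Finset.range (n + 1), if i % (L + 1) = k then a i else 0 := by
    intro k
    rw [Finset.sum_range, ← Equiv.sum_comp Fin.revPerm]
    refine Finset.sum_congr rfl fun i _ => ?_
    have h1 : (⟨min (i : ℕ) n, by omega⟩ : Fin (n + 1)) = i := Fin.ext (min_eq_left (by omega))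
    simp only [a, h1, Fin.revPerm_apply, Fin.rev_rev]
  have h00 : a 0 = c (Fin.last n) := by
    simp only [a]
    congr 1
  rw [e, e, ← h00]
  rcases le_total k l with h | h
  · have := sum_mod_interlace L (n + 1) a ha (fun i => h0 _) k l h l.2
    rw [abs_le]
    constructor <;> linarith [this.1, this.2, h0 (Fin.rev ⟨min 0 n, by omega⟩)]
  · have := sum_mod_interlace L (n + 1) a ha (fun i => h0 _) l k h k.2
    rw [abs_le]
    constructor <;> linarith [this.1, this.2, h0 (Fin.rev ⟨min 0 n, by omega⟩)]

theorem Matrix.norm_trace_le {m : ℕ} (Z : Matrix (Fin m) (Fin m) ℂ) : ‖Z.trace‖ ≤ m * ‖Z‖ := by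
  have h : ∀ i, ‖Z i i‖ ≤ ‖Z‖ := fun i => by
    have h1 := Matrix.l2_opNorm_mulVec Z (EuclideanSpace.single i (1 : ℂ))
    rw [PiLp.norm_single, norm_one, mul_one] at h1
    refine le_trans ?_ h1
    refine le_trans ?_ (PiLp.norm_apply_le _ i)
    simp
  calc ‖Z.trace‖ ≤ ∑ i, ‖Z i i‖ := norm_sum_le _ _
    _ ≤ ∑ _i : Fin m, ‖Z‖ := Finset.sum_le_sum fun i _ => h i
    _ = m * ‖Z‖ := by simp

section

variable {X : Type} [TopologicalSpace X] [CompactSpace X] {m : ℕ}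
  (V : C(X, unitary (Matrix (Fin m) (Fin m) ℂ)))

theorem norm_unitFun_le (a b : Fin m) {c : C(X, ℝ)} (hc : ∀ x, |c x| ≤ 1) :
    ‖unitFun V a b c‖ ≤ 1 := by
  classical
  have h1 : ‖unitFun V a b c‖ * ‖unitFun V a b c‖ ≤ 1 := by
    rw [← CStarRing.norm_star_mul_self, star_unitFun, unitFun_mul, unitFun_eq_diagFun]
    refine norm_diagFun_le V zero_le_one fun i x => ?_
    by_cases hi : i = b
    · subst hi
      rw [Pi.single_eq_same, ContinuousMap.mul_apply, abs_mul]
      exact mul_le_one₀ (hc x) (abs_nonneg _) (hc x)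
    · rw [Pi.single_eq_of_ne hi]
      simp
  nlinarith [norm_nonneg (unitFun V a b c)]

theorem unitFun_add (a b : Fin m) (c c' : C(X, ℝ)) :
    unitFun V a b (c + c') = unitFun V a b c + unitFun V a b c' := by
  ext1 x
  rw [ContinuousMap.add_apply, unitFun, patch_apply, unitFun, patch_apply, unitFun, patch_apply,
    ContinuousMap.add_apply, Complex.ofReal_add, add_smul]

theorem unitFun_smul (a b : Fin m) (r : ℝ) (c : C(X, ℝ)) :
    unitFun V a b (r • c) = (r : ℂ) • unitFun V a b c := by
  ext1 x
  rw [ContinuousMap.smul_apply, unitFun, patch_apply, unitFun, patch_apply,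
    ContinuousMap.smul_apply, smul_eq_mul, Complex.ofReal_mul, mul_smul]

variable {A : Type*} [CStarAlgebra A] [PartialOrder A] [StarOrderedRing A]
  (Q : CornerModel A X m) {τ : A →ₚ[ℂ] ℂ}

/-- The values of a trace on the multiples of a rank one projection in a moving basis. -/
noncomputable def CornerModel.slot (τ : A →ₚ[ℂ] ℂ) (a : Fin m) : C(X, ℝ) →ₗ[ℝ] ℝ where
  toFun c := (τ (Q.ι (unitFun V a a c))).re
  map_add' c c' := by rw [unitFun_add, map_add, map_add, Complex.add_re]
  map_smul' r c := by
    rw [unitFun_smul, map_smul, map_smul, smul_eq_mul, Complex.re_ofReal_mul]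
    rfl

theorem CornerModel.slot_apply (a : Fin m) (c : C(X, ℝ)) :
    Q.slot V τ a c = (τ (Q.ι (unitFun V a a c))).re := rfl

theorem CornerModel.slot_nonneg (a : Fin m) {c : C(X, ℝ)} (hc : ∀ x, 0 ≤ c x) :
    0 ≤ Q.slot V τ a c := by
  have h : unitFun V a a c = unitFun V a a ⟨fun x => √(c x), by fun_prop⟩
      * unitFun V a a ⟨fun x => √(c x), by fun_prop⟩ := by
    rw [unitFun_mul]
    congr 1
    ext x
    exact (Real.mul_self_sqrt (hc x)).symm
  exact trace_re_nonneg τ (Q.map_nonneg_of_sq (star_unitFun V a a _) h)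

theorem CornerModel.slot_mono (a : Fin m) {c c' : C(X, ℝ)} (h : ∀ x, c x ≤ c' x) :
    Q.slot V τ a c ≤ Q.slot V τ a c' := by
  rw [← sub_nonneg, ← map_sub]
  exact Q.slot_nonneg V a fun x => sub_nonneg.mpr (h x)

theorem CornerModel.slot_le_one (hτ : τ ∈ tracialStateSpace A) (a : Fin m) {c : C(X, ℝ)}
    (hc : ∀ x, |c x| ≤ 1) : Q.slot V τ a c ≤ 1 :=
  ((Complex.re_le_norm _).trans (norm_trace_le hτ _)).trans
    ((Q.norm_map_le _).trans (norm_unitFun_le V a a hc))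

/-- Where the diagonal entries `d a` and `d b` of an approximation of the unit of the corner are
one, the corresponding rank one projections have almost the same trace. -/
theorem CornerModel.abs_slot_sub_le (hτ : τ ∈ tracialStateSpace A) {d : Fin m → C(X, ℝ)} {κ : ℝ}
    (hd : ‖diagFun V d - Q.P‖ ≤ κ) (a b : Fin m) {c : C(X, ℝ)} (hc0 : ∀ x, 0 ≤ c x)
    (hc1 : ∀ x, c x ≤ 1) (ha : c * d a = c) (hb : c * d b = c) :
    |Q.slot V τ a c - Q.slot V τ b c| ≤ 2 * κ := by
  set r : C(X, ℝ) := ⟨fun x => √(c x), by fun_prop⟩ with hr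
  have hrr : r * r = c := by
    ext x
    exact Real.mul_self_sqrt (hc0 x)
  have hr1 : ∀ x, |r x| ≤ 1 := fun x => by
    rw [hr, ContinuousMap.coe_mk, abs_of_nonneg (Real.sqrt_nonneg _)]
    exact Real.sqrt_le_one.mpr (hc1 x)
  have key : ∀ a b, c * d b = c →
      ‖Q.ι (unitFun V a b r) * Q.ι (unitFun V b a r) - Q.ι (unitFun V a a c)‖ ≤ κ := by
    intro a b hb
    have h1 : unitFun V a a c = unitFun V a b r * diagFun V d * unitFun V b a r := by
      rw [unitFun_mul_diagFun, unitFun_mul]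
      congr 1
      rw [← hb, ← hrr]
      ring
    have hκ : 0 ≤ κ := (norm_nonneg _).trans hd
    rw [Q.map_mul, h1, ← map_sub, ← sub_mul, ← mul_sub]
    refine (Q.norm_map_le _).trans (norm_mul₃_le.trans ?_)
    rw [norm_sub_rev]
    calc _ ≤ 1 * κ * 1 := by
          gcongr
          exacts [norm_unitFun_le V a b hr1, norm_unitFun_le V b a hr1]
      _ = κ := by ring
  have h1 := (abs_re_trace_sub_le hτ _ _).trans (key a b hb)
  have h2 := (abs_re_trace_sub_le hτ _ _).trans (key b a ha)
  rw [trace_mul_comm hτ] at h2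
  rw [Q.slot_apply, Q.slot_apply]
  rw [abs_le] at h1 h2 ⊢
  constructor <;> linarith [h1.1, h1.2, h2.1, h2.2]

theorem CornerModel.re_trace_diagFun (d : Fin m → C(X, ℝ)) :
    (τ (Q.ι (diagFun V d))).re = ∑ i, Q.slot V τ i (d i) := by
  rw [diagFun_eq_sum, map_sum, map_sum, Complex.re_sum]
  rfl

end

section

variable {X : Type} [TopologicalSpace X] [CompactSpace X] {n : ℕ}
  (V : C(X, unitary (Matrix (Fin (n + 1)) (Fin (n + 1)) ℂ)))
  {A : Type*} [CStarAlgebra A] [PartialOrder A] [StarOrderedRing A]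
  (Q : CornerModel A X (n + 1)) {τ : A →ₚ[ℂ] ℂ}

/-- The part of the entries `c` that belongs to one of the `L + 1` classes of indices. -/
def classPart (L : ℕ) (k : Fin (L + 1)) (c : Fin (n + 1) → C(X, ℝ)) : Fin (n + 1) → C(X, ℝ) :=
  fun i => if (Fin.rev i : ℕ) % (L + 1) = k then c i else 0

/-- If the entries `c` increase, their parts in two classes have almost the same trace, because
the sums over the classes interlace. -/
theorem CornerModel.abs_trace_classPart_sub_le (hτ : τ ∈ tracialStateSpace A)
    {d : Fin (n + 1) → C(X, ℝ)} {κ : ℝ} (hd : ‖diagFun V d - Q.P‖ ≤ κ)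
    {c : Fin (n + 1) → C(X, ℝ)} (hc0 : ∀ i x, 0 ≤ c i x)
    (hc1 : ∀ i x, c i x ≤ 1) (hmono : ∀ x, Monotone fun i => c i x)
    (hcd : ∀ i j, i ≤ j → c i * d j = c i) {S : ℝ}
    (hS : Q.slot V τ (Fin.last n) (c (Fin.last n)) ≤ S) (L : ℕ) (k l : Fin (L + 1)) :
    |(τ (Q.ι (diagFun V (classPart L k c)))).re - (τ (Q.ι (diagFun V (classPart L l c)))).re|
      ≤ S + 4 * (n + 1) * κ := by
  have hκ : 0 ≤ κ := (norm_nonneg _).trans hd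
  have key : ∀ k : Fin (L + 1), |(τ (Q.ι (diagFun V (classPart L k c)))).re
      - Q.slot V τ (Fin.last n) (∑ i, classPart L k c i)| ≤ 2 * (n + 1) * κ := by
    intro k
    rw [Q.re_trace_diagFun, map_sum, ← Finset.sum_sub_distrib]
    refine (Finset.abs_sum_le_sum_abs _ _).trans ?_
    calc _ ≤ ∑ _i : Fin (n + 1), 2 * κ := Finset.sum_le_sum fun i _ => ?_
      _ = 2 * (n + 1) * κ := by simp; ring
    rw [classPart]
    split_ifs
    · exact Q.abs_slot_sub_le V hτ hd i (Fin.last n) (hc0 i) (hc1 i) (hcd i i le_rfl)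
        (hcd i _ (Fin.le_last i))
    · simpa using hκ
  have e : ∀ (k : Fin (L + 1)) x, (∑ i, classPart L k c i) x
      = ∑ i, if (Fin.rev i : ℕ) % (L + 1) = k then c i x else 0 := by
    intro k x
    rw [ContinuousMap.sum_apply]
    refine Finset.sum_congr rfl fun i _ => ?_
    rw [classPart]
    split_ifs <;> rfl
  have hkl : ∀ k l : Fin (L + 1), Q.slot V τ (Fin.last n) (∑ i, classPart L k c i)
      - Q.slot V τ (Fin.last n) (∑ i, classPart L l c i) ≤ S := by
    intro k l
    rw [← map_sub]
    refine (Q.slot_mono V _ fun x => ?_).trans hS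
    rw [ContinuousMap.sub_apply, e, e]
    exact (le_abs_self _).trans (abs_sum_rev_mod_sub_le (hmono x) (fun i => hc0 i x) k l)
  have h1 := abs_le.mp (key k)
  have h2 := abs_le.mp (key l)
  rw [abs_le]
  constructor <;> linarith [hkl k l, hkl l k, h1.1, h1.2, h2.1, h2.2]

/-- If the rank is large, a single rank one projection has small trace. -/
theorem CornerModel.slot_last_le (hτ : τ ∈ tracialStateSpace A)
    {d c : Fin (n + 1) → C(X, ℝ)} {κ : ℝ} (hd : ‖diagFun V d - Q.P‖ ≤ κ)
    (hc : ‖diagFun V c - Q.P‖ ≤ κ) (hc0 : ∀ i x, 0 ≤ c i x) (hc1 : ∀ i x, c i x ≤ 1)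
    (hcd : ∀ i j, i ≤ j → c i * d j = c i) {K : ℝ} (hK : 1 ≤ K)
    (hrank : ∀ x, Q.P x = 0 ∨ K ≤ (Q.P x).trace.re) (hκ1 : (3 * (n + 1) + K) * κ ≤ 1) :
    (K - 1) * Q.slot V τ (Fin.last n) (c (Fin.last n)) ≤ 2 := by
  have hκ : 0 ≤ κ := (norm_nonneg _).trans hd
  have hx : ∀ x, ‖diagFun V c x - Q.P x‖ ≤ κ := fun x =>
    ((diagFun V c - Q.P).norm_coe_le_norm x).trans hc
  have h1 : ∀ x, (K - 1) * c (Fin.last n) x ≤ ∑ i, c i x + K * κ := by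
    intro x
    rcases hrank x with h | h
    · have h2 : c (Fin.last n) x ≤ κ := by
        have h3 := hx x
        rw [h, sub_zero, diagFun_apply, DiagData.norm_toMatrix] at h3
        exact (le_abs_self _).trans ((norm_le_pi_norm (fun i => c i x) (Fin.last n)).trans h3)
      have h3 : (0 : ℝ) ≤ ∑ i, c i x := Finset.sum_nonneg fun i _ => hc0 i x
      nlinarith [hc0 (Fin.last n) x]
    · have h2 := (Matrix.norm_trace_le (diagFun V c x - Q.P x)).trans
        (mul_le_mul_of_nonneg_left (hx x) (Nat.cast_nonneg _))
      rw [Matrix.trace_sub, trace_diagFun] at h2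
      have h3 := (abs_le.mp ((Complex.abs_re_le_norm _).trans h2)).1
      rw [Complex.sub_re, Complex.ofReal_re] at h3
      push_cast at h3
      nlinarith [hc1 (Fin.last n) x, hc0 (Fin.last n) x]
  have h2 : (K - 1) * Q.slot V τ (Fin.last n) (c (Fin.last n))
      ≤ ∑ i, Q.slot V τ (Fin.last n) (c i) + K * κ := by
    have h3 := Q.slot_mono V (τ := τ) (Fin.last n) (c := (K - 1) • c (Fin.last n))
      (c' := ∑ i, c i + (K * κ) • 1) (fun x => by
        rw [ContinuousMap.add_apply, ContinuousMap.sum_apply]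
        simpa using h1 x)
    rw [map_smul, map_add, map_sum, map_smul, smul_eq_mul, smul_eq_mul] at h3
    have h4 := Q.slot_le_one V hτ (Fin.last n) (c := 1) (fun x => by simp)
    have h5 : K * κ * Q.slot V τ (Fin.last n) 1 ≤ K * κ * 1 := by gcongr
    linarith
  have h3 : ∑ i, Q.slot V τ (Fin.last n) (c i)
      ≤ ∑ i, Q.slot V τ i (c i) + 2 * (n + 1) * κ := by
    have h4 : ∑ i : Fin (n + 1), (Q.slot V τ i (c i) + 2 * κ)
        = ∑ i, Q.slot V τ i (c i) + 2 * (n + 1) * κ := by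
      rw [Finset.sum_add_distrib]
      simp
      ring
    rw [← h4]
    refine Finset.sum_le_sum fun i _ => ?_
    have := (abs_le.mp (Q.abs_slot_sub_le V hτ hd i (Fin.last n) (hc0 i) (hc1 i)
      (hcd i i le_rfl) (hcd i _ (Fin.le_last i)))).1
    linarith
  have h4 : ∑ i, Q.slot V τ i (c i) ≤ 1 := by
    rw [← Q.re_trace_diagFun]
    refine ((Complex.re_le_norm _).trans (norm_trace_le hτ _)).trans
      ((Q.norm_map_le _).trans (norm_diagFun_le V zero_le_one fun i x => ?_))
    rw [abs_of_nonneg (hc0 i x)]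
    exact hc1 i x
  have : 0 ≤ ((n : ℝ) + 1) * κ := by positivity
  nlinarith

end

/-- The function `ramp a b` as a continuous map. -/
noncomputable def rampMap (a b : ℝ) : C(ℝ, ℝ) := ⟨ramp a b, continuous_ramp a b⟩

section

variable {X : Type} [TopologicalSpace X] {n : ℕ}

theorem classPart_mul (L : ℕ) (k : Fin (L + 1)) (c c' : Fin (n + 1) → C(X, ℝ)) :
    c * classPart L k c' = classPart L k (c * c') := by
  funext i
  rw [Pi.mul_apply, classPart, classPart]
  split_ifs
  · rfl
  · rw [mul_zero]

theorem classPart_mul_classPart_of_ne (L : ℕ) {k l : Fin (L + 1)} (h : k ≠ l)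
    (c c' : Fin (n + 1) → C(X, ℝ)) : classPart L k c * classPart L l c' = 0 := by
  funext i
  rw [Pi.mul_apply, classPart, classPart]
  split_ifs with h1 h2
  · exact absurd (Fin.ext (h1.symm.trans h2)) h
  all_goals simp

theorem sum_classPart (L : ℕ) (c : Fin (n + 1) → C(X, ℝ)) : ∑ k, classPart L k c = c := by
  funext i
  rw [Finset.sum_apply, Finset.sum_eq_single ⟨(Fin.rev i : ℕ) % (L + 1), Nat.mod_lt _ (by omega)⟩]
  · exact if_pos rfl
  · intro k _ hk
    exact if_neg fun h => hk (Fin.ext h.symm)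
  · simp

theorem saCalculus_one {M : Type*} [CStarAlgebra M] {a : M} (ha : IsSelfAdjoint a) :
    saCalculus 1 a = 1 := cfc_one ℝ a ha

theorem saCalculus_id {M : Type*} [CStarAlgebra M] {a : M} (ha : IsSelfAdjoint a) :
    saCalculus (ContinuousMap.id ℝ) a = a := cfc_id ℝ a ha

end

set_option maxHeartbeats 1000000 in
/-- In a corner of large rank over a graph, the unit of the corner can be divided into `L + 1`
almost projections which almost commute with `N` and give almost the same trace when multiplied
with functions of `N`: diagonalise, and distribute the eigenvalues cyclically over the classes in
decreasing order. -/
theorem CornerModel.exists_divide {X : Type} [TopologicalSpace X] [T2Space X] [CompactSpace X]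
    (Γ : GraphModel X) {m : ℕ} {A : Type*} [CStarAlgebra A] [PartialOrder A] [StarOrderedRing A]
    (Q : CornerModel A X m) {K κ : ℝ} (hκ : 0 < κ) (hK : 1 + 4 / κ ≤ K)
    (hrank : ∀ x, Q.P x = 0 ∨ K ≤ (Q.P x).trace.re) {N : MatFun X m} (hN : IsSelfAdjoint N)
    (hPN : Q.P * N = N) (hn : ‖N‖ ≤ 2) {ι : Type} [Finite ι] {g : ι → C(ℝ, ℝ)}
    (hg : ∀ r, Monotone (g r)) (hg0 : ∀ r t, 0 ≤ g r t) (hg1 : ∀ r t, g r t ≤ 1) (L : ℕ) :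
    ∃ E : Fin (L + 1) → MatFun X m, (∀ k, 0 ≤ Q.ι (E k)) ∧ ∑ k, Q.ι (E k) ≤ 1 ∧
      (∀ k l, k ≠ l → ‖Q.ι (E k) * Q.ι (E l)‖ ≤ κ) ∧
      (∀ k, ‖Q.ι (E k) * Q.ι (E k) - Q.ι (E k)‖ ≤ κ) ∧
      (∀ k, ‖Q.ι N * Q.ι (E k) - Q.ι (E k) * Q.ι N‖ ≤ κ) ∧
      ‖Q.ι Q.P - ∑ k, Q.ι (E k)‖ ≤ κ ∧
      ∀ r, ∀ τ ∈ tracialStateSpace A, ∀ k l,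
        |(τ (Q.ι (Q.P * saCalculus (g r) N) * Q.ι (E k))).re
          - (τ (Q.ι (Q.P * saCalculus (g r) N) * Q.ι (E l))).re| ≤ κ := by
  rcases m with _ | n
  · have h0 : ∀ M : MatFun X 0, M = 0 := fun M => Subsingleton.elim _ _
    refine ⟨0, ?_⟩
    rw [h0 Q.P]
    simp [hκ.le]
  have hK1 : 1 < K := by have : 0 < 4 / κ := by positivity
                         linarith
  set κ' := min (κ / (20 * (n + 1))) (1 / (3 * (n + 1) + K)) with hκ'
  have hκ'0 : 0 < κ' := by positivity
  have hb1 : 20 * (n + 1) * κ' ≤ κ := by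
    have := min_le_left (κ / (20 * ((n : ℝ) + 1))) (1 / (3 * (n + 1) + K))
    rw [← hκ', le_div_iff₀ (by positivity)] at this
    linarith
  have hb2 : (3 * (n + 1) + K) * κ' ≤ 1 := by
    have := min_le_right (κ / (20 * ((n : ℝ) + 1))) (1 / (3 * (n + 1) + K))
    rw [← hκ', le_div_iff₀ (by positivity)] at this
    linarith
  have hb0 : 20 * κ' ≤ κ := by nlinarith [(Nat.cast_nonneg n : (0 : ℝ) ≤ n)]
  -- The spectrum of `N + 5 P` in the corner lies in `[3, 7]`, and so is separated from the
  -- eigenvalue zero on the complement of `P`. The ramps from `1` to `2` and from `2` to `3` both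
  -- take `N + 5 P` to `P`; the first is `1` where the second does not vanish. The function `s`
  -- shifts back.
  set s : C(ℝ, ℝ) := ⟨fun t => t - 5, by fun_prop⟩ with hs
  set f : Fin 3 ⊕ ι → C(ℝ, ℝ) := Sum.elim ![rampMap 1 2, rampMap 2 3, s * rampMap 2 3]
    fun r => ((g r).comp s) * rampMap 2 3 with hf
  have r0 : ∀ a b : ℝ, 0 ≤ a → a < b → ramp a b 0 = 0 := fun a b ha hab => ramp_of_le hab ha
  have r1 : ∀ a b t : ℝ, a < b → b ≤ 3 → |t| ≤ 2 → ramp a b (t + 5) = 1 := fun a b t hab hb ht =>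
    ramp_of_ge hab (by linarith [(abs_le.mp ht).1])
  obtain ⟨V, l, hl, H⟩ := Γ.exists_diagFun_approx Q.isStarProjection hN hPN hn f
    (Sum.elim ![1, 1, ContinuousMap.id ℝ] g) (by
      rintro (j | j)
      · fin_cases j
        · exact r0 1 2 (by norm_num) (by norm_num)
        · exact r0 2 3 (by norm_num) (by norm_num)
        · change _ * ramp 2 3 0 = 0
          rw [r0 2 3 (by norm_num) (by norm_num), mul_zero]
      · change g j _ * ramp 2 3 0 = 0
        rw [r0 2 3 (by norm_num) (by norm_num), mul_zero]) (by
      rintro (j | j) t ht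
      · fin_cases j
        · exact r1 1 2 t (by norm_num) (by norm_num) ht
        · exact r1 2 3 t (by norm_num) (by norm_num) ht
        · change (t + 5 - 5) * ramp 2 3 (t + 5) = t
          rw [r1 2 3 t (by norm_num) (by norm_num) ht, mul_one, add_sub_cancel_right]
      · change g j (t + 5 - 5) * ramp 2 3 (t + 5) = g j t
        rw [r1 2 3 t (by norm_num) (by norm_num) ht, mul_one, add_sub_cancel_right]) hκ'0
  set d : Fin (n + 1) → C(X, ℝ) := fun i => (rampMap 1 2).comp (l i) with hd
  set c : Fin (n + 1) → C(X, ℝ) := fun i => (rampMap 2 3).comp (l i) with hc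
  set y : ι → Fin (n + 1) → C(X, ℝ) := fun r i => (((g r).comp s) * rampMap 2 3).comp (l i) with hy
  set z : Fin (n + 1) → C(X, ℝ) := fun i => (s * rampMap 2 3).comp (l i) with hz
  have H0 : ‖diagFun V d - Q.P‖ ≤ κ' := by
    have := H (Sum.inl 0)
    change ‖diagFun V d - Q.P * saCalculus 1 N‖ ≤ κ' at this
    rwa [saCalculus_one hN, mul_one] at this
  have H1 : ‖diagFun V c - Q.P‖ ≤ κ' := by
    have := H (Sum.inl 1)
    change ‖diagFun V c - Q.P * saCalculus 1 N‖ ≤ κ' at this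
    rwa [saCalculus_one hN, mul_one] at this
  have H2 : ∀ r, ‖diagFun V (y r) - Q.P * saCalculus (g r) N‖ ≤ κ' := fun r => H (Sum.inr r)
  have H3 : ‖diagFun V z - N‖ ≤ κ' := by
    have := H (Sum.inl 2)
    change ‖diagFun V z - Q.P * saCalculus (ContinuousMap.id ℝ) N‖ ≤ κ' at this
    rwa [saCalculus_id hN, hPN] at this
  clear_value f
  have hc0 : ∀ i x, 0 ≤ c i x := fun i x => ramp_nonneg _ _ _
  have hc1 : ∀ i x, c i x ≤ 1 := fun i x => ramp_le_one _ _ _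
  have hy0 : ∀ r i x, 0 ≤ y r i x := fun r i x => mul_nonneg (hg0 r _) (ramp_nonneg _ _ _)
  have hy1 : ∀ r i x, y r i x ≤ 1 := fun r i x =>
    mul_le_one₀ (hg1 r _) (ramp_nonneg _ _ _) (ramp_le_one _ _ _)
  have hcm : ∀ x, Monotone fun i => c i x := fun x i j h => ramp_mono (by norm_num) (hl x h)
  have hym : ∀ r x, Monotone fun i => y r i x := fun r x i j h =>
    mul_le_mul (hg r (sub_le_sub_right (hl x h) 5)) (hcm x h) (hc0 i x) (hg0 r _)
  have hcd : ∀ i j, i ≤ j → c i * d j = c i := by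
    intro i j hij
    ext x
    change ramp 2 3 (l i x) * ramp 1 2 (l j x) = ramp 2 3 (l i x)
    rcases le_or_gt (l i x) 2 with h | h
    · rw [ramp_of_le (by norm_num) h, zero_mul]
    · have := hl x hij
      rw [ramp_of_ge (a := 1) (b := 2) (by norm_num) (h.le.trans this), mul_one]
  have habs : ∀ e : Fin (n + 1) → C(X, ℝ), (∀ i x, 0 ≤ e i x) → (∀ i x, e i x ≤ 1) →
      ∀ k, ‖diagFun V (classPart L k e)‖ ≤ 1 := by
    intro e he0 he1 k
    refine norm_diagFun_le V zero_le_one fun i x => ?_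
    rw [classPart]
    split_ifs
    · rw [abs_of_nonneg (he0 i x)]
      exact he1 i x
    · simp
  obtain ⟨E, hE⟩ : ∃ E : Fin (L + 1) → MatFun X (n + 1), ∀ k, E k = diagFun V (classPart L k c) :=
    ⟨_, fun _ => rfl⟩
  obtain ⟨W, hW⟩ : ∃ W : Fin (L + 1) → MatFun X (n + 1), ∀ k, W k = diagFun V (classPart L k 1) :=
    ⟨_, fun _ => rfl⟩
  have hEW : ∀ k, E k = diagFun V c * W k := fun k => by
    rw [hE, hW, diagFun_mul, classPart_mul, mul_one]
  have hW1 : ∀ k, ‖W k‖ ≤ 1 := fun k => by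
    rw [hW]
    exact habs 1 (fun _ _ => zero_le_one) (fun _ _ => le_rfl) k
  have hE1 : ∀ k, ‖E k‖ ≤ 1 := fun k => by
    rw [hE]
    exact habs c hc0 hc1 k
  clear_value c d y z
  have hP1 := Q.norm_P_le
  have hPE : ∀ k, ‖Q.P * E k - E k‖ ≤ 2 * κ' := by
    intro k
    have e : Q.P * E k - E k = Q.P * (diagFun V c - Q.P) * W k - (diagFun V c - Q.P) * W k := by
      rw [mul_sub, Q.P_mul_P, hEW]
      noncomm_ring
    have h1 : ‖(diagFun V c - Q.P) * W k‖ ≤ κ' := (norm_mul_le _ _).trans (by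
      calc _ ≤ κ' * 1 := by gcongr; exact hW1 k
        _ = κ' := mul_one _)
    rw [e, mul_assoc]
    refine (norm_sub_le _ _).trans ?_
    have h2 : ‖Q.P * ((diagFun V c - Q.P) * W k)‖ ≤ 1 * κ' := (norm_mul_le _ _).trans (by gcongr)
    linarith
  have hmul : ∀ (M : MatFun X (n + 1)) k, ‖M‖ ≤ 1 →
      ‖Q.ι M * Q.ι (E k) - Q.ι (M * E k)‖ ≤ 2 * κ' := by
    intro M k hM
    rw [Q.map_mul, ← map_sub, mul_assoc, ← mul_sub]
    refine (Q.norm_map_le _).trans ((norm_mul_le _ _).trans ?_)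
    calc _ ≤ 1 * (2 * κ') := by gcongr; exact hPE k
      _ = _ := one_mul _
  have hsum : ∑ k, Q.ι (E k) = Q.ι (diagFun V c) := by
    simp only [hE]
    rw [← map_sum, ← diagFun_sum, sum_classPart]
  refine ⟨E, fun k => ?_, ?_, fun k k' hk => ?_, fun k => ?_, fun k => ?_, ?_,
    fun r τ hτ k k' => ?_⟩
  · refine Q.map_nonneg_of_sq (N := diagFun V (classPart L k fun i =>
      ⟨fun x => √(c i x), by fun_prop⟩)) (isSelfAdjoint_diagFun V _) ?_
    rw [diagFun_mul, hE]
    congr 1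
    funext i
    rw [Pi.mul_apply, classPart, classPart]
    split_ifs
    · ext x
      exact (Real.mul_self_sqrt (hc0 i x)).symm
    · rw [mul_zero]
  · rw [hsum]
    refine IsSelfAdjoint.le_one_of_norm_le_one (Q.map_isSelfAdjoint (isSelfAdjoint_diagFun V c))
      ((Q.norm_map_le _).trans (norm_diagFun_le V zero_le_one fun i x => ?_))
    rw [abs_of_nonneg (hc0 i x)]
    exact hc1 i x
  · have h := hmul (E k) k' (hE1 k)
    have h0 : E k * E k' = 0 := by
      rw [hE, hE, diagFun_mul, classPart_mul_classPart_of_ne L hk, diagFun_zero]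
    rw [h0, map_zero, sub_zero] at h
    linarith
  · have h := hmul (E k) k (hE1 k)
    have e : E k * E k = diagFun V c * E k := by
      rw [hE, diagFun_mul, diagFun_mul]
      congr 1
      funext i
      rw [Pi.mul_apply, Pi.mul_apply, classPart]
      split_ifs
      · rfl
      · rw [mul_zero, mul_zero]
    have h1 : ‖Q.ι (E k * E k) - Q.ι (E k)‖ ≤ 3 * κ' := by
      rw [← map_sub, e]
      refine (Q.norm_map_le _).trans ?_
      have e2 : diagFun V c * E k - E k = (diagFun V c - Q.P) * E k + (Q.P * E k - E k) := by
        rw [sub_mul]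
        abel
      rw [e2]
      refine (norm_add_le _ _).trans ?_
      have h3 : ‖(diagFun V c - Q.P) * E k‖ ≤ κ' * 1 := (norm_mul_le _ _).trans (by
        gcongr; exact hE1 k)
      linarith [hPE k]
    have := norm_sub_le_norm_sub_add_norm_sub (Q.ι (E k) * Q.ι (E k)) (Q.ι (E k * E k)) (Q.ι (E k))
    linarith
  · have hNP : N * Q.P = N := by
      have := congrArg star hPN
      rwa [star_mul, hN.star_eq, Q.star_P] at this
    rw [Q.map_mul_of_left _ hNP, Q.map_mul_of_right _ hPN, ← map_sub]
    refine (Q.norm_map_le _).trans ?_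
    have e : N * E k - E k * N = E k * (diagFun V z - N) - (diagFun V z - N) * E k := by
      have : diagFun V z * E k = E k * diagFun V z := by
        rw [hE, diagFun_mul, diagFun_mul, mul_comm]
      rw [mul_sub, sub_mul, this]
      abel
    rw [e]
    refine (norm_sub_le _ _).trans ?_
    have h1 : ‖E k * (diagFun V z - N)‖ ≤ 1 * κ' := (norm_mul_le _ _).trans (by
      gcongr; exact hE1 k)
    have h2 : ‖(diagFun V z - N) * E k‖ ≤ κ' * 1 := (norm_mul_le _ _).trans (by
      gcongr; exact hE1 k)
    linarith
  · rw [hsum, ← map_sub]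
    refine (Q.norm_map_le _).trans ?_
    rw [norm_sub_rev]
    linarith
  · have hS := Q.slot_last_le V hτ H0 H1 hc0 hc1 hcd hK1.le hrank hb2
    have hS2 : Q.slot V τ (Fin.last n) (c (Fin.last n)) ≤ κ / 2 := by
      have h4 : 4 ≤ (K - 1) * κ := by
        have : 4 / κ ≤ K - 1 := by linarith
        rwa [div_le_iff₀ hκ] at this
      have h5 : 0 ≤ Q.slot V τ (Fin.last n) (c (Fin.last n)) := Q.slot_nonneg V _ (hc0 _)
      by_contra! h6
      have : (K - 1) * (κ / 2) < (K - 1) * Q.slot V τ (Fin.last n) (c (Fin.last n)) :=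
        mul_lt_mul_of_pos_left h6 (by linarith)
      linarith
    have hyc : ∀ i x, (y r * c) i x ≤ c i x := fun i x =>
      mul_le_of_le_one_left (hc0 i x) (hy1 r i x)
    have hyd : ∀ i j, i ≤ j → (y r * c) i * d j = (y r * c) i := fun i j h => by
      rw [Pi.mul_apply, mul_assoc, hcd i j h]
    have h1 := Q.abs_trace_classPart_sub_le V hτ H0 (c := y r * c)
      (fun i x => mul_nonneg (hy0 r i x) (hc0 i x)) (fun i x => (hyc i x).trans (hc1 i x))
      (fun x i j h => mul_le_mul (hym r x h) (hcm x h) (hc0 i x) (hy0 r j x)) hyd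
      ((Q.slot_mono V _ (hyc _)).trans hS2) L k k'
    have hyn : ‖diagFun V (y r)‖ ≤ 1 := norm_diagFun_le V zero_le_one fun i x => by
      rw [abs_of_nonneg (hy0 r i x)]
      exact hy1 r i x
    have key : ∀ k, |(τ (Q.ι (Q.P * saCalculus (g r) N) * Q.ι (E k))).re
        - (τ (Q.ι (diagFun V (classPart L k (y r * c))))).re| ≤ 3 * κ' := by
      intro k
      have h2 := hmul (diagFun V (y r)) k hyn
      have e : diagFun V (y r) * E k = diagFun V (classPart L k (y r * c)) := by
        rw [hE, diagFun_mul, classPart_mul]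
      rw [e] at h2
      have h3 : ‖Q.ι (Q.P * saCalculus (g r) N) * Q.ι (E k) - Q.ι (diagFun V (y r)) * Q.ι (E k)‖
          ≤ κ' := by
        rw [← sub_mul, ← map_sub]
        calc _ ≤ κ' * 1 := (norm_mul_le _ _).trans (by
              gcongr
              · exact (Q.norm_map_le _).trans ((norm_sub_rev _ _).trans_le (H2 r))
              · exact (Q.norm_map_le _).trans (hE1 k))
          _ = κ' := mul_one _
      refine (abs_re_trace_sub_le hτ _ _).trans ?_
      have := norm_sub_le_norm_sub_add_norm_sub (Q.ι (Q.P * saCalculus (g r) N) * Q.ι (E k))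
        (Q.ι (diagFun V (y r)) * Q.ι (E k)) (Q.ι (diagFun V (classPart L k (y r * c))))
      linarith
    have h2 := abs_le.mp (key k)
    have h3 := abs_le.mp (key k')
    have h4 := abs_le.mp h1
    have h5 : (0 : ℝ) ≤ n * κ' := by positivity
    rw [abs_le]
    constructor <;> nlinarith [h2.1, h2.2, h3.1, h3.2, h4.1, h4.2]

theorem norm_aeval_sub_saCalculus_le {M : Type*} [CStarAlgebra M] {g : C(ℝ, ℝ)} {R ε : ℝ}
    (hε : 0 ≤ ε) {q : Polynomial ℝ} (hq : ∀ t, |t| ≤ R → |q.eval t - g t| ≤ ε) {x : M}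
    (hx : IsSelfAdjoint x) (hxR : ‖x‖ ≤ R) : ‖Polynomial.aeval x q - saCalculus g x‖ ≤ ε := by
  rw [saCalculus, ← cfc_polynomial q x hx,
    ← cfc_sub q.eval g x (by fun_prop) g.continuous.continuousOn]
  refine norm_cfc_le hε fun t ht => hq t ?_
  have := spectrum.norm_le_norm_mul_of_mem ht
  rcases subsingleton_or_nontrivial M with hs | hs
  · simp [spectrum.of_subsingleton] at ht
  · rw [norm_one, mul_one] at this
    exact this.trans hxR

section

variable {X : Type} [TopologicalSpace X] [CompactSpace X] {m : ℕ} {A : Type*} [CStarAlgebra A]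
  (Q : CornerModel A X m)

theorem CornerModel.aeval_map {N : MatFun X m} (hPN : Q.P * N = N) (q : Polynomial ℝ) :
    Polynomial.aeval (Q.ι N) q * Q.ι Q.P = Q.ι (Polynomial.aeval N q * Q.P) := by
  have hp : ∀ n : ℕ, Q.ι N ^ n * Q.ι Q.P = Q.ι (N ^ n * Q.P) := by
    intro n
    induction n with
    | zero => rw [pow_zero, pow_zero, one_mul, one_mul]
    | succ n ih =>
      rw [pow_succ', mul_assoc, ih, Q.map_mul, mul_assoc N, ← mul_assoc Q.P, pow_succ',
        mul_assoc N]
      cases n with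
      | zero => rw [pow_zero, mul_one, Q.P_mul_P, one_mul]
      | succ n => rw [pow_succ' N n, ← mul_assoc Q.P N, hPN]
  induction q using Polynomial.induction_on' with
  | add p q hp hq => rw [map_add, map_add, add_mul, hp, hq, add_mul, map_add]
  | monomial n r =>
    rw [Polynomial.aeval_monomial, Polynomial.aeval_monomial, ← Algebra.smul_def,
      ← Algebra.smul_def, smul_mul_assoc, smul_mul_assoc, hp]
    exact ((Q.ι.restrictScalars ℝ).map_smul r _).symm

/-- The isomorphism with a corner of matrix-valued functions respects the functional calculus. -/
theorem CornerModel.saCalculus_map {N : MatFun X m} (hN : IsSelfAdjoint N) (hPN : Q.P * N = N)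
    (g : C(ℝ, ℝ)) : saCalculus g (Q.ι N) * Q.ι Q.P = Q.ι (saCalculus g N * Q.P) := by
  rw [← sub_eq_zero, ← norm_eq_zero]
  refine le_antisymm (le_of_forall_pos_le_add fun ε hε => ?_) (norm_nonneg _)
  obtain ⟨q, hq, -⟩ := exists_polynomial_norm_cfc_sub_le (A := A) g.continuous ‖N‖ (ε := ε / 2)
    (by positivity)
  have h1 := norm_aeval_sub_saCalculus_le (by positivity) hq (Q.map_isSelfAdjoint hN)
    (Q.norm_map_le N)
  have h2 := norm_aeval_sub_saCalculus_le (M := MatFun X m) (by positivity) hq hN le_rfl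
  obtain ⟨D, hD⟩ : ∃ D : MatFun X m, D = Polynomial.aeval N q - saCalculus g N := ⟨_, rfl⟩
  have hDn : ‖D‖ ≤ ε / 2 := by
    rw [hD]
    exact h2
  have e : saCalculus g (Q.ι N) * Q.ι Q.P - Q.ι (saCalculus g N * Q.P)
      = Q.ι (D * Q.P) - (Polynomial.aeval (Q.ι N) q - saCalculus g (Q.ι N)) * Q.ι Q.P := by
    rw [hD, sub_mul, sub_mul, map_sub, Q.aeval_map hPN]
    abel
  clear h2 hD
  rw [e]
  refine (norm_sub_le _ _).trans ?_
  have h3 : ‖Q.ι (D * Q.P)‖ ≤ ε / 2 * 1 :=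
    (Q.norm_map_le _).trans ((norm_mul_le _ _).trans (by gcongr; exact Q.norm_P_le))
  have h4 : ‖(Polynomial.aeval (Q.ι N) q - saCalculus g (Q.ι N)) * Q.ι Q.P‖ ≤ ε / 2 * 1 :=
    (norm_mul_le _ _).trans (by gcongr; exact Q.norm_unit_le)
  linarith

end

section

variable {A : Type*} [CStarAlgebra A] [PartialOrder A] [StarOrderedRing A]

/-- A division of the unit, up to small traces, into `L + 1` orthogonal pieces of equal size which
commute with `a`, and are independent of the elements `g r (a)`, all up to the tolerance `δ`. -/
structure IsDivision {ι : Type} (a : A) (g : ι → C(ℝ, ℝ)) {L : ℕ} (δ : ℝ)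
    (e : Fin (L + 1) → A) : Prop where
  nonneg : ∀ k, 0 ≤ e k
  sum_le_one : ∑ k, e k ≤ 1
  norm_mul_le : ∀ k l, k ≠ l → ‖e k * e l‖ ≤ δ
  norm_mul_self_sub_le : ∀ k, ‖e k * e k - e k‖ ≤ δ
  norm_commutator_le : ∀ k, ‖a * e k - e k * a‖ ≤ δ
  abs_trace_sub_le : ∀ r, ∀ τ ∈ tracialStateSpace A, ∀ k l,
    |(τ (saCalculus (g r) a * e k)).re - (τ (saCalculus (g r) a * e l)).re| ≤ δ
  trace_le : ∀ τ ∈ tracialStateSpace A, (τ (1 - ∑ k, e k)).re ≤ δ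

/-- Divisions exist: compress `a` to a corner over a graph whose rank is large and whose complement
has small trace, and divide the unit of the corner. -/
theorem exists_isDivision (hA : IsSimpleCStarAlgebra A) (hinf : ¬ FiniteDimensional ℂ A)
    (hTR : TracialRankLE 1 A) {a : A} (ha : 0 ≤ a) (ha1 : a ≤ 1) {ι : Type} [Finite ι]
    {g : ι → C(ℝ, ℝ)} (hg : ∀ r, Monotone (g r)) (hg0 : ∀ r t, 0 ≤ g r t)
    (hg1 : ∀ r t, g r t ≤ 1) (L : ℕ) {δ : ℝ} (hδ : 0 < δ) :
    ∃ e : Fin (L + 1) → A, IsDivision a g δ e := by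
  have hasa : IsSelfAdjoint a := IsSelfAdjoint.of_nonneg ha
  have han : ‖a‖ ≤ 1 := (CStarAlgebra.norm_le_one_iff_of_nonneg a ha).mpr ha1
  have hH := fun r => exists_cfc_intertwine_le (A := A) (g r).continuous 2 (ε := δ / 8)
    (by positivity)
  choose η' hη' H using hH
  obtain ⟨η, hη, hηle⟩ : ∃ η > 0, ∀ r, η ≤ η' r := by
    rcases isEmpty_or_nonempty ι with hι | hι
    · exact ⟨1, one_pos, fun j => isEmptyElim j⟩
    · obtain ⟨j, hj⟩ := Finite.exists_min η'
      exact ⟨η' j, hη' j, hj⟩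
  obtain ⟨K, hK⟩ := exists_nat_ge (1 + 4 / (δ / 4))
  set δ₀ := min (min (η / 2) (δ / 16)) 1 with hδ₀
  have hδ₀0 : 0 < δ₀ := by positivity
  have hδ₀1 : δ₀ ≤ 1 := min_le_right _ _
  have hδ₀η : δ₀ ≤ η / 2 := (min_le_left _ _).trans (min_le_left _ _)
  have hδ₀δ : δ₀ ≤ δ / 16 := (min_le_left _ _).trans (min_le_right _ _)
  obtain ⟨X, _, _, m, hT2, ⟨Γ⟩, Q, hQ, hrank, htr⟩ :=
    exists_cornerModel_trace_le hA hinf hTR {a} hδ₀0 K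
  have hcomm := hQ.norm_commutator_lt a (by simp)
  obtain ⟨M, hM, hMa⟩ := hQ.exists_near a (by simp)
  set p := Q.ι Q.P with hp
  have hpp : p * p = p := Q.isStarProjection_unit.isIdempotentElem
  have hps : star p = p := Q.isStarProjection_unit.isSelfAdjoint
  have hpn : ‖p‖ ≤ 1 := Q.norm_unit_le
  set N : MatFun X m := (2⁻¹ : ℂ) • (M + star M) with hN
  have hNs : IsSelfAdjoint N := by
    rw [IsSelfAdjoint, hN, star_smul, star_add, star_star, add_comm]
    congr 1
    simp
  have hMs : Q.P * star M * Q.P = star M := by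
    have := congrArg star hM
    rwa [star_mul, star_mul, Q.star_P, ← mul_assoc] at this
  have hPN : Q.P * N = N := by
    rw [hN, mul_smul_comm, mul_add]
    congr 2
    · rw [← hM, ← mul_assoc, ← mul_assoc, Q.P_mul_P]
    · rw [← hMs, ← mul_assoc, ← mul_assoc, Q.P_mul_P]
  have hNP : N * Q.P = N := by
    have := congrArg star hPN
    rwa [star_mul, hNs.star_eq, Q.star_P] at this
  have hNa : ‖p * a * p - Q.ι N‖ ≤ δ₀ := by
    have e : p * a * p - Q.ι N = (2⁻¹ : ℂ) • ((p * a * p - Q.ι M) + star (p * a * p - Q.ι M)) := by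
      rw [star_sub, star_mul, star_mul, hps, hasa.star_eq, ← Q.map_star, hN, map_smul, map_add,
        ← mul_assoc, sub_add_sub_comm, smul_sub, ← two_smul ℂ (p * a * p), smul_smul]
      norm_num
    rw [e, norm_smul]
    have h1 := norm_add_le (p * a * p - Q.ι M) (star (p * a * p - Q.ι M))
    rw [norm_star] at h1
    have h2 : ‖(2⁻¹ : ℂ)‖ = 2⁻¹ := by simp
    rw [h2]
    linarith
  have hpap : ‖p * a * p‖ ≤ 1 := norm_mul₃_le.trans (by
    calc _ ≤ 1 * 1 * 1 := by gcongr
      _ = (1 : ℝ) := by norm_num)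
  have hNιn : ‖Q.ι N‖ ≤ 2 := by
    have := norm_sub_norm_le (Q.ι N) (p * a * p)
    rw [norm_sub_rev] at this
    linarith
  have hNn : ‖N‖ ≤ 2 := by
    rwa [Q.norm_map, hPN, hNP] at hNιn
  have hap : ‖a * p - Q.ι N‖ ≤ 2 * δ₀ := by
    have e : a * p - Q.ι N = (a * p - p * a) * p + (p * a * p - Q.ι N) := by
      rw [sub_mul, mul_assoc a, hpp]
      abel
    rw [e]
    refine (norm_add_le _ _).trans ?_
    have h1 : ‖(a * p - p * a) * p‖ ≤ δ₀ * 1 := (norm_mul_le _ _).trans (by gcongr)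
    linarith
  have hpa : ‖p * a - Q.ι N‖ ≤ 2 * δ₀ := by
    rw [← norm_star, star_sub, star_mul, hps, hasa.star_eq, ← Q.map_star, hNs.star_eq]
    exact hap
  obtain ⟨E, hE0, hE1, hEkl, hEkk, hEN, hPE, hEτ⟩ := Q.exists_divide Γ (κ := δ / 4) (by positivity)
    hK hrank hNs hPN hNn hg hg0 hg1 L
  have hEn : ∀ k, ‖Q.ι (E k)‖ ≤ 1 := fun k => by
    rw [CStarAlgebra.norm_le_one_iff_of_nonneg _ (hE0 k)]
    exact (Finset.single_le_sum (fun k _ => hE0 k) (Finset.mem_univ k)).trans hE1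
  have hga : ∀ r, ‖saCalculus (g r) a * p - Q.ι (Q.P * saCalculus (g r) N)‖ ≤ δ / 8 := by
    intro r
    have h1 := H r a (Q.ι N) p hasa (Q.map_isSelfAdjoint hNs) (han.trans (by norm_num)) hNιn hpn (by
      rw [hp, Q.mul_map]
      exact hap.trans (by linarith [hηle r]))
    have h2 : p * cfc (g r) (Q.ι N) = Q.ι (Q.P * saCalculus (g r) N) := by
      have h3 := congrArg star (Q.saCalculus_map hNs hPN (g r))
      rw [star_mul, ← hp, hps, (isSelfAdjoint_saCalculus (g r) (Q.ι N)).star_eq, ← Q.map_star,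
        star_mul,
        Q.star_P, (isSelfAdjoint_saCalculus (M := MatFun X m) (g r) N).star_eq] at h3
      exact h3
    rwa [h2] at h1
  refine ⟨fun k => Q.ι (E k), hE0, hE1, fun k l h => (hEkl k l h).trans (by linarith),
    fun k => (hEkk k).trans (by linarith), fun k => ?_, fun r τ hτ k l => ?_, fun τ hτ => ?_⟩
  · have e : a * Q.ι (E k) - Q.ι (E k) * a = (a * p - Q.ι N) * Q.ι (E k)
        + (Q.ι N * Q.ι (E k) - Q.ι (E k) * Q.ι N) - Q.ι (E k) * (p * a - Q.ι N) := by
      rw [sub_mul, mul_sub, mul_assoc a, Q.mul_map, ← mul_assoc _ p, Q.map_mul_unit]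
      abel
    rw [e]
    have h1 : ‖(a * p - Q.ι N) * Q.ι (E k)‖ ≤ 2 * δ₀ * 1 := (norm_mul_le _ _).trans (by
      gcongr; exact hEn k)
    have h2 : ‖Q.ι (E k) * (p * a - Q.ι N)‖ ≤ 1 * (2 * δ₀) := (norm_mul_le _ _).trans (by
      gcongr; exact hEn k)
    refine (norm_sub_le _ _).trans ?_
    have := norm_add_le ((a * p - Q.ι N) * Q.ι (E k)) (Q.ι N * Q.ι (E k) - Q.ι (E k) * Q.ι N)
    linarith [hEN k]
  · have key : ∀ k, |(τ (saCalculus (g r) a * Q.ι (E k))).re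
        - (τ (Q.ι (Q.P * saCalculus (g r) N) * Q.ι (E k))).re| ≤ δ / 8 := by
      intro k
      refine (abs_re_trace_sub_le hτ _ _).trans ?_
      rw [← Q.mul_map (E k), ← mul_assoc, Q.mul_map, ← sub_mul]
      calc _ ≤ δ / 8 * 1 := (norm_mul_le _ _).trans (by gcongr; exacts [hga r, hEn k])
        _ = δ / 8 := mul_one _
    have h1 := abs_le.mp (key k)
    have h2 := abs_le.mp (key l)
    have h3 := abs_le.mp (hEτ r τ hτ k l)
    rw [abs_le]
    constructor <;> linarith [h1.1, h1.2, h2.1, h2.2, h3.1, h3.2]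
  · have h1 := htr τ hτ
    have h2 := abs_re_trace_sub_le hτ p (∑ k, Q.ι (E k))
    have h3 := (abs_le.mp (h2.trans hPE)).2
    have e : (1 : A) - ∑ k, Q.ι (E k) = (1 - p) + (p - ∑ k, Q.ι (E k)) := by abel
    rw [e, map_add, Complex.add_re, map_sub τ p, Complex.sub_re]
    linarith

end

/-! ### Copies along a local system -/

theorem trace_eq_ofReal {A : Type*} [CStarAlgebra A] [PartialOrder A] [StarOrderedRing A]
    (τ : A →ₚ[ℂ] ℂ) {a : A} (ha : 0 ≤ a) : τ a = ((τ a).re : ℂ) := by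
  have h : (0 : ℂ) ≤ τ a := by simpa using OrderHomClass.mono τ ha
  exact Complex.ext rfl (Complex.le_def.mp h).2.symm

namespace LocalSystem

variable {A : Type*} [CStarAlgebra A] [PartialOrder A] [StarOrderedRing A] {F : Set A} {ε : ℝ}
  {p : A} (L : LocalSystem F ε p)

/-- The sum of the copies of the elements `x j`, over the `j` of one colour. -/
noncomputable def copies (i : Bool) (x : L.J → A) : A :=
  ∑ j with L.color j = i, ∑ b, L.s j b * x j * star (L.s j b)

theorem norm_φ_le (j : L.J) : ‖L.φ j‖ ≤ 1 :=
  (CStarAlgebra.norm_le_one_iff_of_nonneg _ (L.φ_nonneg j)).mpr (L.φ_le_one j)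

theorem norm_s_le (j : L.J) (b : L.β j) : ‖L.s j b‖ ≤ 1 := by
  have h : L.s j b * star (L.s j b) ≤ 1 := by
    refine le_trans ?_ (L.sum_le_one (L.color j))
    refine le_trans ?_ (Finset.single_le_sum (f := fun j' => ∑ b, L.s j' b * star (L.s j' b))
      (fun j' _ => Finset.sum_nonneg fun b _ => mul_star_self_nonneg _)
      (Finset.mem_filter.mpr ⟨Finset.mem_univ j, rfl⟩))
    exact Finset.single_le_sum (f := fun b => L.s j b * star (L.s j b))
      (fun b _ => mul_star_self_nonneg _) (Finset.mem_univ b)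
  rw [← CStarAlgebra.norm_le_one_iff_of_nonneg _ (mul_star_self_nonneg _),
    CStarRing.norm_self_mul_star] at h
  nlinarith [norm_nonneg (L.s j b)]

theorem copies_add (i : Bool) (x y : L.J → A) :
    L.copies i (x + y) = L.copies i x + L.copies i y := by
  simp only [copies, Pi.add_apply, mul_add, add_mul, Finset.sum_add_distrib]

theorem copies_smul (i : Bool) (c : ℂ) (x : L.J → A) : L.copies i (c • x) = c • L.copies i x := by
  simp only [copies, Pi.smul_apply, mul_smul_comm, smul_mul_assoc, Finset.smul_sum]

/-- Forming copies is linear. -/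
noncomputable def copiesₗ (i : Bool) : (L.J → A) →ₗ[ℂ] A where
  toFun := L.copies i
  map_add' := L.copies_add i
  map_smul' := L.copies_smul i

theorem copies_sub (i : Bool) (x y : L.J → A) :
    L.copies i (x - y) = L.copies i x - L.copies i y := map_sub (L.copiesₗ i) x y

theorem copies_sum {κ : Type*} (i : Bool) (t : Finset κ) (x : κ → L.J → A) :
    L.copies i (∑ k ∈ t, x k) = ∑ k ∈ t, L.copies i (x k) := map_sum (L.copiesₗ i) x t

theorem copies_mul (i : Bool) (x : L.J → A) {y : L.J → A} (hy : ∀ j, L.e j * y j = y j) :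
    L.copies i x * L.copies i y = L.copies i (x * y) := by
  classical
  rw [copies, copies, copies, Finset.sum_mul]
  refine Finset.sum_congr rfl fun j hj => ?_
  rw [Finset.sum_mul]
  refine Finset.sum_congr rfl fun b _ => ?_
  rw [Finset.mul_sum, Finset.sum_eq_single_of_mem j hj, Finset.mul_sum,
    Finset.sum_eq_single_of_mem b (Finset.mem_univ b)]
  · calc _ = L.s j b * x j * (star (L.s j b) * L.s j b) * y j * star (L.s j b) := by
          simp only [mul_assoc]
      _ = L.s j b * x j * (L.e j * (L.e j * y j)) * star (L.s j b) := by
          rw [L.star_mul_self]; simp only [mul_assoc]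
      _ = _ := by rw [hy, hy, Pi.mul_apply]; simp only [mul_assoc]
  · intro b' _ hb
    calc _ = L.s j b * x j * (star (L.s j b) * L.s j b') * y j * star (L.s j b') := by
          simp only [mul_assoc]
      _ = 0 := by rw [L.star_mul_of_ne j b b' hb.symm]; simp
  · intro j' hj' hne
    rw [Finset.mul_sum]
    refine Finset.sum_eq_zero fun b' _ => ?_
    have hcol : L.color j = L.color j' :=
      (Finset.mem_filter.mp hj).2.trans (Finset.mem_filter.mp hj').2.symm
    calc _ = L.s j b * x j * (star (L.s j b) * L.s j' b') * y j' * star (L.s j' b') := by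
          simp only [mul_assoc]
      _ = 0 := by rw [L.star_mul_of_color j j' hne.symm hcol]; simp

theorem copies_nonneg (i : Bool) {x : L.J → A} (hx : ∀ j, 0 ≤ x j) : 0 ≤ L.copies i x :=
  Finset.sum_nonneg fun j _ => Finset.sum_nonneg fun _ _ => star_right_conjugate_nonneg (hx j) _

theorem copies_mono (i : Bool) {x y : L.J → A} (h : ∀ j, x j ≤ y j) :
    L.copies i x ≤ L.copies i y :=
  Finset.sum_le_sum fun j _ => Finset.sum_le_sum fun _ _ =>
    star_right_conjugate_le_conjugate (h j) _

theorem copies_le_one (i : Bool) {x : L.J → A} (h : ∀ j, x j ≤ 1) : L.copies i x ≤ 1 :=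
  (L.copies_mono i h).trans (by
    refine le_of_eq_of_le ?_ (L.sum_le_one i)
    simp only [copies, mul_one])

theorem norm_copies_le (i : Bool) {x : L.J → A} (h0 : ∀ j, 0 ≤ x j) (h1 : ∀ j, x j ≤ 1) :
    ‖L.copies i x‖ ≤ 1 :=
  (CStarAlgebra.norm_le_one_iff_of_nonneg _ (L.copies_nonneg i h0)).mpr (L.copies_le_one i h1)

theorem copies_eq : L.copies false (fun j => L.φ j * L.φ j)
    + L.copies true (fun j => L.φ j * L.φ j) = p := by
  classical
  refine Eq.trans ?_ L.sum_eq
  rw [copies, copies, ← Finset.sum_filter_add_sum_filter_not Finset.univ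
    (fun j => L.color j = false)]
  congr 1
  refine Finset.sum_congr ?_ fun _ _ => rfl
  ext j
  simp

/-- The number of copies. -/
noncomputable def total : ℝ := ∑ j, (Fintype.card (L.β j) : ℝ)

theorem total_nonneg : 0 ≤ L.total := Finset.sum_nonneg fun _ _ => Nat.cast_nonneg _

theorem norm_copies_le_total (i : Bool) {x : L.J → A} {δ : ℝ} (h : ∀ j, ‖x j‖ ≤ δ)
    (hδ : 0 ≤ δ) : ‖L.copies i x‖ ≤ L.total * δ := by
  classical
  refine (norm_sum_le _ _).trans ?_
  rw [total, Finset.sum_mul]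
  refine (Finset.sum_le_sum_of_subset_of_nonneg (Finset.filter_subset _ _)
    fun _ _ _ => norm_nonneg _).trans (Finset.sum_le_sum fun j _ => (norm_sum_le _ _).trans ?_)
  rw [← nsmul_eq_mul, ← Finset.card_univ]
  refine Finset.sum_le_card_nsmul _ _ _ fun b _ => norm_mul₃_le.trans ?_
  rw [norm_star]
  calc _ ≤ 1 * δ * 1 := by
        gcongr
        exacts [L.norm_s_le j b, h j, L.norm_s_le j b]
    _ = δ := by ring

theorem trace_copies {τ : A →ₚ[ℂ] ℂ} (hτ : τ ∈ tracialStateSpace A) (i : Bool) {x : L.J → A}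
    (hx : ∀ j, L.e j * x j = x j) :
    τ (L.copies i x) = ∑ j with L.color j = i, (Fintype.card (L.β j) : ℂ) * τ (x j) := by
  rw [copies, map_sum]
  refine Finset.sum_congr rfl fun j _ => ?_
  rw [map_sum, ← nsmul_eq_mul, ← Finset.card_univ]
  refine Finset.sum_eq_card_nsmul fun b _ => ?_
  rw [trace_mul_comm hτ, ← mul_assoc, L.star_mul_self, mul_assoc, hx, hx]

theorem norm_commutator_copies_le {f : A} (hf : f ∈ F) (i : Bool) {x : L.J → A}
    (hx : ∀ j, L.e j * x j = x j) (h0 : ∀ j, 0 ≤ x j) (h1 : ∀ j, x j ≤ 1) :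
    ‖f * L.copies i x - L.copies i x * f‖ ≤ ε :=
  L.norm_commutator_le f hf i x hx h0 h1

/-- If the traces of the elements `x j` and `c • y j` almost agree, so do the traces of the
products of their copies with the elements of `F`. -/
theorem norm_trace_mul_copies_sub_le {f : A} (hf : f ∈ F) {τ : A →ₚ[ℂ] ℂ}
    (hτ : τ ∈ tracialStateSpace A) (i : Bool) {x y : L.J → A} (hx : ∀ j, L.e j * x j = x j)
    (hx0 : ∀ j, 0 ≤ x j) (hx1 : ∀ j, x j ≤ 1) (hy : ∀ j, L.e j * y j = y j)
    (hy0 : ∀ j, 0 ≤ y j) (hy1 : ∀ j, y j ≤ 1) {c η : ℝ} (hc0 : 0 ≤ c) (hc1 : c ≤ 1)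
    (h : ∀ j, |(τ (x j)).re - c * (τ (y j)).re| ≤ η) (hη : (∑ j, ‖L.weight f j‖) * η ≤ ε) :
    |(τ (f * L.copies i x)).re - c * (τ (f * L.copies i y)).re| ≤ 3 * ε := by
  have h1 := L.norm_trace_sub_le f hf τ hτ i x hx hx0 hx1
  have h2 := L.norm_trace_sub_le f hf τ hτ i y hy hy0 hy1
  have hε : 0 ≤ ε := (norm_nonneg _).trans h1
  have h3 : ‖(∑ j with L.color j = i, L.weight f j * τ (x j))
      - c * ∑ j with L.color j = i, L.weight f j * τ (y j)‖ ≤ ε := by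
    rw [Finset.mul_sum, ← Finset.sum_sub_distrib]
    refine (norm_sum_le _ _).trans (le_trans ?_ hη)
    rw [Finset.sum_mul]
    refine (Finset.sum_le_sum_of_subset_of_nonneg (Finset.filter_subset _ _)
      fun _ _ _ => norm_nonneg _).trans (Finset.sum_le_sum fun j _ => ?_)
    rw [mul_left_comm, ← mul_sub, norm_mul]
    refine mul_le_mul_of_nonneg_left ?_ (norm_nonneg _)
    rw [trace_eq_ofReal τ (hx0 j), trace_eq_ofReal τ (hy0 j), ← Complex.ofReal_mul,
      ← Complex.ofReal_sub, Complex.norm_real, Real.norm_eq_abs]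
    exact h j
  have h4 : ‖τ (f * L.copies i x) - c * τ (f * L.copies i y)‖ ≤ 3 * ε := by
    have e : τ (f * L.copies i x) - c * τ (f * L.copies i y)
        = (τ (f * L.copies i x) - ∑ j with L.color j = i, L.weight f j * τ (x j))
          + ((∑ j with L.color j = i, L.weight f j * τ (x j))
            - c * ∑ j with L.color j = i, L.weight f j * τ (y j))
          - c * (τ (f * L.copies i y) - ∑ j with L.color j = i, L.weight f j * τ (y j)) := by
      ring
    rw [e]
    have h5 : ‖(c : ℂ) * (τ (f * L.copies i y)
        - ∑ j with L.color j = i, L.weight f j * τ (y j))‖ ≤ 1 * ε := by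
      rw [norm_mul, Complex.norm_real, Real.norm_of_nonneg hc0]
      gcongr
      exact h2
    refine (norm_sub_le _ _).trans ?_
    have := norm_add_le (τ (f * L.copies i x) - ∑ j with L.color j = i, L.weight f j * τ (x j))
      ((∑ j with L.color j = i, L.weight f j * τ (x j))
            - c * ∑ j with L.color j = i, L.weight f j * τ (y j))
    change ‖τ (f * L.copies i x) - _‖ ≤ ε at h1
    linarith
  have h5 := (Complex.abs_re_le_norm _).trans h4
  rwa [Complex.sub_re, Complex.re_ofReal_mul] at h5

end LocalSystem

/-! ### Orthogonal almost central elements -/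

section

variable {A : Type*} [CStarAlgebra A] [PartialOrder A] [StarOrderedRing A]

theorem spectrum_subset_Icc {a : A} (h0 : 0 ≤ a) {R : ℝ} (hR : ‖a‖ ≤ R) {t : ℝ}
    (ht : t ∈ spectrum ℝ a) : 0 ≤ t ∧ t ≤ R := by
  refine ⟨spectrum_nonneg_of_nonneg h0 ht, ?_⟩
  have := spectrum.norm_le_norm_mul_of_mem ht
  rcases subsingleton_or_nontrivial A with hs | hs
  · simp [spectrum.of_subsingleton] at ht
  · rw [norm_one, mul_one] at this
    exact (le_abs_self t).trans (this.trans hR)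

theorem saCalculus_clamp_pow {a : A} (h0 : 0 ≤ a) (h1 : a ≤ 1) (n : ℕ) :
    saCalculus (rampMap 0 1 ^ n) a = a ^ n := by
  have hn := (CStarAlgebra.norm_le_one_iff_of_nonneg a h0).mpr h1
  have hsa : IsSelfAdjoint a := IsSelfAdjoint.of_nonneg h0
  rw [← cfc_pow_id (R := ℝ) a n hsa]
  refine cfc_congr fun t ht => ?_
  obtain ⟨ht0, ht1⟩ := spectrum_subset_Icc h0 hn ht
  have : ramp 0 1 t = t := by
    rw [ramp, sub_zero, sub_zero, div_one, min_eq_right ht1, max_eq_right ht0]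
  change ramp 0 1 t ^ n = t ^ n
  rw [this]

theorem saCalculus_nonneg {g : C(ℝ, ℝ)} (hg : ∀ t, 0 ≤ g t) (a : A) : 0 ≤ saCalculus g a :=
  cfc_nonneg fun t _ => hg t

theorem saCalculus_le_one {g : C(ℝ, ℝ)} (hg : ∀ t, g t ≤ 1) (a : A) : saCalculus g a ≤ 1 :=
  cfc_le_one g a fun t _ => hg t

theorem IsDivision.norm_le_one {ι : Type} {a : A} {g : ι → C(ℝ, ℝ)} {L : ℕ} {δ : ℝ}
    {e : Fin (L + 1) → A} (h : IsDivision a g δ e) (k : Fin (L + 1)) : e k ≤ 1 :=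
  (Finset.single_le_sum (fun k _ => h.nonneg k) (Finset.mem_univ k)).trans h.sum_le_one

theorem IsDivision.abs_trace_mul_sub_le {ι : Type} {a : A} {g : ι → C(ℝ, ℝ)} {L : ℕ} {δ : ℝ}
    {e : Fin (L + 1) → A} (h : IsDivision a g δ e) {r : ι} (hg0 : ∀ t, 0 ≤ g r t)
    (hg1 : ∀ t, g r t ≤ 1) {τ : A →ₚ[ℂ] ℂ} (hτ : τ ∈ tracialStateSpace A) (k : Fin (L + 1)) :
    |(τ (saCalculus (g r) a * e k)).re - ((L : ℝ) + 1)⁻¹ * (τ (saCalculus (g r) a)).re|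
      ≤ 2 * δ := by
  set x := saCalculus (g r) a with hx
  have hx0 : 0 ≤ x := saCalculus_nonneg hg0 a
  have hxn : ‖x‖ ≤ 1 :=
    (CStarAlgebra.norm_le_one_iff_of_nonneg x hx0).mpr (saCalculus_le_one hg1 a)
  have h1 := trace_mul_nonneg hτ hx0 (sub_nonneg.mpr h.sum_le_one)
  have hs := trace_re_nonneg τ (sub_nonneg.mpr h.sum_le_one)
  have h2 := trace_mul_le_norm_mul hτ (IsSelfAdjoint.of_nonneg hx0) (sub_nonneg.mpr h.sum_le_one)
  have h3 : (τ (x * (1 - ∑ k, e k))).re ≤ δ :=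
    h2.trans ((mul_le_of_le_one_left hs hxn).trans (h.trace_le τ hτ))
  rw [mul_sub, mul_one, Finset.mul_sum, map_sub, map_sum, Complex.sub_re, Complex.re_sum] at h1 h3
  have h4 : |((L : ℝ) + 1) * (τ (x * e k)).re - ∑ l, (τ (x * e l)).re| ≤ (L + 1) * δ := by
    have e1 : ((L : ℝ) + 1) * (τ (x * e k)).re = ∑ _l : Fin (L + 1), (τ (x * e k)).re := by simp
    rw [e1, ← Finset.sum_sub_distrib]
    refine (Finset.abs_sum_le_sum_abs _ _).trans ?_
    refine (Finset.sum_le_sum fun l _ => h.abs_trace_sub_le r τ hτ k l).trans ?_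
    simp
  have hL : (1 : ℝ) ≤ L + 1 := by simp
  have hδ : 0 ≤ δ := h1.trans h3
  have e2 : (τ (x * e k)).re - ((L : ℝ) + 1)⁻¹ * (τ x).re
      = ((L : ℝ) + 1)⁻¹ * (((L : ℝ) + 1) * (τ (x * e k)).re - (τ x).re) := by
    field_simp
  rw [e2, abs_mul, abs_of_pos (by positivity), inv_mul_le_iff₀ (by positivity)]
  have := abs_le.mp h4
  rw [abs_le]
  constructor <;> nlinarith [this.1, this.2]

/-- The second moment of two positive elements with sum `p` is at least half of `p`. -/
theorem trace_mul_le_two_mul_add {τ : A →ₚ[ℂ] ℂ} (hτ : τ ∈ tracialStateSpace A) {f p y z : A}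
    (hf : 0 ≤ f) (hy : IsSelfAdjoint y) (hz : IsSelfAdjoint z) (hp : y + z = p)
    (hpp : p * p = p) :
    (τ (f * p)).re ≤ 2 * ((τ (f * (y * y))).re + (τ (f * (z * z))).re) := by
  have h1 : 0 ≤ (y - z) * (y - z) := (hy.sub hz).mul_self_nonneg
  have h2 := trace_mul_nonneg hτ hf h1
  have e : f * ((y - z) * (y - z)) = (2 : ℂ) • (f * (y * y)) + (2 : ℂ) • (f * (z * z)) - f * p := by
    conv_rhs => rw [← hpp, ← hp]
    simp only [two_smul]
    noncomm_ring
  rw [e, map_sub, map_add, map_smul, map_smul, Complex.sub_re, Complex.add_re] at h2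
  simp only [smul_eq_mul, Complex.mul_re, Complex.re_ofNat, Complex.im_ofNat, zero_mul,
    sub_zero] at h2
  linarith

theorem trace_mul_mul_ge {τ : A →ₚ[ℂ] ℂ} (hτ : τ ∈ tracialStateSpace A) {r y z : A} {ε : ℝ}
    (hr : IsSelfAdjoint r) (hrn : ‖r‖ ≤ 1) (hy : 0 ≤ y) (hz : 0 ≤ z) (hzn : ‖z‖ ≤ 1)
    (h : ‖r * y - y * r‖ ≤ ε) : -ε ≤ (τ (r * r * (y * z))).re := by
  have h1 : 0 ≤ (τ (r * y * r * z)).re := by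
    refine trace_mul_nonneg hτ ?_ hz
    have := star_left_conjugate_nonneg hy r
    rwa [hr.star_eq] at this
  have h2 := (abs_le.mp (abs_re_trace_sub_le hτ (r * r * (y * z)) (r * y * r * z))).1
  have e : r * r * (y * z) - r * y * r * z = r * ((r * y - y * r) * z) := by noncomm_ring
  rw [e] at h2
  have h3 : ‖r * ((r * y - y * r) * z)‖ ≤ 1 * (ε * 1) := by
    have hε : 0 ≤ ε := (norm_nonneg _).trans h
    refine (norm_mul_le _ _).trans ?_
    gcongr
    exact (norm_mul_le _ _).trans (by gcongr)
  linarith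

end

section

variable {A : Type*} [CStarAlgebra A] [PartialOrder A] [StarOrderedRing A]

/-- Inside the algebra there are positive contractions which almost commute with `F` and have
almost the mean value `1/8` on `F`, and whose spread is bounded below: in each patch, take an eighth
of the unit. -/
theorem exists_spread_element (hA : IsSimpleCStarAlgebra A) (hinf : ¬ FiniteDimensional ℂ A)
    (hTR : TracialRankLE 1 A) (F : Finset A) (hF : ∀ f ∈ F, ‖f‖ ≤ 1) {ε : ℝ} (hε : 0 < ε) :
    ∃ h : A, 0 ≤ h ∧ ‖h‖ ≤ 2 ∧ (∀ f ∈ F, ‖f * h - h * f‖ ≤ ε) ∧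
      ∀ τ ∈ tracialStateSpace A, ∀ f ∈ F, 0 ≤ f →
        (τ (f * h)).re ≤ (τ f).re / 8 + ε ∧ (τ f).re / 16 - ε ≤ (τ (f * (h * h))).re := by
  classical
  set ε₁ := ε / 12 with hε₁
  have hε₁0 : 0 < ε₁ := by positivity
  obtain ⟨p, hp, hptr, ⟨S⟩⟩ := exists_localSystem_trace_le hA hinf hTR
    (F ∪ F.image CFC.sqrt) hε₁0
  set w : ℝ := ∑ f ∈ F, ∑ j, ‖S.weight f j‖ with hw
  have hw0 : 0 ≤ w := Finset.sum_nonneg fun _ _ => Finset.sum_nonneg fun _ _ => norm_nonneg _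
  set δ := ε₁ / (5 * (w + 1)) with hδ
  have hδ0 : 0 < δ := by positivity
  have hwδ : ∀ f ∈ F, (∑ j, ‖S.weight f j‖) * (5 * δ) ≤ ε₁ := by
    intro f hf
    have h1 : ∑ j, ‖S.weight f j‖ ≤ w := Finset.single_le_sum (f := fun f => ∑ j, ‖S.weight f j‖)
      (fun _ _ => Finset.sum_nonneg fun _ _ => norm_nonneg _) hf
    have h2 : (w + 1) * (5 * δ) = ε₁ := by rw [hδ]; field_simp
    nlinarith
  let g : Fin 2 → C(ℝ, ℝ) := ![rampMap 0 1 ^ 2, rampMap 0 1 ^ 4]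
  have hr : ∀ n : ℕ, Monotone ((rampMap 0 1 ^ n : C(ℝ, ℝ)) : ℝ → ℝ)
      ∧ (∀ t, 0 ≤ (rampMap 0 1 ^ n : C(ℝ, ℝ)) t) ∧ ∀ t, (rampMap 0 1 ^ n : C(ℝ, ℝ)) t ≤ 1 := by
    have hv : ∀ (n : ℕ) t, (rampMap 0 1 ^ n : C(ℝ, ℝ)) t = ramp 0 1 t ^ n := fun n t => by
      rw [ContinuousMap.pow_apply]; rfl
    refine fun n => ⟨fun s t h => ?_, fun t => ?_, fun t => ?_⟩
    · rw [hv, hv]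
      exact pow_le_pow_left₀ (ramp_nonneg _ _ _) (ramp_mono zero_lt_one h) n
    · rw [hv]
      exact pow_nonneg (ramp_nonneg _ _ _) n
    · rw [hv]
      exact pow_le_one₀ (ramp_nonneg _ _ _) (ramp_le_one _ _ _)
  have hg : ∀ r, ∃ n, g r = rampMap 0 1 ^ n := by
    intro r
    fin_cases r
    exacts [⟨2, rfl⟩, ⟨4, rfl⟩]
  have hdiv : ∀ j, ∃ e : Fin (7 + 1) → A, IsDivision (S.φ j) g δ e := fun j =>
    exists_isDivision hA hinf hTR (S.φ_nonneg j) (S.φ_le_one j)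
      (fun r => by obtain ⟨n, hn⟩ := hg r; rw [hn]; exact (hr n).1)
      (fun r => by obtain ⟨n, hn⟩ := hg r; rw [hn]; exact (hr n).2.1)
      (fun r => by obtain ⟨n, hn⟩ := hg r; rw [hn]; exact (hr n).2.2) 7 hδ0
  choose e he using hdiv
  set x : S.J → A := fun j => S.φ j * e j 0 * S.φ j with hx
  set y : S.J → A := fun j => S.φ j * S.φ j with hy
  have hφs : ∀ j, star (S.φ j) = S.φ j := fun j => IsSelfAdjoint.of_nonneg (S.φ_nonneg j)
  have hy0 : ∀ j, 0 ≤ y j := fun j => (IsSelfAdjoint.of_nonneg (S.φ_nonneg j)).mul_self_nonneg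
  have hsq1 : ∀ z : A, IsSelfAdjoint z → ‖z‖ ≤ 1 → z * z ≤ 1 := fun z hz hzn =>
    IsSelfAdjoint.le_one_of_norm_le_one (by rw [IsSelfAdjoint, star_mul, hz.star_eq])
      ((norm_mul_le _ _).trans (mul_le_one₀ hzn (norm_nonneg _) hzn))
  have hy1 : ∀ j, y j ≤ 1 := fun j =>
    hsq1 _ (IsSelfAdjoint.of_nonneg (S.φ_nonneg j)) (S.norm_φ_le j)
  have hx0 : ∀ j, 0 ≤ x j := fun j => by
    have := star_left_conjugate_nonneg ((he j).nonneg 0) (S.φ j)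
    rwa [hφs] at this
  have hx1 : ∀ j, x j ≤ 1 := fun j => by
    have := star_left_conjugate_le_conjugate ((he j).norm_le_one 0) (S.φ j)
    rw [hφs, mul_one] at this
    exact this.trans (hy1 j)
  have hex : ∀ j, S.e j * x j = x j := fun j => by
    rw [hx, ← mul_assoc, ← mul_assoc, S.e_mul_φ]
  have hey : ∀ j, S.e j * y j = y j := fun j => by
    rw [hy, ← mul_assoc, S.e_mul_φ]
  have hn1 : ∀ z : A, 0 ≤ z → z ≤ 1 → ‖z‖ ≤ 1 := fun z h0 h1 =>
    (CStarAlgebra.norm_le_one_iff_of_nonneg z h0).mpr h1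
  have hsqs : ∀ z : S.J → A, (∀ j, 0 ≤ z j) → (∀ j, z j ≤ 1) → (∀ j, S.e j * z j = z j) →
      (∀ j, S.e j * (z * z) j = (z * z) j) ∧ (∀ j, 0 ≤ (z * z) j) ∧ (∀ j, (z * z) j ≤ 1) :=
    fun z h0 h1 hez => ⟨fun j => by rw [Pi.mul_apply, ← mul_assoc, hez],
      fun j => (IsSelfAdjoint.of_nonneg (h0 j)).mul_self_nonneg,
      fun j => hsq1 _ (IsSelfAdjoint.of_nonneg (h0 j)) (hn1 _ (h0 j) (h1 j))⟩
  obtain ⟨hexx, hxx0, hxx1⟩ := hsqs x hx0 hx1 hex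
  obtain ⟨heyy, hyy0, hyy1⟩ := hsqs y hy0 hy1 hey
  -- traces on the patches
  have htx : ∀ τ ∈ tracialStateSpace A, ∀ j,
      |(τ (x j)).re - 1 / 8 * (τ (y j)).re| ≤ 5 * δ := by
    intro τ hτ j
    have h1 := (he j).abs_trace_mul_sub_le (r := 0) (hr 2).2.1 (hr 2).2.2 hτ 0
    change |(τ (saCalculus (rampMap 0 1 ^ 2) (S.φ j) * e j 0)).re
      - _ * (τ (saCalculus (rampMap 0 1 ^ 2) (S.φ j))).re| ≤ 2 * δ at h1
    rw [saCalculus_clamp_pow (S.φ_nonneg j) (S.φ_le_one j), pow_two] at h1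
    have h2 : τ (x j) = τ (S.φ j * S.φ j * e j 0) := by
      rw [hx, trace_mul_comm hτ, ← mul_assoc]
    rw [h2]
    norm_num at h1
    norm_num
    exact h1.trans (by linarith)
  have htxx : ∀ τ ∈ tracialStateSpace A, ∀ j,
      |(τ ((x * x) j)).re - 1 / 8 * (τ ((y * y) j)).re| ≤ 5 * δ := by
    intro τ hτ j
    have h1 := (he j).abs_trace_mul_sub_le (r := 1) (hr 4).2.1 (hr 4).2.2 hτ 0
    change |(τ (saCalculus (rampMap 0 1 ^ 4) (S.φ j) * e j 0)).re
      - _ * (τ (saCalculus (rampMap 0 1 ^ 4) (S.φ j))).re| ≤ 2 * δ at h1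
    rw [saCalculus_clamp_pow (S.φ_nonneg j) (S.φ_le_one j)] at h1
    set φ := S.φ j with hφ
    set c := e j 0 with hc
    have hφ4 : φ ^ 4 = (y * y) j := by
      rw [Pi.mul_apply, hy]
      noncomm_ring
    have h2 : τ ((x * x) j) = τ (φ * φ * (c * φ * φ * c)) := by
      have e1 : (x * x) j = φ * (c * φ * φ * c * φ) := by
        rw [Pi.mul_apply, hx]
        simp only [mul_assoc]
        rw [← hφ, ← hc]
      rw [e1, trace_mul_comm hτ]
      have e2 : c * φ * φ * c * φ * φ = (c * φ * φ * c) * (φ * φ) := by simp only [mul_assoc]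
      rw [e2, trace_mul_comm hτ]
    have h3 : ‖φ * φ * (c * φ * φ * c) - φ ^ 4 * c‖ ≤ 3 * δ := by
      have e1 : φ * φ * (c * φ * φ * c) - φ ^ 4 * c = φ * φ * (φ * φ * (c * c - c)
          - (φ * c - c * φ) * φ * c - φ * (φ * c - c * φ) * c) := by
        noncomm_ring
      have hφn := S.norm_φ_le j
      have hcn := hn1 _ ((he j).nonneg 0) ((he j).norm_le_one 0)
      have b1 : ‖φ * φ * (c * c - c)‖ ≤ 1 * 1 * δ := norm_mul₃_le.trans (by
        gcongr
        exact (he j).norm_mul_self_sub_le 0)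
      have b2 : ‖(φ * c - c * φ) * φ * c‖ ≤ δ * 1 * 1 := norm_mul₃_le.trans (by
        gcongr
        exact (he j).norm_commutator_le 0)
      have b3 : ‖φ * (φ * c - c * φ) * c‖ ≤ 1 * δ * 1 := norm_mul₃_le.trans (by
        gcongr
        exact (he j).norm_commutator_le 0)
      rw [e1]
      calc _ ≤ 1 * 1 * (3 * δ) := norm_mul₃_le.trans (by
            gcongr
            refine (norm_sub_le _ _).trans ?_
            have := norm_sub_le (φ * φ * (c * c - c)) ((φ * c - c * φ) * φ * c)
            linarith)
        _ = 3 * δ := by ring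
    have h4 := abs_le.mp ((abs_re_trace_sub_le hτ _ _).trans h3)
    rw [← h2, hφ4] at h4
    rw [hφ4, show (((7 : ℕ) : ℝ) + 1)⁻¹ = 1 / 8 by norm_num] at h1
    have h5 := abs_le.mp h1
    rw [abs_le]
    constructor <;> linarith [h4.1, h4.2, h5.1, h5.2]
  -- assembling the patches
  set H : Bool → A := fun i => S.copies i x with hH
  set Y : Bool → A := fun i => S.copies i y with hY
  have hH0 : ∀ i, 0 ≤ H i := fun i => S.copies_nonneg i hx0
  have hHn : ∀ i, ‖H i‖ ≤ 1 := fun i => S.norm_copies_le i hx0 hx1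
  have hmem : ∀ f ∈ F, f ∈ ((F ∪ F.image CFC.sqrt : Finset A) : Set A) := fun f hf => by
    simp [hf]
  have hcomm : ∀ f ∈ ((F ∪ F.image CFC.sqrt : Finset A) : Set A), ∀ i,
      ‖f * H i - H i * f‖ ≤ ε₁ := fun f hf i => S.norm_commutator_copies_le hf i hex hx0 hx1
  have hpY : Y false + Y true = p := S.copies_eq
  have hYs : ∀ i, IsSelfAdjoint (Y i) := fun i => IsSelfAdjoint.of_nonneg (S.copies_nonneg i hy0)
  refine ⟨H false + H true, add_nonneg (hH0 _) (hH0 _), ?_, fun f hf => ?_,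
    fun τ hτ f hf hf0 => ?_⟩
  · exact (norm_add_le _ _).trans (by linarith [hHn false, hHn true])
  · have e1 : f * (H false + H true) - (H false + H true) * f
        = (f * H false - H false * f) + (f * H true - H true * f) := by
      rw [mul_add, add_mul]; abel
    rw [e1]
    refine (norm_add_le _ _).trans ?_
    linarith [hcomm f (hmem f hf) false, hcomm f (hmem f hf) true]
  · have b1 : ∀ i, |(τ (f * H i)).re - 1 / 8 * (τ (f * Y i)).re| ≤ 3 * ε₁ := fun i =>
      S.norm_trace_mul_copies_sub_le (hmem f hf) hτ i hex hx0 hx1 hey hy0 hy1 (by norm_num)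
        (by norm_num) (htx τ hτ) (hwδ f hf)
    have b2 : ∀ i, |(τ (f * (H i * H i))).re - 1 / 8 * (τ (f * (Y i * Y i))).re| ≤ 3 * ε₁ := by
      intro i
      simp only [hH, hY]
      rw [S.copies_mul i x hex, S.copies_mul i y hey]
      exact S.norm_trace_mul_copies_sub_le (hmem f hf) hτ i hexx hxx0 hxx1 heyy hyy0 hyy1
        (by norm_num) (by norm_num) (htxx τ hτ) (hwδ f hf)
    -- the mixed products contribute almost positive values
    have b3 : ∀ i i', -ε₁ ≤ (τ (f * (H i * H i'))).re := by
      intro i i'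
      have hs : CFC.sqrt f * CFC.sqrt f = f := CFC.sqrt_mul_sqrt_self f hf0
      have hss : IsSelfAdjoint (CFC.sqrt f) := IsSelfAdjoint.of_nonneg (CFC.sqrt_nonneg f)
      have hsn : ‖CFC.sqrt f‖ ≤ 1 := by
        have h1 : ‖CFC.sqrt f‖ * ‖CFC.sqrt f‖ ≤ 1 := by
          rw [← CStarRing.norm_star_mul_self, hss.star_eq, hs]
          exact hF f hf
        nlinarith [norm_nonneg (CFC.sqrt f)]
      have := trace_mul_mul_ge hτ hss hsn (hH0 i) (hH0 i') (hHn i')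
        (hcomm _ (by simp only [Finset.coe_union, Finset.coe_image]; exact Or.inr ⟨f, hf, rfl⟩) i)
      rwa [hs] at this
    have b4 : (τ (f * p)).re ≤ (τ f).re ∧ (τ f).re - ε₁ ≤ (τ (f * p)).re := by
      have h1 := trace_mul_nonneg hτ hf0 (sub_nonneg.mpr hp.le_one)
      have h2 := trace_mul_le_norm_mul hτ (IsSelfAdjoint.of_nonneg hf0)
        (sub_nonneg.mpr hp.le_one)
      have h3 := hptr τ hτ
      have h4 := trace_re_nonneg τ (sub_nonneg.mpr hp.le_one)
      have h5 : ‖f‖ * (τ (1 - p)).re ≤ ε₁ := (mul_le_of_le_one_left h4 (hF f hf)).trans h3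
      rw [mul_sub, mul_one, map_sub, Complex.sub_re] at h1 h2
      constructor <;> linarith
    have b5 : (τ (f * p)).re = (τ (f * Y false)).re + (τ (f * Y true)).re := by
      rw [← hpY, mul_add, map_add, Complex.add_re]
    have b6 := trace_mul_le_two_mul_add hτ hf0 (hYs false) (hYs true) hpY
      hp.isIdempotentElem.eq
    have hfr := trace_re_nonneg τ hf0
    constructor
    · rw [mul_add, map_add, Complex.add_re]
      have h1 := abs_le.mp (b1 false)
      have h2 := abs_le.mp (b1 true)
      linarith [h1.1, h1.2, h2.1, h2.2, b4.1, b4.2]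
    · have e1 : f * ((H false + H true) * (H false + H true)) = f * (H false * H false)
          + f * (H true * H true) + f * (H false * H true) + f * (H true * H false) := by
        noncomm_ring
      rw [e1, map_add, map_add, map_add, Complex.add_re, Complex.add_re, Complex.add_re]
      have h1 := abs_le.mp (b2 false)
      have h2 := abs_le.mp (b2 true)
      linarith [h1.1, h1.2, h2.1, h2.2, b4.1, b4.2, b3 false true, b3 true false]

/-- There are two orthogonal positive contractions which almost commute with `F` and are spread
evenly with respect to `F`. -/
theorem exists_orthogonal_pair (hA : IsSimpleCStarAlgebra A) (hinf : ¬ FiniteDimensional ℂ A)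
    (hTR : TracialRankLE 1 A) (F : Finset A) (hF : ∀ f ∈ F, ‖f‖ ≤ 1) {ε : ℝ} (hε : 0 < ε) :
    ∃ d : Bool → A, (∀ i, 0 ≤ d i ∧ d i ≤ 1) ∧ (∀ i i', i ≠ i' → d i * d i' = 0) ∧
      (∀ f ∈ F, ∀ i, ‖f * d i - d i * f‖ ≤ ε) ∧
      ∀ τ ∈ tracialStateSpace A, ∀ f ∈ F, 0 ≤ f → ∀ i,
        (τ f).re / 128 - ε ≤ (τ (f * d i)).re := by
  -- On `[0, 2]`, `q₀` vanishes beyond `1/4` and `q₁` before. As `q₀ t ≥ 1 - 4t` and `h` has mean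
  -- `1/8` at most, the mean of `q₀ h` is at least `1/2`; as `q₁ t ≥ t²/4 - t/16` and `h²` has mean
  -- at least `1/16`, that of `q₁ h` is at least `1/64 - 1/128`, up to small errors.
  let q₀ : ℝ → ℝ := fun t => max (1 - 4 * t) 0
  let q₁ : ℝ → ℝ := fun t => max (t ^ 2 / 4 - t / 16) 0
  have hc0 : Continuous q₀ := by fun_prop
  have hc1 : Continuous q₁ := by fun_prop
  obtain ⟨η₀, hη₀, H₀⟩ := exists_cfc_intertwine_le (A := A) hc0 2 hε
  obtain ⟨η₁, hη₁, H₁⟩ := exists_cfc_intertwine_le (A := A) hc1 2 hε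
  obtain ⟨h, h0, hn, hcomm, htr⟩ := exists_spread_element hA hinf hTR F hF
    (ε := min (min η₀ η₁) (ε / 4)) (by positivity)
  have hsa : IsSelfAdjoint h := IsSelfAdjoint.of_nonneg h0
  have hη0 : min (min η₀ η₁) (ε / 4) ≤ η₀ := (min_le_left _ _).trans (min_le_left _ _)
  have hη1 : min (min η₀ η₁) (ε / 4) ≤ η₁ := (min_le_left _ _).trans (min_le_right _ _)
  have hηε : min (min η₀ η₁) (ε / 4) ≤ ε / 4 := min_le_right _ _
  have hcm : ∀ f ∈ F, ‖h * f - f * h‖ ≤ min (min η₀ η₁) (ε / 4) := fun f hf => by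
    rw [norm_sub_rev]
    exact hcomm f hf
  have hmul : cfc q₀ h * cfc q₁ h = 0 := by
    rw [← cfc_mul q₀ q₁ h hc0.continuousOn hc1.continuousOn, ← cfc_zero ℝ h]
    refine cfc_congr fun t ht => ?_
    obtain ⟨ht0, -⟩ := spectrum_subset_Icc h0 hn ht
    rcases le_total t (1 / 4) with h1 | h1
    · have : q₁ t = 0 := max_eq_right (by nlinarith)
      simp [this]
    · have : q₀ t = 0 := max_eq_right (by linarith)
      simp [this]
  have hmul' : cfc q₁ h * cfc q₀ h = 0 := by
    have := congrArg star hmul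
    rwa [star_mul, (cfc_predicate q₀ h : IsSelfAdjoint _).star_eq,
      (cfc_predicate q₁ h : IsSelfAdjoint _).star_eq, star_zero] at this
  refine ⟨fun i => bif i then cfc q₁ h else cfc q₀ h, ?_, ?_, ?_, ?_⟩
  · rintro (_ | _)
    · exact ⟨cfc_nonneg fun t _ => le_max_right _ _, cfc_le_one q₀ h fun t ht =>
        max_le (by linarith [(spectrum_subset_Icc h0 hn ht).1]) zero_le_one⟩
    · refine ⟨cfc_nonneg fun t _ => le_max_right _ _, cfc_le_one q₁ h fun t ht =>
        max_le ?_ zero_le_one⟩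
      obtain ⟨h1, h2⟩ := spectrum_subset_Icc h0 hn ht
      nlinarith
  · rintro (_ | _) (_ | _) hne
    · exact absurd rfl hne
    · exact hmul
    · exact hmul'
    · exact absurd rfl hne
  · rintro f hf (_ | _)
    · rw [norm_sub_rev]
      exact H₀ h h f hsa hsa hn hn (hF f hf) ((hcm f hf).trans hη0)
    · rw [norm_sub_rev]
      exact H₁ h h f hsa hsa hn hn (hF f hf) ((hcm f hf).trans hη1)
  · rintro τ hτ f hf hf0 i
    obtain ⟨h1, h2⟩ := htr τ hτ f hf hf0
    have hfr := trace_re_nonneg τ hf0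
    rcases i with _ | _
    · have h3 : 1 - (4 : ℝ) • h ≤ cfc q₀ h := by
        have e1 : cfc (fun t : ℝ => 1 - 4 * t) h = 1 - (4 : ℝ) • h := by
          rw [cfc_sub (fun _ : ℝ => (1 : ℝ)) (fun t => 4 * t) h, cfc_const_one ℝ h,
            cfc_const_mul_id (4 : ℝ) h]
        rw [← e1]
        exact cfc_mono (fun t _ => le_max_left _ _) (by fun_prop) hc0.continuousOn
      have h4 := trace_mul_mono hτ hf0 h3
      rw [mul_sub, mul_one, mul_smul_comm, ← Complex.coe_smul, map_sub, map_smul, Complex.sub_re,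
        smul_eq_mul, Complex.re_ofReal_mul] at h4
      change _ ≤ (τ (f * cfc q₀ h)).re
      linarith
    · have h3 : (1 / 4 : ℝ) • (h * h) - (1 / 16 : ℝ) • h ≤ cfc q₁ h := by
        have e1 : cfc (fun t : ℝ => t ^ 2 / 4 - t / 16) h
            = (1 / 4 : ℝ) • (h * h) - (1 / 16 : ℝ) • h := by
          have e2 : (fun t : ℝ => t ^ 2 / 4 - t / 16)
              = fun t : ℝ => 1 / 4 * t ^ 2 - 1 / 16 * t := by
            funext t; ring
          rw [e2, cfc_sub (fun t : ℝ => 1 / 4 * t ^ 2) (fun t => 1 / 16 * t) h,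
            cfc_const_mul_id (1 / 16 : ℝ) h, cfc_const_mul (1 / 4 : ℝ) (fun t : ℝ => t ^ 2) h,
            cfc_pow_id h 2, pow_two]
        rw [← e1]
        exact cfc_mono (fun t _ => le_max_left _ _) (by fun_prop) hc1.continuousOn
      have h4 := trace_mul_mono hτ hf0 h3
      rw [mul_sub, mul_smul_comm, mul_smul_comm, ← Complex.coe_smul, ← Complex.coe_smul, map_sub,
        map_smul, map_smul, Complex.sub_re, smul_eq_mul, smul_eq_mul, Complex.re_ofReal_mul,
        Complex.re_ofReal_mul] at h4
      change _ ≤ (τ (f * cfc q₁ h)).re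
      linarith

end

/-! ### Spreading a commuting spectrum evenly -/

section

variable {A : Type*} [CStarAlgebra A] [PartialOrder A] [StarOrderedRing A]

/-- The weighted sum of the pieces of a division acts on each piece as multiplication by its weight,
up to cut-offs. -/
theorem IsDivision.norm_weighted_mul_sub_le {ι : Type} {a : A} {g : ι → C(ℝ, ℝ)} {L : ℕ} {δ : ℝ}
    {e : Fin (L + 1) → A} (h : IsDivision a g δ e) {ρ ρ₁ : A} (hρn : ‖ρ‖ ≤ 1) (hρ₁n : ‖ρ₁‖ ≤ 1)
    (hρ : ρ * ρ₁ = ρ₁) (hc : ∀ k, ‖ρ₁ * e k - e k * ρ₁‖ ≤ δ) {c : Fin (L + 1) → ℝ}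
    (hc0 : ∀ k, 0 ≤ c k) (hc1 : ∀ k, c k ≤ 1) (l : Fin (L + 1)) :
    ‖ρ * (∑ k, c k • e k) * ρ * (ρ₁ * e l * ρ₁) - c l • (ρ₁ * e l * ρ₁)‖
      ≤ 2 * (L + 1) * δ := by
  have hδ : 0 ≤ δ := (norm_nonneg _).trans (hc l)
  have hel : ‖e l‖ ≤ 1 :=
    (CStarAlgebra.norm_le_one_iff_of_nonneg _ (h.nonneg l)).mpr (h.norm_le_one l)
  set m := ∑ k, c k • e k with hm
  have h1 : ‖m * ρ₁ - ρ₁ * m‖ ≤ (L + 1) * δ := by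
    rw [hm, Finset.sum_mul, Finset.mul_sum, ← Finset.sum_sub_distrib]
    refine (norm_sum_le _ _).trans ?_
    calc _ ≤ ∑ _k : Fin (L + 1), δ := by
          refine Finset.sum_le_sum fun k _ => ?_
          rw [smul_mul_assoc, mul_smul_comm, ← smul_sub, norm_smul, Real.norm_of_nonneg (hc0 k),
            norm_sub_rev]
          exact (mul_le_of_le_one_left (norm_nonneg _) (hc1 k)).trans (hc k)
      _ = (L + 1) * δ := by simp
  have h2 : ‖m * e l - c l • e l‖ ≤ (L + 1) * δ := by
    have e1 : m * e l - c l • e l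
        = ∑ k, (c k • (e k * e l) - if k = l then c l • e l else 0) := by
      rw [Finset.sum_sub_distrib, Finset.sum_ite_eq' Finset.univ l, if_pos (Finset.mem_univ l), hm,
        Finset.sum_mul]
      simp only [smul_mul_assoc]
    rw [e1]
    refine (norm_sum_le _ _).trans ?_
    calc _ ≤ ∑ _k : Fin (L + 1), δ := by
          refine Finset.sum_le_sum fun k _ => ?_
          split_ifs with hk
          · subst hk
            rw [← smul_sub, norm_smul, Real.norm_of_nonneg (hc0 k)]
            exact (mul_le_of_le_one_left (norm_nonneg _) (hc1 k)).trans
              (h.norm_mul_self_sub_le k)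
          · rw [sub_zero, norm_smul, Real.norm_of_nonneg (hc0 k)]
            exact (mul_le_of_le_one_left (norm_nonneg _) (hc1 k)).trans (h.norm_mul_le k l hk)
      _ = (L + 1) * δ := by simp
  have e2 : ρ * m * ρ * (ρ₁ * e l * ρ₁) - c l • (ρ₁ * e l * ρ₁)
      = ρ * (m * ρ₁ - ρ₁ * m) * (e l * ρ₁) + ρ₁ * (m * e l - c l • e l) * ρ₁ := by
    have e3 : ρ * m * ρ * (ρ₁ * e l * ρ₁) = ρ * m * (ρ * ρ₁) * e l * ρ₁ := by
      simp only [mul_assoc]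
    have e4 : ρ * (m * ρ₁ - ρ₁ * m) * (e l * ρ₁)
        = ρ * m * ρ₁ * e l * ρ₁ - (ρ * ρ₁) * m * e l * ρ₁ := by noncomm_ring
    rw [e3, e4, hρ, mul_sub, sub_mul, mul_smul_comm, smul_mul_assoc]
    simp only [mul_assoc]
    abel
  rw [e2]
  refine (norm_add_le _ _).trans ?_
  have b1 : ‖ρ * (m * ρ₁ - ρ₁ * m) * (e l * ρ₁)‖ ≤ 1 * ((L + 1) * δ) * (1 * 1) :=
    norm_mul₃_le.trans (by
      gcongr
      exact (_root_.norm_mul_le _ _).trans (by gcongr))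
  have b2 : ‖ρ₁ * (m * e l - c l • e l) * ρ₁‖ ≤ 1 * ((L + 1) * δ) * 1 :=
    norm_mul₃_le.trans (by gcongr)
  linarith

/-- Elements under orthogonal almost central cut-offs are almost orthogonal. -/
theorem norm_mul_conj_mul_le {A : Type*} [CStarAlgebra A] {κ : ℝ} {d d' t t' φ φ' : A}
    (hdd : d * d' = 0) (hd : IsSelfAdjoint d)
    (hdn : ‖d‖ ≤ 1) (hdn' : ‖d'‖ ≤ 1) (ht : ‖t‖ ≤ 1) (ht' : ‖t'‖ ≤ 1) (hφ : ‖φ‖ ≤ 1)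
    (hφ' : ‖φ'‖ ≤ 1) (hc : ‖t * d - d * t‖ ≤ κ) (hc' : ‖t' * d' - d' * t'‖ ≤ κ) :
    ‖φ * d * star t * (t' * d' * φ')‖ ≤ 2 * κ := by
  have hκ : 0 ≤ κ := (norm_nonneg _).trans hc
  have hs : ‖d * star t - star t * d‖ ≤ κ := by
    rw [← norm_star, star_sub, star_mul, star_mul, star_star, hd.star_eq]
    exact hc
  have e1 : φ * d * star t * (t' * d' * φ')
      = φ * (d * star t - star t * d) * (t' * d' * φ')
        + φ * star t * d * ((t' * d' - d' * t') * φ') := by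
    have e2 : φ * (d * star t - star t * d) * (t' * d' * φ')
        + φ * star t * d * ((t' * d' - d' * t') * φ') = φ * d * star t * (t' * d' * φ')
        - φ * star t * (d * d') * t' * φ' := by noncomm_ring
    rw [e2, hdd]
    noncomm_ring
  rw [e1]
  refine (norm_add_le _ _).trans ?_
  have b1 : ‖φ * (d * star t - star t * d) * (t' * d' * φ')‖ ≤ 1 * κ * (1 * 1 * 1) :=
    norm_mul₃_le.trans (by
      gcongr
      exact norm_mul₃_le.trans (by gcongr))
  have b2 : ‖φ * star t * d * ((t' * d' - d' * t') * φ')‖ ≤ 1 * 1 * 1 * (κ * 1) := by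
    refine (norm_mul_le _ _).trans ?_
    gcongr
    · exact norm_mul₃_le.trans (by
        rw [norm_star]
        gcongr)
    · exact (norm_mul_le _ _).trans (by gcongr)
  linarith

namespace LocalSystem

variable {F : Set A} {ε : ℝ} {p : A} (L : LocalSystem F ε p)

theorem norm_copies_mul_copies_le {i i' : Bool} {x y : L.J → A} {η : ℝ} (hη : 0 ≤ η)
    (h : ∀ j j' b b', L.color j = i → L.color j' = i' →
      ‖x j * star (L.s j b) * (L.s j' b' * y j')‖ ≤ η) :
    ‖L.copies i x * L.copies i' y‖ ≤ L.total ^ 2 * η := by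
  classical
  have key : ∀ (i : Bool) (w : ∀ j, L.β j → A) (c : ℝ), 0 ≤ c →
      (∀ j b, L.color j = i → ‖w j b‖ ≤ c) →
      ‖∑ j with L.color j = i, ∑ b, w j b‖ ≤ L.total * c := by
    intro i w c hc hw
    refine (norm_sum_le _ _).trans ?_
    rw [total, Finset.sum_mul]
    refine (Finset.sum_le_sum (g := fun j => (Fintype.card (L.β j) : ℝ) * c) fun j hj =>
      (norm_sum_le _ _).trans ?_).trans
      (Finset.sum_le_sum_of_subset_of_nonneg (Finset.filter_subset _ _)
        fun _ _ _ => by positivity)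
    rw [← nsmul_eq_mul, ← Finset.card_univ]
    exact Finset.sum_le_card_nsmul _ _ _ fun b _ => hw j b (Finset.mem_filter.mp hj).2
  rw [copies, Finset.sum_mul]
  simp only [Finset.sum_mul]
  have ht := L.total_nonneg
  refine (key i _ (L.total * η) (by positivity) fun j b hj => ?_).trans (le_of_eq (by ring))
  rw [copies, Finset.mul_sum]
  simp only [Finset.mul_sum]
  refine key i' _ η hη fun j' b' hj' => ?_
  have e1 : L.s j b * x j * star (L.s j b) * (L.s j' b' * y j' * star (L.s j' b'))
      = L.s j b * (x j * star (L.s j b) * (L.s j' b' * y j')) * star (L.s j' b') := by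
    simp only [mul_assoc]
  rw [e1]
  refine norm_mul₃_le.trans ?_
  rw [norm_star]
  calc _ ≤ 1 * η * 1 := by
        gcongr
        exacts [L.norm_s_le j b, h j j' b b' hj hj', L.norm_s_le j' b']
    _ = η := by ring

theorem norm_copies_sub_mul_copies_le {i : Bool} {d : A} {x : L.J → A} {κ : ℝ} (hκ : 0 ≤ κ)
    (hx : ∀ j, L.color j = i → x j = L.φ j * d * L.φ j)
    (hc : ∀ j b, ‖L.s j b * L.φ j * d - d * (L.s j b * L.φ j)‖ ≤ κ) :
    ‖L.copies i x - d * L.copies i (fun j => L.φ j * L.φ j)‖ ≤ L.total * κ := by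
  classical
  rw [copies, copies, Finset.mul_sum, ← Finset.sum_sub_distrib]
  refine (norm_sum_le _ _).trans ?_
  rw [total, Finset.sum_mul]
  refine (Finset.sum_le_sum (g := fun j => (Fintype.card (L.β j) : ℝ) * κ) fun j hj => ?_).trans
      (Finset.sum_le_sum_of_subset_of_nonneg (Finset.filter_subset _ _)
        fun _ _ _ => by positivity)
  rw [Finset.mul_sum, ← Finset.sum_sub_distrib]
  refine (norm_sum_le _ _).trans ?_
  rw [← nsmul_eq_mul, ← Finset.card_univ]
  refine Finset.sum_le_card_nsmul _ _ _ fun b _ => ?_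
  have e1 : L.s j b * x j * star (L.s j b) - d * (L.s j b * (L.φ j * L.φ j) * star (L.s j b))
      = (L.s j b * L.φ j * d - d * (L.s j b * L.φ j)) * L.φ j * star (L.s j b) := by
    rw [hx j (Finset.mem_filter.mp hj).2]
    noncomm_ring
  rw [e1]
  refine norm_mul₃_le.trans ?_
  rw [norm_star]
  calc _ ≤ κ * 1 * 1 := by
        gcongr
        exacts [hc j b, L.norm_φ_le j, L.norm_s_le j b]
    _ = κ := by ring

end LocalSystem

end

section

variable {A : Type*} [CStarAlgebra A]

theorem saCalculus_mul (f g : C(ℝ, ℝ)) (a : A) :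
    saCalculus (f * g) a = saCalculus f a * saCalculus g a :=
  cfc_mul f g a f.continuous.continuousOn g.continuous.continuousOn

variable [PartialOrder A] [StarOrderedRing A]

theorem IsDivision.mono {ι : Type} {a : A} {g : ι → C(ℝ, ℝ)} {L : ℕ} {δ δ' : ℝ}
    {e : Fin (L + 1) → A} (h : IsDivision a g δ e) (hδ : δ ≤ δ') : IsDivision a g δ' e where
  nonneg := h.nonneg
  sum_le_one := h.sum_le_one
  norm_mul_le k l hkl := (h.norm_mul_le k l hkl).trans hδ
  norm_mul_self_sub_le k := (h.norm_mul_self_sub_le k).trans hδ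
  norm_commutator_le k := (h.norm_commutator_le k).trans hδ
  abs_trace_sub_le r τ hτ k l := (h.abs_trace_sub_le r τ hτ k l).trans hδ
  trace_le τ hτ := (h.trace_le τ hτ).trans hδ

/-- The square root of `rampMap s (s + 1)`. -/
noncomputable def sqrtRamp (s : ℝ) : C(ℝ, ℝ) :=
  ⟨fun t => √(ramp s (s + 1) t), (continuous_ramp _ _).sqrt⟩

theorem sqrtRamp_mul_self (s : ℝ) : sqrtRamp s * sqrtRamp s = rampMap s (s + 1) := by
  ext t
  exact Real.mul_self_sqrt (ramp_nonneg _ _ _)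

theorem sqrtRamp_nonneg (s t : ℝ) : 0 ≤ sqrtRamp s t := Real.sqrt_nonneg _

theorem sqrtRamp_le_one (s t : ℝ) : sqrtRamp s t ≤ 1 := by
  rw [← Real.sqrt_one]
  exact Real.sqrt_le_sqrt (ramp_le_one _ _ _)

/-- A positive contraction has a local unit for `sqrtRamp s`, which is divisible by `a`. -/
theorem exists_local_unit {s : ℝ} (hs : 0 < s) {a : A} (ha : 0 ≤ a) :
    ∃ ρ r : A, 0 ≤ ρ ∧ ρ ≤ 1 ∧ ‖r‖ ≤ 2 / s ∧ ρ = r * a ∧ ρ = a * r ∧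
      ρ * saCalculus (sqrtRamp s) a = saCalculus (sqrtRamp s) a := by
  have hsa : IsSelfAdjoint a := IsSelfAdjoint.of_nonneg ha
  let rf : C(ℝ, ℝ) := ⟨fun t => ramp (s / 2) s t / max t (s / 2), by
    refine (continuous_ramp _ _).div (by fun_prop) fun t => ?_
    have : s / 2 ≤ max t (s / 2) := le_max_right _ _
    positivity⟩
  have h1 : rampMap (s / 2) s = rf * ContinuousMap.id ℝ := by
    ext t
    change ramp (s / 2) s t = ramp (s / 2) s t / max t (s / 2) * t
    rcases le_total t (s / 2) with h | h
    · rw [ramp_of_le (by linarith) h]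
      simp
    · rw [max_eq_left h, div_mul_cancel₀]
      have : 0 < t := by linarith
      exact this.ne'
  have h2 : rampMap (s / 2) s * sqrtRamp s = sqrtRamp s := by
    ext t
    change ramp (s / 2) s t * √(ramp s (s + 1) t) = √(ramp s (s + 1) t)
    rcases le_total t s with h | h
    · rw [ramp_of_le (by linarith : s < s + 1) h]
      simp
    · rw [ramp_of_ge (by linarith) h, one_mul]
  have hid : saCalculus (ContinuousMap.id ℝ) a = a := saCalculus_id hsa
  refine ⟨saCalculus (rampMap (s / 2) s) a, saCalculus rf a,
    saCalculus_nonneg (ramp_nonneg _ _) a, saCalculus_le_one (ramp_le_one _ _) a, ?_, ?_, ?_, ?_⟩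
  · refine norm_cfc_le (by positivity) fun t _ => ?_
    change ‖ramp (s / 2) s t / max t (s / 2)‖ ≤ 2 / s
    have h3 : s / 2 ≤ max t (s / 2) := le_max_right _ _
    rw [Real.norm_of_nonneg (div_nonneg (ramp_nonneg _ _ _) (by linarith)),
      div_le_div_iff₀ (by linarith) hs]
    nlinarith [ramp_le_one (s / 2) s t]
  · rw [h1, saCalculus_mul, hid]
  · rw [h1, mul_comm, saCalculus_mul, hid]
  · rw [← saCalculus_mul, h2]

theorem sub_le_saCalculus_rampMap {s : ℝ} (hs : 0 < s) {a : A} (ha : 0 ≤ a) (ha1 : a ≤ 1) :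
    a - s • (1 : A) ≤ saCalculus (rampMap s (s + 1)) a := by
  have hsa : IsSelfAdjoint a := IsSelfAdjoint.of_nonneg ha
  have hn : ‖a‖ ≤ 1 := (CStarAlgebra.norm_le_one_iff_of_nonneg a ha).mpr ha1
  have e1 : cfc (fun t : ℝ => t - s) a = a - s • (1 : A) := by
    rw [cfc_sub (fun t : ℝ => t) (fun _ => s) a, cfc_id' ℝ a, cfc_const s a,
      Algebra.algebraMap_eq_smul_one]
  rw [← e1]
  refine cfc_mono (fun t ht => ?_) (by fun_prop) (rampMap s (s + 1)).continuous.continuousOn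
  obtain ⟨h0, h1⟩ := spectrum_subset_Icc ha hn ht
  change t - s ≤ max 0 (min 1 ((t - s) / (s + 1 - s)))
  rw [add_sub_cancel_left, div_one, min_eq_right (by linarith)]
  exact le_max_right _ _

theorem exists_pos_mul_le {C c : ℝ} (hC : 0 ≤ C) (hc : 0 < c) : ∃ κ > 0, κ * C ≤ c :=
  ⟨c / (C + 1), by positivity, by
    rw [div_mul_eq_mul_div, div_le_iff₀ (by positivity)]
    nlinarith⟩

/-- The heart of the matter: positive contractions `H i`, almost commuting with `F`, and pieces
`z i k` on which `H i` is almost the scalar `k / (N + 1)` and the other `H i'` almost vanishes. For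
each `i` the pieces cannot be told apart by the traces, even in products with the elements of `F`,
and altogether they have trace at least `1/130`. -/
theorem exists_spread (hA : IsSimpleCStarAlgebra A) (hinf : ¬ FiniteDimensional ℂ A)
    (hTR : TracialRankLE 1 A) (F : Finset A) (N : ℕ) {ε : ℝ} (hε : 0 < ε) :
    ∃ (H : Bool → A) (z : Bool → Fin (N + 1) → A), (∀ i, 0 ≤ H i ∧ ‖H i‖ ≤ 1) ∧
      (∀ f ∈ F, ∀ i, ‖f * H i - H i * f‖ ≤ ε) ∧ (∀ i k, 0 ≤ z i k) ∧ (∀ i k, ‖z i k‖ ≤ 1) ∧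
      (∀ i, ∑ k, z i k ≤ 1) ∧ (∀ f ∈ F, ∀ i k, ‖f * z i k - z i k * f‖ ≤ ε) ∧
      (∀ i k, ‖H i * z i k - ((k : ℝ) / (N + 1)) • z i k‖ ≤ ε) ∧
      (∀ i i' k, i ≠ i' → ‖H i * z i' k‖ ≤ ε) ∧
      (∀ τ ∈ tracialStateSpace A, ∀ f ∈ F, ∀ i k l,
        |(τ (f * z i k)).re - (τ (f * z i l)).re| ≤ ε) ∧
      ∀ τ ∈ tracialStateSpace A, 1 / 130 ≤ ∑ i, ∑ k, (τ (z i k)).re := by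
  classical
  obtain ⟨ε₁, hε₁0, hε₁⟩ : ∃ ε₁ > 0, 3 * ε₁ ≤ ε ∧ ε₁ ≤ 1 / 1000 :=
    ⟨min (ε / 3) (1 / 1000), by positivity, by linarith [min_le_left (ε / 3) (1 / 1000 : ℝ)],
      min_le_right _ _⟩
  obtain ⟨p, hp, hptr, ⟨S⟩⟩ := exists_localSystem_trace_le hA hinf hTR F hε₁0
  have hT := S.total_nonneg
  set s : ℝ := 1 / 100000 with hs
  have hs0 : 0 < s := by norm_num [hs]
  -- the orthogonal pair, chosen after the local system
  obtain ⟨κ, hκ0, hκ⟩ := exists_pos_mul_le (C := 1 + S.total + S.total ^ 2 * (2 / s * (2 / s * 2)))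
    (c := min ε (1 / 100000)) (by positivity) (by positivity)
  have hκ1 : κ ≤ 1 / 100000 := by
    have : κ * 1 ≤ κ * (1 + S.total + S.total ^ 2 * (2 / s * (2 / s * 2))) := by
      gcongr
      nlinarith [show 0 ≤ S.total ^ 2 * (2 / s * (2 / s * 2)) by positivity]
    linarith [min_le_right ε (1 / 100000)]
  have hκ2 : S.total * κ ≤ 1 / 100000 := by
    have : κ * S.total ≤ κ * (1 + S.total + S.total ^ 2 * (2 / s * (2 / s * 2))) := by
      gcongr
      nlinarith [show 0 ≤ S.total ^ 2 * (2 / s * (2 / s * 2)) by positivity]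
    linarith [min_le_right ε (1 / 100000)]
  have hκ3 : S.total ^ 2 * (2 / s * (2 / s * (2 * κ))) ≤ ε := by
    have : κ * (S.total ^ 2 * (2 / s * (2 / s * 2)))
        ≤ κ * (1 + S.total + S.total ^ 2 * (2 / s * (2 / s * 2))) := by
      gcongr
      linarith
    calc _ = κ * (S.total ^ 2 * (2 / s * (2 / s * 2))) := by ring
      _ ≤ _ := this
      _ ≤ _ := hκ
      _ ≤ ε := min_le_left _ _
  set Y : Bool → A := fun i => S.copies i (fun j => S.φ j * S.φ j) with hY
  have hφ2 : ∀ j, 0 ≤ S.φ j * S.φ j ∧ S.φ j * S.φ j ≤ 1 := fun j => by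
    have hsa := IsSelfAdjoint.of_nonneg (S.φ_nonneg j)
    exact ⟨hsa.mul_self_nonneg, IsSelfAdjoint.le_one_of_norm_le_one
      (by rw [IsSelfAdjoint, star_mul, hsa.star_eq])
      ((norm_mul_le _ _).trans (mul_le_one₀ (S.norm_φ_le j) (norm_nonneg _) (S.norm_φ_le j)))⟩
  have hsφ : ∀ j b, ‖S.s j b * S.φ j‖ ≤ 1 := fun j b =>
    (norm_mul_le _ _).trans (mul_le_one₀ (S.norm_s_le j b) (norm_nonneg _) (S.norm_φ_le j))
  have hY0 : ∀ i, 0 ≤ Y i := fun i => S.copies_nonneg i fun j => (hφ2 j).1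
  have hYn : ∀ i, ‖Y i‖ ≤ 1 := fun i =>
    S.norm_copies_le i (fun j => (hφ2 j).1) fun j => (hφ2 j).2
  obtain ⟨d, hd01, hdd, hdc, hdt⟩ := exists_orthogonal_pair hA hinf hTR
    ((Finset.univ.image fun q : Σ j, S.β j => S.s q.1 q.2 * S.φ q.1) ∪ Finset.univ.image Y) (by
      intro f hf
      rcases Finset.mem_union.mp hf with hf | hf
      · obtain ⟨q, -, rfl⟩ := Finset.mem_image.mp hf
        exact hsφ q.1 q.2
      · obtain ⟨i, -, rfl⟩ := Finset.mem_image.mp hf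
        exact hYn i) hκ0
  have hdc' : ∀ j b i, ‖S.s j b * S.φ j * d i - d i * (S.s j b * S.φ j)‖ ≤ κ := fun j b i =>
    hdc _ (Finset.mem_union_left _ (Finset.mem_image.mpr ⟨⟨j, b⟩, Finset.mem_univ _, rfl⟩)) i
  have hdsa : ∀ i, IsSelfAdjoint (d i) := fun i => IsSelfAdjoint.of_nonneg (hd01 i).1
  have hdn : ∀ i, ‖d i‖ ≤ 1 := fun i =>
    (CStarAlgebra.norm_le_one_iff_of_nonneg _ (hd01 i).1).mpr (hd01 i).2
  -- the parts of `φ j` under the member of the pair for the colour of `j`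
  set a : S.J → A := fun j => S.φ j * d (S.color j) * S.φ j with ha
  have hφs : ∀ j, star (S.φ j) = S.φ j := fun j => IsSelfAdjoint.of_nonneg (S.φ_nonneg j)
  have ha0 : ∀ j, 0 ≤ a j := fun j => by
    have := star_left_conjugate_nonneg (hd01 (S.color j)).1 (S.φ j)
    rwa [hφs] at this
  have ha1 : ∀ j, a j ≤ 1 := fun j => by
    have := star_left_conjugate_le_conjugate (hd01 (S.color j)).2 (S.φ j)
    rw [hφs, mul_one] at this
    exact this.trans (hφ2 j).2
  have han : ∀ j, ‖a j‖ ≤ 1 := fun j =>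
    (CStarAlgebra.norm_le_one_iff_of_nonneg _ (ha0 j)).mpr (ha1 j)
  have hea : ∀ j, S.e j * a j = a j := fun j => by
    rw [ha, ← mul_assoc, ← mul_assoc, S.e_mul_φ]
  -- the divisions, chosen after the orthogonal pair
  obtain ⟨δ, hδ0, hδ⟩ := exists_pos_mul_le
    (C := S.total + S.total * (2 * (N + 1)) + ∑ f ∈ F, ∑ j, ‖S.weight f j‖)
    (c := min ε₁ (1 / 100000)) (by positivity) (by positivity)
  have hw0 : 0 ≤ ∑ f ∈ F, ∑ j, ‖S.weight f j‖ := by positivity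
  have hδle : ∀ x, x ≤ S.total + S.total * (2 * (N + 1)) + ∑ f ∈ F, ∑ j, ‖S.weight f j‖ →
      x * δ ≤ ε₁ ∧ x * δ ≤ 1 / 100000 := fun x hx => by
    have : x * δ ≤ δ * (S.total + S.total * (2 * (N + 1)) + ∑ f ∈ F, ∑ j, ‖S.weight f j‖) := by
      rw [mul_comm]
      gcongr
    exact ⟨this.trans (hδ.trans (min_le_left _ _)), this.trans (hδ.trans (min_le_right _ _))⟩
  have hδ1 : S.total * δ ≤ 1 / 100000 := (hδle _ (by
    have : 0 ≤ S.total * (2 * ((N : ℝ) + 1)) := by positivity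
    linarith)).2
  have hδ2 : S.total * (2 * (N + 1) * δ) ≤ ε := by
    have := (hδle (S.total * (2 * (N + 1))) (by linarith)).1
    rw [← mul_assoc]
    linarith
  have hδ3 : ∀ f ∈ F, (∑ j, ‖S.weight f j‖) * δ ≤ ε₁ := fun f hf => (hδle _ (by
    have h1 : ∑ j, ‖S.weight f j‖ ≤ ∑ f ∈ F, ∑ j, ‖S.weight f j‖ :=
      Finset.single_le_sum (f := fun f => ∑ j, ‖S.weight f j‖)
        (fun _ _ => Finset.sum_nonneg fun _ _ => norm_nonneg _) hf
    have : 0 ≤ S.total * (2 * ((N : ℝ) + 1)) := by positivity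
    linarith)).1
  obtain ⟨η, hη0, hη⟩ := exists_cfc_intertwine_le (A := A) (sqrtRamp s).continuous 1 hδ0
  have hdiv : ∀ j, ∃ e : Fin (N + 1) → A,
      IsDivision (a j) (fun _ : Unit => rampMap s (s + 1)) (min δ η) e := fun j =>
    exists_isDivision hA hinf hTR (ha0 j) (ha1 j) (fun _ => ramp_mono (by linarith))
      (fun _ => ramp_nonneg _ _) (fun _ => ramp_le_one _ _) N (by positivity)
  choose e he' using hdiv
  have he : ∀ j, IsDivision (a j) (fun _ : Unit => rampMap s (s + 1)) δ (e j) := fun j =>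
    (he' j).mono (min_le_left _ _)
  set ρ₁ : S.J → A := fun j => saCalculus (sqrtRamp s) (a j) with hρ₁
  have hρ₁0 : ∀ j, 0 ≤ ρ₁ j := fun j => saCalculus_nonneg (sqrtRamp_nonneg s) _
  have hρ₁1 : ∀ j, ρ₁ j ≤ 1 := fun j => saCalculus_le_one (sqrtRamp_le_one s) _
  have hρ₁n : ∀ j, ‖ρ₁ j‖ ≤ 1 := fun j =>
    (CStarAlgebra.norm_le_one_iff_of_nonneg _ (hρ₁0 j)).mpr (hρ₁1 j)
  have hρ₁s : ∀ j, star (ρ₁ j) = ρ₁ j := fun j => IsSelfAdjoint.of_nonneg (hρ₁0 j)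
  have hρ₁2 : ∀ j, ρ₁ j * ρ₁ j = saCalculus (rampMap s (s + 1)) (a j) := fun j => by
    rw [hρ₁, ← saCalculus_mul, sqrtRamp_mul_self]
  have hρ₁e : ∀ j k, ‖ρ₁ j * e j k - e j k * ρ₁ j‖ ≤ δ := fun j k =>
    hη _ _ _ (IsSelfAdjoint.of_nonneg (ha0 j)) (IsSelfAdjoint.of_nonneg (ha0 j)) (han j) (han j)
      ((CStarAlgebra.norm_le_one_iff_of_nonneg _ ((he j).nonneg k)).mpr ((he j).norm_le_one k))
      (((he' j).norm_commutator_le k).trans (min_le_right _ _))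
  have hunit := fun j => exists_local_unit hs0 (ha0 j)
  choose ρ r hρ0 hρ1 hr hρr hρr' hρρ using hunit
  have hρn : ∀ j, ‖ρ j‖ ≤ 1 := fun j =>
    (CStarAlgebra.norm_le_one_iff_of_nonneg _ (hρ0 j)).mpr (hρ1 j)
  have hρs : ∀ j, star (ρ j) = ρ j := fun j => IsSelfAdjoint.of_nonneg (hρ0 j)
  have heρ : ∀ j, S.e j * ρ j = ρ j := fun j => by rw [hρr', ← mul_assoc, hea]
  have heρ₁ : ∀ j, S.e j * ρ₁ j = ρ₁ j := fun j => by
    have h1 : ρ j * ρ₁ j = ρ₁ j := hρρ j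
    rw [← h1, ← mul_assoc, heρ]
  have hN : (0 : ℝ) < N + 1 := by positivity
  set c : Fin (N + 1) → ℝ := fun k => (k : ℝ) / (N + 1) with hc
  have hc0 : ∀ k, 0 ≤ c k := fun k => by positivity
  have hc1 : ∀ k, c k ≤ 1 := fun k => by
    rw [hc, div_le_one hN]
    have : (k : ℕ) ≤ N := by omega
    have : ((k : ℕ) : ℝ) ≤ N := by exact_mod_cast this
    linarith
  set m : S.J → A := fun j => ∑ k, c k • e j k with hm
  have hm0 : ∀ j, 0 ≤ m j := fun j =>
    Finset.sum_nonneg fun k _ => smul_nonneg (hc0 k) ((he j).nonneg k)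
  have hm1 : ∀ j, m j ≤ 1 := fun j =>
    (Finset.sum_le_sum fun k _ => smul_le_of_le_one_left ((he j).nonneg k) (hc1 k)).trans
      (he j).sum_le_one
  have hmn : ∀ j, ‖m j‖ ≤ 1 := fun j =>
    (CStarAlgebra.norm_le_one_iff_of_nonneg _ (hm0 j)).mpr (hm1 j)
  -- conjugation of a positive contraction by a positive contraction
  have conj : ∀ x y : A, 0 ≤ x → x ≤ 1 → 0 ≤ y → y ≤ 1 → 0 ≤ x * y * x ∧ x * y * x ≤ 1 := by
    intro x y hx0 hx1 hy0 hy1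
    have hxs : IsSelfAdjoint x := IsSelfAdjoint.of_nonneg hx0
    have hxn := (CStarAlgebra.norm_le_one_iff_of_nonneg _ hx0).mpr hx1
    have hyn := (CStarAlgebra.norm_le_one_iff_of_nonneg _ hy0).mpr hy1
    have h0 : 0 ≤ x * y * x := by
      have := star_left_conjugate_nonneg hy0 x
      rwa [hxs.star_eq] at this
    refine ⟨h0, (CStarAlgebra.norm_le_one_iff_of_nonneg _ h0).mp (norm_mul₃_le.trans ?_)⟩
    calc _ ≤ (1 : ℝ) * 1 * 1 := by gcongr
      _ = 1 := by norm_num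
  -- the parts of `H i` and of the pieces on the patches
  set h : S.J → A := fun j => ρ j * m j * ρ j with hh
  have hh01 : ∀ j, 0 ≤ h j ∧ h j ≤ 1 := fun j => conj _ _ (hρ0 j) (hρ1 j) (hm0 j) (hm1 j)
  have heh : ∀ j, S.e j * h j = h j := fun j => by
    rw [hh, ← mul_assoc, ← mul_assoc, heρ]
  set x : Fin (N + 1) → S.J → A := fun k j => ρ₁ j * e j k * ρ₁ j with hx
  have hx01 : ∀ k j, 0 ≤ x k j ∧ x k j ≤ 1 := fun k j =>
    conj _ _ (hρ₁0 j) (hρ₁1 j) ((he j).nonneg k) ((he j).norm_le_one k)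
  have hex : ∀ k j, S.e j * x k j = x k j := fun k j => by
    rw [hx, ← mul_assoc, ← mul_assoc, heρ₁]
  refine ⟨fun i => S.copies i h, fun i k => S.copies i (x k),
    fun i => ⟨S.copies_nonneg i fun j => (hh01 j).1,
      S.norm_copies_le i (fun j => (hh01 j).1) fun j => (hh01 j).2⟩,
    fun f hf i => (S.norm_commutator_copies_le hf i heh (fun j => (hh01 j).1)
      fun j => (hh01 j).2).trans (by linarith), fun i k => S.copies_nonneg i fun j => (hx01 k j).1,
    fun i k => S.norm_copies_le i (fun j => (hx01 k j).1) fun j => (hx01 k j).2, fun i => ?_,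
    fun f hf i k => (S.norm_commutator_copies_le hf i (hex k) (fun j => (hx01 k j).1)
      fun j => (hx01 k j).2).trans (by linarith), fun i k => ?_, fun i i' k hii' => ?_,
    fun τ hτ f hf i k l => ?_, fun τ hτ => ?_⟩
  · rw [← S.copies_sum]
    refine S.copies_le_one i fun j => ?_
    rw [Finset.sum_apply]
    simp only [hx]
    rw [← Finset.sum_mul, ← Finset.mul_sum]
    exact (conj _ _ (hρ₁0 j) (hρ₁1 j) (Finset.sum_nonneg fun k _ => (he j).nonneg k)
      (he j).sum_le_one).2
  · have e1 : ((k : ℝ) / (N + 1)) • S.copies i (x k) = S.copies i (((c k : ℝ) : ℂ) • x k) := by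
      rw [S.copies_smul, Complex.coe_smul]
    rw [e1, S.copies_mul i h (hex k), ← S.copies_sub]
    refine (S.norm_copies_le_total i (fun j => ?_) (by positivity)).trans hδ2
    have := (he j).norm_weighted_mul_sub_le (hρn j) (hρ₁n j) (hρρ j) (hρ₁e j) hc0 hc1 k
    rw [Pi.sub_apply, Pi.mul_apply, Pi.smul_apply, Complex.coe_smul]
    exact this
  · refine (S.norm_copies_mul_copies_le (η := 2 / s * (2 / s * (2 * κ))) (by positivity)
      fun j j' b b' hj hj' => ?_).trans hκ3
    have e1 : h j * star (S.s j b) * (S.s j' b' * x k j')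
        = (ρ j * m j * r j) * (S.φ j * d i * star (S.s j b * S.φ j)
          * (S.s j' b' * S.φ j' * d i' * S.φ j')) * (r j' * (ρ₁ j' * e j' k * ρ₁ j')) := by
      have e2 : x k j' = a j' * r j' * (ρ₁ j' * e j' k * ρ₁ j') := by
        rw [← hρr', hx, ← mul_assoc, ← mul_assoc, hρρ]
      have e3 : h j = ρ j * m j * r j * a j := by
        rw [mul_assoc _ (r j), ← hρr]
      have e4 : a j = S.φ j * d i * S.φ j := by rw [← hj]
      have e5 : a j' = S.φ j' * d i' * S.φ j' := by rw [← hj']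
      rw [e2, e3, e4, e5, star_mul, hφs]
      simp only [mul_assoc]
    rw [e1]
    have b1 := norm_mul_conj_mul_le (hdd i i' hii') (hdsa i) (hdn i) (hdn i') (hsφ j b)
      (hsφ j' b') (S.norm_φ_le j) (S.norm_φ_le j') (hdc' j b i) (hdc' j' b' i')
    have b2 : ‖ρ j * m j * r j‖ ≤ 1 * 1 * (2 / s) := norm_mul₃_le.trans (by
      gcongr
      exacts [hρn j, hmn j, hr j])
    have b3 : ‖r j' * (ρ₁ j' * e j' k * ρ₁ j')‖ ≤ 2 / s * 1 := (norm_mul_le _ _).trans (by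
      gcongr
      · exact hr j'
      · exact (CStarAlgebra.norm_le_one_iff_of_nonneg _ (hx01 k j').1).mpr (hx01 k j').2)
    calc _ ≤ 1 * 1 * (2 / s) * (2 * κ) * (2 / s * 1) := norm_mul₃_le.trans (by gcongr)
      _ = _ := by ring
  · have key : ∀ j, ∀ k, τ (x k j) = τ (saCalculus (rampMap s (s + 1)) (a j) * e j k) := by
      intro j k
      rw [← hρ₁2, hx, trace_mul_comm hτ, ← mul_assoc]
    have := S.norm_trace_mul_copies_sub_le hf hτ i (hex k) (fun j => (hx01 k j).1)
      (fun j => (hx01 k j).2) (hex l) (fun j => (hx01 l j).1) (fun j => (hx01 l j).2)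
      zero_le_one le_rfl (fun j => by
        rw [one_mul, key, key]
        exact (he j).abs_trace_sub_le () τ hτ k l) (hδ3 f hf)
    rw [one_mul] at this
    exact this.trans hε₁.1
  · -- the trace of the pieces of one colour
    have key : ∀ i, (τ (Y i)).re / 128 - 4 / 100000 ≤ ∑ k, (τ (S.copies i (x k))).re := by
      intro i
      set g : S.J → A := fun j => saCalculus (rampMap s (s + 1)) (a j) with hg
      have hg0 : ∀ j, 0 ≤ g j := fun j => saCalculus_nonneg (ramp_nonneg _ _) _
      have hg1 : ∀ j, g j ≤ 1 := fun j => saCalculus_le_one (ramp_le_one _ _) _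
      have hgρ : ∀ j, g j = ρ₁ j * ρ₁ j := fun j => (hρ₁2 j).symm
      have heg : ∀ j, S.e j * g j = g j := fun j => by
        rw [hgρ, ← mul_assoc, heρ₁]
      have b1 : ∀ j, (τ (g j)).re - δ ≤ ∑ k, (τ (x k j)).re := by
        intro j
        have h1 := trace_mul_le_norm_mul hτ (IsSelfAdjoint.of_nonneg (hg0 j))
          (sub_nonneg.mpr (he j).sum_le_one)
        have h2 := (he j).trace_le τ hτ
        have h3 := trace_re_nonneg τ (sub_nonneg.mpr (he j).sum_le_one)
        have h4 : ‖g j‖ ≤ 1 :=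
          (CStarAlgebra.norm_le_one_iff_of_nonneg _ (hg0 j)).mpr (hg1 j)
        have h5 : (τ (g j * (1 - ∑ k, e j k))).re = (τ (g j)).re - ∑ k, (τ (x k j)).re := by
          rw [mul_sub, mul_one, Finset.mul_sum, map_sub, map_sum, Complex.sub_re, Complex.re_sum]
          congr 1
          refine Finset.sum_congr rfl fun k _ => ?_
          change _ = (τ (ρ₁ j * e j k * ρ₁ j)).re
          rw [hgρ, trace_mul_comm hτ (ρ₁ j * e j k), ← mul_assoc]
        nlinarith
      have b2 : (τ (S.copies i g)).re - S.total * δ ≤ ∑ k, (τ (S.copies i (x k))).re := by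
        have e1 : ∀ y : S.J → A, (∀ j, S.e j * y j = y j) → (τ (S.copies i y)).re
            = ∑ j with S.color j = i, (Fintype.card (S.β j) : ℝ) * (τ (y j)).re := by
          intro y hy
          rw [S.trace_copies hτ i hy, Complex.re_sum]
          refine Finset.sum_congr rfl fun j _ => ?_
          rw [← Complex.ofReal_natCast, Complex.re_ofReal_mul]
        rw [e1 g heg]
        simp only [fun k => e1 (x k) (hex k)]
        rw [Finset.sum_comm]
        have h1 : ∑ j with S.color j = i, (Fintype.card (S.β j) : ℝ) * δ ≤ S.total * δ := by
          rw [LocalSystem.total, Finset.sum_mul]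
          exact Finset.sum_le_sum_of_subset_of_nonneg (Finset.filter_subset _ _)
            fun _ _ _ => by positivity
        rw [sub_le_iff_le_add]
        refine le_trans ?_ (add_le_add_right h1 _)
        rw [← Finset.sum_add_distrib]
        refine Finset.sum_le_sum fun j _ => ?_
        rw [← Finset.mul_sum, ← mul_add]
        exact mul_le_mul_of_nonneg_left (by linarith [b1 j]) (Nat.cast_nonneg _)
      have b3 : (τ (S.copies i a)).re - s ≤ (τ (S.copies i g)).re := by
        have h1 : S.copies i (a - ((s : ℝ) : ℂ) • (1 : S.J → A)) ≤ S.copies i g :=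
          S.copies_mono i fun j => by
            rw [Pi.sub_apply, Pi.smul_apply, Pi.one_apply, Complex.coe_smul]
            exact sub_le_saCalculus_rampMap hs0 (ha0 j) (ha1 j)
        have h2 := trace_mono τ h1
        have h3 := trace_re_le_one hτ (S.copies_le_one i (x := 1) fun j => le_rfl)
        rw [S.copies_sub, S.copies_smul, map_sub, map_smul, Complex.sub_re, smul_eq_mul,
          Complex.re_ofReal_mul] at h2
        nlinarith
      have b4 := (abs_le.mp ((abs_re_trace_sub_le hτ _ _).trans
        (S.norm_copies_sub_mul_copies_le hκ0.le (i := i) (d := d i) (x := a)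
          (fun j hj => by rw [← hj]) fun j b => hdc' j b i))).1
      have b5 := hdt τ hτ (Y i) (Finset.mem_union_right _ (Finset.mem_image_of_mem _
        (Finset.mem_univ i))) (hY0 i) i
      rw [trace_mul_comm hτ] at b5
      change _ ≤ (τ (S.copies i a)).re - (τ (d i * Y i)).re at b4
      refine le_trans ?_ b2
      refine le_trans ?_ (sub_le_sub_right b3 _)
      have b6 : (τ (Y i)).re / 128 - κ - S.total * κ ≤ (τ (S.copies i a)).re := by linarith
      refine le_trans ?_ (sub_le_sub_right (sub_le_sub_right b6 _) _)
      linarith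
    have h1 := key false
    have h2 := key true
    have h3 : (τ (Y false)).re + (τ (Y true)).re = (τ p).re := by
      rw [← Complex.add_re, ← map_add, ← S.copies_eq]
    have h4 := hptr τ hτ
    rw [map_sub, hτ.1, Complex.sub_re, Complex.one_re] at h4
    rw [Fintype.sum_bool]
    linarith [hε₁.2]

end

/-! ### Functional calculus of almost intertwined unitaries -/

section

variable {A : Type*} [CStarAlgebra A]

/-- The rotation of the circle by `c`. -/
noncomputable def circleRotation (c : Circle) : C(Circle, Circle) := ⟨fun x => c * x, by fun_prop⟩

/-- The inclusion of the circle into the complex numbers. -/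
noncomputable def circleCoe : C(Circle, ℂ) := ⟨fun x => x, by fun_prop⟩

theorem unitaryCalculus_circleCoe (x : unitary A) : unitaryCalculus x circleCoe = (x : A) :=
  cfcHom_id _

theorem norm_unitaryCalculus_le (x : unitary A) (g : C(Circle, ℂ)) :
    ‖unitaryCalculus x g‖ ≤ ‖g‖ :=
  NonUnitalStarAlgHom.norm_apply_le (unitaryCalculus x) g

theorem norm_comp_circleRotation_le (g : C(Circle, ℂ)) (c : Circle) :
    ‖g.comp (circleRotation c)‖ ≤ ‖g‖ :=
  (ContinuousMap.norm_le _ (norm_nonneg _)).mpr fun _ => g.norm_coe_le_norm _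

theorem norm_coe_unitary_le (x : unitary A) : ‖(x : A)‖ ≤ 1 := by
  rcases subsingleton_or_nontrivial A with h | h
  · simp [Subsingleton.elim (x : A) 0]
  · exact (CStarRing.norm_coe_unitary x).le

/-- If `z` almost intertwines `x` and the multiple `c y` of `y`, for unitaries `x` and `y`, it
almost intertwines `g(x)` and `g(c y)`. -/
theorem exists_unitaryCalculus_intertwine_le (A : Type*) [CStarAlgebra A] (g : C(Circle, ℂ))
    {ε : ℝ} (hε : 0 < ε) :
    ∃ δ > 0, ∀ (x y : unitary A) (z : A) (c : Circle), ‖z‖ ≤ 1 →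
      ‖(x : A) * z - (c : ℂ) • (z * (y : A))‖ ≤ δ →
      ‖unitaryCalculus x g * z - z * unitaryCalculus y (g.comp (circleRotation c))‖ ≤ ε := by
  let P : C(Circle, ℂ) → Prop := fun g => ∀ ε > 0, ∃ δ > 0, ∀ (x y : unitary A) (z : A)
    (c : Circle), ‖z‖ ≤ 1 → ‖(x : A) * z - (c : ℂ) • (z * (y : A))‖ ≤ δ →
      ‖unitaryCalculus x g * z - z * unitaryCalculus y (g.comp (circleRotation c))‖ ≤ ε
  have hcoe : P circleCoe := by
    refine fun ε hε => ⟨ε, hε, fun x y z c hz h => ?_⟩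
    have e : circleCoe.comp (circleRotation c) = (c : ℂ) • circleCoe := by
      ext t
      exact Circle.coe_mul c t
    rwa [e, map_smul, unitaryCalculus_circleCoe, unitaryCalculus_circleCoe, mul_smul_comm]
  have hstar : P (star circleCoe) := by
    refine fun ε hε => ⟨ε, hε, fun x y z c hz h => ?_⟩
    have e : (star circleCoe).comp (circleRotation c)
        = (((c⁻¹ : Circle) : ℂ)) • star circleCoe := by
      ext t
      change (starRingEnd ℂ) ((c * t : Circle) : ℂ)
        = ((c⁻¹ : Circle) : ℂ) * (starRingEnd ℂ) (t : ℂ)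
      rw [Circle.coe_mul, map_mul, Circle.coe_inv_eq_conj]
    rw [e, map_smul, map_star, map_star, unitaryCalculus_circleCoe, unitaryCalculus_circleCoe,
      mul_smul_comm]
    have hxx : star (x : A) * x = 1 := Unitary.coe_star_mul_self x
    have hyy : (y : A) * star (y : A) = 1 := Unitary.coe_mul_star_self y
    have e2 : star (x : A) * z - ((c⁻¹ : Circle) : ℂ) • (z * star (y : A))
        = -(((c⁻¹ : Circle) : ℂ)
          • (star (x : A) * (x * z - (c : ℂ) • (z * y)) * star (y : A))) := by
      have hcc : ((c⁻¹ : Circle) : ℂ) * c = 1 := by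
        rw [← Circle.coe_mul, inv_mul_cancel, Circle.coe_one]
      have e3 : star (x : A) * (x * z - (c : ℂ) • (z * y)) * star (y : A)
          = z * star (y : A) - (c : ℂ) • (star (x : A) * z) := by
        rw [mul_sub, sub_mul, ← mul_assoc, hxx, one_mul, mul_smul_comm, smul_mul_assoc,
          mul_assoc (star (x : A)), mul_assoc z, hyy, mul_one]
      rw [e3, smul_sub, smul_smul, hcc, one_smul, neg_sub]
    rw [e2, norm_neg, norm_smul, Circle.norm_coe, one_mul]
    refine norm_mul₃_le.trans ?_
    rw [norm_star, norm_star]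
    calc _ ≤ 1 * ε * 1 := by
          gcongr
          exacts [norm_coe_unitary_le x, norm_coe_unitary_le y]
      _ = ε := by ring
  have hconst : ∀ r : ℂ, P (algebraMap ℂ _ r) := by
    refine fun r ε hε => ⟨1, one_pos, fun x y z c hz h => ?_⟩
    have e : (algebraMap ℂ C(Circle, ℂ) r).comp (circleRotation c) = algebraMap ℂ _ r := rfl
    rw [e, AlgHomClass.commutes, AlgHomClass.commutes, Algebra.commutes, sub_self, norm_zero]
    exact hε.le
  have hadd : ∀ g h, P g → P h → P (g + h) := by
    intro g h hg hh ε hε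
    obtain ⟨δ₁, h₁, H₁⟩ := hg (ε / 2) (by positivity)
    obtain ⟨δ₂, h₂, H₂⟩ := hh (ε / 2) (by positivity)
    refine ⟨min δ₁ δ₂, by positivity, fun x y z c hz hd => ?_⟩
    have b1 := H₁ x y z c hz (hd.trans (min_le_left _ _))
    have b2 := H₂ x y z c hz (hd.trans (min_le_right _ _))
    have e : unitaryCalculus x (g + h) * z
        - z * unitaryCalculus y ((g + h).comp (circleRotation c))
        = (unitaryCalculus x g * z - z * unitaryCalculus y (g.comp (circleRotation c)))
          + (unitaryCalculus x h * z - z * unitaryCalculus y (h.comp (circleRotation c))) := by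
      rw [ContinuousMap.add_comp, map_add, map_add]
      noncomm_ring
    rw [e]
    exact (norm_add_le _ _).trans (by linarith)
  have hmul : ∀ g h, P g → P h → P (g * h) := by
    intro g h hg hh ε hε
    obtain ⟨δ₁, h₁, H₁⟩ := hg (ε / (2 * (‖h‖ + 1))) (by positivity)
    obtain ⟨δ₂, h₂, H₂⟩ := hh (ε / (2 * (‖g‖ + 1))) (by positivity)
    refine ⟨min δ₁ δ₂, by positivity, fun x y z c hz hd => ?_⟩
    have b1 := H₁ x y z c hz (hd.trans (min_le_left _ _))
    have b2 := H₂ x y z c hz (hd.trans (min_le_right _ _))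
    have e : unitaryCalculus x (g * h) * z
        - z * unitaryCalculus y ((g * h).comp (circleRotation c))
        = unitaryCalculus x g
            * (unitaryCalculus x h * z - z * unitaryCalculus y (h.comp (circleRotation c)))
          + (unitaryCalculus x g * z - z * unitaryCalculus y (g.comp (circleRotation c)))
            * unitaryCalculus y (h.comp (circleRotation c)) := by
      rw [ContinuousMap.mul_comp, map_mul, map_mul]
      noncomm_ring
    rw [e]
    refine (norm_add_le _ _).trans ?_
    have c1 : ‖unitaryCalculus x g
        * (unitaryCalculus x h * z - z * unitaryCalculus y (h.comp (circleRotation c)))‖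
        ≤ (‖g‖ + 1) * (ε / (2 * (‖g‖ + 1))) := (norm_mul_le _ _).trans (by
      gcongr
      exact (norm_unitaryCalculus_le x g).trans (by linarith))
    have c2 : ‖(unitaryCalculus x g * z - z * unitaryCalculus y (g.comp (circleRotation c)))
        * unitaryCalculus y (h.comp (circleRotation c))‖
        ≤ (ε / (2 * (‖h‖ + 1))) * (‖h‖ + 1) := (norm_mul_le _ _).trans (by
      gcongr
      exact (norm_unitaryCalculus_le y _).trans
        ((norm_comp_circleRotation_le h c).trans (by linarith)))
    have d1 : (‖g‖ + 1) * (ε / (2 * (‖g‖ + 1))) = ε / 2 := by field_simp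
    have d2 : (ε / (2 * (‖h‖ + 1))) * (‖h‖ + 1) = ε / 2 := by field_simp
    linarith
  have hQ : ∀ g ∈ StarAlgebra.adjoin ℂ {circleCoe}, P g ∧ P (star g) := by
    intro g hg
    induction hg using StarAlgebra.adjoin_induction with
    | mem g hg =>
      rw [Set.mem_singleton_iff] at hg
      subst hg
      exact ⟨hcoe, hstar⟩
    | algebraMap r =>
      refine ⟨hconst r, ?_⟩
      rw [← algebraMap_star_comm]
      exact hconst _
    | add g h _ _ hg hh =>
      rw [star_add]
      exact ⟨hadd g h hg.1 hh.1, hadd _ _ hg.2 hh.2⟩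
    | mul g h _ _ hg hh =>
      rw [star_mul]
      exact ⟨hmul g h hg.1 hh.1, hmul _ _ hh.2 hg.2⟩
    | star g _ hg =>
      rw [star_star]
      exact ⟨hg.2, hg.1⟩
  have hdense : g ∈ (StarAlgebra.adjoin ℂ {circleCoe}).topologicalClosure := by
    rw [ContinuousMap.starSubalgebra_topologicalClosure_eq_top_of_separatesPoints]
    · trivial
    · intro s t hst
      refine ⟨circleCoe, ⟨circleCoe, StarAlgebra.self_mem_adjoin_singleton ℂ circleCoe, rfl⟩, ?_⟩
      exact fun h => hst (Circle.ext h)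
  obtain ⟨h, hh, hgh⟩ := Metric.mem_closure_iff.mp hdense (ε / 3) (by positivity)
  rw [dist_eq_norm] at hgh
  obtain ⟨δ, hδ, H⟩ := (hQ h hh).1 (ε / 3) (by positivity)
  refine ⟨δ, hδ, fun x y z c hz hd => ?_⟩
  have b := H x y z c hz hd
  have e : unitaryCalculus x g * z - z * unitaryCalculus y (g.comp (circleRotation c))
      = unitaryCalculus x (g - h) * z
        + (unitaryCalculus x h * z - z * unitaryCalculus y (h.comp (circleRotation c)))
        - z * unitaryCalculus y ((g - h).comp (circleRotation c)) := by
    have e1 : (g - h).comp (circleRotation c)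
        = g.comp (circleRotation c) - h.comp (circleRotation c) := rfl
    rw [e1, map_sub, map_sub]
    noncomm_ring
  rw [e]
  refine (norm_sub_le _ _).trans ?_
  have b1 : ‖unitaryCalculus x (g - h) * z‖ ≤ ε / 3 * 1 := (norm_mul_le _ _).trans (by
    gcongr
    exact (norm_unitaryCalculus_le x _).trans hgh.le)
  have b2 : ‖z * unitaryCalculus y ((g - h).comp (circleRotation c))‖ ≤ 1 * (ε / 3) :=
    (norm_mul_le _ _).trans (by
      gcongr
      exact (norm_unitaryCalculus_le y _).trans
        ((norm_comp_circleRotation_le _ c).trans hgh.le))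
  have := norm_add_le (unitaryCalculus x (g - h) * z)
    (unitaryCalculus x h * z - z * unitaryCalculus y (h.comp (circleRotation c)))
  linarith

end

/-! ### Cut-off functions on the circle -/

theorem Circle.exp_eq_or (n : ℕ) (hn : 0 < n) (x : Circle) :
    ∃ j : ℕ, ∃ r : ℝ, 0 ≤ r ∧ r < 1 ∧ x = Circle.exp ((j + r) * (2 * Real.pi / n)) := by
  have hn' : (0 : ℝ) < n := by exact_mod_cast hn
  obtain ⟨t, ht0, -, rfl⟩ : ∃ t : ℝ, 0 ≤ t ∧ t < 2 * Real.pi ∧ Circle.exp t = x := by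
    obtain ⟨t, rfl⟩ := Circle.exp_surjective x
    obtain ⟨t', ⟨h0, h1⟩, h⟩ := Circle.periodic_exp.exists_mem_Ico₀ Real.two_pi_pos t
    exact ⟨t', h0, h1, h.symm⟩
  have hpi := Real.pi_pos
  set y := t / (2 * Real.pi / n) with hy
  have hy0 : 0 ≤ y := by positivity
  refine ⟨⌊y⌋₊, y - ⌊y⌋₊, sub_nonneg.mpr (Nat.floor_le hy0), ?_, ?_⟩
  · linarith [Nat.lt_floor_add_one y]
  · rw [add_sub_cancel, hy, div_mul_cancel₀]
    positivity

theorem Circle.exp_mul_two_pi_div (n : ℕ) (hn : 0 < n) :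
    Circle.exp (n * (2 * Real.pi / n)) = 1 := by
  have hn' : (n : ℝ) ≠ 0 := by positivity
  rw [mul_div_cancel₀ _ hn', Circle.exp_two_pi]

/-- There is a continuous function which vanishes outside an arc of `m + 2` steps of length
`2π / n`, and whose `n` rotations by such steps have sum at least `m` everywhere. -/
theorem exists_arcFunction {n m : ℕ} (hmn : m + 2 ≤ n) :
    ∃ T : C(Circle, ℝ), (∀ x, 0 ≤ T x) ∧ (∀ x, T x ≤ 1) ∧
      (∀ x, x ∉ openArc 0 ((m + 2) * (2 * Real.pi / n)) → T x = 0) ∧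
      ∀ x, (m : ℝ) ≤ ∑ k ∈ Finset.range n, T (Circle.exp (k * (2 * Real.pi / n)) * x) := by
  have hn : 0 < n := by omega
  have hn' : (0 : ℝ) < n := by exact_mod_cast hn
  have hpi := Real.pi_pos
  set h : ℝ := 2 * Real.pi / n with hh
  have hh0 : 0 < h := by positivity
  have hnh : n * h = 2 * Real.pi := by rw [hh]; field_simp
  have hmn' : (m : ℝ) + 2 ≤ n := by exact_mod_cast hmn
  have hclosed : ∀ a b : ℝ, IsClosed (Circle.exp '' Set.Icc a b) := fun a b =>
    (isCompact_Icc.image Circle.exp.continuous).isClosed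
  obtain ⟨T, hT0, hT1, hT⟩ := exists_continuous_zero_one_of_isClosed
    (hclosed ((m + 2) * h) (n * h)) (hclosed (1 * h) ((m + 1) * h)) (by
      rw [Set.disjoint_left]
      rintro _ ⟨s, ⟨hs1, hs2⟩, rfl⟩ ⟨t, ⟨ht1, ht2⟩, hst⟩
      have hinj := Circle.exp_injOn_Ioc (a := 0) (b := n * h) (by rw [sub_zero, hnh])
      have : t = s := hinj ⟨by nlinarith, by nlinarith⟩ ⟨by nlinarith, hs2⟩ hst
      nlinarith)
  refine ⟨T, fun x => (hT x).1, fun x => (hT x).2, fun x hx => ?_, fun x => ?_⟩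
  · apply hT0
    obtain ⟨j, r, hr0, hr1, rfl⟩ := Circle.exp_eq_or 1 one_pos x
    obtain ⟨t, ⟨ht0, ht1⟩, ht⟩ := Circle.periodic_exp.exists_mem_Ioc Real.two_pi_pos
      ((j + r) * (2 * Real.pi / (1 : ℕ))) 0
    rw [zero_add] at ht1
    rw [ht] at hx ⊢
    refine ⟨t, ⟨?_, by rwa [hnh]⟩, rfl⟩
    by_contra hlt
    exact hx ⟨t, ⟨ht0, by rw [zero_add]; exact not_le.mp hlt⟩, rfl⟩
  · set f : ℕ → Circle → ℝ := fun k x => T (Circle.exp (k * h) * x) with hf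
    have hshift : ∀ (k l : ℕ) x, f k (Circle.exp (l * h) * x) = f (k + l) x := by
      intro k l x
      simp only [hf]
      rw [← mul_assoc, ← Circle.exp_add, ← add_mul, Nat.cast_add]
    have hper : ∀ x, f n x = f 0 x := by
      intro x
      simp only [hf]
      rw [Circle.exp_mul_two_pi_div n hn, Nat.cast_zero, zero_mul, Circle.exp_zero]
    -- The sum of all rotations is invariant under the rotation by one step, so that it suffices to
    -- bound it below on the arc of the first step.
    have hinv : ∀ (j : ℕ) x, ∑ k ∈ Finset.range n, f k (Circle.exp (j * h) * x)
        = ∑ k ∈ Finset.range n, f k x := by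
      intro j
      induction j with
      | zero => intro x; simp
      | succ j ih =>
        intro x
        have e : Circle.exp (((j + 1 : ℕ) : ℝ) * h) * x
            = Circle.exp (j * h) * (Circle.exp ((1 : ℕ) * h) * x) := by
          rw [← mul_assoc, ← Circle.exp_add, ← add_mul, Nat.cast_add]
        rw [e, ih]
        simp only [hshift]
        have h1 := Finset.sum_range_succ (fun k => f k x) n
        have h2 := Finset.sum_range_succ' (fun k => f k x) n
        rw [hper] at h1
        linarith
    obtain ⟨j, r, hr0, hr1, rfl⟩ := Circle.exp_eq_or n hn x
    rw [add_mul, Circle.exp_add]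
    change (m : ℝ) ≤ ∑ k ∈ Finset.range n, f k (Circle.exp (j * h) * Circle.exp (r * h))
    rw [hinv]
    have hsub : Finset.Icc 1 m ⊆ Finset.range n := fun k hk => by
      rw [Finset.mem_Icc] at hk
      rw [Finset.mem_range]
      omega
    refine le_trans ?_ (Finset.sum_le_sum_of_subset_of_nonneg hsub fun k _ _ => (hT _).1)
    have e : ∀ k ∈ Finset.Icc 1 m, f k (Circle.exp (r * h)) = 1 := by
      intro k hk
      rw [Finset.mem_Icc] at hk
      have hk1 : (1 : ℝ) ≤ k := by exact_mod_cast hk.1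
      have hk2 : (k : ℝ) ≤ m := by exact_mod_cast hk.2
      simp only [hf]
      rw [← Circle.exp_add, ← add_mul]
      exact hT1 ⟨_, ⟨by gcongr; linarith, by gcongr⟩, rfl⟩
    rw [Finset.sum_congr rfl e]
    simp

/-! ### Unitaries which spread the spectrum -/

section

variable {A : Type*} [CStarAlgebra A]

theorem norm_two_pi_smul_le {H : selfAdjoint A} (hH : ‖(H : A)‖ ≤ 1) {t : ℝ} (ht0 : 0 ≤ t)
    (ht1 : t ≤ 1) : ‖Complex.I • (((2 * Real.pi * t) • H : selfAdjoint A) : A)‖ ≤ 2 * Real.pi := by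
  have hpi := Real.pi_pos
  rw [selfAdjoint.val_smul, norm_smul, norm_smul, Complex.norm_I, one_mul,
    Real.norm_of_nonneg (by positivity)]
  calc _ ≤ 2 * Real.pi * 1 * 1 := by gcongr
    _ = _ := by ring

theorem norm_expUnitary_commutator_le {H : selfAdjoint A} (hH : ‖(H : A)‖ ≤ 1) {t : ℝ}
    (ht0 : 0 ≤ t) (ht1 : t ≤ 1) {f : A} {ε : ℝ} (h : ‖f * H - H * f‖ ≤ ε) :
    ‖f * (selfAdjoint.expUnitary ((2 * Real.pi * t) • H) : A)
        - (selfAdjoint.expUnitary ((2 * Real.pi * t) • H) : A) * f‖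
      ≤ Real.exp (2 * Real.pi) * (2 * Real.pi * ε) := by
  have hpi := Real.pi_pos
  have hn := norm_two_pi_smul_le hH ht0 ht1
  rw [norm_sub_rev, selfAdjoint.expUnitary_coe]
  refine (norm_exp_intertwine_le _ _ f _ hn hn).trans ?_
  gcongr
  rw [selfAdjoint.val_smul, smul_mul_assoc, smul_mul_assoc, mul_smul_comm, mul_smul_comm,
    ← smul_sub, ← smul_sub, norm_smul, norm_smul, Complex.norm_I, one_mul,
    Real.norm_of_nonneg (by positivity), norm_sub_rev]
  calc _ ≤ 2 * Real.pi * 1 * ε := by gcongr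
    _ = _ := by ring

/-- If `H` is almost the scalar `c` on `z`, then `exp (2πi H)` is almost `exp (2πi c)` on `z`. -/
theorem norm_expUnitary_mul_sub_le {H : selfAdjoint A} (hH : ‖(H : A)‖ ≤ 1) {c : ℝ}
    (hc0 : 0 ≤ c) (hc1 : c ≤ 1) {z : A} {ε : ℝ} (h : ‖(H : A) * z - c • z‖ ≤ ε) :
    ‖(selfAdjoint.expUnitary ((2 * Real.pi * 1) • H) : A) * z
        - (Circle.exp (2 * Real.pi * c) : ℂ) • z‖ ≤ Real.exp (2 * Real.pi) * (2 * Real.pi * ε) := by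
  have hpi := Real.pi_pos
  have hn := norm_two_pi_smul_le hH zero_le_one le_rfl
  set y : A := algebraMap ℂ A ((2 * Real.pi * c : ℝ) * Complex.I) with hy
  have hyn : ‖y‖ ≤ 2 * Real.pi := by
    rw [hy, Algebra.algebraMap_eq_smul_one, norm_smul, norm_mul, Complex.norm_I, mul_one,
      Complex.norm_real, Real.norm_of_nonneg (by positivity)]
    have h1 : ‖(1 : A)‖ ≤ 1 := norm_coe_unitary_le (1 : unitary A)
    calc _ ≤ 2 * Real.pi * 1 * 1 := by gcongr
      _ = _ := by ring
  have hye : NormedSpace.exp y = algebraMap ℂ A (Circle.exp (2 * Real.pi * c) : ℂ) := by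
    rw [hy, ← NormedSpace.algebraMap_exp_comm, Circle.coe_exp, Complex.exp_eq_exp_ℂ]
  have key := norm_exp_intertwine_le _ y z _ hn hyn
  rw [hye, ← Algebra.commutes, ← Algebra.smul_def, ← selfAdjoint.expUnitary_coe] at key
  refine key.trans ?_
  gcongr
  have e : Complex.I • (((2 * Real.pi * 1) • H : selfAdjoint A) : A) * z - z * y
      = ((2 * Real.pi : ℝ) * Complex.I) • ((H : A) * z - c • z) := by
    rw [selfAdjoint.val_smul, mul_one, smul_mul_assoc, smul_mul_assoc, hy, ← Algebra.commutes,
      ← Algebra.smul_def, smul_sub, ← Complex.coe_smul, ← Complex.coe_smul, smul_smul, smul_smul]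
    congr 2
    · ring
    · push_cast
      ring
  rw [e, norm_smul, norm_mul, Complex.norm_I, mul_one, Complex.norm_real,
    Real.norm_of_nonneg (by positivity)]
  gcongr

theorem mem_pathComponentOne_of_path {w : unitInterval → unitary A} (hw : Continuous w)
    (hw0 : w 0 = 1) (t : unitInterval) : w t ∈ Subgroup.pathComponentOne (unitary A) := by
  change Joined 1 (w t)
  exact ⟨⟨⟨fun s => w (s * t), by fun_prop⟩, by simp [hw0], by simp⟩⟩

variable [PartialOrder A] [StarOrderedRing A]

/-- A path of unitaries, almost commuting with `F`, whose end is almost the scalar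
`exp (2πi k / (N + 1))` on the pieces `z i k`; the traces cannot tell these apart, even in products
with the elements of `F`. -/
theorem exists_spread_path (hA : IsSimpleCStarAlgebra A) (hinf : ¬ FiniteDimensional ℂ A)
    (hTR : TracialRankLE 1 A) (F : Finset A) (N : ℕ) {ε : ℝ} (hε : 0 < ε) :
    ∃ (w : unitInterval → unitary A) (z : Bool → Fin (N + 1) → A), Continuous w ∧ w 0 = 1 ∧
      (∀ f ∈ F, ∀ t, ‖f * (w t : A) - (w t : A) * f‖ ≤ ε) ∧
      (∀ i k, 0 ≤ z i k) ∧ (∀ i k, ‖z i k‖ ≤ 1) ∧ (∀ i, ∑ k, z i k ≤ 1) ∧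
      (∀ f ∈ F, ∀ i k, ‖f * z i k - z i k * f‖ ≤ ε) ∧
      (∀ i k, ‖(w 1 : A) * z i k
        - (Circle.exp (k * (2 * Real.pi / (N + 1 : ℕ))) : ℂ) • z i k‖ ≤ ε) ∧
      (∀ τ ∈ tracialStateSpace A, ∀ f ∈ F, ∀ i k l,
        |(τ (f * z i k)).re - (τ (f * z i l)).re| ≤ ε) ∧
      ∀ τ ∈ tracialStateSpace A, 1 / 130 ≤ ∑ i, ∑ k, (τ (z i k)).re := by
  have hpi := Real.pi_pos
  set C : ℝ := Real.exp (2 * Real.pi) * (2 * Real.pi) with hC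
  have hC0 : 0 < C := by positivity
  obtain ⟨ε₀, hε₀, h₀⟩ := exists_pos_mul_le (C := 1 + 2 * C) (c := ε) (by positivity) hε
  have h1 : ε₀ ≤ ε := by nlinarith
  have h2 : 2 * (C * ε₀) ≤ ε := by nlinarith
  have hCe : ∀ x, Real.exp (2 * Real.pi) * (2 * Real.pi * x) = C * x := fun x => by
    rw [hC]
    ring
  obtain ⟨H, z, hH, hHF, hz0, hz1, hzs, hzF, hHz, hHz', htr, hlow⟩ :=
    exists_spread hA hinf hTR F N hε₀
  let K : Bool → selfAdjoint A := fun i => ⟨H i, IsSelfAdjoint.of_nonneg (hH i).1⟩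
  let E : Bool → ℝ → unitary A := fun i t => selfAdjoint.expUnitary ((2 * Real.pi * t) • K i)
  have hEc : ∀ i, Continuous (E i) := fun i =>
    selfAdjoint.continuous_expUnitary.comp (by fun_prop)
  have hEF : ∀ i (t : unitInterval), ∀ f ∈ F, ‖f * (E i t : A) - (E i t : A) * f‖ ≤ C * ε₀ :=
    fun i t f hf => by
      rw [← hCe]
      exact norm_expUnitary_commutator_le (H := K i) (hH i).2 t.2.1 t.2.2 (hHF f hf i)
  refine ⟨fun t => E false t * E true t, z, ((hEc _).comp continuous_subtype_val).mul
    ((hEc _).comp continuous_subtype_val), ?_, fun f hf t => ?_, hz0, hz1, hzs,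
    fun f hf i k => (hzF f hf i k).trans h1, fun i k => ?_,
    fun τ hτ f hf i k l => (htr τ hτ f hf i k l).trans h1, hlow⟩
  · simp [E, selfAdjoint.expUnitary_zero]
  · rw [Submonoid.coe_mul]
    have e : f * ((E false t : A) * (E true t : A)) - (E false t : A) * (E true t : A) * f
        = (f * (E false t : A) - (E false t : A) * f) * (E true t : A)
          + (E false t : A) * (f * (E true t : A) - (E true t : A) * f) := by noncomm_ring
    rw [e]
    refine (norm_add_le _ _).trans (le_trans ?_ h2)
    have b1 : ‖(f * (E false t : A) - (E false t : A) * f) * (E true t : A)‖ ≤ C * ε₀ * 1 :=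
      (norm_mul_le _ _).trans (by
        gcongr
        exacts [hEF _ t f hf, norm_coe_unitary_le _])
    have b2 : ‖(E false t : A) * (f * (E true t : A) - (E true t : A) * f)‖ ≤ 1 * (C * ε₀) :=
      (norm_mul_le _ _).trans (by
        gcongr
        exacts [norm_coe_unitary_le _, hEF _ t f hf])
    linarith
  · have hN : (0 : ℝ) < N + 1 := by positivity
    set c : ℝ := (k : ℝ) / (N + 1) with hc
    have hc0 : 0 ≤ c := by positivity
    have hc1 : c ≤ 1 := by
      rw [hc, div_le_one hN]
      have : (k : ℕ) ≤ N := by omega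
      have : ((k : ℕ) : ℝ) ≤ N := by exact_mod_cast this
      linarith
    have hcc : (k : ℝ) * (2 * Real.pi / (N + 1 : ℕ)) = 2 * Real.pi * c := by
      rw [hc]
      push_cast
      ring
    rw [hcc]
    set ζ : ℂ := (Circle.exp (2 * Real.pi * c) : ℂ) with hζ
    have hζn : ‖ζ‖ = 1 := Circle.norm_coe _
    have b1 : ‖(E i (1 : ℝ) : A) * z i k - ζ • z i k‖ ≤ C * ε₀ := by
      rw [← hCe]
      exact norm_expUnitary_mul_sub_le (H := K i) (hH i).2 hc0 hc1 (hHz i k)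
    have b2 : ‖(E (!i) (1 : ℝ) : A) * z i k - z i k‖ ≤ C * ε₀ := by
      have := norm_expUnitary_mul_sub_le (H := K (!i)) (hH (!i)).2 le_rfl zero_le_one
        (z := z i k) (ε := ε₀) (by
          rw [zero_smul, sub_zero]
          exact hHz' _ _ k (by simp))
      rwa [hCe, mul_zero, Circle.exp_zero, Circle.coe_one, one_smul] at this
    rw [Submonoid.coe_mul]
    change ‖(E false (1 : ℝ) : A) * (E true (1 : ℝ) : A) * z i k - ζ • z i k‖ ≤ ε
    refine le_trans ?_ h2
    rcases i with _ | _
    · have e : (E false (1 : ℝ) : A) * (E true (1 : ℝ) : A) * z false k - ζ • z false k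
          = (E false (1 : ℝ) : A) * ((E true (1 : ℝ) : A) * z false k - z false k)
            + ((E false (1 : ℝ) : A) * z false k - ζ • z false k) := by noncomm_ring
      rw [e]
      have b3 : ‖(E false (1 : ℝ) : A) * ((E true (1 : ℝ) : A) * z false k - z false k)‖
          ≤ 1 * (C * ε₀) := (norm_mul_le _ _).trans (by
        gcongr
        exacts [norm_coe_unitary_le _, b2])
      exact (norm_add_le _ _).trans (by linarith)
    · have e : (E false (1 : ℝ) : A) * (E true (1 : ℝ) : A) * z true k - ζ • z true k
          = (E false (1 : ℝ) : A) * ((E true (1 : ℝ) : A) * z true k - ζ • z true k)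
            + ζ • ((E false (1 : ℝ) : A) * z true k - z true k) := by
        rw [mul_sub, smul_sub, mul_smul_comm, mul_assoc]
        abel
      rw [e]
      have b3 : ‖(E false (1 : ℝ) : A) * ((E true (1 : ℝ) : A) * z true k - ζ • z true k)‖
          ≤ 1 * (C * ε₀) := (norm_mul_le _ _).trans (by
        gcongr
        exact norm_coe_unitary_le _)
      have b4 : ‖ζ • ((E false (1 : ℝ) : A) * z true k - z true k)‖ ≤ C * ε₀ := by
        rw [norm_smul, hζn, one_mul]
        exact b2
      exact (norm_add_le _ _).trans (by linarith)

/-! ### The spectral measures -/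

/-- An element which is shifted by the pieces through a sequence `g k` of elements with large sum
has large trace. -/
theorem trace_ge_of_intertwine {τ : A →ₚ[ℂ] ℂ} (hτ : τ ∈ tracialStateSpace A) {N : ℕ} {ε : ℝ}
    {z : Bool → Fin (N + 1) → A} (hz0 : ∀ i k, 0 ≤ z i k) (hzs : ∀ i, ∑ k, z i k ≤ 1)
    (hlow : 1 / 130 ≤ ∑ i, ∑ k, (τ (z i k)).re)
    (hz : ∀ i k l, |(τ (z i k)).re - (τ (z i l)).re| ≤ ε) {f : A} (hf : 0 ≤ f)
    {g : Fin (N + 1) → A} (hfg : ∀ i k, ‖f * z i k - z i k * g k‖ ≤ ε)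
    (hg : ∀ i k l, |(τ (g k * z i k)).re - (τ (g k * z i l)).re| ≤ ε) {m : ℝ} (hm0 : 0 ≤ m)
    (hm : m ≤ N + 1) (hsum : m • (1 : A) ≤ ∑ k, g k) :
    m / (260 * (N + 1)) - 3 * (N + 1) * ε ≤ (τ f).re := by
  have hN : (0 : ℝ) < N + 1 := by positivity
  have hε : 0 ≤ ε := (norm_nonneg _).trans (hfg false 0)
  have hsc : ∀ (c : ℝ) (x : A), (τ (c • x)).re = c * (τ x).re := fun c x => by
    rw [← Complex.coe_smul, map_smul, smul_eq_mul, Complex.re_ofReal_mul]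
  have h1 : ∀ i, m * (τ (z i 0)).re - (N + 1) * (2 * ε) ≤ (τ f).re := by
    intro i
    have a1 := trace_mul_mono hτ hf (hzs i)
    rw [mul_one, Finset.mul_sum, map_sum, Complex.re_sum] at a1
    refine le_trans ?_ a1
    have a2 : ∀ k, (τ (g k * z i 0)).re - 2 * ε ≤ (τ (f * z i k)).re := by
      intro k
      have b1 := (abs_le.mp ((abs_re_trace_sub_le hτ _ _).trans (hfg i k))).1
      have b2 := (abs_le.mp (hg i k 0)).1
      rw [trace_mul_comm hτ (z i k)] at b1
      linarith
    have a3 := trace_mul_mono hτ (hz0 i 0) hsum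
    rw [mul_smul_comm, mul_one, hsc, Finset.mul_sum, map_sum, Complex.re_sum] at a3
    have a4 : ∑ k, ((τ (g k * z i 0)).re - 2 * ε) ≤ ∑ k, (τ (f * z i k)).re :=
      Finset.sum_le_sum fun k _ => a2 k
    rw [Finset.sum_sub_distrib, Finset.sum_const, Finset.card_univ, Fintype.card_fin,
      nsmul_eq_mul] at a4
    simp only [trace_mul_comm hτ (z i 0)] at a3
    push_cast at a4
    linarith
  have h2 : ∀ i, ∑ k, (τ (z i k)).re ≤ (N + 1) * ((τ (z i 0)).re + ε) := by
    intro i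
    calc _ ≤ ∑ _k : Fin (N + 1), ((τ (z i 0)).re + ε) := Finset.sum_le_sum fun k _ => by
          have := (abs_le.mp (hz i k 0)).2
          linarith
      _ = _ := by
          rw [Finset.sum_const, Finset.card_univ, Fintype.card_fin, nsmul_eq_mul]
          push_cast
          ring
  rw [Fintype.sum_bool] at hlow
  have h3 : 1 / 130 ≤ (N + 1) * ((τ (z true 0)).re + (τ (z false 0)).re + 2 * ε) := by
    linarith [h2 true, h2 false]
  have h4 : m / (130 * (N + 1)) ≤ m * ((τ (z true 0)).re + (τ (z false 0)).re + 2 * ε) := by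
    rw [div_le_iff₀ (by positivity)]
    have := mul_le_mul_of_nonneg_left h3 hm0
    linarith
  have h5 : m * ε ≤ (N + 1) * ε := by gcongr
  have h6 : m / (260 * (N + 1)) = m / (130 * (N + 1)) / 2 := by
    field_simp
    ring
  rw [h6]
  linarith [h1 true, h1 false]

/-- A real function on the circle, as a complex one. -/
noncomputable def complexify (T : C(Circle, ℝ)) : C(Circle, ℂ) := ⟨fun x => (T x : ℂ), by fun_prop⟩

theorem complexify_nonneg {T : C(Circle, ℝ)} (hT : ∀ x, 0 ≤ T x) : 0 ≤ complexify T := by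
  intro x
  exact Complex.zero_le_real.mpr (hT x)

/-- The measure of a set bounds the traces of the cut-off functions which vanish outside of it. -/
theorem ofReal_trace_le_traceSpectralMeasure (τ : A →ₚ[ℂ] ℂ) (x : unitary A) {T : C(Circle, ℝ)}
    (hT1 : ∀ y, T y ≤ 1) {s : Set Circle} (hs : ∀ y, y ∉ s → T y = 0) :
    ENNReal.ofReal (τ (unitaryCalculus x (complexify T))).re ≤ traceSpectralMeasure τ x s := by
  have h := integral_inducedMeasure (τ.comp (PositiveLinearMap.ofClass (unitaryCalculus x)))
    (complexify T)
  have h2 : (τ (unitaryCalculus x (complexify T))).re = ∫ y, T y ∂(traceSpectralMeasure τ x) := by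
    change _ = τ (unitaryCalculus x (complexify T)) at h
    rw [← h]
    change (∫ y, ((T y : ℝ) : ℂ) ∂(traceSpectralMeasure τ x)).re = _
    have h3 : ∫ y, ((T y : ℝ) : ℂ) ∂(traceSpectralMeasure τ x)
        = ((∫ y, T y ∂(traceSpectralMeasure τ x) : ℝ) : ℂ) := integral_ofReal
    rw [h3, Complex.ofReal_re]
  rw [h2]
  exact MeasureTheory.integral_le_measure (fun y _ => hT1 y) fun y hy => (hs y hy).le

end

/-- The values `1 / (2 (n + 1) ^ 2)` are quadratically small where `a` is larger than
`8π / (n + 1)`. -/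
theorem Delta00_le {a : ℝ} (ha : 0 < a) : Delta00 a ≤ a / 2000 := by
  have hpi := Real.pi_gt_three
  unfold Delta00
  split_ifs with h1 h2
  · have h3 : 8 * Real.pi / 64 ≤ arcBreak 64 := by
      unfold arcBreak
      push_cast
      exact le_add_of_nonneg_right (by positivity)
    norm_num at h3 ⊢
    linarith
  · obtain ⟨hn, hlt, -⟩ := h2.choose_spec
    set n := h2.choose
    have hn' : (64 : ℝ) ≤ n := by exact_mod_cast hn
    have h3 : 8 * Real.pi / (n + 1) < a := by
      refine lt_of_le_of_lt ?_ hlt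
      unfold arcBreak
      push_cast
      exact le_add_of_nonneg_right (by positivity)
    rw [div_lt_iff₀ (by positivity)] at h3
    rw [div_le_div_iff₀ (by positivity) (by norm_num)]
    have h4 : 24 * ((n : ℝ) + 1) ≤ a * (n + 1) * (n + 1) := by
      have : (24 : ℝ) ≤ a * (n + 1) := by linarith
      gcongr
    nlinarith
  · positivity

/-- Around the circle there are, for each number `m` of steps, arcs starting at a multiple of a
step; the one with `m` maximal inside a given arc has almost its length. -/
theorem exists_grid_arc {n : ℕ} (hn : 0 < n) {s a : ℝ} (ha0 : 6 * (2 * Real.pi / n) ≤ a)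
    (ha : a ≤ 2 * Real.pi) : ∃ m j : ℕ, m + 2 ≤ n ∧ j < n ∧ a * n / (2 * Real.pi) - 4 ≤ m ∧
      ∀ x : Circle, Circle.exp (-(j * (2 * Real.pi / n))) * x
        ∈ openArc 0 ((m + 2) * (2 * Real.pi / n)) → x ∈ openArc s a := by
  have hn' : (0 : ℝ) < n := by exact_mod_cast hn
  have hpi := Real.pi_pos
  set h : ℝ := 2 * Real.pi / n with hh
  have hh0 : 0 < h := by positivity
  have hnh : n * h = 2 * Real.pi := by rw [hh]; field_simp
  have hah : a * n / (2 * Real.pi) = a / h := by rw [hh]; field_simp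
  have hq : 6 ≤ a / h := by rwa [le_div_iff₀ hh0]
  have hfl : (6 : ℕ) ≤ ⌊a / h⌋₊ := Nat.le_floor (by exact_mod_cast hq)
  have hfl1 : (⌊a / h⌋₊ : ℝ) ≤ a / h := Nat.floor_le (by linarith)
  have hfl2 := Nat.lt_floor_add_one (a / h)
  have hfn : ⌊a / h⌋₊ ≤ n := by
    have : a / h ≤ n := by rw [div_le_iff₀ hh0, hnh]; exact ha
    exact_mod_cast hfl1.trans this
  -- The first step inside the arc starts at most one step after `s`, and reducing `J` modulo `n`
  -- does not change the point of the circle. Three steps are lost so that the arc of `m + 2` steps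
  -- fits.
  set J : ℤ := ⌈s / h⌉ with hJ
  have hnz : (n : ℤ) ≠ 0 := by omega
  have hj0 := Int.emod_nonneg J hnz
  have hjn := Int.emod_lt_of_pos J (by omega : (0 : ℤ) < n)
  have hjc : (((J % n).toNat : ℕ) : ℝ) = J - n * (J / n : ℤ) := by
    have h1 : (((J % n).toNat : ℕ) : ℤ) = J - n * (J / n) := by
      rw [Int.toNat_of_nonneg hj0, Int.emod_def]
    exact_mod_cast h1
  refine ⟨⌊a / h⌋₊ - 3, (J % n).toNat, by omega, by omega, ?_, fun x hx => ?_⟩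
  · rw [hah, Nat.cast_sub (by omega)]
    push_cast
    linarith
  · obtain ⟨t, ⟨ht0, ht1⟩, ht⟩ := hx
    rw [zero_add, Nat.cast_sub (by omega)] at ht1
    push_cast at ht1
    have hx : x = Circle.exp (J * h + t) := by
      have h1 : x = Circle.exp ((J % n).toNat * h) * Circle.exp t := by
        rw [ht, ← mul_assoc, ← Circle.exp_add, add_neg_cancel, Circle.exp_zero, one_mul]
      have h2 : ((J : ℝ) - n * (J / n : ℤ)) * h = J * h - (J / n : ℤ) * (2 * Real.pi) := by
        rw [← hnh]
        ring
      rw [h1, hjc, h2, Circle.exp_sub, Circle.exp_int_mul_two_pi, div_one, Circle.exp_add]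
    have h1 : s ≤ J * h := by
      rw [← div_le_iff₀ hh0]
      exact Int.le_ceil _
    have h2 : J * h < s + h := by
      have := Int.ceil_lt_add_one (s / h)
      calc J * h < (s / h + 1) * h := by gcongr
        _ = s + h := by field_simp
    have h3 : (⌊a / h⌋₊ : ℝ) * h ≤ a := by rwa [← le_div_iff₀ hh0]
    exact ⟨J * h + t, ⟨by linarith, by linarith⟩, hx.symm⟩

theorem lemma4p13 {A : Type*} [CStarAlgebra A] [PartialOrder A] [StarOrderedRing A]
    [TopologicalSpace.SeparableSpace A] (hsimple : IsSimpleCStarAlgebra A)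
    (hinf : ¬ FiniteDimensional ℂ A) (hTR : TracialRankLE 1 A)
    (F : Finset A) (u : unitary A) (ε η : ℝ) (hε : 0 < ε) (hη : 0 < η) :
    ∃ v ∈ Subgroup.pathComponentOne (unitary A), ∃ w : unitInterval → unitary A,
      Continuous w ∧ (∀ t, w t ∈ Subgroup.pathComponentOne (unitary A)) ∧
      w 0 = 1 ∧ w 1 = v ∧
      (∀ f ∈ F, ∀ t, ‖f * (w t : A) - (w t : A) * f‖ < ε) ∧
      ∀ τ ∈ tracialStateSpace A, ∀ s a : ℝ, η ≤ a → a ≤ 2 * Real.pi →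
        ENNReal.ofReal (Delta00 a) ≤ traceSpectralMeasure τ (v * u) (openArc s a) := by
  classical
  -- Every arc in question contains many steps of length `2π / (N + 1)`.
  obtain ⟨N, hN⟩ := exists_nat_gt (1000 / η)
  have hN0 : (0 : ℝ) < N + 1 := by positivity
  have hNη : 1000 ≤ η * (N + 1) := by
    rw [div_lt_iff₀ hη] at hN
    nlinarith
  set h : ℝ := 2 * Real.pi / (N + 1 : ℕ) with hh
  have hT : ∀ m : ℕ, ∃ T : C(Circle, ℝ), m + 2 ≤ N + 1 → (∀ x, 0 ≤ T x) ∧ (∀ x, T x ≤ 1) ∧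
      (∀ x, x ∉ openArc 0 ((m + 2) * h) → T x = 0) ∧
      ∀ x, (m : ℝ) ≤ ∑ k ∈ Finset.range (N + 1), T (Circle.exp (k * h) * x) := by
    intro m
    by_cases hm : m + 2 ≤ N + 1
    · obtain ⟨T, hT⟩ := exists_arcFunction hm
      exact ⟨T, fun _ => hT⟩
    · exact ⟨0, fun h => absurd h hm⟩
  choose T hT using hT
  -- the rotated cut-off functions
  let S : ℕ → ℕ → C(Circle, ℝ) := fun m j => (T m).comp (circleRotation (Circle.exp (-(j * h))))
  let G : ℕ → ℕ → ℕ → C(Circle, ℂ) := fun m j k =>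
    (complexify (S m j)).comp (circleRotation (Circle.exp (k * h)))
  set ε' : ℝ := 1 / (300 * (N + 1) ^ 2) with hε'
  have hε'0 : 0 < ε' := by positivity
  choose δ hδ0 hδ using fun m j =>
    exists_unitaryCalculus_intertwine_le A (complexify (S m j)) hε'0
  obtain ⟨δ', hδ'0, hδ'⟩ : ∃ δ' > 0, ∀ q : Fin (N + 1) × Fin (N + 1), δ' ≤ δ q.1 q.2 := by
    obtain ⟨q, hq⟩ := Finite.exists_min fun q : Fin (N + 1) × Fin (N + 1) => δ q.1 q.2
    exact ⟨_, hδ0 _ _, hq⟩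
  -- The pieces have to be independent of the rotated cut-off functions of `u`.
  let F' : Finset A := F ∪ {1, (u : A)} ∪ Finset.univ.image
    fun q : Fin (N + 1) × Fin (N + 1) × Fin (N + 1) => unitaryCalculus u (G q.1 q.2.1 q.2.2)
  obtain ⟨w, z, hwc, hw0, hwF, hz0, hz1, hzs, hzF, hwz, htr, hlow⟩ :=
    exists_spread_path hsimple hinf hTR F' N (ε := min (min (ε / 2) ε') (δ' / 2)) (by positivity)
  have hε1 : min (min (ε / 2) ε') (δ' / 2) ≤ ε / 2 := (min_le_left _ _).trans (min_le_left _ _)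
  have hε2 : min (min (ε / 2) ε') (δ' / 2) ≤ ε' := (min_le_left _ _).trans (min_le_right _ _)
  have hε3 : min (min (ε / 2) ε') (δ' / 2) ≤ δ' / 2 := min_le_right _ _
  have hu : (u : A) ∈ F' := by simp [F']
  have h1F : (1 : A) ∈ F' := by simp [F']
  refine ⟨w 1, mem_pathComponentOne_of_path hwc hw0 1, w, hwc,
    mem_pathComponentOne_of_path hwc hw0, hw0, rfl, fun f hf t => ?_, fun τ hτ s a hηa ha => ?_⟩
  · refine (hwF f (by simp [F', hf]) t).trans_lt ?_
    linarith
  -- the new unitary is almost a multiple of `u` on each piece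
  have hrot : ∀ i k, ‖((w 1 * u : unitary A) : A) * z i k
      - (Circle.exp (k * h) : ℂ) • (z i k * (u : A))‖ ≤ δ' := by
    intro i k
    have e : ((w 1 * u : unitary A) : A) * z i k - (Circle.exp (k * h) : ℂ) • (z i k * (u : A))
        = (w 1 : A) * ((u : A) * z i k - z i k * u)
          + ((w 1 : A) * z i k - (Circle.exp (k * h) : ℂ) • z i k) * u := by
      rw [Submonoid.coe_mul, mul_sub, sub_mul, smul_mul_assoc]
      simp only [mul_assoc]
      abel
    rw [e]
    refine (norm_add_le _ _).trans ?_
    have b1 : ‖(w 1 : A) * ((u : A) * z i k - z i k * u)‖ ≤ 1 * (δ' / 2) :=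
      (norm_mul_le _ _).trans (by
        gcongr
        exacts [norm_coe_unitary_le _, (hzF u hu i k).trans hε3])
    have b2 : ‖((w 1 : A) * z i k - (Circle.exp (k * h) : ℂ) • z i k) * u‖ ≤ δ' / 2 * 1 :=
      (norm_mul_le _ _).trans (by
        gcongr
        exacts [(hwz i k).trans hε3, norm_coe_unitary_le _])
    linarith
  have ha0 : 0 < a := hη.trans_le hηa
  have hpi3 := Real.pi_gt_three
  have hpi4 := Real.pi_lt_d2
  obtain ⟨m, j, hm, hj, hma, harc⟩ := exists_grid_arc (n := N + 1) (Nat.succ_pos N) (s := s)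
    (a := a) (by
      rw [← mul_div_assoc, div_le_iff₀ (by positivity)]
      push_cast
      nlinarith) ha
  obtain ⟨hT0, hT1, hTs, hTsum⟩ := hT m hm
  have hmu := ofReal_trace_le_traceSpectralMeasure τ (w 1 * u) (T := S m j)
    (s := openArc s a) (fun y => hT1 _) fun y hy => hTs _ fun hmem => hy (harc y hmem)
  refine le_trans (ENNReal.ofReal_le_ofReal ?_) hmu
  have key := trace_ge_of_intertwine hτ (ε := ε') hz0 hzs (hlow τ hτ)
    (fun i k l => by
      have := htr τ hτ 1 h1F i k l
      rw [one_mul, one_mul] at this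
      exact this.trans hε2)
    (f := unitaryCalculus (w 1 * u) (complexify (S m j)))
    (map_nonneg _ (complexify_nonneg fun y => hT0 _))
    (g := fun k => unitaryCalculus u (G m j k))
    (fun i k => hδ m j _ _ _ _ (hz1 i k)
      ((hrot i k).trans (hδ' (⟨m, by omega⟩, ⟨j, hj⟩))))
    (fun i k l => (htr τ hτ _ (Finset.mem_union_right _ (Finset.mem_image.mpr
      ⟨(⟨m, by omega⟩, ⟨j, hj⟩, k), Finset.mem_univ _, rfl⟩)) i k l).trans hε2)
    (m := m) (Nat.cast_nonneg m) (by exact_mod_cast (by omega : m ≤ N + 1)) (by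
      have h1 : (m : ℝ) • (1 : A)
          = unitaryCalculus u (complexify (ContinuousMap.const _ (m : ℝ))) := by
        have : complexify (ContinuousMap.const _ (m : ℝ)) = ((m : ℝ) : ℂ) • 1 := by
          ext y
          simp [complexify]
        rw [this, map_smul, map_one, Complex.coe_smul]
      rw [h1, ← map_sum, ← sub_nonneg, ← map_sub]
      refine map_nonneg _ fun y => ?_
      have h2 := hTsum (Circle.exp (-(j * h)) * y)
      rw [← Fin.sum_univ_eq_sum_range (fun k => T m (Circle.exp (k * h)
        * (Circle.exp (-(j * h)) * y)))] at h2
      change (0 : ℂ) ≤ (∑ k : Fin (N + 1), G m j k - complexify (ContinuousMap.const _ (m : ℝ))) y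
      rw [ContinuousMap.sub_apply, ContinuousMap.sum_apply]
      change (0 : ℂ) ≤ (∑ k : Fin (N + 1), ((T m (Circle.exp (-(j * h))
        * (Circle.exp (k * h) * y)) : ℝ) : ℂ)) - ((m : ℝ) : ℂ)
      rw [← Complex.ofReal_sum, ← Complex.ofReal_sub]
      refine Complex.zero_le_real.mpr (sub_nonneg.mpr (h2.trans (le_of_eq ?_)))
      exact Finset.sum_congr rfl fun k _ => by rw [mul_left_comm])
  refine (Delta00_le ha0).trans (le_trans ?_ key)
  -- Of an arc of `a / h` steps, `m` is smaller by `4` at most. The constant `1640` is slightly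
  -- larger than `520π`.
  have e1 : 3 * ((N : ℝ) + 1) * ε' = 1 / 100 / (N + 1) := by
    rw [hε']
    field_simp
    norm_num
  have e2 : a / 1640 - 4 / 260 / (N + 1) ≤ m / (260 * (N + 1)) := by
    have h1 : a * (N + 1) / (63 / 10) - 4 ≤ m := by
      refine le_trans (sub_le_sub_right ?_ _) hma
      push_cast
      gcongr
      linarith
    have h2 : m / (260 * ((N : ℝ) + 1)) = m / 260 / (N + 1) := by rw [div_div]
    rw [h2, le_div_iff₀ hN0, sub_mul, div_mul_cancel₀ _ hN0.ne']
    have h3 : 0 ≤ a * ((N : ℝ) + 1) := by positivity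
    linarith
  rw [e1]
  have e3 : 1 / ((N : ℝ) + 1) ≤ a / 1000 := by
    rw [div_le_div_iff₀ hN0 (by norm_num)]
    nlinarith
  have e4 : 4 / 260 / ((N : ℝ) + 1) = 4 / 260 * (1 / (N + 1)) := by ring
  have e5 : 1 / 100 / ((N : ℝ) + 1) = 1 / 100 * (1 / (N + 1)) := by ring
  linarith
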